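/- For $a=(a_1,a_2)\in\mathbb R^2$ put $a^\perp=(a_2,-a_1)$, and let $K(x)=\frac{1}{2\pi}\frac{x^\perp}{|x|^2}$ and $v^G(\xi)=\frac{1}{2\pi}\frac{\xi^\perp}{|\xi|^2}\bigl(1-e^{-|\xi|^2/4}\bigr)$, with $v^G(0)=0$. Let $z_0\in\mathbb R^2$ and let $\omega^E_0\in W^{4,4}(\mathbb R^2)$ have compact support and vanish in a neighborhood of $z_0$. Let $(z,\omega^E)$ be a global classical solution of the vortex-wave system $$\partial_t\omega^E+\bigl(v^E+K(\cdot-z(t))\bigr)\cdot\nabla\omega^E=0,\qquad \dot z(t)=v^E(t,z(t)),\qquad v^E=K\star\omega^E,\qquad \omega^E|_{t=0}=\omega^E_0,\quad z(0)=z_0,$$ that is, $\omega^E\in C^1([0,\infty)\times\mathbb R^2)$ is bounded in $L^1\cap L^\infty(\mathbb R^2)$ on every bounded time interval, the first equation holds for $x\neq z(t)$ and $t\ge0$, and the second one for all $t\ge 0$. Let $$T_*=\inf\Bigl\{t\ge 0:\ z(t)\in\bigcup_{0\le s\le t}\operatorname{supp}\omega^E(s)\Bigr\}\in[0,\infty],\qquad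 \inf\emptyset=\infty .$$ Then for every $0<T<T_*$ there is a constant $C_T$ such that the following holds for every $\nu>0$. There is a unique classical solution $w_{1,a}$ on $[0,T]$ (that is, $w_{1,a}\in C^1([0,T]\times\mathbb R^2)$, bounded in $L^1\cap L^\infty(\mathbb R^2)$ uniformly on $[0,T]$) of $$\partial_t w_{1,a}+\Bigl(v^E+\tfrac{1}{\sqrt{\nu t}}\,v^G\bigl(\tfrac{x-z(t)}{\sqrt{\nu t}}\bigr)\Bigr)\cdot\nabla w_{1,a}+v_{1,a}\cdot\nabla\omega^E=\Delta\omega^E\quad(0<t\le T),\qquad w_{1,a}|_{t=0}=0,\qquad v_{1,a}=K\star w_{1,a}.$$ For every $t\in[0,T]$ the function $w_{1,a}(t)$ has compact support, vanishes in a neighborhood of $z(t)$, and satisfies $$\mathfrak m\bigl(\operatorname{supp} w_{1,a}(t)\bigr)+\|w_{1,a}(t)\|_{W^{2,4}(\mathbb R^2)}+\|\partial_t w_{1,a}(t)\|_{L^\infty(\mathbb R^2)}+\|v_{1,a}(t)\|_{W^{2,\infty}(\mathbb R^2)}\le C_T,$$ where $\mathfrak m$ is the Lebesgue measure on $\mathbb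 R^2$. Moreover, the problem $$\frac{d}{dt}\widetilde z(t)=\bigl(K\star(\omega^E+\nu w_{1,a})(t)\bigr)(\widetilde z(t))\quad(0\le t\le T),\qquad \widetilde z(0)=z_0,$$ has a solution $\widetilde z$ on $[0,T]$, and every such solution satisfies $$|\widetilde z(t)-z(t)|\le C_T\,\nu t\qquad\text{for all } t\in[0,T].$$ -/

import Mathlib

open MeasureTheory Set Filter Topology
open scoped ENNReal NNReal Laplacian

noncomputable section

namespace VortexWave

/-- The plane `ℝ²` with its Euclidean norm. -/
abbrev Plane : Type := EuclideanSpace ℝ (Fin 2)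

/-- `(a₁, a₂)^⊥ = (a₂, -a₁)`. -/
def perp (a : Plane) : Plane := !₂[a 1, -a 0]

/-- The kernel `K(x) = x^⊥ / (2π|x|²)` (with value `0` at the origin). -/
def kernelK (x : Plane) : Plane := (1 / (2 * Real.pi * ‖x‖ ^ 2)) • perp x

/-- The Biot–Savart velocity `K ⋆ f` of a vorticity `f`. -/
def biotSavart (f : Plane → ℝ) (x : Plane) : Plane := ∫ y, f y • kernelK (x - y)

/-- The velocity `v^G(ξ) = ξ^⊥ / (2π|ξ|²) (1 - exp(-|ξ|²/4))` of the Lamb–Oseen vortex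
(with its limit value `0` at the origin). -/
def lambOseen (ξ : Plane) : Plane := (1 - Real.exp (-‖ξ‖ ^ 2 / 4)) • kernelK ξ

/-- `g` is the weak derivative `∂_{α₀} ⋯ ∂_{αₙ₋₁} f` of order `n` on `ℝ²`. -/
def HasWeakDeriv {F : Type*} [NormedAddCommGroup F] [NormedSpace ℝ F] {n : ℕ}
    (α : Fin n → Fin 2) (f g : Plane → F) : Prop :=
  LocallyIntegrable f ∧ LocallyIntegrable g ∧
    ∀ φ : Plane → ℝ, ContDiff ℝ (⊤ : ℕ∞) φ → HasCompactSupport φ →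
      ∫ x, iteratedFDeriv ℝ n φ x (fun j => EuclideanSpace.single (α j) (1 : ℝ)) • f x =
        (-1 : ℝ) ^ n • ∫ x, φ x • g x

/-- The `W^{k,p}(ℝ²)` norm: the sum of the `L^p` norms of the weak derivatives of order at most
`k`. It is `∞` if one of them does not exist or is not in `L^p`; a weak derivative is unique up to
null sets, so the infimum only selects it. -/
def sobolevNorm {F : Type*} [NormedAddCommGroup F] [NormedSpace ℝ F]
    (k : ℕ) (p : ℝ≥0∞) (f : Plane → F) : ℝ≥0∞ :=
  ∑ n ∈ Finset.range (k + 1), ∑ α : Fin n → Fin 2,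
    ⨅ (g : Plane → F) (_ : HasWeakDeriv α f g), eLpNorm g p volume

/-- Membership in `W^{k,p}(ℝ²)`. -/
def MemSobolev {F : Type*} [NormedAddCommGroup F] [NormedSpace ℝ F]
    (k : ℕ) (p : ℝ≥0∞) (f : Plane → F) : Prop :=
  sobolevNorm k p f < ∞

/-- `(z, ω)` is a global classical solution of the vortex-wave system
`∂ₜω + (K ⋆ ω + K(· - z(t))) · ∇ω = 0`, `ż(t) = (K ⋆ ω)(t, z(t))` with initial data `(z₀, ω₀)`,
in the class of vorticities that are locally bounded in time with values in `L¹ ∩ L^∞`. -/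
structure IsVortexWaveSolution (z₀ : Plane) (ω₀ : Plane → ℝ)
    (z : ℝ → Plane) (ω : ℝ → Plane → ℝ) : Prop where
  contDiff : ContDiffOn ℝ 1 (fun p : ℝ × Plane => ω p.1 p.2) (Ici 0 ×ˢ univ)
  bounded : ∀ T : ℝ, ∃ C : ℝ≥0, ∀ t ∈ Icc 0 T,
    eLpNorm (ω t) 1 volume + eLpNorm (ω t) ∞ volume ≤ C
  vorticity_eq : ∀ t : ℝ, 0 ≤ t → ∀ x : Plane, x ≠ z t →
    derivWithin (fun s => ω s x) (Ici 0) t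
      + fderiv ℝ (ω t) x (biotSavart (ω t) x + kernelK (x - z t)) = 0
  point_eq : ∀ t : ℝ, 0 ≤ t → HasDerivWithinAt z (biotSavart (ω t) (z t)) (Ici 0) t
  vorticity_zero : ω 0 = ω₀
  point_zero : z 0 = z₀

/-- `T_* = inf {t ≥ 0 : z(t) ∈ ⋃_{0 ≤ s ≤ t} supp ω(s)}`, equal to `∞` if there is no such `t`. -/
def meetingTime (z : ℝ → Plane) (ω : ℝ → Plane → ℝ) : EReal :=
  sInf ((fun t : ℝ => (t : EReal)) '' {t : ℝ | 0 ≤ t ∧ z t ∈ ⋃ s ∈ Icc 0 t, tsupport (ω s)})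

/-- `w` is a classical solution on `[0, T]`, bounded with values in `L¹ ∩ L^∞`, of
`∂ₜw + (K ⋆ ω + (νt)^{-1/2} v^G((x - z(t)) / (νt)^{1/2})) · ∇w + (K ⋆ w) · ∇ω = Δω`
with zero initial data. The equation is imposed for `0 < t ≤ T`, its drift being undefined at
`t = 0`; the initial condition is attained since `w` is `C¹` up to `t = 0`. -/
structure IsCorrection (ν T : ℝ) (z : ℝ → Plane) (ω : ℝ → Plane → ℝ)
    (w : ℝ → Plane → ℝ) : Prop where
  contDiff : ContDiffOn ℝ 1 (fun p : ℝ × Plane => w p.1 p.2) (Icc 0 T ×ˢ univ)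
  bounded : ∃ C : ℝ≥0, ∀ t ∈ Icc 0 T,
    eLpNorm (w t) 1 volume + eLpNorm (w t) ∞ volume ≤ C
  vorticity_eq : ∀ t ∈ Ioc 0 T, ∀ x : Plane,
    derivWithin (fun s => w s x) (Icc 0 T) t
      + fderiv ℝ (w t) x (biotSavart (ω t) x
          + (1 / √(ν * t)) • lambOseen ((1 / √(ν * t)) • (x - z t)))
      + fderiv ℝ (ω t) x (biotSavart (w t) x) = (Δ (ω t)) x
  vorticity_zero : ∀ x : Plane, w 0 x = 0

/-- `z'` is the corrected point vortex on `[0, T]`: it starts at `z₀` and is advected by the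
velocity `K ⋆ (ω + ν w)`. -/
structure IsCorrectedPoint (ν T : ℝ) (z₀ : Plane) (ω w : ℝ → Plane → ℝ)
    (z' : ℝ → Plane) : Prop where
  point_eq : ∀ t ∈ Icc 0 T,
    HasDerivWithinAt z' (biotSavart (fun y => ω t y + ν * w t y) (z' t)) (Icc 0 T) t
  point_zero : z' 0 = z₀

end VortexWave

end

noncomputable section

namespace VortexWave

set_option linter.unusedSectionVars false

/-! The velocity of the spreading vortex at `x` is orthogonal to `x - z(t)`. Hence for every `ν`,
and also for the point vortex itself (`ν = 0`), a characteristic `γ` of the full drift satisfies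
`d/dt |γ - z|² = 2⟨γ - z, v(γ) - v(z)⟩` with `v = v^E`. A Lipschitz bound on `v` alone then compares
`|γ - z|` at any two times of `[0, T]`, with the factor `e^{LT}` (`IsDrift.norm_trajectory_sub_le`).
So `ω^E` vanishes in a disc of fixed radius around `z(t)` on `[0, T]`, and everything obtained by
integrating expressions in `ω^E` along characteristics vanishes in a smaller disc.

The core of the vortex can therefore be erased from the drift (`swirl`, `cutField`). What remains is
smooth in space, uniformly in `ν` and down to `t = 0`: away from the origin `exp(-|y|²/(4νt))` is
flat at `νt = 0`, and in the parameter `νt/(1+νt)`, which stays in `[0, 1]`, all `ν ≥ 0` form one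
family with common bounds. The member `ν = 0` transports `ω^E`, the others transport the correction.
The structure `Background` collects the geometric constants.

Regularity is measured by `Reg H k`: `k` locally bounded space derivatives, uniformly over a family,
the last one locally `1/2`-Hölder if `H` holds. The class is stable under products, compositions,
time integrals and flows. The Biot–Savart law turns bounded into Hölder (`reg_biotSavart`) and gains
a whole derivative on Hölder vorticities (`reg_biotSavart_succ`, from the singular integral
`hasFDerivAt_conv_zero`). By `morrey` the initial vorticity is of class `C^{3,1/2}`. Since `ω^E` is
the initial vorticity composed with the inverse flow, alternating the two gains gives `ω^E` of class
`C^{3,1/2}` and `v` of class `C⁴` (`Background.reg_velocity_of_le`).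

The correction solves `w(t, x) = ∫₀ᵗ (Δω - u·∇ω)(s, X_s) ds` with `u = K ⋆ w`. It is found as a
fixed point for `u` in bounded continuous functions with an exponential weight in time, and the
constants do not depend on `ν` (`Background.exists_velocity`). The same two gains applied to this
formula give `w` of class `C^{1,1/2}` and `u` with two bounded derivatives; the time derivative is
read off from the equation.

The bound of `w` in `W^{2,4}` is beyond Hölder spaces, since it uses four derivatives of the initial
vorticity in `L⁴`. The part of `w` coming from `u·∇ω` is `C²`. The part coming from `Δω` is linear
in the initial profile, and its second derivatives at a point are bounded by the time integral of
the derivatives of order at most four of the profile along bi-Lipschitz maps. A change of variables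
bounds them in `L⁴` (`Background.exists_eLpNorm_second_deriv_le`), and mollified profiles give the
weak derivatives in the limit (`Background.exists_sobolevNorm_w_le`).

For uniqueness, the difference of two solutions is written as an integral along characteristics of
the full drift, which exist through every point except `z(t)`, and a Gronwall argument in the
supremum norm applies. The estimate of `|z̃ - z|` is Gronwall's inequality with the Lipschitz
constant of `v` and the bound of `u`. -/

/-! ### Families of functions with locally uniform spatial regularity -/

section Reg

variable {Λ : Type} {F G H' : Type} [NormedAddCommGroup F] [NormedSpace ℝ F]
  [NormedAddCommGroup G] [NormedSpace ℝ G] [NormedAddCommGroup H'] [NormedSpace ℝ H']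

/-- A family of jointly continuous functions of time and space, bounded on bounded sets uniformly
in the index. If `H` holds, they are moreover `1/2`-Hölder continuous in space on bounded sets,
uniformly in the index and locally uniformly in time. -/
structure RegZero (H : Prop) (f : Λ → ℝ → Plane → F) : Prop where
  cont : ∀ l, Continuous fun p : ℝ × Plane => f l p.1 p.2
  bdd : ∀ R : ℝ, ∃ C : ℝ, ∀ l t x, |t| ≤ R → ‖x‖ ≤ R → ‖f l t x‖ ≤ C
  holder : H → ∀ R : ℝ, ∃ C : ℝ, ∀ l t x y, |t| ≤ R → ‖x‖ ≤ R → ‖y‖ ≤ R →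
    ‖f l t x - f l t y‖ ≤ C * √‖x - y‖

/-- The family `f` has `k` spatial derivatives that are jointly continuous and locally bounded
uniformly in the index; if `H` holds, the last one is locally `1/2`-Hölder continuous in space. -/
def Reg (H : Prop) : ℕ → ∀ {F : Type} [NormedAddCommGroup F] [NormedSpace ℝ F],
    (Λ → ℝ → Plane → F) → Prop
  | 0, _, _, _, f => RegZero H f
  | k + 1, _, _, _, f => RegZero False f ∧ (∀ l t, Differentiable ℝ (f l t)) ∧
      Reg H k (fun l t x => fderiv ℝ (f l t) x)

variable {H : Prop} {k : ℕ}

theorem RegZero.weaken {f : Λ → ℝ → Plane → F} (h : RegZero H f) : RegZero False f :=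
  ⟨h.cont, h.bdd, False.elim⟩

theorem Reg.regZero {f : Λ → ℝ → Plane → F} (h : Reg H k f) : RegZero False f := by
  cases k with
  | zero => exact RegZero.weaken h
  | succ k => exact h.1

theorem Reg.weaken {f : Λ → ℝ → Plane → F} (h : Reg H k f) : Reg False k f := by
  induction k generalizing F with
  | zero => exact RegZero.weaken h
  | succ k ih => exact ⟨h.1, h.2.1, ih h.2.2⟩

theorem Reg.of_hasFDerivAt {f : Λ → ℝ → Plane → F} {f' : Λ → ℝ → Plane → Plane →L[ℝ] F}
    (h0 : RegZero False f) (hd : ∀ l t x, HasFDerivAt (f l t) (f' l t x) x)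
    (h : Reg H k f') : Reg H (k + 1) f := by
  refine ⟨h0, fun l t x => (hd l t x).differentiableAt, ?_⟩
  have : (fun l t x => fderiv ℝ (f l t) x) = f' := by
    funext l t x; exact (hd l t x).fderiv
  rwa [this]

theorem Reg.exists_lipschitz {f : Λ → ℝ → Plane → F} (h : Reg H (k + 1) f) (R : ℝ) :
    ∃ C : ℝ, 0 ≤ C ∧ ∀ l t x y, |t| ≤ R → ‖x‖ ≤ R → ‖y‖ ≤ R →
      ‖f l t x - f l t y‖ ≤ C * ‖x - y‖ := by
  obtain ⟨C, hC⟩ := h.2.2.regZero.bdd R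
  refine ⟨max C 0, le_max_right _ _, fun l t x y ht hx hy => ?_⟩
  refine (convex_closedBall (0 : Plane) R).norm_image_sub_le_of_norm_fderiv_le
    (f := f l t) (fun u _ => (h.2.1 l t) u) (fun u hu => ?_) ?_ ?_
  · exact (hC l t u ht (by simpa using hu)).trans (le_max_left _ _)
  · simpa using hy
  · simpa using hx

/-- On a ball of radius `R`, `‖x - y‖ ≤ √(2R) √‖x - y‖`, so a local Lipschitz bound is a local
Hölder bound. -/
theorem Reg.regZero_true {f : Λ → ℝ → Plane → F} (h : Reg H (k + 1) f) : RegZero True f := by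
  refine ⟨h.1.cont, h.1.bdd, fun _ R => ?_⟩
  obtain ⟨C, hC0, hC⟩ := h.exists_lipschitz R
  refine ⟨C * √(2 * R), fun l t x y ht hx hy => (hC l t x y ht hx hy).trans ?_⟩
  have h1 : ‖x - y‖ ≤ 2 * R := (norm_sub_le _ _).trans (by linarith)
  have h2 : ‖x - y‖ = √‖x - y‖ * √‖x - y‖ := (Real.mul_self_sqrt (norm_nonneg _)).symm
  rw [mul_assoc]
  refine mul_le_mul_of_nonneg_left ?_ hC0
  conv_lhs => rw [h2]
  gcongr

/-- Giving up one derivative leaves a locally Lipschitz top derivative. It is Hölder, so the flag of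
the conclusion can be chosen freely. -/
theorem Reg.of_succ {H₂ : Prop} {f : Λ → ℝ → Plane → F} (h : Reg H (k + 1) f) : Reg H₂ k f := by
  induction k generalizing F with
  | zero =>
    have := h.regZero_true
    exact ⟨this.cont, this.bdd, fun _ => this.holder trivial⟩
  | succ k ih => exact ⟨h.1, h.2.1, ih h.2.2⟩

theorem Reg.of_le {j : ℕ} {f : Λ → ℝ → Plane → F} (h : Reg H k f) (hj : j ≤ k) : Reg H j f := by
  obtain ⟨n, rfl⟩ := Nat.exists_eq_add_of_le hj
  clear hj
  induction n with
  | zero => exact h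
  | succ n ih => exact ih h.of_succ

theorem RegZero.add {f g : Λ → ℝ → Plane → F} (hf : RegZero H f) (hg : RegZero H g) :
    RegZero H (fun l t x => f l t x + g l t x) := by
  refine ⟨fun l => (hf.cont l).add (hg.cont l), fun R => ?_, fun hH R => ?_⟩
  · obtain ⟨C, hC⟩ := hf.bdd R
    obtain ⟨D, hD⟩ := hg.bdd R
    exact ⟨C + D, fun l t x ht hx => (norm_add_le _ _).trans
      (add_le_add (hC l t x ht hx) (hD l t x ht hx))⟩
  · obtain ⟨C, hC⟩ := hf.holder hH R
    obtain ⟨D, hD⟩ := hg.holder hH R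
    refine ⟨C + D, fun l t x y ht hx hy => ?_⟩
    rw [add_sub_add_comm, add_mul]
    exact (norm_add_le _ _).trans (add_le_add (hC l t x y ht hx hy) (hD l t x y ht hx hy))

theorem Reg.add {f g : Λ → ℝ → Plane → F} (hf : Reg H k f) (hg : Reg H k g) :
    Reg H k (fun l t x => f l t x + g l t x) := by
  induction k generalizing F with
  | zero => exact RegZero.add hf hg
  | succ k ih =>
    exact Reg.of_hasFDerivAt (hf.1.add hg.1)
      (fun l t x => (hf.2.1 l t x).hasFDerivAt.add (hg.2.1 l t x).hasFDerivAt)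
      (ih hf.2.2 hg.2.2)

theorem Reg.of_time {c : Λ → ℝ → F} (hc : ∀ l, Continuous (c l))
    (hb : ∀ R : ℝ, ∃ C : ℝ, ∀ l t, |t| ≤ R → ‖c l t‖ ≤ C) :
    Reg H k (fun l t (_ : Plane) => c l t) := by
  have base : ∀ {F : Type} [NormedAddCommGroup F] [NormedSpace ℝ F] {c : Λ → ℝ → F} {K : Prop},
      (∀ l, Continuous (c l)) → (∀ R : ℝ, ∃ C : ℝ, ∀ l t, |t| ≤ R → ‖c l t‖ ≤ C) →
      RegZero K (fun l t (_ : Plane) => c l t) := by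
    intro F _ _ c K hc hb
    refine ⟨fun l => (hc l).comp continuous_fst, fun R => ?_, fun _ R => ⟨0, by simp⟩⟩
    obtain ⟨C, hC⟩ := hb R
    exact ⟨C, fun l t x ht _ => hC l t ht⟩
  induction k generalizing F with
  | zero => exact base hc hb
  | succ k ih =>
    refine Reg.of_hasFDerivAt (base hc hb) (fun l t x => hasFDerivAt_const _ _) ?_
    exact ih (c := fun _ _ => 0) (fun _ => continuous_const) (fun R => ⟨0, by simp⟩)

theorem Reg.const (c : F) : Reg H k (fun (_ : Λ) _ _ => c) :=
  Reg.of_time (c := fun _ _ => c) (fun _ => continuous_const) (fun _ => ⟨‖c‖, by simp⟩)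

/-- The product rule. Scalar multiples, evaluation of operators and composition of operators are all
instances for a suitable bilinear map. -/
theorem Reg.bilin {f : Λ → ℝ → Plane → F} {g : Λ → ℝ → Plane → G} (B : F →L[ℝ] G →L[ℝ] H')
    (hf : Reg H k f) (hg : Reg H k g) : Reg H k (fun l t x => B (f l t x) (g l t x)) := by
  have base : ∀ {F G H' : Type} [NormedAddCommGroup F] [NormedSpace ℝ F] [NormedAddCommGroup G]
      [NormedSpace ℝ G] [NormedAddCommGroup H'] [NormedSpace ℝ H'] {K : Prop}
      {f : Λ → ℝ → Plane → F} {g : Λ → ℝ → Plane → G} (B : F →L[ℝ] G →L[ℝ] H'),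
      RegZero K f → RegZero K g → RegZero K (fun l t x => B (f l t x) (g l t x)) := by
    intro F G H' _ _ _ _ _ _ K f g B hf hg
    refine ⟨fun l => (B.isBoundedBilinearMap.continuous).comp ((hf.cont l).prodMk (hg.cont l)),
      fun R => ?_, fun hK R => ?_⟩
    · obtain ⟨C, hC⟩ := hf.bdd R
      obtain ⟨D, hD⟩ := hg.bdd R
      refine ⟨‖B‖ * C * D, fun l t x ht hx => (B.le_opNorm₂ _ _).trans ?_⟩
      have := hC l t x ht hx
      have := hD l t x ht hx
      have : 0 ≤ C := (norm_nonneg _).trans (hC l t x ht hx)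
      gcongr
    · obtain ⟨C, hC⟩ := hf.bdd R
      obtain ⟨D, hD⟩ := hg.bdd R
      obtain ⟨C', hC'⟩ := hf.holder hK R
      obtain ⟨D', hD'⟩ := hg.holder hK R
      refine ⟨‖B‖ * C * D' + ‖B‖ * C' * D, fun l t x y ht hx hy => ?_⟩
      have e : B (f l t x) (g l t x) - B (f l t y) (g l t y)
          = B (f l t x) (g l t x - g l t y) + B (f l t x - f l t y) (g l t y) := by
        simp [map_sub]
      rw [e]
      refine (norm_add_le _ _).trans ?_
      have h1 := (B.le_opNorm₂ (f l t x) (g l t x - g l t y))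
      have h2 := (B.le_opNorm₂ (f l t x - f l t y) (g l t y))
      have i1 := hC l t x ht hx
      have i2 := hD l t y ht hy
      have i3 := hC' l t x y ht hx hy
      have i4 := hD' l t x y ht hx hy
      have i5 : 0 ≤ C := (norm_nonneg _).trans i1
      have i6 : 0 ≤ C' * √‖x - y‖ := (norm_nonneg _).trans i3
      calc _ ≤ ‖B‖ * ‖f l t x‖ * ‖g l t x - g l t y‖ + ‖B‖ * ‖f l t x - f l t y‖ * ‖g l t y‖ :=
            add_le_add h1 h2
        _ ≤ ‖B‖ * C * (D' * √‖x - y‖) + ‖B‖ * (C' * √‖x - y‖) * D := by gcongr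
        _ = _ := by ring
  induction k generalizing F G H' with
  | zero => exact base B hf hg
  | succ k ih =>
    refine Reg.of_hasFDerivAt (base B hf.1 hg.1)
      (fun l t x => B.hasFDerivAt_of_bilinear (hf.2.1 l t x).hasFDerivAt
        (hg.2.1 l t x).hasFDerivAt) ?_
    exact Reg.add (ih (B.precompR Plane) hf.of_succ hg.2.2) (ih (B.precompL Plane) hf.2.2 hg.of_succ)

theorem Reg.clm {f : Λ → ℝ → Plane → F} (L : F →L[ℝ] G) (hf : Reg H k f) :
    Reg H k (fun l t x => L (f l t x)) :=
  Reg.bilin (ContinuousLinearMap.id ℝ (F →L[ℝ] G)) (Reg.const L) hf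

theorem Reg.neg {f : Λ → ℝ → Plane → F} (hf : Reg H k f) : Reg H k (fun l t x => -f l t x) :=
  hf.clm (-ContinuousLinearMap.id ℝ F)

theorem Reg.sub {f g : Λ → ℝ → Plane → F} (hf : Reg H k f) (hg : Reg H k g) :
    Reg H k (fun l t x => f l t x - g l t x) := by
  simpa only [sub_eq_add_neg] using hf.add hg.neg

theorem Reg.smul {c : Λ → ℝ → Plane → ℝ} {f : Λ → ℝ → Plane → F} (hc : Reg H k c)
    (hf : Reg H k f) : Reg H k (fun l t x => c l t x • f l t x) :=
  Reg.bilin (ContinuousLinearMap.lsmul ℝ ℝ) hc hf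

theorem Reg.clm_apply {f : Λ → ℝ → Plane → F →L[ℝ] G} {g : Λ → ℝ → Plane → F} (hf : Reg H k f)
    (hg : Reg H k g) : Reg H k (fun l t x => f l t x (g l t x)) :=
  Reg.bilin (ContinuousLinearMap.id ℝ (F →L[ℝ] G)) hf hg

theorem Reg.clm_comp {f : Λ → ℝ → Plane → G →L[ℝ] H'} {g : Λ → ℝ → Plane → F →L[ℝ] G}
    (hf : Reg H k f) (hg : Reg H k g) : Reg H k (fun l t x => (f l t x).comp (g l t x)) :=
  Reg.bilin (ContinuousLinearMap.compL ℝ F G H') hf hg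

theorem Reg.reindex {Λ' : Type} {f : Λ → ℝ → Plane → F} (φ : Λ' → Λ) (hf : Reg H k f) :
    Reg H k (fun l => f (φ l)) := by
  have base : ∀ {F : Type} [NormedAddCommGroup F] [NormedSpace ℝ F] {f : Λ → ℝ → Plane → F}
      {K : Prop}, RegZero K f → RegZero K (fun l => f (φ l)) := by
    intro F _ _ f K hf
    refine ⟨fun l => hf.cont _, fun R => ?_, fun hK R => ?_⟩
    · obtain ⟨C, hC⟩ := hf.bdd R
      exact ⟨C, fun l => hC _⟩
    · obtain ⟨C, hC⟩ := hf.holder hK R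
      exact ⟨C, fun l => hC _⟩
  induction k generalizing F with
  | zero => exact base hf
  | succ k ih => exact ⟨base hf.1, fun l => hf.2.1 _, ih hf.2.2⟩

theorem RegZero.of_continuous {g : Plane → F} (hg : Continuous g) :
    RegZero False (fun (_ : Λ) (_ : ℝ) x => g x) := by
  refine ⟨fun l => hg.comp continuous_snd, fun R => ?_, False.elim⟩
  obtain ⟨C, hC⟩ := (isCompact_closedBall (0 : Plane) R).exists_bound_of_continuousOn
    hg.continuousOn
  exact ⟨C, fun l t x _ hx => hC x (by simpa using hx)⟩

theorem Reg.of_contDiff {g : Plane → F} (hg : ContDiff ℝ k g) :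
    Reg False k (fun (_ : Λ) (_ : ℝ) x => g x) := by
  induction k generalizing F with
  | zero => exact RegZero.of_continuous hg.continuous
  | succ k ih =>
    have := (contDiff_succ_iff_fderiv (𝕜 := ℝ) (n := k) (f := g)).1 (by exact_mod_cast hg)
    exact ⟨RegZero.of_continuous hg.continuous, fun _ _ => this.1, ih this.2.2⟩

theorem Reg.contDiff {f : Λ → ℝ → Plane → F} (hf : Reg H k f) (l : Λ) (t : ℝ) :
    ContDiff ℝ k (f l t) := by
  induction k generalizing F with
  | zero => exact contDiff_zero.2 ((RegZero.cont hf l).comp (Continuous.prodMk_right t))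
  | succ k ih =>
    have := (contDiff_succ_iff_fderiv (𝕜 := ℝ) (n := k) (f := f l t)).2
      ⟨hf.2.1 l t, by simp, ih hf.2.2⟩
    exact_mod_cast this

/-- For `k = 0` a Hölder function of a merely Hölder map would have a worse exponent, so the inner
map is separately assumed to have one derivative. -/
theorem Reg.comp {g : Λ → ℝ → Plane → F} {f : Λ → ℝ → Plane → Plane} (hg : Reg H k g)
    (hf : Reg H k f) (hf1 : Reg False 1 f) : Reg H k (fun l t x => g l t (f l t x)) := by
  have base : ∀ {F : Type} [NormedAddCommGroup F] [NormedSpace ℝ F] {g : Λ → ℝ → Plane → F}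
      {K : Prop}, RegZero K g → RegZero K (fun l t x => g l t (f l t x)) := by
    intro F _ _ g K hg
    have bd : ∀ R : ℝ, ∃ S : ℝ, R ≤ S ∧ ∀ l t x, |t| ≤ R → ‖x‖ ≤ R → ‖f l t x‖ ≤ S := fun R => by
      obtain ⟨S, hS⟩ := hf1.1.bdd R
      exact ⟨max R S, le_max_left _ _, fun l t x ht hx => (hS l t x ht hx).trans (le_max_right _ _)⟩
    refine ⟨fun l => (hg.cont l).comp (continuous_fst.prodMk (hf1.1.cont l)), fun R => ?_,
      fun hK R => ?_⟩
    · obtain ⟨S, hRS, hS⟩ := bd R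
      obtain ⟨C, hC⟩ := hg.bdd S
      exact ⟨C, fun l t x ht hx => hC l t _ (ht.trans hRS) (hS l t x ht hx)⟩
    · obtain ⟨S, hRS, hS⟩ := bd R
      obtain ⟨C, hC⟩ := hg.holder hK S
      obtain ⟨L, hL0, hL⟩ := hf1.exists_lipschitz R
      refine ⟨max C 0 * √L, fun l t x y ht hx hy => ?_⟩
      refine (hC l t _ _ (ht.trans hRS) (hS l t x ht hx) (hS l t y ht hy)).trans ?_
      rw [mul_assoc, ← Real.sqrt_mul hL0]
      have := hL l t x y ht hx hy
      gcongr
      exact le_max_left _ _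
  induction k generalizing F with
  | zero => exact base hg
  | succ k ih =>
    refine Reg.of_hasFDerivAt (base hg.1)
      (fun l t x => ((hg.2.1 l t _).hasFDerivAt).comp x (hf.2.1 l t x).hasFDerivAt) ?_
    exact Reg.clm_comp (ih hg.2.2 hf.of_succ) hf.2.2

theorem Reg.hasFDerivAt_integral [CompleteSpace F] {f : Λ → ℝ → Plane → F} (hf : Reg H (k + 1) f)
    (l : Λ) (t : ℝ) (x : Plane) : HasFDerivAt (fun x => ∫ s in (0 : ℝ)..t, f l s x)
      (∫ s in (0 : ℝ)..t, fderiv ℝ (f l s) x) x := by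
  obtain ⟨C, hC⟩ := hf.2.2.regZero.bdd (max |t| (‖x‖ + 1))
  have cf : ∀ u, Continuous (fun s => f l s u) := fun u =>
    (hf.1.cont l).comp (Continuous.prodMk_left u)
  have cf' : Continuous (fun s => fderiv ℝ (f l s) x) :=
    (hf.2.2.regZero.cont l).comp (Continuous.prodMk_left x)
  refine intervalIntegral.hasFDerivAt_integral_of_dominated_of_fderiv_le
    (F := fun x s => f l s x) (F' := fun x s => fderiv ℝ (f l s) x) (bound := fun _ => C)
    (Metric.ball_mem_nhds x one_pos)
    (Eventually.of_forall fun u => (cf u).aestronglyMeasurable)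
    ((cf x).intervalIntegrable _ _) cf'.aestronglyMeasurable ?_ (by simp) ?_
  · refine Eventually.of_forall fun s hs u hu => hC l s u ?_ ?_
    · have := Set.abs_sub_left_of_mem_uIcc (Set.uIoc_subset_uIcc hs)
      simp at this
      exact this.trans (le_max_left _ _)
    · refine le_trans ?_ (le_max_right _ _)
      have := norm_sub_norm_le u x
      rw [mem_ball_iff_norm] at hu
      linarith
  · exact Eventually.of_forall fun s hs u hu => (hf.2.1 l s u).hasFDerivAt

theorem Reg.integral [CompleteSpace F] {f : Λ → ℝ → Plane → F} (hf : Reg H k f) :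
    Reg H k (fun l t x => ∫ s in (0 : ℝ)..t, f l s x) := by
  have base : ∀ {F : Type} [NormedAddCommGroup F] [NormedSpace ℝ F] {f : Λ → ℝ → Plane → F}
      {K : Prop}, RegZero K f → RegZero K (fun l t x => ∫ s in (0 : ℝ)..t, f l s x) := by
    intro F _ _ f K hf
    have mem : ∀ {t R s : ℝ}, |t| ≤ R → s ∈ Set.uIoc 0 t → |s| ≤ R := by
      intro t R s ht hs
      have := Set.uIoc_subset_uIcc hs
      have := Set.abs_sub_left_of_mem_uIcc this
      simp at this
      linarith
    refine ⟨fun l => ?_, fun R => ?_, fun hK R => ?_⟩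
    · exact intervalIntegral.continuous_parametric_intervalIntegral_of_continuous
        (f := fun p : ℝ × Plane => fun s => f l s p.2)
        ((hf.cont l).comp (continuous_snd.prodMk (continuous_snd.comp continuous_fst)))
        continuous_fst
    · obtain ⟨C, hC⟩ := hf.bdd R
      refine ⟨C * R, fun l t x ht hx => ?_⟩
      refine (intervalIntegral.norm_integral_le_of_norm_le_const (C := C)
        fun s hs => hC l s x (mem ht hs) hx).trans ?_
      rw [sub_zero]
      have : 0 ≤ C := (norm_nonneg _).trans (hC l t x ht hx)
      gcongr
    · obtain ⟨C, hC⟩ := hf.holder hK R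
      refine ⟨max C 0 * R, fun l t x y ht hx hy => ?_⟩
      have ci : ∀ u, IntervalIntegrable (fun s => f l s u) volume 0 t := fun u =>
        ((hf.cont l).comp (Continuous.prodMk_left u)).intervalIntegrable _ _
      rw [← intervalIntegral.integral_sub (ci x) (ci y)]
      refine (intervalIntegral.norm_integral_le_of_norm_le_const (C := max C 0 * √‖x - y‖)
        fun s hs => (hC l s x y (mem ht hs) hx hy).trans ?_).trans ?_
      · gcongr
        exact le_max_left _ _
      · rw [sub_zero, mul_right_comm]
        gcongr
  induction k generalizing F with
  | zero => exact base hf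
  | succ k ih =>
    refine Reg.of_hasFDerivAt (base hf.1) hf.hasFDerivAt_integral (ih hf.2.2)

/-- From `DN = -N (DM) N` the regularity of the inverse follows by induction; at order zero the same
role is played by `N(x) - N(y) = N(x) (M(y) - M(x)) N(y)`. -/
theorem Reg.inverse {M N : Λ → ℝ → Plane → Plane →L[ℝ] Plane} (hM : Reg H k M)
    (hN : RegZero False N) (hMN : ∀ l t x, (M l t x).comp (N l t x) = .id ℝ Plane)
    (hNM : ∀ l t x, (N l t x).comp (M l t x) = .id ℝ Plane) : Reg H k N := by
  induction k with
  | zero =>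
    refine ⟨hN.cont, hN.bdd, fun hH R => ?_⟩
    obtain ⟨C, hC⟩ := hN.bdd R
    obtain ⟨D, hD⟩ := RegZero.holder hM hH R
    refine ⟨C * D * C, fun l t x y ht hx hy => ?_⟩
    have e : N l t x - N l t y = (N l t x).comp ((M l t y - M l t x).comp (N l t y)) := by
      rw [ContinuousLinearMap.sub_comp, hMN, ContinuousLinearMap.comp_sub,
        ← ContinuousLinearMap.comp_assoc, hNM]
      rfl
    rw [e]
    have h0 := hC l t x ht hx
    have h1 := hC l t y ht hy
    have h2 := hD l t y x ht hy hx
    rw [norm_sub_rev y x] at h2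
    have h3 : 0 ≤ C := (norm_nonneg _).trans h0
    calc _ ≤ ‖N l t x‖ * (‖M l t y - M l t x‖ * ‖N l t y‖) :=
          (ContinuousLinearMap.opNorm_comp_le _ _).trans
            (mul_le_mul_of_nonneg_left (ContinuousLinearMap.opNorm_comp_le _ _) (norm_nonneg _))
      _ ≤ C * ((D * √‖x - y‖) * C) := by
          have := (norm_nonneg _).trans h2
          gcongr
      _ = _ := by ring
  | succ k ih =>
    have hNk := ih hM.of_succ
    let u : Λ → ℝ → Plane → (Plane →L[ℝ] Plane)ˣ := fun l t x =>
      ⟨M l t x, N l t x, hMN l t x, hNM l t x⟩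
    have e : ∀ l t, N l t = fun x => Ring.inverse (M l t x) := fun l t => by
      funext x
      exact (Ring.inverse_unit (u l t x)).symm
    let B := ContinuousLinearMap.compL ℝ Plane Plane Plane
    refine Reg.of_hasFDerivAt hN (f' := fun l t x =>
      -((B (N l t x)).comp ((B.flip (N l t x)).comp (fderiv ℝ (M l t) x)))) (fun l t x => ?_) ?_
    · have h1 := hasFDerivAt_ringInverse (𝕜 := ℝ) (u l t x)
      have h2 := h1.comp x (hM.2.1 l t x).hasFDerivAt
      have h3 : Ring.inverse ∘ M l t = N l t := (e l t).symm
      rw [h3] at h2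
      refine h2.congr_fderiv ?_
      ext v w : 2
      rfl
    · have h1 := Reg.clm (G := (Plane →L[ℝ] Plane) →L[ℝ] (Plane →L[ℝ] Plane)) B hNk
      have h2 := Reg.clm (G := (Plane →L[ℝ] Plane) →L[ℝ] (Plane →L[ℝ] Plane)) B.flip hNk
      exact Reg.neg (Reg.clm_comp h1 (Reg.clm_comp h2 hM.2.2))

end Reg

/-! ### Global solutions of ordinary differential equations with Lipschitz right-hand side -/

section ODE

variable {V : Type*} [NormedAddCommGroup V] [NormedSpace ℝ V]

/-- Gronwall's inequality in both directions of time; the backward half is the forward half for the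
reversed trajectories. -/
theorem dist_trajectories_le {f : ℝ → V → V} {K : ℝ≥0} (hf : ∀ t, LipschitzWith K (f t))
    {γ₁ γ₂ : ℝ → V} (h₁ : ∀ t, HasDerivAt γ₁ (f t (γ₁ t)) t)
    (h₂ : ∀ t, HasDerivAt γ₂ (f t (γ₂ t)) t) (s t : ℝ) :
    dist (γ₁ t) (γ₂ t) ≤ dist (γ₁ s) (γ₂ s) * Real.exp (K * |t - s|) := by
  rcases le_total s t with hst | hst
  · rw [abs_of_nonneg (sub_nonneg.2 hst)]
    exact dist_le_of_trajectories_ODE hf (fun u _ => (h₁ u).continuousAt.continuousWithinAt)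
      (fun u _ => (h₁ u).hasDerivWithinAt) (fun u _ => (h₂ u).continuousAt.continuousWithinAt)
      (fun u _ => (h₂ u).hasDerivWithinAt) le_rfl t ⟨hst, le_rfl⟩
  · rw [abs_of_nonpos (sub_nonpos.2 hst)]
    have rev : ∀ {γ : ℝ → V}, (∀ t, HasDerivAt γ (f t (γ t)) t) →
        ∀ u, HasDerivAt (fun u => γ (-u)) (-f (-u) (γ (-u))) u := fun {γ} h u => by
      simpa [Function.comp_def] using (h (-u)).scomp u (hasDerivAt_neg u)
    have := dist_le_of_trajectories_ODE (v := fun u x => -f (-u) x) (K := K) (a := -s) (b := -t)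
      (fun u => (hf (-u)).neg) (fun u _ => (rev h₁ u).continuousAt.continuousWithinAt)
      (fun u _ => (rev h₁ u).hasDerivWithinAt)
      (fun u _ => (rev h₂ u).continuousAt.continuousWithinAt)
      (fun u _ => (rev h₂ u).hasDerivWithinAt) le_rfl (-t) ⟨neg_le_neg hst, le_rfl⟩
    simp only [neg_neg] at this
    convert this using 3
    ring

theorem trajectory_unique {f : ℝ → V → V} {K : ℝ≥0} (hf : ∀ t, LipschitzWith K (f t))
    {γ₁ γ₂ : ℝ → V} (h₁ : ∀ t, HasDerivAt γ₁ (f t (γ₁ t)) t)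
    (h₂ : ∀ t, HasDerivAt γ₂ (f t (γ₂ t)) t) {s : ℝ} (hs : γ₁ s = γ₂ s) : γ₁ = γ₂ := by
  funext t
  have := dist_trajectories_le hf h₁ h₂ s t
  rw [hs, dist_self, zero_mul] at this
  exact dist_le_zero.1 this

/-- The Picard–Lindelöf theorem needs a bounded field. The field is precomposed with a compactly
supported map `g` that is the identity on the ball of radius `R`, and the linear growth of `f` shows
that the solution never leaves that ball. -/
theorem exists_trajectory_on_Icc [FiniteDimensional ℝ V] {f : ℝ → V → V} {K : ℝ≥0}
    (hc : Continuous fun p : ℝ × V => f p.1 p.2) (hf : ∀ t, LipschitzWith K (f t))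
    (t₀ : ℝ) (x₀ : V) {T : ℝ} (hT : 0 < T) :
    ∃ γ : ℝ → V, γ t₀ = x₀ ∧ ∀ t ∈ Ioo (t₀ - T) (t₀ + T), HasDerivAt γ (f t (γ t)) t := by
  obtain ⟨D, hD⟩ := (isCompact_Icc (a := t₀ - T) (b := t₀ + T)).exists_bound_of_continuousOn
    (f := fun t => f t 0) (hc.comp (Continuous.prodMk_left 0)).continuousOn
  have hD0 : 0 ≤ D := (norm_nonneg _).trans (hD t₀ ⟨by linarith, by linarith⟩)
  -- The a priori bound for solutions of `‖γ'‖ ≤ K ‖γ‖ + D`, which holds for the truncated field as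
  -- well because `‖g x‖ ≤ ‖x‖`.
  let R := gronwallBound ‖x₀‖ K D T
  have hR : ∀ t ∈ Icc 0 T, gronwallBound ‖x₀‖ K D t ≤ R := fun t ht =>
    gronwallBound_mono (norm_nonneg _) hD0 K.2 ht.2
  have hR0 : 0 ≤ R := by
    have := hR 0 ⟨le_rfl, hT.le⟩
    rw [gronwallBound_x0] at this
    exact (norm_nonneg _).trans this
  let φ : ContDiffBump (0 : V) := ⟨R + 1, R + 2, by linarith, by linarith⟩
  let g : V → V := fun x => φ x • x
  have gc : HasCompactSupport g := φ.hasCompactSupport.smul_right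
  have gd : ContDiff ℝ 1 g := φ.contDiff.smul contDiff_id
  obtain ⟨L, hL⟩ := gd.lipschitzWith_of_hasCompactSupport gc one_ne_zero
  have gle : ∀ x, ‖g x‖ ≤ ‖x‖ := fun x => by
    rw [norm_smul, Real.norm_of_nonneg φ.nonneg]
    exact mul_le_of_le_one_left (norm_nonneg _) φ.le_one
  have geq : ∀ x, ‖x‖ ≤ R → g x = x := fun x hx => by
    have : φ x = 1 := φ.one_of_mem_closedBall (by
      rw [mem_closedBall_zero_iff]; exact hx.trans (by simp [φ]))
    simp [g, this]
  have fle : ∀ t ∈ Icc (t₀ - T) (t₀ + T), ∀ x, ‖f t (g x)‖ ≤ K * ‖x‖ + D := fun t ht x => by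
    have h1 := (hf t).dist_le_mul (g x) 0
    rw [dist_eq_norm, dist_zero_right] at h1
    calc ‖f t (g x)‖ ≤ ‖f t (g x) - f t 0‖ + ‖f t 0‖ := by
          simpa using norm_add_le (f t (g x) - f t 0) (f t 0)
      _ ≤ K * ‖g x‖ + D := add_le_add h1 (hD t ht)
      _ ≤ K * ‖x‖ + D := by gcongr; exact gle x
  have cfg : Continuous fun p : ℝ × V => f p.1 (g p.2) :=
    hc.comp (continuous_fst.prodMk (gd.continuous.comp continuous_snd))
  obtain ⟨B, hB⟩ := (isCompact_Icc (a := t₀ - T) (b := t₀ + T)).prod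
    (isCompact_closedBall (0 : V) (R + 2)) |>.exists_bound_of_continuousOn cfg.continuousOn
  have hB' : ∀ t ∈ Icc (t₀ - T) (t₀ + T), ∀ x, ‖f t (g x)‖ ≤ max B D := fun t ht x => by
    by_cases hx : ‖x‖ ≤ R + 2
    · exact (hB (t, x) ⟨ht, by simpa using hx⟩).trans (le_max_left _ _)
    · have : g x = 0 := by
        have : φ x = 0 := φ.zero_of_le_dist (by
          rw [dist_zero_right]; exact (not_le.1 hx).le)
        simp [g, this]
      rw [this]
      exact (hD t ht).trans (le_max_right _ _)
  let B' : ℝ≥0 := ⟨max B D, hD0.trans (le_max_right _ _)⟩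
  let T' : ℝ≥0 := ⟨T, hT.le⟩
  -- A field bounded by `B'` moves a point by at most `B' * T'` in time `T`, hence this radius. The
  -- initial ball is a single point, hence `0`.
  have pl : IsPicardLindelof (fun t x => f t (g x)) (tmin := t₀ - T) (tmax := t₀ + T)
      ⟨t₀, by linarith, by linarith⟩ x₀ (B' * T') 0 B' (K * L) := by
    refine ⟨fun t _ => ((hf t).comp hL).lipschitzOnWith, fun x _ =>
      (cfg.comp (Continuous.prodMk_left x)).continuousOn, fun t ht x _ => hB' t ht x, ?_⟩
    simp only [add_sub_cancel_left, sub_sub_cancel, max_self, NNReal.coe_zero, sub_zero]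
    exact le_rfl
  obtain ⟨γ, h0, hγ⟩ := pl.exists_eq_forall_mem_Icc_hasDerivWithinAt₀
  have hγ' : ∀ t ∈ Ioo (t₀ - T) (t₀ + T), HasDerivAt γ (f t (g (γ t))) t := fun t ht =>
    (hγ t (Ioo_subset_Icc_self ht)).hasDerivAt (Icc_mem_nhds ht.1 ht.2)
  have bound : ∀ t ∈ Ioo (t₀ - T) (t₀ + T), ‖γ t‖ ≤ R := by
    intro t ht
    rcases le_total t₀ t with h | h
    · have := norm_le_gronwallBound_of_norm_deriv_right_le (f := γ)
        (f' := fun t => f t (g (γ t))) (δ := ‖x₀‖) (K := K) (ε := D) (a := t₀) (b := t)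
        (fun s hs => (hγ' s ⟨by linarith [hs.1], hs.2.trans_lt ht.2⟩).continuousAt.continuousWithinAt)
        (fun s hs => (hγ' s ⟨by linarith [hs.1], hs.2.trans ht.2⟩).hasDerivWithinAt)
        (by rw [h0]) (fun s hs => fle s ⟨by linarith [hs.1], (hs.2.trans ht.2).le⟩ _) t ⟨h, le_rfl⟩
      exact this.trans (hR _ ⟨by linarith, by linarith [ht.2]⟩)
    · have rev : ∀ u, -u ∈ Ioo (t₀ - T) (t₀ + T) →
          HasDerivAt (fun u => γ (-u)) (-f (-u) (g (γ (-u)))) u := fun u hu => by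
        simpa [Function.comp_def] using (hγ' (-u) hu).scomp u (hasDerivAt_neg u)
      have := norm_le_gronwallBound_of_norm_deriv_right_le (f := fun u => γ (-u))
        (f' := fun u => -f (-u) (g (γ (-u)))) (δ := ‖x₀‖) (K := K) (ε := D) (a := -t₀) (b := -t)
        (fun s hs => (rev s ⟨by linarith [hs.2, ht.1],
          by linarith [hs.1]⟩).continuousAt.continuousWithinAt)
        (fun s hs => (rev s ⟨by linarith [hs.2, ht.1], by linarith [hs.1]⟩).hasDerivWithinAt)
        (by simp [h0])
        (fun s hs => by
          rw [norm_neg]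
          exact fle (-s) ⟨by linarith [hs.2, ht.1], by linarith [hs.1]⟩ _) (-t) ⟨by linarith, le_rfl⟩
      simp only [neg_neg] at this
      exact this.trans (hR _ ⟨by linarith, by linarith [ht.1]⟩)
  refine ⟨γ, h0, fun t ht => ?_⟩
  have := hγ' t ht
  rwa [geq _ (bound t ht)] at this

/-- Solutions on the intervals of radius `n + 1` agree where both are defined; at time `t` the one
with index `N t > |t - t₀|` is used, which leaves a neighbourhood to differentiate in. -/
theorem exists_trajectory [FiniteDimensional ℝ V] {f : ℝ → V → V} {K : ℝ≥0}
    (hc : Continuous fun p : ℝ × V => f p.1 p.2) (hf : ∀ t, LipschitzWith K (f t))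
    (t₀ : ℝ) (x₀ : V) : ∃ γ : ℝ → V, γ t₀ = x₀ ∧ ∀ t, HasDerivAt γ (f t (γ t)) t := by
  choose γ h0 hγ using fun n : ℕ => exists_trajectory_on_Icc hc hf t₀ x₀ (T := n + 1) (by positivity)
  have agree : ∀ m n : ℕ, m ≤ n → ∀ t ∈ Ioo (t₀ - (m + 1)) (t₀ + (m + 1)), γ m t = γ n t := by
    intro m n hmn t ht
    have hmn' : (m : ℝ) ≤ n := by exact_mod_cast hmn
    refine ODE_solution_unique_of_mem_Ioo (v := f) (s := fun _ => univ) (K := K)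
      (t₀ := t₀) (a := t₀ - (m + 1)) (b := t₀ + (m + 1))
      (fun t _ => (hf t).lipschitzOnWith) ⟨by linarith, by linarith⟩
      (fun u hu => ⟨hγ m u hu, trivial⟩)
      (fun u hu => ⟨hγ n u ⟨by linarith [hu.1], by linarith [hu.2]⟩, trivial⟩)
      ((h0 m).trans (h0 n).symm) ht
  have hN : ∀ t, ∃ n : ℕ, |t - t₀| < n := fun t => exists_nat_gt _
  choose N hN using hN
  refine ⟨fun t => γ (N t) t, h0 _, fun t => ?_⟩
  have ht := abs_lt.1 (hN t)
  refine (hγ (N t) t ⟨by linarith, by linarith⟩).congr_of_eventuallyEq ?_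
  filter_upwards [Ioo_mem_nhds (a := t₀ - (N t + 1)) (b := t₀ + (N t + 1)) (x := t)
    (by linarith) (by linarith)] with s hs
  have hs' := abs_lt.1 (hN s)
  rcases le_total (N s) (N t) with h | h
  · exact agree _ _ h s ⟨by linarith, by linarith⟩
  · exact (agree _ _ h s hs).symm

end ODE

/-! ### Linear equations depending on a parameter -/

section Linear

variable {Λ : Type} {F G : Type} [NormedAddCommGroup F] [NormedSpace ℝ F]
  [NormedAddCommGroup G] [NormedSpace ℝ G] {H : Prop} {k : ℕ}

theorem RegZero.comp_inner {g : Λ → ℝ → Plane → F} {f : Λ → ℝ → Plane → Plane}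
    (hg : RegZero False g) (hf : RegZero False f) :
    RegZero False (fun l t x => g l t (f l t x)) := by
  refine ⟨fun l => (hg.cont l).comp (continuous_fst.prodMk (hf.cont l)), fun R => ?_, False.elim⟩
  obtain ⟨S, hS⟩ := hf.bdd R
  obtain ⟨C, hC⟩ := hg.bdd (max R S)
  exact ⟨C, fun l t x ht hx => hC l t _ (ht.trans (le_max_left _ _))
    ((hS l t x ht hx).trans (le_max_right _ _))⟩

/-- The integrand need be differentiable only at `x₀`, with a Lipschitz bound relative to `x₀`. This
is what the variation of constants formulas below provide. -/
theorem hasFDerivAt_intervalIntegral_of_lip [CompleteSpace F] {g : ℝ → Plane → F} {g' : ℝ → Plane →L[ℝ] F}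
    {x₀ : Plane} {t C : ℝ} (hg : ∀ x, Continuous fun s => g s x) (hg' : Continuous g')
    (hd : ∀ s, HasFDerivAt (g s) (g' s) x₀)
    (hC : ∀ s, |s| ≤ |t| → ∀ x, ‖x - x₀‖ ≤ 1 → ‖g s x - g s x₀‖ ≤ C * ‖x - x₀‖) :
    HasFDerivAt (fun x => ∫ s in (0 : ℝ)..t, g s x) (∫ s in (0 : ℝ)..t, g' s) x₀ := by
  simp only [intervalIntegral.intervalIntegral_eq_integral_uIoc]
  refine HasFDerivAt.const_smul ?_ _
  have := hasFDerivAt_integral_of_dominated_loc_of_lip' (𝕜 := ℝ) (μ := volume.restrict (uIoc 0 t))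
    (F := fun x s => g s x) (F' := g') (x₀ := x₀) (bound := fun _ => C)
    (Metric.ball_mem_nhds x₀ one_pos)
    (fun x _ => (hg x).aestronglyMeasurable) ?_ hg'.aestronglyMeasurable ?_ ?_ ?_
  · exact this.2
  · exact ((hg x₀).integrableOn_uIcc (a := 0) (b := t)).mono_set uIoc_subset_uIcc
  · refine (ae_restrict_iff' measurableSet_uIoc).2 (Eventually.of_forall fun s hs x hx => ?_)
    refine hC s ?_ x (by rw [mem_ball_iff_norm] at hx; exact hx.le)
    have := Set.abs_sub_left_of_mem_uIcc (Set.uIoc_subset_uIcc hs)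
    simpa using this
  · exact (continuous_const.integrableOn_uIcc (a := 0) (b := t)).mono_set uIoc_subset_uIcc
  · exact Eventually.of_forall hd

/-- If one factor vanishes at the point, the term with the derivative of the other factor drops out,
so mere continuity of that factor is enough. -/
theorem hasFDerivAt_bilin_of_zero {E₁ : Type*} [NormedAddCommGroup E₁] [NormedSpace ℝ E₁]
    {P : Plane → F} {Q : Plane → G} {P' : Plane →L[ℝ] F}
    {x₀ : Plane} (B : F →L[ℝ] G →L[ℝ] E₁) (hP : HasFDerivAt P P' x₀) (h0 : P x₀ = 0)
    (hQ : ContinuousAt Q x₀) :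
    HasFDerivAt (fun x => B (P x) (Q x)) ((B.flip (Q x₀)).comp P') x₀ := by
  have h1 : HasFDerivAt (fun x => B.flip (Q x₀) (P x)) ((B.flip (Q x₀)).comp P') x₀ :=
    (B.flip (Q x₀)).hasFDerivAt.comp x₀ hP
  have h2 : HasFDerivAt (fun x => B (P x) (Q x - Q x₀)) (0 : Plane →L[ℝ] E₁) x₀ := by
    rw [hasFDerivAt_iff_isLittleO]
    simp only [h0, map_zero, zero_apply, sub_zero]
    have hPO : P =O[𝓝 x₀] fun x => x - x₀ := by
      have := hP.isBigO_sub
      simpa [h0] using this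
    have hQo : (fun x => Q x - Q x₀) =o[𝓝 x₀] fun _ => (1 : ℝ) := by
      rw [Asymptotics.isLittleO_one_iff]
      simpa using hQ.tendsto.sub_const (Q x₀)
    have h3 := hPO.norm_norm.mul_isLittleO hQo.norm_norm
    simp only [norm_one, mul_one] at h3
    refine Asymptotics.IsBigO.trans_isLittleO ?_ (Asymptotics.isLittleO_norm_right.1 h3)
    refine Asymptotics.IsBigO.of_bound ‖B‖ (Eventually.of_forall fun x => ?_)
    rw [Real.norm_of_nonneg (by positivity), ← mul_assoc]
    exact B.le_opNorm₂ _ _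
  refine ((h1.add h2).congr_fderiv (add_zero _)).congr_of_eventuallyEq
    (Eventually.of_forall fun x => ?_)
  simp

/-- `M` and `N` are the fundamental matrix of `M' = A M` and its inverse. -/
structure IsFundamental (A M N : Λ → ℝ → Plane → Plane →L[ℝ] Plane) (K : ℝ≥0) : Prop where
  bound : ∀ l t x, ‖A l t x‖ ≤ K
  M_zero : ∀ l x, M l 0 x = .id ℝ Plane
  N_zero : ∀ l x, N l 0 x = .id ℝ Plane
  M_deriv : ∀ l t x, HasDerivAt (fun s => M l s x) ((A l t x).comp (M l t x)) t
  N_deriv : ∀ l t x, HasDerivAt (fun s => N l s x) (-(N l t x).comp (A l t x)) t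

variable {A M N : Λ → ℝ → Plane → Plane →L[ℝ] Plane} {K : ℝ≥0}

/-- `N` is obtained from its own linear equation, not as an inverse; that it inverts `M` is derived
afterwards. -/
theorem exists_isFundamental (hA : ∀ l, Continuous fun p : ℝ × Plane => A l p.1 p.2)
    (hK : ∀ l t x, ‖A l t x‖ ≤ K) : ∃ M N, IsFundamental A M N K := by
  have h1 : ∀ l x, ∃ γ : ℝ → Plane →L[ℝ] Plane, γ 0 = .id ℝ Plane ∧
      ∀ t, HasDerivAt γ ((A l t x).comp (γ t)) t := fun l x => by
    have hc : Continuous fun t => A l t x := (hA l).comp (Continuous.prodMk_left x)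
    refine exists_trajectory (f := fun t (m : Plane →L[ℝ] Plane) => (A l t x).comp m) (K := K)
      ((hc.comp continuous_fst).clm_comp continuous_snd) (fun t => ?_) 0 _
    refine LipschitzWith.of_dist_le_mul fun m m' => ?_
    rw [dist_eq_norm, dist_eq_norm, ← ContinuousLinearMap.comp_sub]
    exact (ContinuousLinearMap.opNorm_comp_le _ _).trans (by gcongr; exact hK l t x)
  have h2 : ∀ l x, ∃ γ : ℝ → Plane →L[ℝ] Plane, γ 0 = .id ℝ Plane ∧
      ∀ t, HasDerivAt γ (-(γ t).comp (A l t x)) t := fun l x => by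
    have hc : Continuous fun t => A l t x := (hA l).comp (Continuous.prodMk_left x)
    refine exists_trajectory (f := fun t (m : Plane →L[ℝ] Plane) => -m.comp (A l t x)) (K := K)
      ((continuous_snd.clm_comp (hc.comp continuous_fst)).neg) (fun t => ?_) 0 _
    refine LipschitzWith.of_dist_le_mul fun m m' => ?_
    rw [dist_neg_neg, dist_eq_norm, dist_eq_norm, ← ContinuousLinearMap.sub_comp, mul_comm]
    exact (ContinuousLinearMap.opNorm_comp_le _ _).trans (by gcongr; exact hK l t x)
  choose M hM hM' using h1
  choose N hN hN' using h2
  exact ⟨fun l t x => M l x t, fun l t x => N l x t, hK, hM, hN, fun l t x => hM' l x t,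
    fun l t x => hN' l x t⟩

namespace IsFundamental

theorem bound_M (h : IsFundamental A M N K) (l t x) :
    ‖M l t x‖ ≤ Real.exp (K * |t|) := by
  -- Comparison with the zero solution of the same linear equation.
  have := dist_trajectories_le (f := fun t (m : Plane →L[ℝ] Plane) => (A l t x).comp m) (K := K)
    (fun t => LipschitzWith.of_dist_le_mul fun m m' => by
      rw [dist_eq_norm, dist_eq_norm, ← ContinuousLinearMap.comp_sub]
      exact (ContinuousLinearMap.opNorm_comp_le _ _).trans (by gcongr; exact h.bound l t x))
    (γ₁ := fun s => M l s x) (γ₂ := fun _ => 0) (h.M_deriv l · x)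
    (fun t => by simpa using hasDerivAt_const t (0 : Plane →L[ℝ] Plane)) 0 t
  simp only [dist_zero_right, h.M_zero, sub_zero] at this
  exact this.trans (mul_le_of_le_one_left (by positivity) ContinuousLinearMap.norm_id_le)

theorem bound_N (h : IsFundamental A M N K) (l t x) :
    ‖N l t x‖ ≤ Real.exp (K * |t|) := by
  have := dist_trajectories_le (f := fun t (m : Plane →L[ℝ] Plane) => -m.comp (A l t x)) (K := K)
    (fun t => LipschitzWith.of_dist_le_mul fun m m' => by
      rw [dist_neg_neg, dist_eq_norm, dist_eq_norm, ← ContinuousLinearMap.sub_comp, mul_comm]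
      exact (ContinuousLinearMap.opNorm_comp_le _ _).trans (by gcongr; exact h.bound l t x))
    (γ₁ := fun s => N l s x) (γ₂ := fun _ => 0) (h.N_deriv l · x)
    (fun t => by simpa using hasDerivAt_const t (0 : Plane →L[ℝ] Plane)) 0 t
  simp only [dist_zero_right, h.N_zero, sub_zero] at this
  exact this.trans (mul_le_of_le_one_left (by positivity) ContinuousLinearMap.norm_id_le)

theorem continuous_M_time (h : IsFundamental A M N K) (l x) : Continuous fun t => M l t x :=
  continuous_iff_continuousAt.2 fun t => (h.M_deriv l t x).continuousAt

theorem continuous_N_time (h : IsFundamental A M N K) (l x) : Continuous fun t => N l t x :=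
  continuous_iff_continuousAt.2 fun t => (h.N_deriv l t x).continuousAt

/-- Variation of constants: the time derivative of `N(y) M(x)` is `N(y) (A(x) - A(y)) M(x)`. The
case `x = y` shows that `N` inverts `M`; the general case yields continuity, Hölder continuity and
the derivative of `M` in the parameter. -/
theorem comp_sub_eq_integral (h : IsFundamental A M N K)
    (hA : ∀ l, Continuous fun p : ℝ × Plane => A l p.1 p.2) (l t x y) :
    (N l t y).comp (M l t x) = .id ℝ Plane +
      ∫ s in (0 : ℝ)..t, (N l s y).comp ((A l s x - A l s y).comp (M l s x)) := by
  have hc : ∀ x, Continuous fun t => A l t x := fun x => (hA l).comp (Continuous.prodMk_left x)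
  have hd : ∀ s, HasDerivAt (fun s => (N l s y).comp (M l s x))
      ((N l s y).comp ((A l s x - A l s y).comp (M l s x))) s := fun s => by
    have := (h.N_deriv l s y).clm_comp (h.M_deriv l s x)
    convert this using 1
    ext v : 1
    simp
    abel
  have := intervalIntegral.integral_eq_sub_of_hasDerivAt (a := 0) (b := t) (fun s _ => hd s)
    (((h.continuous_N_time l y).clm_comp
      (((hc x).sub (hc y)).clm_comp (h.continuous_M_time l x))).intervalIntegrable _ _)
  rw [this, h.N_zero, h.M_zero]
  simp

theorem N_comp_M (h : IsFundamental A M N K)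
    (hA : ∀ l, Continuous fun p : ℝ × Plane => A l p.1 p.2) (l t x) :
    (N l t x).comp (M l t x) = .id ℝ Plane := by
  rw [h.comp_sub_eq_integral hA]
  simp

theorem M_comp_N (h : IsFundamental A M N K)
    (hA : ∀ l, Continuous fun p : ℝ × Plane => A l p.1 p.2) (l t x) :
    (M l t x).comp (N l t x) = .id ℝ Plane := by
  have h1 := h.N_comp_M hA l t x
  have h2 : (N l t x : Plane →ₗ[ℝ] Plane) * (M l t x : Plane →ₗ[ℝ] Plane) = 1 :=
    LinearMap.ext fun v => by simpa using congrArg (fun f => f v) h1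
  have h3 := mul_eq_one_comm.1 h2
  ext1 v
  simpa using congrArg (fun f => f v) h3

theorem M_eq (h : IsFundamental A M N K)
    (hA : ∀ l, Continuous fun p : ℝ × Plane => A l p.1 p.2) (l t x y) :
    M l t x = M l t y + (M l t y).comp
      (∫ s in (0 : ℝ)..t, (N l s y).comp ((A l s x - A l s y).comp (M l s x))) := by
  have h1 := congrArg (fun P => (M l t y).comp P) (h.comp_sub_eq_integral hA l t x y)
  rw [← ContinuousLinearMap.comp_assoc, h.M_comp_N hA, ContinuousLinearMap.comp_add,
    ContinuousLinearMap.id_comp, ContinuousLinearMap.comp_id] at h1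
  exact h1

theorem norm_M_sub_le (h : IsFundamental A M N K)
    (hA : ∀ l, Continuous fun p : ℝ × Plane => A l p.1 p.2) (l t x y) :
    ‖M l t x - M l t y‖ ≤ Real.exp (K * |t|) * (Real.exp (K * |t|) * Real.exp (K * |t|) *
      |∫ s in (0 : ℝ)..t, ‖A l s x - A l s y‖|) := by
  have hc : ∀ x, Continuous fun t => A l t x := fun x => (hA l).comp (Continuous.prodMk_left x)
  conv_lhs => rw [h.M_eq hA l t x y, add_sub_cancel_left]
  refine (ContinuousLinearMap.opNorm_comp_le _ _).trans ?_
  refine mul_le_mul (h.bound_M l t y) ?_ (norm_nonneg _) (by positivity)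
  rw [← abs_of_nonneg (a := Real.exp (K * |t|) * Real.exp (K * |t|)) (by positivity), ← abs_mul,
    ← intervalIntegral.integral_const_mul]
  refine intervalIntegral.norm_integral_le_abs_of_norm_le ?_ ?_
  · refine (ae_restrict_iff' measurableSet_uIoc).2 (Eventually.of_forall fun s hs => ?_)
    have hs' : |s| ≤ |t| := by
      have := Set.abs_sub_left_of_mem_uIcc (Set.uIoc_subset_uIcc hs)
      simpa using this
    have e1 : ‖N l s y‖ ≤ Real.exp (K * |t|) := (h.bound_N l s y).trans (by gcongr)
    have e2 : ‖M l s x‖ ≤ Real.exp (K * |t|) := (h.bound_M l s x).trans (by gcongr)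
    calc _ ≤ ‖N l s y‖ * (‖A l s x - A l s y‖ * ‖M l s x‖) :=
          (ContinuousLinearMap.opNorm_comp_le _ _).trans (by
            gcongr; exact ContinuousLinearMap.opNorm_comp_le _ _)
      _ ≤ Real.exp (K * |t|) * (‖A l s x - A l s y‖ * Real.exp (K * |t|)) := by gcongr
      _ = _ := by ring
  · exact ((((hc x).sub (hc y)).norm).const_mul _).intervalIntegrable _ _

theorem regZero_M (h : IsFundamental A M N K) (hA : RegZero H A) : RegZero H M := by
  refine ⟨fun l => ?_, fun R => ⟨Real.exp (K * R), fun l t x ht _ => (h.bound_M l t x).trans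
    (by gcongr)⟩, fun hH R => ?_⟩
  · rw [continuous_iff_continuousAt]
    rintro ⟨t₀, y⟩
    have h1 : Continuous fun p : ℝ × Plane => M l p.1 y := (h.continuous_M_time l y).comp continuous_fst
    have h2 : Tendsto (fun p : ℝ × Plane => M l p.1 p.2 - M l p.1 y) (𝓝 (t₀, y)) (𝓝 0) := by
      refine squeeze_zero_norm (fun p => h.norm_M_sub_le hA.cont l p.1 p.2 y) ?_
      have ci : Continuous fun p : ℝ × Plane => ∫ s in (0 : ℝ)..p.1, ‖A l s p.2 - A l s y‖ := by
        refine intervalIntegral.continuous_parametric_intervalIntegral_of_continuous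
          (f := fun p : ℝ × Plane => fun s => ‖A l s p.2 - A l s y‖) ?_ continuous_fst
        exact (((hA.cont l).comp (continuous_snd.prodMk (continuous_snd.comp continuous_fst))).sub
          ((hA.cont l).comp (continuous_snd.prodMk continuous_const))).norm
      have cc : Continuous fun p : ℝ × Plane => Real.exp (K * |p.1|) * (Real.exp (K * |p.1|) *
          Real.exp (K * |p.1|) * |∫ s in (0 : ℝ)..p.1, ‖A l s p.2 - A l s y‖|) := by fun_prop
      simpa using cc.tendsto (t₀, y)
    have := h2.add (h1.tendsto (t₀, y))
    simpa [ContinuousAt] using this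
  · obtain ⟨C, hC⟩ := hA.holder hH R
    let E := Real.exp (K * R)
    refine ⟨E * (E * E * (max C 0 * R)), fun l t x y ht hx hy =>
      (h.norm_M_sub_le hA.cont l t x y).trans ?_⟩
    have hi : |∫ s in (0 : ℝ)..t, ‖A l s x - A l s y‖| ≤ max C 0 * √‖x - y‖ * R := by
      have hs : ∀ s ∈ uIoc 0 t, ‖‖A l s x - A l s y‖‖ ≤ max C 0 * √‖x - y‖ := fun s hs => by
        have hs' : |s| ≤ |t| := by
          have := Set.abs_sub_left_of_mem_uIcc (Set.uIoc_subset_uIcc hs)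
          simpa using this
        rw [norm_norm]
        refine (hC l s x y (hs'.trans ht) hx hy).trans ?_
        gcongr
        exact le_max_left _ _
      have := intervalIntegral.norm_integral_le_of_norm_le_const hs
      rw [sub_zero] at this
      exact this.trans (by gcongr)
    calc _ ≤ E * (E * E * (max C 0 * √‖x - y‖ * R)) := by gcongr <;> (simp only [E]; gcongr)
      _ = _ := by ring

theorem regZero_N (h : IsFundamental A M N K) (hA : RegZero False A) : RegZero False N := by
  refine ⟨fun l => ?_, fun R => ⟨Real.exp (K * R), fun l t x ht _ => (h.bound_N l t x).trans
    (by gcongr)⟩, False.elim⟩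
  rw [continuous_iff_continuousAt]
  intro p
  let u : ℝ × Plane → (Plane →L[ℝ] Plane)ˣ := fun p =>
    ⟨M l p.1 p.2, N l p.1 p.2, h.M_comp_N hA.cont l _ _, h.N_comp_M hA.cont l _ _⟩
  have e : (fun p : ℝ × Plane => N l p.1 p.2) = fun p => Ring.inverse (M l p.1 p.2) := by
    funext p
    exact (Ring.inverse_unit (u p)).symm
  rw [e]
  exact ContinuousAt.comp (g := Ring.inverse) (f := fun p : ℝ × Plane => M l p.1 p.2)
    (NormedRing.inverse_continuousAt (u p)) ((h.regZero_M hA).cont l).continuousAt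

/-- In the formula `M_eq` around `x₀` the factor `A(x) - A(x₀)` vanishes at `x₀`, so differentiating
there requires only continuity of `M(x)`. The resulting derivative `M ∫ N (DA) M` contains no
derivative of `M` or `N`, which makes the induction on `k` close. -/
theorem reg_M (h : IsFundamental A M N K) (hA : Reg H k A) : Reg H k M := by
  induction k with
  | zero => exact h.regZero_M hA
  | succ k ih =>
    have hMk := ih hA.of_succ
    have hNk : Reg H k N := Reg.inverse hMk (h.regZero_N hA.1) (h.M_comp_N hA.1.cont)
      (h.N_comp_M hA.1.cont)
    let B := ContinuousLinearMap.compL ℝ Plane Plane Plane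
    let D : Λ → ℝ → Plane → Plane →L[ℝ] Plane →L[ℝ] Plane := fun l s x =>
      (B (N l s x)).comp ((B.flip (M l s x)).comp (fderiv ℝ (A l s) x))
    have hD : Reg H k D := by
      have h1 := Reg.clm (G := (Plane →L[ℝ] Plane) →L[ℝ] (Plane →L[ℝ] Plane)) B hNk
      have h2 := Reg.clm (G := (Plane →L[ℝ] Plane) →L[ℝ] (Plane →L[ℝ] Plane)) B.flip hMk
      exact Reg.clm_comp h1 (Reg.clm_comp h2 hA.2.2)
    refine Reg.of_hasFDerivAt (f' := fun l t x => (B (M l t x)).comp (∫ s in (0 : ℝ)..t, D l s x))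
      hMk.regZero (fun l t x₀ => ?_) ?_
    · have hc : ∀ x, Continuous fun t => A l t x := fun x =>
        (hA.1.cont l).comp (Continuous.prodMk_left x)
      have hMx : ∀ s, Continuous fun x => M l s x := fun s =>
        (hMk.regZero.cont l).comp (Continuous.prodMk_right s)
      obtain ⟨C, hC0, hC⟩ := hA.exists_lipschitz (max |t| (‖x₀‖ + 1))
      have key : HasFDerivAt (fun x => ∫ s in (0 : ℝ)..t,
          (N l s x₀).comp ((A l s x - A l s x₀).comp (M l s x))) (∫ s in (0 : ℝ)..t, D l s x₀) x₀ := by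
        refine hasFDerivAt_intervalIntegral_of_lip
          (C := Real.exp (K * |t|) * (C * Real.exp (K * |t|))) (fun x => ?_) ?_ (fun s => ?_) ?_
        · exact (h.continuous_N_time l x₀).clm_comp
            (((hc x).sub (hc x₀)).clm_comp (h.continuous_M_time l x))
        · exact (hD.regZero.cont l).comp (Continuous.prodMk_left x₀)
        · have h1 := hasFDerivAt_bilin_of_zero B (P := fun x => A l s x - A l s x₀)
            (Q := fun x => M l s x) ((hA.2.1 l s x₀).hasFDerivAt.sub_const _) (sub_self _)
            (hMx s).continuousAt
          exact (B (N l s x₀)).hasFDerivAt.comp x₀ h1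
        · intro s hs x hx
          have hx1 : ‖x‖ ≤ ‖x₀‖ + 1 := by
            have := norm_sub_norm_le x x₀
            linarith
          have e1 : ‖N l s x₀‖ ≤ Real.exp (K * |t|) := (h.bound_N l s x₀).trans (by gcongr)
          have e2 : ‖M l s x‖ ≤ Real.exp (K * |t|) := (h.bound_M l s x).trans (by gcongr)
          have e3 := hC l s x x₀ (hs.trans (le_max_left _ _)) (hx1.trans (le_max_right _ _))
            ((by linarith : ‖x₀‖ ≤ ‖x₀‖ + 1).trans (le_max_right _ _))
          simp only [sub_self, ContinuousLinearMap.zero_comp, ContinuousLinearMap.comp_zero, sub_zero]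
          calc _ ≤ ‖N l s x₀‖ * (‖A l s x - A l s x₀‖ * ‖M l s x‖) :=
                (ContinuousLinearMap.opNorm_comp_le _ _).trans (by
                  gcongr; exact ContinuousLinearMap.opNorm_comp_le _ _)
            _ ≤ Real.exp (K * |t|) * ((C * ‖x - x₀‖) * Real.exp (K * |t|)) := by gcongr
            _ = _ := by ring
      have h2 := ((B (M l t x₀)).hasFDerivAt.comp x₀ key).const_add (M l t x₀)
      refine h2.congr_of_eventuallyEq (Eventually.of_forall fun x => ?_)
      exact h.M_eq hA.1.cont l t x x₀
    · have h1 := Reg.clm (G := (Plane →L[ℝ] Plane) →L[ℝ] (Plane →L[ℝ] Plane)) B hMk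
      exact Reg.clm_comp h1 hD.integral

theorem reg_N (h : IsFundamental A M N K) (hA : Reg H k A) : Reg H k N :=
  Reg.inverse (h.reg_M hA) (h.regZero_N hA.regZero) (h.M_comp_N hA.regZero.cont)
    (h.N_comp_M hA.regZero.cont)

end IsFundamental

end Linear

/-! ### Flows -/

theorem contDiff_one_of_partials {F : Type*} [NormedAddCommGroup F] [NormedSpace ℝ F]
    {f ft : ℝ → Plane → F} {fx : ℝ → Plane → Plane →L[ℝ] F}
    (ht : ∀ t x, HasDerivAt (fun s => f s x) (ft t x) t) (hx : ∀ t x, HasFDerivAt (f t) (fx t x) x)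
    (hct : Continuous fun p : ℝ × Plane => ft p.1 p.2)
    (hcx : Continuous fun p : ℝ × Plane => fx p.1 p.2) :
    ContDiff ℝ 1 fun p : ℝ × Plane => f p.1 p.2 := by
  have hct' : Continuous fun p : ℝ × Plane => ContinuousLinearMap.toSpanSingleton ℝ (ft p.1 p.2) :=
    (ContinuousLinearMap.toSpanSingletonCLE (𝕜 := ℝ) (E := F)).continuous.comp hct
  rw [contDiff_one_iff_hasFDerivAt]
  refine ⟨fun p => (ContinuousLinearMap.toSpanSingleton ℝ (ft p.1 p.2)).coprod (fx p.1 p.2), ?_,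
    fun p => ?_⟩
  · exact hct'.continuousLinearMapCoprod hcx
  · exact (hasStrictFDerivAt_uncurry_coprod (u := p) (f := f)
      (f₁ := fun t x => ContinuousLinearMap.toSpanSingleton ℝ (ft t x)) (f₂ := fx)
      (Eventually.of_forall fun v => (ht v.1 v.2).hasFDerivAt)
      (Eventually.of_forall fun v => hx v.1 v.2) hct'.continuousAt hcx.continuousAt).hasFDerivAt

/-- The position at time `t` of the trajectory of `b` that passes through `x` at time `s`. -/
def flow (b : ℝ → Plane → Plane) (s : ℝ) (x : Plane) (t : ℝ) : Plane :=
  open Classical in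
  if h : ∃ γ : ℝ → Plane, γ s = x ∧ ∀ t, HasDerivAt γ (b t (γ t)) t then h.choose t else x

/-- A family of bounded vector fields that are Lipschitz continuous in space, with uniform
constants. -/
structure IsLipField {Λ : Type} (b : Λ → ℝ → Plane → Plane) (K M : ℝ≥0) : Prop where
  cont : ∀ l, Continuous fun p : ℝ × Plane => b l p.1 p.2
  lip : ∀ l t, LipschitzWith K (b l t)
  bound : ∀ l t x, ‖b l t x‖ ≤ M

namespace IsLipField

variable {Λ : Type} {b : Λ → ℝ → Plane → Plane} {K M : ℝ≥0} {H : Prop} {k : ℕ}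

theorem flow_spec (h : IsLipField b K M) (l s x) :
    flow (b l) s x s = x ∧ ∀ t, HasDerivAt (flow (b l) s x) (b l t (flow (b l) s x t)) t := by
  have h1 := exists_trajectory (h.cont l) (h.lip l) s x
  have h2 : flow (b l) s x = h1.choose := by
    funext t
    simp only [flow, dif_pos h1]
  rw [h2]
  exact h1.choose_spec

theorem flow_self (h : IsLipField b K M) (l s x) : flow (b l) s x s = x := (h.flow_spec l s x).1

theorem hasDerivAt_flow (h : IsLipField b K M) (l s x t) :
    HasDerivAt (flow (b l) s x) (b l t (flow (b l) s x t)) t := (h.flow_spec l s x).2 t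

theorem eq_flow (h : IsLipField b K M) (l) {γ : ℝ → Plane}
    (hγ : ∀ t, HasDerivAt γ (b l t (γ t)) t) (s : ℝ) : γ = flow (b l) s (γ s) :=
  trajectory_unique (h.lip l) hγ (h.hasDerivAt_flow l s _) (h.flow_self l s _).symm

theorem flow_flow (h : IsLipField b K M) (l s t u x) :
    flow (b l) t (flow (b l) s x t) u = flow (b l) s x u :=
  (congrFun (h.eq_flow l (h.hasDerivAt_flow l s x) t) u).symm

theorem flow_cancel (h : IsLipField b K M) (l s t x) :
    flow (b l) t (flow (b l) s x t) s = x := by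
  rw [h.flow_flow, h.flow_self]

theorem norm_flow_sub_flow_le (h : IsLipField b K M) (l s t x y) :
    ‖flow (b l) s x t - flow (b l) s y t‖ ≤ ‖x - y‖ * Real.exp (K * |t - s|) := by
  have := dist_trajectories_le (h.lip l) (h.hasDerivAt_flow l s x) (h.hasDerivAt_flow l s y) s t
  simpa [h.flow_self, dist_eq_norm] using this

theorem norm_flow_sub_time_le (h : IsLipField b K M) (l s x t t') :
    ‖flow (b l) s x t - flow (b l) s x t'‖ ≤ M * |t - t'| := by
  have := convex_univ.norm_image_sub_le_of_norm_hasDerivWithin_le (f := flow (b l) s x) (C := M)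
    (fun u _ => (h.hasDerivAt_flow l s x u).hasDerivWithinAt) (fun u _ => h.bound l u _)
    (mem_univ t') (mem_univ t)
  simpa using this

theorem norm_flow_sub_le (h : IsLipField b K M) (l s x t) :
    ‖flow (b l) s x t - x‖ ≤ M * |t - s| := by
  simpa [h.flow_self] using h.norm_flow_sub_time_le l s x t s

theorem norm_flow_le (h : IsLipField b K M) (l s x t) :
    ‖flow (b l) s x t‖ ≤ ‖x‖ + M * |t - s| := by
  have := norm_sub_norm_le (flow (b l) s x t) x
  linarith [h.norm_flow_sub_le l s x t]

theorem regZero_forward (h : IsLipField b K M) :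
    RegZero False (fun l t x => flow (b l) 0 x t) := by
  refine ⟨fun l => ?_, fun R => ⟨R + M * R, fun l t x ht hx => ?_⟩, False.elim⟩
  · refine continuous_prod_of_continuous_lipschitzWith (fun p : ℝ × Plane => flow (b l) 0 p.2 p.1)
      M (fun t => ?_) (fun x => LipschitzWith.of_dist_le_mul fun t t' => ?_)
    · refine (LipschitzWith.of_dist_le_mul (K := ⟨Real.exp (K * |t - 0|), by positivity⟩)
        fun x y => ?_).continuous
      rw [dist_eq_norm, dist_eq_norm, mul_comm]
      exact h.norm_flow_sub_flow_le l 0 t x y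
    · rw [dist_eq_norm, Real.dist_eq]
      exact h.norm_flow_sub_time_le l 0 x t t'
  · refine (h.norm_flow_le l 0 x t).trans ?_
    rw [sub_zero]
    gcongr

/-- If `y` is the image of `x₀` at time `0`, the Lipschitz bound along the flow estimates the
distance of the backward image of `x` to `y` by that of `x` to the forward image of `y`; the latter
is already known to be continuous in time. -/
theorem regZero_backward (h : IsLipField b K M) :
    RegZero False (fun l t x => flow (b l) t x 0) := by
  refine ⟨fun l => ?_, fun R => ⟨R + M * R, fun l t x ht hx => ?_⟩, False.elim⟩
  · rw [continuous_iff_continuousAt]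
    rintro ⟨t₀, x₀⟩
    let y := flow (b l) t₀ x₀ 0
    have h1 : ∀ p : ℝ × Plane, ‖flow (b l) p.1 p.2 0 - y‖ ≤
        ‖p.2 - flow (b l) 0 y p.1‖ * Real.exp (K * |0 - p.1|) := fun p => by
      have := h.norm_flow_sub_flow_le l p.1 0 p.2 (flow (b l) 0 y p.1)
      rwa [h.flow_cancel] at this
    refine tendsto_iff_norm_sub_tendsto_zero.2 (squeeze_zero (fun _ => norm_nonneg _) h1 ?_)
    have c : Continuous fun p : ℝ × Plane =>
        ‖p.2 - flow (b l) 0 y p.1‖ * Real.exp (K * |0 - p.1|) := by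
      have : Continuous fun p : ℝ × Plane => flow (b l) 0 y p.1 :=
        (h.regZero_forward.cont l).comp (continuous_fst.prodMk continuous_const)
      fun_prop
    have e := c.tendsto (t₀, x₀)
    simpa [y, h.flow_cancel] using e
  · refine (h.norm_flow_le l t x 0).trans ?_
    rw [zero_sub, abs_neg]
    gcongr

/-- The derivative of the flow of `b` solves the linearized equation. -/
theorem exists_fundamental (h : IsLipField b K M) (hb : Reg H (k + 1) b) :
    ∃ m n, IsFundamental (fun l t x => fderiv ℝ (b l t) (flow (b l) 0 x t)) m n K ∧
      ∀ l t x, HasFDerivAt (fun x => flow (b l) 0 x t) (m l t x) x := by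
  have hA : RegZero False (fun l t x => fderiv ℝ (b l t) (flow (b l) 0 x t)) :=
    hb.2.2.regZero.comp_inner h.regZero_forward
  obtain ⟨m, n, hmn⟩ := exists_isFundamental
    (A := fun l t x => fderiv ℝ (b l t) (flow (b l) 0 x t)) (K := K) hA.cont
    (fun l t x => norm_fderiv_le_of_lipschitz ℝ (h.lip l t))
  refine ⟨m, n, hmn, fun l t x₀ => ?_⟩
  set X := fun t x => flow (b l) 0 x t with hX
  have hXt : ∀ x, Continuous fun t => X t x := fun x =>
    (h.regZero_forward.cont l).comp (Continuous.prodMk_left x)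
  let A := fun s => fderiv ℝ (b l s) (X s x₀)
  have hAc : Continuous A := (hA.cont l).comp (Continuous.prodMk_left x₀)
  let r := fun s x => b l s (X s x) - b l s (X s x₀) - A s (X s x - X s x₀)
  have hbc : ∀ x, Continuous fun s => b l s (X s x) := fun x =>
    (h.cont l).comp (continuous_id.prodMk (hXt x))
  have hr : ∀ x, Continuous fun s => r s x := fun x =>
    ((hbc x).sub (hbc x₀)).sub (hAc.clm_apply ((hXt x).sub (hXt x₀)))
  have hnr : ∀ x, Continuous fun s => n l s x₀ (r s x) := fun x =>
    (hmn.continuous_N_time l x₀).clm_apply (hr x)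
  -- Variation of constants for the difference of two trajectories. The remainder `r` is the error
  -- of the linearization of `b`, hence of order `o(‖x - x₀‖)`, and its integral has derivative zero
  -- at `x₀`.
  have formula : ∀ x, X t x = X t x₀ + m l t x₀ ((x - x₀) + ∫ s in (0 : ℝ)..t, n l s x₀ (r s x)) := by
    intro x
    have hd : ∀ s, HasDerivAt (fun s => n l s x₀ (X s x - X s x₀)) (n l s x₀ (r s x)) s := fun s => by
      have := (hmn.N_deriv l s x₀).clm_apply
        ((h.hasDerivAt_flow l 0 x s).sub (h.hasDerivAt_flow l 0 x₀ s))
      refine this.congr_deriv ?_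
      simp only [r, A, X, map_sub, neg_apply, ContinuousLinearMap.comp_apply, Pi.sub_apply]
      abel
    have := intervalIntegral.integral_eq_sub_of_hasDerivAt (a := 0) (b := t) (fun s _ => hd s)
      ((hnr x).intervalIntegrable _ _)
    have e := congrArg (fun L => L (X t x - X t x₀)) (hmn.M_comp_N hA.cont l t x₀)
    simp only [ContinuousLinearMap.comp_apply, ContinuousLinearMap.id_apply] at e
    have e0 : n l 0 x₀ (X 0 x - X 0 x₀) = x - x₀ := by
      simp [hmn.N_zero, X, h.flow_self]
    rw [this, e0, add_sub_cancel, e, add_sub_cancel]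
  have key : HasFDerivAt (fun x => ∫ s in (0 : ℝ)..t, n l s x₀ (r s x))
      (∫ _ in (0 : ℝ)..t, (0 : Plane →L[ℝ] Plane)) x₀ := by
    refine hasFDerivAt_intervalIntegral_of_lip (C := Real.exp (K * |t|) *
      (2 * K * Real.exp (K * |t|))) hnr continuous_const (fun s => ?_) ?_
    · have h1 : HasFDerivAt (r s) (0 : Plane →L[ℝ] Plane) x₀ := by
        rw [hasFDerivAt_iff_isLittleO]
        have d := (hb.2.1 l s (X s x₀)).hasFDerivAt
        rw [hasFDerivAt_iff_isLittleO] at d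
        have hc : Tendsto (X s) (𝓝 x₀) (𝓝 (X s x₀)) :=
          ((h.regZero_forward.cont l).comp (Continuous.prodMk_right s)).continuousAt
        have d' := d.comp_tendsto hc
        have hO : (fun x => X s x - X s x₀) =O[𝓝 x₀] fun x => x - x₀ :=
          Asymptotics.IsBigO.of_bound (Real.exp (K * |s - 0|)) (Eventually.of_forall fun x => by
            rw [mul_comm]; exact h.norm_flow_sub_flow_le l 0 s x x₀)
        have := d'.trans_isBigO hO
        refine this.congr_left fun x => ?_
        simp [r, A]
      exact ((n l s x₀).hasFDerivAt.comp x₀ h1).congr_fderiv (ContinuousLinearMap.comp_zero _)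
    · intro s hs x _
      have e0 : r s x₀ = 0 := by simp [r]
      rw [e0, map_zero, sub_zero]
      have e1 : ‖n l s x₀‖ ≤ Real.exp (K * |t|) := (hmn.bound_N l s x₀).trans (by gcongr)
      have e2 : ‖X s x - X s x₀‖ ≤ ‖x - x₀‖ * Real.exp (K * |t|) :=
        (h.norm_flow_sub_flow_le l 0 s x x₀).trans (by rw [sub_zero]; gcongr)
      have e3 : ‖r s x‖ ≤ 2 * K * ‖X s x - X s x₀‖ := by
        have h1 := (h.lip l s).dist_le_mul (X s x) (X s x₀)
        rw [dist_eq_norm, dist_eq_norm] at h1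
        have h2 : ‖A s (X s x - X s x₀)‖ ≤ K * ‖X s x - X s x₀‖ :=
          (A s).le_of_opNorm_le (norm_fderiv_le_of_lipschitz ℝ (h.lip l s)) _
        calc _ ≤ _ := norm_sub_le _ _
          _ ≤ _ := add_le_add h1 h2
          _ = _ := by ring
      calc _ ≤ ‖n l s x₀‖ * ‖r s x‖ := ContinuousLinearMap.le_opNorm _ _
        _ ≤ Real.exp (K * |t|) * (2 * K * (‖x - x₀‖ * Real.exp (K * |t|))) := by
            gcongr
            exact e3.trans (by gcongr)
        _ = _ := by ring
  have h2 := ((m l t x₀).hasFDerivAt.comp x₀ (((hasFDerivAt_id x₀).sub_const x₀).add key)).const_add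
    (X t x₀)
  refine (h2.congr_of_eventuallyEq (Eventually.of_forall fun x => formula x)).congr_fderiv ?_
  ext v
  simp

/-- The derivative of the flow is the fundamental matrix of `Db` along the flow. Each derivative
known for the flow gives one for the coefficient, thus for the matrix, thus one more for the flow.
The start with one derivative is the same argument at order zero. -/
theorem reg_forward (h : IsLipField b K M) (hb : Reg H (k + 1) b) :
    Reg H (k + 1) (fun l t x => flow (b l) 0 x t) := by
  obtain ⟨m, n, hmn, hd⟩ := h.exists_fundamental hb
  have h1 : Reg False 1 (fun l t x => flow (b l) 0 x t) := by
    refine Reg.of_hasFDerivAt h.regZero_forward hd (k := 0) ?_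
    exact hmn.regZero_M (hb.2.2.regZero.comp_inner h.regZero_forward)
  induction k with
  | zero =>
    refine Reg.of_hasFDerivAt h.regZero_forward hd ?_
    refine hmn.reg_M (Reg.comp (g := fun l t x => fderiv ℝ (b l t) x) hb.2.2 ?_ h1)
    exact h1.of_succ
  | succ k ih =>
    have hX := ih hb.of_succ
    exact Reg.of_hasFDerivAt h.regZero_forward hd (hmn.reg_M
      (Reg.comp (g := fun l t x => fderiv ℝ (b l t) x) hb.2.2 hX h1))

/-- The joint derivative of the backward flow. -/
theorem exists_backward (h : IsLipField b K M) (hb : Reg H (k + 1) b) :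
    ∃ n : Λ → ℝ → Plane → Plane →L[ℝ] Plane, Reg H k n ∧
      (∀ l t x, HasFDerivAt (fun x => flow (b l) t x 0) (n l t (flow (b l) t x 0)) x) ∧
      ∀ l t x, HasDerivAt (fun t => flow (b l) t x 0) (-(n l t (flow (b l) t x 0)) (b l t x)) t := by
  obtain ⟨m, n, hmn, hd⟩ := h.exists_fundamental hb
  have h1 := h.reg_forward hb
  have hA : Reg H k (fun l t x => fderiv ℝ (b l t) (flow (b l) 0 x t)) :=
    Reg.comp (g := fun l t x => fderiv ℝ (b l t) x) hb.2.2 h1.of_succ (h1.of_le (by omega)).weaken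
  have hm := hmn.reg_M hA
  refine ⟨n, hmn.reg_N hA, ?_⟩
  -- The map `(t, x) ↦ (t, Y)` with the backward flow `Y` is inverse to `(t, y) ↦ (t, X)` with the
  -- forward flow `X`. The differential of the latter is `(τ, v) ↦ (τ, τ b + m v)`, and it is
  -- inverted explicitly with `n`.
  have key : ∀ l t x, HasFDerivAt (fun p : ℝ × Plane => (p.1, flow (b l) p.1 p.2 0))
      ((ContinuousLinearMap.fst ℝ ℝ Plane).prod ((n l t (flow (b l) t x 0)).comp
        (ContinuousLinearMap.snd ℝ ℝ Plane -
          (ContinuousLinearMap.fst ℝ ℝ Plane).smulRight (b l t x)))) (t, x) := by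
    intro l t x
    have hΘ : HasFDerivAt (fun p : ℝ × Plane => (p.1, flow (b l) 0 p.2 p.1))
        ((ContinuousLinearMap.fst ℝ ℝ Plane).prod
          ((ContinuousLinearMap.toSpanSingleton ℝ (b l t x)).coprod (m l t (flow (b l) t x 0))))
        (t, flow (b l) t x 0) := by
      refine hasFDerivAt_fst.prodMk ?_
      have := (hasStrictFDerivAt_uncurry_coprod (u := (t, flow (b l) t x 0))
        (f := fun t x => flow (b l) 0 x t)
        (f₁ := fun t x => ContinuousLinearMap.toSpanSingleton ℝ (b l t (flow (b l) 0 x t)))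
        (f₂ := m l)
        (Eventually.of_forall fun v => (h.hasDerivAt_flow l 0 v.2 v.1).hasFDerivAt)
        (Eventually.of_forall fun v => hd l v.1 v.2) ?_ (hm.regZero.cont l).continuousAt).hasFDerivAt
      · simpa [Function.HasUncurry.uncurry, h.flow_cancel] using this
      · refine Continuous.continuousAt ?_
        exact (ContinuousLinearMap.toSpanSingletonCLE (𝕜 := ℝ) (E := Plane)).continuous.comp
          ((h.cont l).comp (continuous_fst.prodMk (h.regZero_forward.cont l)))
    refine (HasFDerivAt.of_comp_of_leftInverse
      (g := fun p : ℝ × Plane => (p.1, flow (b l) p.1 p.2 0)) (a := (t, x))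
      (f'symm := (ContinuousLinearMap.fst ℝ ℝ Plane).prod ((n l t (flow (b l) t x 0)).comp
        (ContinuousLinearMap.snd ℝ ℝ Plane -
          (ContinuousLinearMap.fst ℝ ℝ Plane).smulRight (b l t x))))
      ?_ hΘ (hasFDerivAt_id _) (Eventually.of_forall fun p => ?_) ?_).congr_fderiv
      (ContinuousLinearMap.comp_id _)
    · exact (continuous_fst.prodMk (h.regZero_backward.cont l)).continuousAt
    · simp [h.flow_cancel]
    · rintro ⟨τ, v⟩
      have e := congrArg (fun L => L v) (hmn.N_comp_M hA.regZero.cont l t (flow (b l) t x 0))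
      simp only [ContinuousLinearMap.comp_apply, ContinuousLinearMap.id_apply] at e
      simp [e]
  refine ⟨fun l t x => ?_, fun l t x => ?_⟩
  · have h2 : HasFDerivAt (fun x : Plane => (t, x)) (ContinuousLinearMap.inr ℝ ℝ Plane) x :=
      hasFDerivAt_prodMk_right t x
    have := (hasFDerivAt_snd (p := (t, flow (b l) t x 0))).comp x ((key l t x).comp x h2)
    refine this.congr_fderiv ?_
    ext v
    simp
  · have h2 : HasDerivAt (fun t : ℝ => (t, x)) ((1 : ℝ), (0 : Plane)) t :=
      (hasDerivAt_id t).prodMk (hasDerivAt_const t x)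
    have := (hasFDerivAt_snd (p := (t, flow (b l) t x 0))).comp_hasDerivAt t
      ((key l t x).comp_hasDerivAt t h2)
    refine this.congr_deriv ?_
    simp

theorem reg_backward (h : IsLipField b K M) (hb : Reg H (k + 1) b) :
    Reg H (k + 1) (fun l t x => flow (b l) t x 0) := by
  obtain ⟨n, hn, hx, -⟩ := h.exists_backward hb
  have h1 : Reg False 1 (fun l t x => flow (b l) t x 0) :=
    Reg.of_hasFDerivAt h.regZero_backward hx (k := 0) (hn.regZero.comp_inner h.regZero_backward)
  -- The derivative of the backward flow is `n` evaluated along the backward flow itself, so every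
  -- round raises its order by one until the `k` derivatives of `n` are used up.
  have : ∀ j ≤ k, Reg H (j + 1) (fun l t x => flow (b l) t x 0) := by
    intro j
    induction j with
    | zero =>
      intro _
      exact Reg.of_hasFDerivAt h.regZero_backward hx
        (Reg.comp (hn.of_le (Nat.zero_le k)) h1.of_succ h1)
    | succ j ih =>
      intro hj
      exact Reg.of_hasFDerivAt h.regZero_backward hx (Reg.comp (hn.of_le hj) (ih (by omega)) h1)
  exact this k le_rfl

theorem contDiff_backward (h : IsLipField b K M) (hb : Reg H (k + 1) b) (l : Λ) :
    ContDiff ℝ 1 fun p : ℝ × Plane => flow (b l) p.1 p.2 0 := by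
  obtain ⟨n, hn, hx, ht⟩ := h.exists_backward hb
  have c := (hn.regZero.comp_inner h.regZero_backward).cont l
  exact contDiff_one_of_partials (f := fun t x => flow (b l) t x 0) (ht l) (hx l)
    (c.clm_apply (h.cont l)).neg c

end IsLipField

/-! ### Convolution with homogeneous kernels of degree `-1` -/

section Kernel

variable {F : Type} [NormedAddCommGroup F] [NormedSpace ℝ F]

/-- In polar coordinates of the plane the density is `r^{1-s}`, integrable at zero since `s < 2`. -/
theorem integrableOn_norm_rpow_neg {s : ℝ} (hs : s < 2) (R : ℝ) :
    IntegrableOn (fun u : Plane => ‖u‖ ^ (-s)) (Metric.ball 0 R) := by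
  rw [integrableOn_fun_norm_addHaar (μ := (volume : Measure Plane)) (f := fun r : ℝ => r ^ (-s))]
  have h1 : IntegrableOn (fun y : ℝ => y ^ (1 - s)) (Ioo 0 R) :=
    ((intervalIntegral.integrableOn_Ioo_rpow_iff (t := |R| + 1) (by positivity)).2
      (by linarith)).mono_set (Ioo_subset_Ioo_right (by linarith [le_abs_self R]))
  refine h1.congr_fun (fun y hy => ?_) measurableSet_Ioo
  have hy0 : (0 : ℝ) < y := hy.1
  simp only [finrank_euclideanSpace, Fintype.card_fin, smul_eq_mul]
  rw [show (1 : ℝ) - s = 1 + -s by ring, Real.rpow_add hy0]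
  simp

/-- The integral of `|u|^{-s}` over the unit disc. -/
def discInt (s : ℝ) : ℝ := ∫ u in Metric.ball (0 : Plane) 1, ‖u‖ ^ (-s)

theorem discInt_nonneg (s : ℝ) : 0 ≤ discInt s :=
  integral_nonneg fun u => by positivity

theorem measurable_norm_rpow (s : ℝ) : Measurable fun u : Plane => ‖u‖ ^ s :=
  measurable_norm.pow_const s

theorem norm_rpow_neg_le_one {s : ℝ} (hs : 0 ≤ s) {u : Plane} (hu : 1 ≤ ‖u‖) : ‖u‖ ^ (-s) ≤ 1 :=
  Real.rpow_le_one_of_one_le_of_nonpos hu (by linarith)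

/-- Inside the unit disc the sup bound of `f` meets an integrable singularity; outside, the kernel
is at most one and the `L¹` norm of `f` suffices. -/
theorem integrable_rpow_mul {s A : ℝ} (hs0 : 0 ≤ s) (hs : s < 2) {f : Plane → F}
    (hA : ∀ y, ‖f y‖ ≤ A) (hf : Integrable f) (x : Plane) :
    Integrable (fun u => ‖u‖ ^ (-s) * ‖f (x - u)‖) ∧
      ∫ u, ‖u‖ ^ (-s) * ‖f (x - u)‖ ≤ A * discInt s + ∫ y, ‖f y‖ := by
  have hA0 : 0 ≤ A := (norm_nonneg _).trans (hA 0)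
  have hf' : Integrable fun u => ‖f (x - u)‖ := (hf.comp_sub_left x).norm
  have h1 : Integrable fun u : Plane => (Metric.ball (0 : Plane) 1).indicator
      (fun u => A * ‖u‖ ^ (-s)) u :=
    (integrable_indicator_iff measurableSet_ball).2
      ((integrableOn_norm_rpow_neg hs 1).const_mul A)
  have hle : ∀ u, ‖u‖ ^ (-s) * ‖f (x - u)‖ ≤ (Metric.ball (0 : Plane) 1).indicator
      (fun u => A * ‖u‖ ^ (-s)) u + ‖f (x - u)‖ := fun u => by
    by_cases hu : u ∈ Metric.ball (0 : Plane) 1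
    · rw [indicator_of_mem hu, mul_comm]
      have := hA (x - u)
      have : ‖f (x - u)‖ * ‖u‖ ^ (-s) ≤ A * ‖u‖ ^ (-s) := by gcongr
      linarith [norm_nonneg (f (x - u))]
    · rw [indicator_of_notMem hu, zero_add]
      refine mul_le_of_le_one_left (norm_nonneg _) (norm_rpow_neg_le_one hs0 ?_)
      simpa using hu
  have hi : Integrable (fun u => ‖u‖ ^ (-s) * ‖f (x - u)‖) := by
    refine (h1.add hf').mono' ((measurable_norm_rpow _).aestronglyMeasurable.mul
      hf'.aestronglyMeasurable) (Eventually.of_forall fun u => ?_)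
    rw [Real.norm_of_nonneg (by positivity)]
    exact hle u
  refine ⟨hi, (integral_mono hi (h1.add hf') hle).trans_eq ?_⟩
  rw [integral_add' h1 hf', integral_indicator measurableSet_ball, integral_const_mul,
    integral_sub_left_eq_self (fun y => ‖f y‖)]
  rfl

/-- The kernel `ℓ(u) / (|u|² + ε²)`. -/
def kern (ℓ : Plane →L[ℝ] ℝ) (ε : ℝ) (u : Plane) : ℝ := ℓ u / (‖u‖ ^ 2 + ε ^ 2)

/-- Convolution with the kernel `ℓ(u) / (|u|² + ε²)`. -/
def conv (ℓ : Plane →L[ℝ] ℝ) (ε : ℝ) (f : Plane → F) (x : Plane) : F :=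
  ∫ u, kern ℓ ε u • f (x - u)

variable {ℓ : Plane →L[ℝ] ℝ} {ε : ℝ}

theorem conv_eq (f : Plane → F) (x : Plane) : conv ℓ ε f x = ∫ y, kern ℓ ε (x - y) • f y := by
  have := integral_sub_left_eq_self (μ := volume) (fun y => kern ℓ ε (x - y) • f y) x
  rw [← this]
  simp [conv]

theorem measurable_kern : Measurable (kern ℓ ε) := by
  unfold kern
  fun_prop

theorem abs_kern_le (u : Plane) : |kern ℓ ε u| ≤ ‖ℓ‖ * ‖u‖ ^ (-1 : ℝ) := by
  rcases eq_or_ne u 0 with rfl | hu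
  · simp [kern]
  have hu' : 0 < ‖u‖ := norm_pos_iff.2 hu
  rw [kern, abs_div, abs_of_nonneg (by positivity : 0 ≤ ‖u‖ ^ 2 + ε ^ 2), Real.rpow_neg_one,
    div_le_iff₀ (by positivity)]
  have h1 := ℓ.le_opNorm u
  rw [Real.norm_eq_abs] at h1
  calc _ ≤ ‖ℓ‖ * ‖u‖ := h1
    _ = ‖ℓ‖ * ‖u‖⁻¹ * ‖u‖ ^ 2 := by field_simp
    _ ≤ _ := by gcongr; nlinarith [sq_nonneg ε]

/-- The inversion `a ↦ a / |a|²` satisfies `|a* - b*| = |a - b| / (|a| |b|)` exactly. One half power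
of `|a - b|` is kept, the other is spent through `√|a - b| ≤ √|a| + √|b|`; the remaining singularity
`-3/2` is still integrable in the plane. -/
theorem abs_kern_zero_sub_le (a b : Plane) : |kern ℓ 0 a - kern ℓ 0 b| ≤
    ‖ℓ‖ * √‖a - b‖ * (‖a‖ ^ (-(3 / 2) : ℝ) + ‖b‖ ^ (-(3 / 2) : ℝ)) := by
  have k1 : ∀ c : Plane, c ≠ 0 → |kern ℓ 0 c| ≤ ‖ℓ‖ * √‖c‖ * ‖c‖ ^ (-(3 / 2) : ℝ) := by
    intro c hc
    have hc' : 0 < ‖c‖ := norm_pos_iff.2 hc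
    refine (abs_kern_le c).trans_eq ?_
    rw [mul_assoc, Real.sqrt_eq_rpow, ← Real.rpow_add hc']
    norm_num
  rcases eq_or_ne a 0 with rfl | ha
  · rcases eq_or_ne b 0 with rfl | hb
    · simp
    · have : kern ℓ 0 0 = 0 := by simp [kern]
      rw [this, zero_sub, abs_neg, zero_sub, norm_neg]
      refine (k1 b hb).trans ?_
      gcongr
      simp
  rcases eq_or_ne b 0 with rfl | hb
  · have : kern ℓ 0 0 = 0 := by simp [kern]
    rw [this, sub_zero, sub_zero]
    refine (k1 a ha).trans ?_
    gcongr
    simp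
  have ha' : 0 < ‖a‖ := norm_pos_iff.2 ha
  have hb' : 0 < ‖b‖ := norm_pos_iff.2 hb
  have e : kern ℓ 0 a - kern ℓ 0 b = ℓ ((1 / ‖a‖) ^ 2 • a - (1 / ‖b‖) ^ 2 • b) := by
    simp only [kern, map_sub, map_smul, smul_eq_mul]
    field_simp
    ring
  have h1 := dist_div_norm_sq_smul ha hb 1
  rw [dist_eq_norm, dist_eq_norm] at h1
  have h2 := ℓ.le_opNorm ((1 / ‖a‖) ^ 2 • a - (1 / ‖b‖) ^ 2 • b)
  rw [h1, ← e, Real.norm_eq_abs] at h2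
  refine h2.trans ?_
  rw [mul_assoc]
  refine mul_le_mul_of_nonneg_left ?_ (norm_nonneg _)
  -- In `p = |a|^{-1/2}` and `q = |b|^{-1/2}` all powers are integral, and the claim reduces to `p
  -- q² + p² q ≤ p³ + q³`.
  set p := ‖a‖ ^ (-(1 / 2) : ℝ) with hp
  set q := ‖b‖ ^ (-(1 / 2) : ℝ) with hq
  have hp0 : 0 < p := by positivity
  have hq0 : 0 < q := by positivity
  have p3 : ‖a‖ ^ (-(3 / 2) : ℝ) = p ^ 3 := by
    rw [hp, ← Real.rpow_natCast, ← Real.rpow_mul ha'.le]; norm_num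
  have q3 : ‖b‖ ^ (-(3 / 2) : ℝ) = q ^ 3 := by
    rw [hq, ← Real.rpow_natCast, ← Real.rpow_mul hb'.le]; norm_num
  have pa : ‖a‖ = (p⁻¹) ^ 2 := by
    rw [hp, ← Real.rpow_neg ha'.le, ← Real.rpow_natCast, ← Real.rpow_mul ha'.le]; norm_num
  have qb : ‖b‖ = (q⁻¹) ^ 2 := by
    rw [hq, ← Real.rpow_neg hb'.le, ← Real.rpow_natCast, ← Real.rpow_mul hb'.le]; norm_num
  have hs : √‖a - b‖ ≤ p⁻¹ + q⁻¹ := by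
    rw [Real.sqrt_le_left (by positivity)]
    have := norm_sub_le a b
    rw [pa, qb] at this
    nlinarith [mul_pos (inv_pos.2 hp0) (inv_pos.2 hq0)]
  rw [p3, q3]
  have hd : ‖a - b‖ = √‖a - b‖ * √‖a - b‖ := (Real.mul_self_sqrt (norm_nonneg _)).symm
  calc 1 ^ 2 / (‖a‖ * ‖b‖) * ‖a - b‖ = √‖a - b‖ * (√‖a - b‖ * (p ^ 2 * q ^ 2)) := by
        rw [pa, qb]
        conv_lhs => rw [hd]
        field_simp
    _ ≤ √‖a - b‖ * ((p⁻¹ + q⁻¹) * (p ^ 2 * q ^ 2)) := by gcongr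
    _ = √‖a - b‖ * (p * q ^ 2 + p ^ 2 * q) := by field_simp
    _ ≤ √‖a - b‖ * (p ^ 3 + q ^ 3) := by
        refine mul_le_mul_of_nonneg_left ?_ (Real.sqrt_nonneg _)
        nlinarith [mul_nonneg (sq_nonneg (p - q)) (add_pos hp0 hq0).le]

theorem integrable_kern_smul {A : ℝ} {f : Plane → F} (hA : ∀ y, ‖f y‖ ≤ A) (hf : Integrable f)
    (x : Plane) : Integrable fun u => kern ℓ ε u • f (x - u) := by
  refine ((integrable_rpow_mul (s := 1) (by norm_num) (by norm_num) hA hf x).1.const_mul ‖ℓ‖).mono'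
    (measurable_kern.aestronglyMeasurable.smul (hf.comp_sub_left x).aestronglyMeasurable)
    (Eventually.of_forall fun u => ?_)
  rw [norm_smul, Real.norm_eq_abs, ← mul_assoc]
  gcongr
  exact abs_kern_le u

theorem norm_conv_le {A : ℝ} {f : Plane → F} (hA : ∀ y, ‖f y‖ ≤ A) (hf : Integrable f)
    (x : Plane) : ‖conv ℓ ε f x‖ ≤ ‖ℓ‖ * (A * discInt 1 + ∫ y, ‖f y‖) := by
  obtain ⟨h1, h2⟩ := integrable_rpow_mul (s := 1) (by norm_num) (by norm_num) hA hf x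
  refine (norm_integral_le_of_norm_le (h1.const_mul ‖ℓ‖) (Eventually.of_forall fun u => ?_)).trans ?_
  · rw [norm_smul, Real.norm_eq_abs, ← mul_assoc]
    gcongr
    exact abs_kern_le u
  · rw [integral_const_mul]
    gcongr

/-- The velocity of a vorticity that is only bounded and integrable is already `1/2`-Hölder, on the
whole plane. -/
theorem norm_conv_sub_le {A : ℝ} {f : Plane → F} (hA : ∀ y, ‖f y‖ ≤ A) (hf : Integrable f)
    (x x' : Plane) : ‖conv ℓ 0 f x - conv ℓ 0 f x'‖ ≤
      ‖ℓ‖ * (2 * (A * discInt (3 / 2) + ∫ y, ‖f y‖)) * √‖x - x'‖ := by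
  have hi : ∀ z, Integrable fun y => kern ℓ 0 (z - y) • f y := fun z => by
    have := (integrable_kern_smul (ℓ := ℓ) (ε := 0) hA hf z).comp_sub_left z
    simpa using this
  have hr : ∀ z, Integrable (fun y => ‖z - y‖ ^ (-(3 / 2) : ℝ) * ‖f y‖) ∧
      ∫ y, ‖z - y‖ ^ (-(3 / 2) : ℝ) * ‖f y‖ ≤ A * discInt (3 / 2) + ∫ y, ‖f y‖ := fun z => by
    obtain ⟨h1, h2⟩ := integrable_rpow_mul (s := 3 / 2) (by norm_num) (by norm_num) hA hf z
    refine ⟨by simpa using h1.comp_sub_left z, ?_⟩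
    rw [← integral_sub_left_eq_self _ _ z] at h2
    simpa using h2
  rw [conv_eq, conv_eq, ← integral_sub (hi x) (hi x')]
  obtain ⟨a1, a2⟩ := hr x
  obtain ⟨b1, b2⟩ := hr x'
  refine (norm_integral_le_of_norm_le ((a1.add b1).const_mul (‖ℓ‖ * √‖x - x'‖))
    (Eventually.of_forall fun y => ?_)).trans ?_
  · rw [← sub_smul, norm_smul, Real.norm_eq_abs]
    have := abs_kern_zero_sub_le (ℓ := ℓ) (x - y) (x' - y)
    rw [sub_sub_sub_cancel_right] at this
    calc _ ≤ _ := mul_le_mul_of_nonneg_right this (norm_nonneg _)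
      _ = _ := by simp only [Pi.add_apply]; ring
  · rw [integral_const_mul, integral_add' a1 b1]
    calc _ ≤ ‖ℓ‖ * √‖x - x'‖ * ((A * discInt (3 / 2) + ∫ y, ‖f y‖) +
          (A * discInt (3 / 2) + ∫ y, ‖f y‖)) := by gcongr
      _ = _ := by ring

/-- Bounded functions with support in a ball are integrable. -/
theorem integrable_of_support {A R : ℝ} {f : Plane → F} (hc : Continuous f) (hA : ∀ y, ‖f y‖ ≤ A)
    (hR : ∀ y, R < ‖y‖ → f y = 0) :
    Integrable f ∧ ∫ y, ‖f y‖ ≤ A * volume.real (Metric.closedBall (0 : Plane) R) := by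
  have hA0 : 0 ≤ A := (norm_nonneg _).trans (hA 0)
  have hcs : HasCompactSupport f :=
    HasCompactSupport.intro (isCompact_closedBall (0 : Plane) R) fun y hy => hR y (by simpa using hy)
  refine ⟨hc.integrable_of_hasCompactSupport hcs, ?_⟩
  have h1 : ∫ y, ‖f y‖ = ∫ y in Metric.closedBall (0 : Plane) R, ‖f y‖ := by
    rw [setIntegral_eq_integral_of_forall_compl_eq_zero]
    intro y hy
    rw [hR y (by simpa using hy), norm_zero]
  rw [h1]
  have h2 := norm_setIntegral_le_of_norm_le_const (μ := volume) (C := A) (f := fun y => ‖f y‖)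
    (s := Metric.closedBall (0 : Plane) R) measure_closedBall_lt_top
    (fun y _ => by rw [norm_norm]; exact hA y)
  exact (le_abs_self _).trans h2

end Kernel

/-! ### Regularity of convolutions -/

section ConvReg

variable {Λ : Type} {F : Type} [NormedAddCommGroup F] [NormedSpace ℝ F] {ℓ : Plane →L[ℝ] ℝ}
  {H : Prop} {k : ℕ} {R : ℝ}

/-- All functions of the family vanish outside the ball of radius `R`. -/
def SuppIn (R : ℝ) (f : Λ → ℝ → Plane → F) : Prop := ∀ l t x, R < ‖x‖ → f l t x = 0

theorem SuppIn.fderiv {f : Λ → ℝ → Plane → F} (h : SuppIn R f) :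
    SuppIn R (fun l t x => fderiv ℝ (f l t) x) := fun l t x hx => by
  have : f l t =ᶠ[𝓝 x] fun _ => 0 := by
    filter_upwards [(isOpen_lt continuous_const continuous_norm).mem_nhds hx] with y hy
    exact h l t y hy
  show _root_.fderiv ℝ (f l t) x = 0
  rw [this.fderiv_eq]
  simp

theorem RegZero.exists_bound {f : Λ → ℝ → Plane → F} (hf : RegZero H f) (h : SuppIn R f) (S : ℝ) :
    ∃ A : ℝ, 0 ≤ A ∧ ∀ l t x, |t| ≤ S → ‖f l t x‖ ≤ A := by
  obtain ⟨A, hA⟩ := hf.bdd (max R S)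
  refine ⟨max A 0, le_max_right _ _, fun l t x ht => ?_⟩
  by_cases hx : ‖x‖ ≤ R
  · exact (hA l t x (ht.trans (le_max_right _ _)) (hx.trans (le_max_left _ _))).trans
      (le_max_left _ _)
  · rw [h l t x (not_le.1 hx), norm_zero]
    exact le_max_right _ _

theorem RegZero.exists_holder {f : Λ → ℝ → Plane → F} (hf : RegZero True f) (h : SuppIn R f)
    (S : ℝ) : ∃ C : ℝ, 0 ≤ C ∧ ∀ l t x y, |t| ≤ S → ‖f l t x - f l t y‖ ≤ C * √‖x - y‖ := by
  obtain ⟨A, hA0, hA⟩ := hf.exists_bound h S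
  obtain ⟨C, hC⟩ := hf.holder trivial (max (R + 1) S)
  refine ⟨max C (2 * A), le_max_of_le_right (by positivity), fun l t x y ht => ?_⟩
  rcases le_total 1 ‖x - y‖ with h1 | h1
  · have h2 : 1 ≤ √‖x - y‖ := Real.one_le_sqrt.2 h1
    calc _ ≤ ‖f l t x‖ + ‖f l t y‖ := norm_sub_le _ _
      _ ≤ A + A := add_le_add (hA l t x ht) (hA l t y ht)
      _ = 2 * A * 1 := by ring
      _ ≤ _ := by
        gcongr
        exact le_max_right _ _
  · by_cases hxy : ‖x‖ ≤ R ∨ ‖y‖ ≤ R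
    · have hx : ‖x‖ ≤ R + 1 ∧ ‖y‖ ≤ R + 1 := by
        have e1 := norm_sub_norm_le x y
        have e2 := norm_sub_norm_le y x
        rw [norm_sub_rev] at e2
        rcases hxy with hh | hh <;> constructor <;> linarith
      refine (hC l t x y (ht.trans (le_max_right _ _)) (hx.1.trans (le_max_left _ _))
        (hx.2.trans (le_max_left _ _))).trans ?_
      gcongr
      exact le_max_left _ _
    · rw [not_or, not_le, not_le] at hxy
      rw [h l t x hxy.1, h l t y hxy.2, sub_zero, norm_zero]
      have : 0 ≤ max C (2 * A) := le_max_of_le_right (by positivity)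
      positivity

theorem RegZero.continuous_space {f : Λ → ℝ → Plane → F} (hf : RegZero H f) (l t) :
    Continuous (f l t) := (hf.cont l).comp (Continuous.prodMk_right t)

/-- Uniform bound on the convolution, on the whole plane. -/
theorem RegZero.exists_bound_conv {f : Λ → ℝ → Plane → F} (hf : RegZero H f) (h : SuppIn R f)
    (S : ℝ) : ∃ C : ℝ, 0 ≤ C ∧ ∀ l t x, |t| ≤ S → ‖conv ℓ 0 (f l t) x‖ ≤ C := by
  obtain ⟨A, hA0, hA⟩ := hf.exists_bound h S
  refine ⟨‖ℓ‖ * (A * discInt 1 + A * volume.real (Metric.closedBall (0 : Plane) R)), ?_,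
    fun l t x ht => ?_⟩
  · have := discInt_nonneg 1
    positivity
  · obtain ⟨h1, h2⟩ := integrable_of_support (hf.continuous_space l t) (fun y => hA l t y ht)
      (h l t)
    refine (norm_conv_le (fun y => hA l t y ht) h1 x).trans ?_
    gcongr

theorem regZero_conv {f : Λ → ℝ → Plane → F} (hf : RegZero H f) (h : SuppIn R f) :
    RegZero True (fun l t x => conv ℓ 0 (f l t) x) := by
  refine ⟨fun l => continuous_iff_continuousAt.2 ?_, fun S => ?_, fun _ S => ?_⟩
  · rintro ⟨t₀, x₀⟩
    obtain ⟨A, hA0, hA⟩ := hf.exists_bound h (|t₀| + 1)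
    let r := R + ‖x₀‖ + 1
    have near : ∀ᶠ p : ℝ × Plane in 𝓝 (t₀, x₀), |p.1| ≤ |t₀| + 1 ∧ ‖p.2‖ ≤ ‖x₀‖ + 1 := by
      have h1 : ∀ᶠ p : ℝ × Plane in 𝓝 (t₀, x₀), |p.1| < |t₀| + 1 :=
        (continuous_fst.abs.tendsto (t₀, x₀)).eventually_lt_const (by simp)
      have h2 : ∀ᶠ p : ℝ × Plane in 𝓝 (t₀, x₀), ‖p.2‖ < ‖x₀‖ + 1 :=
        (continuous_snd.norm.tendsto (t₀, x₀)).eventually_lt_const (by simp)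
      filter_upwards [h1, h2] with p a b using ⟨a.le, b.le⟩
    refine continuousAt_of_dominated (F := fun (p : ℝ × Plane) u => kern ℓ 0 u • f l p.1 (p.2 - u))
      (bound := (Metric.ball (0 : Plane) (r + 1)).indicator
        fun u => ‖ℓ‖ * ‖u‖ ^ (-1 : ℝ) * A) ?_ ?_ ?_ ?_
    · refine Eventually.of_forall fun p => ?_
      exact measurable_kern.aestronglyMeasurable.smul
        ((hf.continuous_space l p.1).comp (continuous_const.sub continuous_id)).aestronglyMeasurable
    · filter_upwards [near] with p hp
      refine Eventually.of_forall fun u => ?_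
      by_cases hu : u ∈ Metric.ball (0 : Plane) (r + 1)
      · rw [indicator_of_mem hu, norm_smul, Real.norm_eq_abs]
        have := abs_kern_le (ℓ := ℓ) (ε := 0) u
        have := hA l p.1 (p.2 - u) hp.1
        gcongr
      · rw [indicator_of_notMem hu, h l p.1 (p.2 - u), smul_zero, norm_zero]
        have h1 : r + 1 ≤ ‖u‖ := by simpa using hu
        have h2 := norm_sub_norm_le u p.2
        rw [norm_sub_rev] at h2
        have := hp.2
        simp only [r] at h1
        linarith
    · rw [integrable_indicator_iff measurableSet_ball]
      exact ((integrableOn_norm_rpow_neg (by norm_num) _).const_mul _).mul_const _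
    · refine Eventually.of_forall fun u => Continuous.continuousAt ?_
      exact ((hf.cont l).comp (continuous_fst.prodMk (continuous_snd.sub continuous_const))).const_smul _
  · obtain ⟨C, -, hC⟩ := hf.exists_bound_conv (ℓ := ℓ) h S
    exact ⟨C, fun l t x ht _ => hC l t x ht⟩
  · obtain ⟨A, hA0, hA⟩ := hf.exists_bound h S
    refine ⟨‖ℓ‖ * (2 * (A * discInt (3 / 2) + A * volume.real (Metric.closedBall (0 : Plane) R))),
      fun l t x y ht _ _ => ?_⟩
    obtain ⟨h1, h2⟩ := integrable_of_support (hf.continuous_space l t) (fun y => hA l t y ht)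
      (h l t)
    refine (norm_conv_sub_le (fun y => hA l t y ht) h1 x y).trans ?_
    gcongr

theorem hasFDerivAt_conv {f : Λ → ℝ → Plane → F} (hf : Reg H (k + 1) f) (h : SuppIn R f) (l t x) :
    HasFDerivAt (conv ℓ 0 (f l t)) (conv ℓ 0 (fun y => fderiv ℝ (f l t) y) x) x := by
  obtain ⟨A, hA0, hA⟩ := hf.2.2.regZero.exists_bound h.fderiv |t|
  obtain ⟨B, hB0, hB⟩ := hf.1.exists_bound h |t|
  let r := R + ‖x‖ + 1
  have cf := hf.1.continuous_space l t
  have cf' := hf.2.2.regZero.continuous_space l t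
  obtain ⟨h1, -⟩ := integrable_of_support cf (fun y => hB l t y le_rfl) (h l t)
  refine hasFDerivAt_integral_of_dominated_of_fderiv_le (𝕜 := ℝ)
    (F := fun x u => kern ℓ 0 u • f l t (x - u))
    (F' := fun x u => kern ℓ 0 u • fderiv ℝ (f l t) (x - u))
    (bound := (Metric.ball (0 : Plane) (r + 1)).indicator fun u => ‖ℓ‖ * ‖u‖ ^ (-1 : ℝ) * A)
    (Metric.ball_mem_nhds x one_pos) ?_ ?_ ?_ ?_ ?_ ?_
  · exact Eventually.of_forall fun x => measurable_kern.aestronglyMeasurable.smul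
      (cf.comp (continuous_const.sub continuous_id)).aestronglyMeasurable
  · exact integrable_kern_smul (fun y => hB l t y le_rfl) h1 x
  · exact measurable_kern.aestronglyMeasurable.smul
      (cf'.comp (continuous_const.sub continuous_id)).aestronglyMeasurable
  · refine Eventually.of_forall fun u y hy => ?_
    by_cases hu : u ∈ Metric.ball (0 : Plane) (r + 1)
    · rw [indicator_of_mem hu, norm_smul, Real.norm_eq_abs]
      have := abs_kern_le (ℓ := ℓ) (ε := 0) u
      have := hA l t (y - u) le_rfl
      gcongr
    · have e : fderiv ℝ (f l t) (y - u) = 0 := h.fderiv l t (y - u) ?_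
      · rw [indicator_of_notMem hu, e, smul_zero, norm_zero]
      have h1 : r + 1 ≤ ‖u‖ := by simpa using hu
      have h2 := norm_sub_norm_le u y
      rw [norm_sub_rev] at h2
      rw [mem_ball_iff_norm] at hy
      have h3 := norm_sub_norm_le y x
      simp only [r] at h1
      linarith
  · rw [integrable_indicator_iff measurableSet_ball]
    exact ((integrableOn_norm_rpow_neg (by norm_num) _).const_mul _).mul_const _
  · refine Eventually.of_forall fun u y _ => ?_
    have h2 : HasFDerivAt (fun y => f l t (y - u)) (fderiv ℝ (f l t) (y - u)) y := by
      have := (hf.2.1 l t (y - u)).hasFDerivAt.comp y ((hasFDerivAt_id y).sub_const u)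
      exact this.congr_fderiv (ContinuousLinearMap.comp_id _)
    exact h2.const_smul _

/-- All derivatives fall on `f`, and the convolution is Hölder even if the last derivative of `f` is
only continuous. -/
theorem reg_conv {f : Λ → ℝ → Plane → F} (hf : Reg H k f) (h : SuppIn R f) :
    Reg True k (fun l t x => conv ℓ 0 (f l t) x) := by
  induction k generalizing F with
  | zero => exact regZero_conv hf h
  | succ k ih =>
    exact Reg.of_hasFDerivAt (regZero_conv hf.1 h).weaken (hasFDerivAt_conv hf h)
      (ih hf.2.2 h.fderiv)

end ConvReg

/-! ### Differentiability of the convolution of a Hölder continuous function -/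

section Singular

variable {Λ : Type} {F : Type} [NormedAddCommGroup F] [NormedSpace ℝ F] {ℓ : Plane →L[ℝ] ℝ}
  {H : Prop} {k : ℕ} {R ε : ℝ}

/-- The derivative of `kern`. -/
def dkern (ℓ : Plane →L[ℝ] ℝ) (ε : ℝ) (u : Plane) : Plane →L[ℝ] ℝ :=
  (1 / (‖u‖ ^ 2 + ε ^ 2)) • ℓ - (2 * ℓ u / (‖u‖ ^ 2 + ε ^ 2) ^ 2) • innerSL ℝ u

theorem hasFDerivAt_kern (hε : 0 < ε) (u : Plane) : HasFDerivAt (kern ℓ ε) (dkern ℓ ε u) u := by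
  have hpos : 0 < ‖u‖ ^ 2 + ε ^ 2 := by positivity
  have h1 : HasFDerivAt (fun u : Plane => ‖u‖ ^ 2 + ε ^ 2) (2 • innerSL ℝ u) u :=
    (hasStrictFDerivAt_norm_sq u).hasFDerivAt.add_const _
  have h2 := (hasDerivAt_inv hpos.ne').comp_hasFDerivAt u h1
  have h3 := ℓ.hasFDerivAt.mul (x := u) h2
  refine h3.congr_fderiv ?_
  ext v
  simp [dkern]
  field_simp
  ring

theorem measurable_dkern : Measurable (dkern ℓ ε) := by
  unfold dkern
  have h1 : Measurable fun u : Plane => (1 / (‖u‖ ^ 2 + ε ^ 2)) := by fun_prop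
  have h2 : Measurable fun u : Plane => (2 * ℓ u / (‖u‖ ^ 2 + ε ^ 2) ^ 2) := by fun_prop
  have h3 : Measurable fun u : Plane => innerSL ℝ u := (innerSL ℝ (E := Plane)).continuous.measurable
  exact (h1.smul_const ℓ).sub (h2.smul h3)

theorem norm_dkern_le_div {u : Plane} (hr : 0 < ‖u‖ ^ 2 + ε ^ 2) :
    ‖dkern ℓ ε u‖ ≤ 3 * ‖ℓ‖ / (‖u‖ ^ 2 + ε ^ 2) := by
  have h1 := ℓ.le_opNorm u
  set r := ‖u‖ ^ 2 + ε ^ 2 with hrdef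
  calc ‖dkern ℓ ε u‖ ≤ ‖(1 / r) • ℓ‖ + ‖(2 * ℓ u / r ^ 2) • innerSL ℝ u‖ := norm_sub_le _ _
    _ = 1 / r * ‖ℓ‖ + 2 * ‖ℓ u‖ / r ^ 2 * ‖u‖ := by
        rw [norm_smul, norm_smul, innerSL_apply_norm, norm_div, norm_div, norm_mul]
        simp [abs_of_pos hr]
    _ ≤ 1 / r * ‖ℓ‖ + 2 * (‖ℓ‖ * ‖u‖) / r ^ 2 * ‖u‖ := by gcongr
    _ = 1 / r * ‖ℓ‖ + 2 * ‖ℓ‖ * ‖u‖ ^ 2 / r ^ 2 := by ring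
    _ ≤ 1 / r * ‖ℓ‖ + 2 * ‖ℓ‖ * r / r ^ 2 := by
        gcongr
        rw [hrdef]
        nlinarith [sq_nonneg ε]
    _ = _ := by field_simp; ring

theorem norm_dkern_sub_le {u : Plane} (hu : u ≠ 0) :
    ‖dkern ℓ ε u - dkern ℓ 0 u‖ ≤ 5 * ‖ℓ‖ * (ε ^ 2 / (‖u‖ ^ 2 + ε ^ 2)) / ‖u‖ ^ 2 := by
  have h1 := ℓ.le_opNorm u
  have hr : 0 < ‖u‖ ^ 2 := by have := norm_pos_iff.2 hu; positivity
  set r := ‖u‖ ^ 2 with hrdef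
  set e := ε ^ 2 with he
  have he0 : 0 ≤ e := by positivity
  have eq : dkern ℓ ε u - dkern ℓ 0 u = (1 / (r + e) - 1 / r) • ℓ -
      ((1 / (r + e) ^ 2 - 1 / r ^ 2) * (2 * ℓ u)) • innerSL ℝ u := by
    ext v
    simp only [dkern, sub_apply, smul_apply, smul_eq_mul]
    simp only [← hrdef, ← he]
    ring
  have a1 : |1 / (r + e) - 1 / r| = e / (r * (r + e)) := by
    rw [abs_of_nonpos]
    · field_simp; ring
    · rw [sub_nonpos]; gcongr; linarith
  have a2 : |1 / (r + e) ^ 2 - 1 / r ^ 2| ≤ 2 * e / (r ^ 2 * (r + e)) := by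
    rw [abs_of_nonpos]
    · have : -(1 / (r + e) ^ 2 - 1 / r ^ 2) = e * (2 * r + e) / (r ^ 2 * (r + e) ^ 2) := by
        field_simp; ring
      rw [this, div_le_div_iff₀ (by positivity) (by positivity)]
      have : e * (2 * r + e) * (r ^ 2 * (r + e)) ≤ e * (2 * (r + e)) * (r ^ 2 * (r + e)) := by
        gcongr; linarith
      linarith
    · rw [sub_nonpos]; gcongr; linarith
  rw [eq]
  calc _ ≤ ‖(1 / (r + e) - 1 / r) • ℓ‖ +
        ‖((1 / (r + e) ^ 2 - 1 / r ^ 2) * (2 * ℓ u)) • innerSL ℝ u‖ := norm_sub_le _ _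
    _ = e / (r * (r + e)) * ‖ℓ‖ + |1 / (r + e) ^ 2 - 1 / r ^ 2| * (2 * ‖ℓ u‖) * ‖u‖ := by
        rw [norm_smul, norm_smul, innerSL_apply_norm, norm_mul, norm_mul, Real.norm_eq_abs, a1,
          Real.norm_eq_abs]
        simp
    _ ≤ e / (r * (r + e)) * ‖ℓ‖ + 2 * e / (r ^ 2 * (r + e)) * (2 * (‖ℓ‖ * ‖u‖)) * ‖u‖ := by gcongr
    _ = e / (r * (r + e)) * ‖ℓ‖ + 4 * e / (r ^ 2 * (r + e)) * ‖ℓ‖ * r := by rw [hrdef]; ring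
    _ = _ := by field_simp; ring

theorem abs_kern_sub_kern_zero_le {u : Plane} (hu : u ≠ 0) :
    |kern ℓ ε u - kern ℓ 0 u| ≤ ‖ℓ‖ * (ε ^ 2 / (‖u‖ ^ 2 + ε ^ 2)) / ‖u‖ := by
  have h1 := ℓ.le_opNorm u
  rw [Real.norm_eq_abs] at h1
  have hu0 : 0 < ‖u‖ := norm_pos_iff.2 hu
  have e : kern ℓ ε u - kern ℓ 0 u = -(ℓ u * (ε ^ 2 / (‖u‖ ^ 2 * (‖u‖ ^ 2 + ε ^ 2)))) := by
    simp only [kern]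
    field_simp
    ring
  rw [e, abs_neg, abs_mul, abs_of_nonneg (by positivity : 0 ≤ ε ^ 2 / (‖u‖ ^ 2 * (‖u‖ ^ 2 + ε ^ 2)))]
  calc _ ≤ ‖ℓ‖ * ‖u‖ * (ε ^ 2 / (‖u‖ ^ 2 * (‖u‖ ^ 2 + ε ^ 2))) := by gcongr
    _ = _ := by field_simp

/-- The left side is at most `min(1, (ε/r)²)`. The exponent `1/4` is small enough for the
singularity `|u|^{-2-1/4}`, softened by the Hölder exponent to `|u|^{-7/4}`, to remain integrable.
-/
theorem ratio_le (hε : 0 < ε) {r : ℝ} (hr : 0 < r) :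
    ε ^ 2 / (r ^ 2 + ε ^ 2) ≤ ε ^ (1 / 4 : ℝ) * r ^ (-(1 / 4) : ℝ) := by
  have e1 : ε ^ (1 / 4 : ℝ) * r ^ (-(1 / 4) : ℝ) = (ε / r) ^ (1 / 4 : ℝ) := by
    rw [Real.div_rpow hε.le hr.le, Real.rpow_neg hr.le]; rfl
  rw [e1]
  rcases le_total ε r with h | h
  · have hq : ε / r ≤ 1 := (div_le_one hr).2 h
    calc ε ^ 2 / (r ^ 2 + ε ^ 2) ≤ ε ^ 2 / r ^ 2 := by gcongr; nlinarith
      _ = (ε / r) ^ (2 : ℝ) := by rw [Real.rpow_two, div_pow]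
      _ ≤ _ := Real.rpow_le_rpow_of_exponent_ge (by positivity) hq (by norm_num)
  · have hq : 1 ≤ ε / r := (one_le_div hr).2 h
    calc ε ^ 2 / (r ^ 2 + ε ^ 2) ≤ 1 := (div_le_one (by positivity)).2 (by nlinarith)
      _ ≤ _ := Real.one_le_rpow hq (by norm_num)

/-- A fixed cutoff function, equal to one on the unit disc. -/
def cut : ContDiffBump (0 : Plane) := ⟨1, 2, one_pos, one_lt_two⟩

theorem cut_nonneg_le (u : Plane) : 0 ≤ cut u ∧ cut u ≤ 1 := ⟨cut.nonneg, cut.le_one⟩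

theorem cut_contDiff : ContDiff ℝ 1 (fun u => cut u) := cut.contDiff

/-- Majorant of the integrands of the singular integrals. -/
def majorant (A C : ℝ) (g : Plane → ℝ) (u : Plane) : ℝ :=
  (Metric.ball (0 : Plane) 1).indicator (fun u => C * ‖u‖ ^ (-(7 / 4) : ℝ)) u + g u +
    (Metric.ball (0 : Plane) 3).indicator (fun _ => A) u

theorem integrable_majorant {A C : ℝ} {g : Plane → ℝ} (hg : Integrable g) :
    Integrable (majorant A C g) ∧ ∫ u, majorant A C g u =
      C * discInt (7 / 4) + (∫ u, g u) + A * volume.real (Metric.ball (0 : Plane) 3) := by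
  have h1 : Integrable ((Metric.ball (0 : Plane) 1).indicator
      (fun u => C * ‖u‖ ^ (-(7 / 4) : ℝ))) :=
    (integrable_indicator_iff measurableSet_ball).2
      ((integrableOn_norm_rpow_neg (by norm_num) 1).const_mul C)
  have h3 : Integrable ((Metric.ball (0 : Plane) 3).indicator (fun _ => A)) :=
    (integrable_indicator_iff measurableSet_ball).2 (integrableOn_const measure_ball_lt_top.ne)
  refine ⟨(h1.add hg).add h3, ?_⟩
  have : majorant A C g = ((Metric.ball (0 : Plane) 1).indicator
      (fun u => C * ‖u‖ ^ (-(7 / 4) : ℝ)) + g) + (Metric.ball (0 : Plane) 3).indicator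
        (fun _ => A) := rfl
  rw [this, integral_add' (h1.add hg) h3, integral_add' h1 hg, integral_indicator measurableSet_ball,
    integral_indicator measurableSet_ball, integral_const_mul]
  simp [discInt, mul_comm]

/-- Near the origin the cutoff is one and the difference `f(x - u) - f(x)` gains `√|u|`, so powers
up to `9/4` become `7/4 < 2`. This is used with `s = 2` for the singular integral and with `s = 9/4`
for its convergence in `ε`. -/
theorem rpow_mul_norm_le_majorant {s A C : ℝ} (hs0 : 0 ≤ s) (hs : s ≤ 9 / 4) {f : Plane → F}
    (hA : ∀ y, ‖f y‖ ≤ A) (hC0 : 0 ≤ C) (hC : ∀ y z, ‖f y - f z‖ ≤ C * √‖y - z‖) (x : Plane)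
    {u : Plane} (hu : u ≠ 0) :
    ‖u‖ ^ (-s) * ‖f (x - u) - cut u • f x‖ ≤ majorant A C (fun u => ‖f (x - u)‖) u := by
  have hA0 : 0 ≤ A := (norm_nonneg _).trans (hA 0)
  have hu0 : 0 < ‖u‖ := norm_pos_iff.2 hu
  unfold majorant
  by_cases h1 : ‖u‖ < 1
  · have hm : u ∈ Metric.ball (0 : Plane) 1 := by simpa using h1
    have hm3 : u ∈ Metric.ball (0 : Plane) 3 := by
      rw [mem_ball_zero_iff]; linarith
    rw [indicator_of_mem hm, indicator_of_mem hm3]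
    have e : cut u = 1 := cut.one_of_mem_closedBall (Metric.ball_subset_closedBall hm)
    rw [e, one_smul]
    have h2 := hC (x - u) x
    rw [sub_sub_cancel_left, norm_neg] at h2
    have h3 : ‖u‖ ^ (-s) * √‖u‖ ≤ ‖u‖ ^ (-(7 / 4) : ℝ) := by
      rw [Real.sqrt_eq_rpow, ← Real.rpow_add hu0]
      exact Real.rpow_le_rpow_of_exponent_ge hu0 h1.le (by linarith)
    calc _ ≤ ‖u‖ ^ (-s) * (C * √‖u‖) := by gcongr
      _ = C * (‖u‖ ^ (-s) * √‖u‖) := by ring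
      _ ≤ C * ‖u‖ ^ (-(7 / 4) : ℝ) := by gcongr
      _ ≤ _ := by
        have := norm_nonneg (f (x - u))
        linarith
  · have hm : u ∉ Metric.ball (0 : Plane) 1 := by simpa using h1
    rw [indicator_of_notMem hm, zero_add]
    have h2 : ‖u‖ ^ (-s) ≤ 1 := norm_rpow_neg_le_one hs0 (not_lt.1 h1)
    have h3 : ‖cut u • f x‖ ≤ (Metric.ball (0 : Plane) 3).indicator (fun _ => A) u := by
      by_cases hm3 : u ∈ Metric.ball (0 : Plane) 3
      · rw [indicator_of_mem hm3, norm_smul, Real.norm_of_nonneg (cut_nonneg_le u).1]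
        exact (mul_le_of_le_one_left (norm_nonneg _) (cut_nonneg_le u).2).trans (hA x)
      · rw [indicator_of_notMem hm3]
        have : cut u = 0 := cut.zero_of_le_dist (by
          rw [dist_zero_right]
          have : 3 ≤ ‖u‖ := by simpa using hm3
          show (2 : ℝ) ≤ ‖u‖
          linarith)
        simp [this]
    calc _ ≤ 1 * ‖f (x - u) - cut u • f x‖ := by gcongr
      _ ≤ ‖f (x - u)‖ + ‖cut u • f x‖ := by rw [one_mul]; exact norm_sub_le _ _
      _ ≤ _ := by gcongr

theorem norm_dkern_zero_le {u : Plane} (hu : u ≠ 0) :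
    ‖dkern ℓ 0 u‖ ≤ 3 * ‖ℓ‖ * ‖u‖ ^ (-2 : ℝ) := by
  have hu0 : 0 < ‖u‖ := norm_pos_iff.2 hu
  have := norm_dkern_le_div (ℓ := ℓ) (u := u) (ε := 0) (by positivity)
  refine this.trans_eq ?_
  rw [Real.rpow_neg hu0.le, Real.rpow_two]
  simp
  ring

theorem norm_dkern_sub_le_rpow (hε : 0 < ε) {u : Plane} (hu : u ≠ 0) :
    ‖dkern ℓ ε u - dkern ℓ 0 u‖ ≤ 5 * ‖ℓ‖ * ε ^ (1 / 4 : ℝ) * ‖u‖ ^ (-(9 / 4) : ℝ) := by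
  have hu0 : 0 < ‖u‖ := norm_pos_iff.2 hu
  refine (norm_dkern_sub_le hu).trans ?_
  have h1 := ratio_le hε hu0
  have e : ‖u‖ ^ (-(9 / 4) : ℝ) = ‖u‖ ^ (-(1 / 4) : ℝ) * (‖u‖ ^ 2)⁻¹ := by
    rw [← Real.rpow_two, ← Real.rpow_neg hu0.le, ← Real.rpow_add hu0]; norm_num
  rw [e, div_eq_mul_inv]
  calc _ ≤ 5 * ‖ℓ‖ * (ε ^ (1 / 4 : ℝ) * ‖u‖ ^ (-(1 / 4) : ℝ)) * (‖u‖ ^ 2)⁻¹ := by gcongr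
    _ = _ := by ring

theorem abs_kern_sub_le_rpow (hε : 0 < ε) (u : Plane) :
    |kern ℓ ε u - kern ℓ 0 u| ≤ ‖ℓ‖ * ε ^ (1 / 4 : ℝ) * ‖u‖ ^ (-(5 / 4) : ℝ) := by
  rcases eq_or_ne u 0 with rfl | hu
  · simp [kern]
  have hu0 : 0 < ‖u‖ := norm_pos_iff.2 hu
  refine (abs_kern_sub_kern_zero_le hu).trans ?_
  have h1 := ratio_le hε hu0
  have e : ‖u‖ ^ (-(5 / 4) : ℝ) = ‖u‖ ^ (-(1 / 4) : ℝ) * (‖u‖)⁻¹ := by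
    rw [← Real.rpow_neg_one, ← Real.rpow_add hu0]; norm_num
  rw [e, div_eq_mul_inv]
  calc _ ≤ ‖ℓ‖ * (ε ^ (1 / 4 : ℝ) * ‖u‖ ^ (-(1 / 4) : ℝ)) * (‖u‖)⁻¹ := by gcongr
    _ = _ := by ring

/-- The derivative of the cutoff function. -/
def dcut (u : Plane) : Plane →L[ℝ] ℝ := fderiv ℝ (fun u => cut u) u

theorem dcut_spec : Continuous dcut ∧ (∀ u, 2 < ‖u‖ → dcut u = 0) ∧ ∃ A, ∀ u, ‖dcut u‖ ≤ A := by
  have hc : Continuous dcut := cut_contDiff.continuous_fderiv one_ne_zero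
  have hs : HasCompactSupport dcut := cut.hasCompactSupport.fderiv ℝ
  refine ⟨hc, fun u hu => ?_, hc.bounded_above_of_compact_support hs⟩
  refine image_eq_zero_of_notMem_tsupport (f := dcut) fun h => ?_
  have := (tsupport_fderiv_subset ℝ (f := fun u => cut u)) h
  have h2 : tsupport (fun u => cut u) = Metric.closedBall 0 2 := cut.tsupport_eq
  rw [h2, mem_closedBall_zero_iff] at this
  linarith

/-- The constant in the singular integral. -/
def singConst (ℓ : Plane →L[ℝ] ℝ) (ε : ℝ) : Plane →L[ℝ] ℝ := -∫ u, kern ℓ ε u • dcut u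

/-- Integration by parts. The form with the derivative on the cutoff is the one that still makes
sense for `ε = 0`, where `cut • dkern` is not integrable. -/
theorem singConst_eq (hε : 0 < ε) : ∫ u, cut u • dkern ℓ ε u = singConst ℓ ε := by
  have hk : Continuous (dkern ℓ ε) := by
    unfold dkern
    have h0 : ∀ u : Plane, ‖u‖ ^ 2 + ε ^ 2 ≠ 0 := fun u => by positivity
    have h1 : Continuous fun u : Plane => (1 / (‖u‖ ^ 2 + ε ^ 2)) := by fun_prop (disch := exact h0 _)
    have h2 : Continuous fun u : Plane => (2 * ℓ u / (‖u‖ ^ 2 + ε ^ 2) ^ 2) := by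
      refine Continuous.div (by fun_prop) (by fun_prop) fun u => pow_ne_zero _ (h0 u)
    exact (h1.smul continuous_const).sub (h2.smul (innerSL ℝ (E := Plane)).continuous)
  have hkd : Differentiable ℝ (kern ℓ ε) := fun u => (hasFDerivAt_kern hε u).differentiableAt
  have hkf : ∀ u, fderiv ℝ (kern ℓ ε) u = dkern ℓ ε u := fun u => (hasFDerivAt_kern hε u).fderiv
  have hcc : Continuous fun u => cut u := cut_contDiff.continuous
  have i1 : Integrable fun u => cut u • dkern ℓ ε u :=
    (hcc.smul hk).integrable_of_hasCompactSupport (cut.hasCompactSupport.smul_right)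
  have hs : HasCompactSupport dcut := cut.hasCompactSupport.fderiv ℝ
  have i2 : Integrable fun u => kern ℓ ε u • dcut u :=
    (hkd.continuous.smul dcut_spec.1).integrable_of_hasCompactSupport hs.smul_left
  ext v
  rw [ContinuousLinearMap.integral_apply i1, singConst, neg_apply,
    ContinuousLinearMap.integral_apply i2]
  have h1 : Integrable fun u => fderiv ℝ (kern ℓ ε) u v * cut u := by
    have := i1.apply_continuousLinearMap v
    refine this.congr (Eventually.of_forall fun u => ?_)
    simp [hkf, mul_comm]
  have h2 : Integrable fun u => kern ℓ ε u * fderiv ℝ (fun u => cut u) u v :=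
    i2.apply_continuousLinearMap v
  have h3 : Integrable fun u => kern ℓ ε u * cut u :=
    (hkd.continuous.mul hcc).integrable_of_hasCompactSupport cut.hasCompactSupport.mul_left
  have := integral_mul_fderiv_eq_neg_fderiv_mul_of_integrable h1 h2 h3 (fun u _ => hkd u)
    (fun u _ => cut_contDiff.differentiable one_ne_zero u)
  simp only [hkf] at this
  simp only [dcut, smul_apply, smul_eq_mul]
  rw [this, neg_neg]
  simp only [mul_comm]

theorem norm_singConst_sub_le : ∃ C, 0 ≤ C ∧ ∀ ε, 0 < ε →
    ‖singConst ℓ ε - singConst ℓ 0‖ ≤ C * ε ^ (1 / 4 : ℝ) := by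
  obtain ⟨hc, hs, A, hA⟩ := dcut_spec
  obtain ⟨hi, -⟩ := integrable_of_support hc hA hs
  have hi' : ∀ ε, Integrable fun u => kern ℓ ε u • dcut u := fun ε => by
    have := integrable_kern_smul (ℓ := ℓ) (ε := ε) (f := fun u => dcut (-u)) (fun y => hA (-y))
      hi.comp_neg 0
    simpa using this
  obtain ⟨h1, h2⟩ := integrable_rpow_mul (s := 5 / 4) (by norm_num) (by norm_num)
    (f := fun u => dcut (-u)) (fun y => hA (-y)) hi.comp_neg 0
  refine ⟨‖ℓ‖ * ∫ u, ‖u‖ ^ (-(5 / 4) : ℝ) * ‖dcut (-(0 - u))‖, ?_, fun ε hε => ?_⟩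
  · exact mul_nonneg (norm_nonneg _) (integral_nonneg fun u => by positivity)
  · have e : singConst ℓ ε - singConst ℓ 0 = -∫ u, (kern ℓ ε u - kern ℓ 0 u) • dcut u := by
      have e1 : ∫ u, (kern ℓ ε u - kern ℓ 0 u) • dcut u =
          ∫ u, (kern ℓ ε u • dcut u - kern ℓ 0 u • dcut u) :=
        integral_congr_ae (Eventually.of_forall fun u => by ext v; simp [sub_mul])
      rw [e1, integral_sub (hi' ε) (hi' 0), singConst, singConst]
      abel
    rw [e, norm_neg]
    refine (norm_integral_le_of_norm_le (h1.const_mul (‖ℓ‖ * ε ^ (1 / 4 : ℝ)))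
      (Eventually.of_forall fun u => ?_)).trans_eq ?_
    · rw [norm_smul, Real.norm_eq_abs, ← mul_assoc]
      simp only [zero_sub, neg_neg]
      gcongr
      exact abs_kern_sub_le_rpow hε u
    · rw [integral_const_mul]
      ring

end Singular

/-! ### The singular integral, the limit `ε → 0`, and the gain of one derivative. -/

section SingularIntegral

variable {Λ : Type} {F : Type} [NormedAddCommGroup F] [NormedSpace ℝ F] [CompleteSpace F]
  {ℓ : Plane →L[ℝ] ℝ} {H : Prop} {k : ℕ} {R ε : ℝ}

/-- The derivative of `conv`, written as a regularized singular integral. -/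
def sing (ℓ : Plane →L[ℝ] ℝ) (ε : ℝ) (f : Plane → F) (x : Plane) : Plane →L[ℝ] F :=
  (∫ u, (dkern ℓ ε u).smulRight (f (x - u) - cut u • f x)) + (singConst ℓ ε).smulRight (f x)

theorem aestronglyMeasurable_smulRight {c : Plane → Plane →L[ℝ] ℝ} {g : Plane → F}
    (hc : AEStronglyMeasurable c) (hg : AEStronglyMeasurable g) :
    AEStronglyMeasurable fun u => (c u).smulRight (g u) :=
  (ContinuousLinearMap.smulRightL ℝ Plane F).aestronglyMeasurable_comp₂ hc hg

theorem continuous_cut_sub {f : Plane → F} (hf : Continuous f) (x : Plane) :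
    Continuous fun u => f (x - u) - cut u • f x :=
  (hf.comp (continuous_const.sub continuous_id)).sub
    ((cut_contDiff.continuous).smul continuous_const)

theorem norm_dkern_le_const (hε : 0 < ε) (u : Plane) : ‖dkern ℓ ε u‖ ≤ 3 * ‖ℓ‖ / ε ^ 2 := by
  refine (norm_dkern_le_div (by positivity)).trans ?_
  gcongr
  nlinarith [sq_nonneg ‖u‖]

theorem integrable_smulRight (hε : 0 < ε) {g : Plane → F} (hg : Integrable g) :
    Integrable fun u => (dkern ℓ ε u).smulRight (g u) := by
  refine (hg.norm.const_mul (3 * ‖ℓ‖ / ε ^ 2)).mono' (aestronglyMeasurable_smulRight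
    measurable_dkern.aestronglyMeasurable hg.aestronglyMeasurable)
    (Eventually.of_forall fun u => ?_)
  rw [ContinuousLinearMap.norm_smulRight_apply]
  gcongr
  exact norm_dkern_le_const hε u

theorem integrable_sub_cut {f : Plane → F} (hf : Integrable f) (x : Plane) :
    Integrable (fun u => f (x - u) - cut u • f x) ∧ Integrable fun u => cut u • f x := by
  have hcut : Integrable fun u => cut u • f x :=
    ((cut_contDiff.continuous).smul continuous_const).integrable_of_hasCompactSupport
      (cut.hasCompactSupport.smul_right)
  exact ⟨(hf.comp_sub_left x).sub hcut, hcut⟩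

/-- For `ε > 0` the derivative of the kernel is bounded and can be put under the integral.
Subtracting `cut u • f x` is harmless, as `singConst` restores exactly what it removes. -/
theorem hasFDerivAt_conv_sing (hε : 0 < ε) {f : Plane → F} (hf : Continuous f)
    (h : HasCompactSupport f) (x : Plane) : HasFDerivAt (conv ℓ ε f) (sing ℓ ε f x) x := by
  obtain ⟨A, hA⟩ := hf.bounded_above_of_compact_support h
  have hfi : Integrable f := hf.integrable_of_hasCompactSupport h
  have hb := norm_dkern_le_const (ℓ := ℓ) hε
  have h1 : HasFDerivAt (fun x => ∫ y, kern ℓ ε (x - y) • f y)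
      (∫ y, (dkern ℓ ε (x - y)).smulRight (f y)) x := by
    refine hasFDerivAt_integral_of_dominated_of_fderiv_le (𝕜 := ℝ)
      (F := fun x y => kern ℓ ε (x - y) • f y)
      (F' := fun x y => (dkern ℓ ε (x - y)).smulRight (f y))
      (bound := fun y => 3 * ‖ℓ‖ / ε ^ 2 * ‖f y‖) univ_mem ?_ ?_ ?_ ?_ ?_ ?_
    · exact Eventually.of_forall fun z =>
        (measurable_kern.comp (measurable_const.sub measurable_id)).aestronglyMeasurable.smul
          hf.aestronglyMeasurable
    · have := (integrable_kern_smul (ℓ := ℓ) (ε := ε) hA hfi x).comp_sub_left x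
      simpa using this
    · exact aestronglyMeasurable_smulRight
        (measurable_dkern.comp (measurable_const.sub measurable_id)).aestronglyMeasurable
        hf.aestronglyMeasurable
    · refine Eventually.of_forall fun y z _ => ?_
      rw [ContinuousLinearMap.norm_smulRight_apply]
      gcongr
      exact hb _
    · exact hfi.norm.const_mul _
    · refine Eventually.of_forall fun y z _ => ?_
      have := (hasFDerivAt_kern (ℓ := ℓ) hε (z - y)).comp z ((hasFDerivAt_id z).sub_const y)
      exact (this.congr_fderiv (ContinuousLinearMap.comp_id _)).smul_const (f y)
  have h2 : conv ℓ ε f = fun x => ∫ y, kern ℓ ε (x - y) • f y := funext fun x => conv_eq f x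
  rw [h2]
  refine h1.congr_fderiv ?_
  have e1 : ∫ y, (dkern ℓ ε (x - y)).smulRight (f y) =
      ∫ u, (dkern ℓ ε u).smulRight (f (x - u)) := by
    have := integral_sub_left_eq_self (μ := volume)
      (fun y => (dkern ℓ ε (x - y)).smulRight (f y)) x
    rw [← this]
    simp
  obtain ⟨i1, i2⟩ := integrable_sub_cut hfi x
  replace i1 := integrable_smulRight (ℓ := ℓ) hε i1
  replace i2 := integrable_smulRight (ℓ := ℓ) hε i2
  have i3 : Integrable fun u => cut u • dkern ℓ ε u := by
    have : Integrable fun u => cut u := cut_contDiff.continuous.integrable_of_hasCompactSupport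
      cut.hasCompactSupport
    refine (this.norm.const_mul (3 * ‖ℓ‖ / ε ^ 2)).mono'
      (this.aestronglyMeasurable.smul measurable_dkern.aestronglyMeasurable)
      (Eventually.of_forall fun u => ?_)
    rw [norm_smul, mul_comm]
    gcongr
    exact hb u
  rw [e1, sing, ← singConst_eq hε]
  have e2 : (∫ u, cut u • dkern ℓ ε u).smulRight (f x) =
      ∫ u, (dkern ℓ ε u).smulRight (cut u • f x) := by
    have := ((ContinuousLinearMap.smulRightL ℝ Plane F).flip (f x)).integral_comp_comm i3
    refine this.symm.trans (integral_congr_ae (Eventually.of_forall fun u => ?_))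
    ext v
    simp [smul_smul, mul_comm]
  rw [e2, ← integral_add i1 i2]
  refine integral_congr_ae (Eventually.of_forall fun u => ?_)
  ext v
  simp [smul_sub]

theorem norm_sing_integrand_le {A C : ℝ} {f : Plane → F} (hA : ∀ y, ‖f y‖ ≤ A) (hC0 : 0 ≤ C)
    (hC : ∀ y z, ‖f y - f z‖ ≤ C * √‖y - z‖) (x : Plane) {u : Plane} (hu : u ≠ 0) :
    ‖(dkern ℓ 0 u).smulRight (f (x - u) - cut u • f x)‖ ≤
      3 * ‖ℓ‖ * majorant A C (fun u => ‖f (x - u)‖) u := by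
  rw [ContinuousLinearMap.norm_smulRight_apply]
  have h1 := rpow_mul_norm_le_majorant (s := 2) (by norm_num) (by norm_num) hA hC0 hC x hu
  calc _ ≤ 3 * ‖ℓ‖ * ‖u‖ ^ (-2 : ℝ) * ‖f (x - u) - cut u • f x‖ := by
        gcongr; exact norm_dkern_zero_le hu
    _ = 3 * ‖ℓ‖ * (‖u‖ ^ (-2 : ℝ) * ‖f (x - u) - cut u • f x‖) := by ring
    _ ≤ _ := by gcongr

theorem ae_ne_zero : ∀ᵐ u : Plane, u ≠ 0 := by
  rw [ae_iff]
  simp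

theorem integrable_sing {A C : ℝ} {f : Plane → F} (hf : Continuous f) (hfi : Integrable f)
    (hA : ∀ y, ‖f y‖ ≤ A) (hC0 : 0 ≤ C)
    (hC : ∀ y z, ‖f y - f z‖ ≤ C * √‖y - z‖) (x : Plane) :
    Integrable fun u => (dkern ℓ 0 u).smulRight (f (x - u) - cut u • f x) := by
  refine ((integrable_majorant (A := A) (C := C) (hfi.comp_sub_left x).norm).1.const_mul
    (3 * ‖ℓ‖)).mono' (aestronglyMeasurable_smulRight measurable_dkern.aestronglyMeasurable
      (continuous_cut_sub hf x).aestronglyMeasurable) ?_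
  filter_upwards [ae_ne_zero] with u hu
  exact norm_sing_integrand_le hA hC0 hC x hu

theorem norm_sing_le {A C : ℝ} {f : Plane → F} (hfi : Integrable f)
    (hA : ∀ y, ‖f y‖ ≤ A) (hC0 : 0 ≤ C)
    (hC : ∀ y z, ‖f y - f z‖ ≤ C * √‖y - z‖) (x : Plane) :
    ‖sing ℓ 0 f x‖ ≤ 3 * ‖ℓ‖ * (C * discInt (7 / 4) + (∫ y, ‖f y‖) +
      A * volume.real (Metric.ball (0 : Plane) 3)) + ‖singConst ℓ 0‖ * A := by
  obtain ⟨m1, m2⟩ := integrable_majorant (A := A) (C := C) (hfi.comp_sub_left x).norm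
  rw [integral_sub_left_eq_self (fun y => ‖f y‖) volume x] at m2
  refine (norm_add_le _ _).trans (add_le_add ?_ ?_)
  · rw [← m2, ← integral_const_mul]
    refine norm_integral_le_of_norm_le (m1.const_mul _) ?_
    filter_upwards [ae_ne_zero] with u hu
    exact norm_sing_integrand_le hA hC0 hC x hu
  · rw [ContinuousLinearMap.norm_smulRight_apply]
    gcongr
    exact hA x

/-- The rate is uniform in `x`, which is what differentiating the limit requires. -/
theorem norm_sing_sub_le {A C : ℝ} {f : Plane → F} (hf : Continuous f) (h : HasCompactSupport f)
    (hA : ∀ y, ‖f y‖ ≤ A) (hC0 : 0 ≤ C) (hC : ∀ y z, ‖f y - f z‖ ≤ C * √‖y - z‖) :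
    ∃ B, ∀ ε, 0 < ε → ∀ x, ‖sing ℓ ε f x - sing ℓ 0 f x‖ ≤ B * ε ^ (1 / 4 : ℝ) := by
  have hfi : Integrable f := hf.integrable_of_hasCompactSupport h
  obtain ⟨D, hD0, hD⟩ := norm_singConst_sub_le (ℓ := ℓ)
  refine ⟨5 * ‖ℓ‖ * (C * discInt (7 / 4) + (∫ y, ‖f y‖) +
      A * volume.real (Metric.ball (0 : Plane) 3)) + D * A, fun ε hε x => ?_⟩
  obtain ⟨m1, m2⟩ := integrable_majorant (A := A) (C := C) (hfi.comp_sub_left x).norm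
  rw [integral_sub_left_eq_self (fun y => ‖f y‖) volume x] at m2
  have i0 := integrable_sing (ℓ := ℓ) hf hfi hA hC0 hC x
  have hle : ∀ᵐ u : Plane, ‖(dkern ℓ ε u).smulRight (f (x - u) - cut u • f x) -
      (dkern ℓ 0 u).smulRight (f (x - u) - cut u • f x)‖ ≤
      5 * ‖ℓ‖ * ε ^ (1 / 4 : ℝ) * majorant A C (fun u => ‖f (x - u)‖) u := by
    filter_upwards [ae_ne_zero] with u hu
    have e : (dkern ℓ ε u).smulRight (f (x - u) - cut u • f x) -
      (dkern ℓ 0 u).smulRight (f (x - u) - cut u • f x) =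
        (dkern ℓ ε u - dkern ℓ 0 u).smulRight (f (x - u) - cut u • f x) := by
      ext v
      simp [sub_smul]
    rw [e, ContinuousLinearMap.norm_smulRight_apply]
    have h1 := rpow_mul_norm_le_majorant (s := 9 / 4) (by norm_num) (by norm_num) hA hC0 hC x hu
    calc _ ≤ 5 * ‖ℓ‖ * ε ^ (1 / 4 : ℝ) * ‖u‖ ^ (-(9 / 4) : ℝ) * ‖f (x - u) - cut u • f x‖ := by
          gcongr; exact norm_dkern_sub_le_rpow hε hu
      _ = 5 * ‖ℓ‖ * ε ^ (1 / 4 : ℝ) * (‖u‖ ^ (-(9 / 4) : ℝ) * ‖f (x - u) - cut u • f x‖) := by ring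
      _ ≤ _ := by gcongr
  have iε := integrable_smulRight (ℓ := ℓ) hε (integrable_sub_cut hfi x).1
  have e : sing ℓ ε f x - sing ℓ 0 f x =
      (∫ u, ((dkern ℓ ε u).smulRight (f (x - u) - cut u • f x) -
        (dkern ℓ 0 u).smulRight (f (x - u) - cut u • f x))) +
      (singConst ℓ ε - singConst ℓ 0).smulRight (f x) := by
    rw [integral_sub iε i0, sing, sing]
    ext v
    simp [sub_smul]
    abel
  rw [e, add_mul]
  refine (norm_add_le _ _).trans (add_le_add ?_ ?_)
  · refine (norm_integral_le_of_norm_le (m1.const_mul _) hle).trans_eq ?_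
    rw [integral_const_mul, m2]
    ring
  · rw [ContinuousLinearMap.norm_smulRight_apply]
    calc _ ≤ D * ε ^ (1 / 4 : ℝ) * A := by
          gcongr
          · exact hD ε hε
          · exact hA x
      _ = _ := by ring

theorem norm_conv_sub_conv_zero_le {A : ℝ} {f : Plane → F} (hfi : Integrable f)
    (hA : ∀ y, ‖f y‖ ≤ A) (hε : 0 < ε) (x : Plane) : ‖conv ℓ ε f x - conv ℓ 0 f x‖ ≤
      ‖ℓ‖ * (A * discInt (5 / 4) + ∫ y, ‖f y‖) * ε ^ (1 / 4 : ℝ) := by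
  obtain ⟨h1, h2⟩ := integrable_rpow_mul (s := 5 / 4) (by norm_num) (by norm_num) hA hfi x
  rw [conv, conv, ← integral_sub (integrable_kern_smul hA hfi x) (integrable_kern_smul hA hfi x)]
  refine (norm_integral_le_of_norm_le (h1.const_mul (‖ℓ‖ * ε ^ (1 / 4 : ℝ)))
    (Eventually.of_forall fun u => ?_)).trans ?_
  · rw [← sub_smul, norm_smul, Real.norm_eq_abs, ← mul_assoc]
    gcongr
    exact abs_kern_sub_le_rpow hε u
  · rw [integral_const_mul]
    calc _ ≤ ‖ℓ‖ * ε ^ (1 / 4 : ℝ) * (A * discInt (5 / 4) + ∫ y, ‖f y‖) := by gcongr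
      _ = _ := by ring

/-- The regularized convolutions converge pointwise and their derivatives converge uniformly as `ε →
0`; the limit of the derivatives is the singular integral. -/
theorem hasFDerivAt_conv_zero {A C : ℝ} {f : Plane → F} (hf : Continuous f)
    (h : HasCompactSupport f) (hA : ∀ y, ‖f y‖ ≤ A) (hC0 : 0 ≤ C)
    (hC : ∀ y z, ‖f y - f z‖ ≤ C * √‖y - z‖) (x : Plane) :
    HasFDerivAt (conv ℓ 0 f) (sing ℓ 0 f x) x := by
  have hfi : Integrable f := hf.integrable_of_hasCompactSupport h
  obtain ⟨B, hB⟩ := norm_sing_sub_le (ℓ := ℓ) hf h hA hC0 hC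
  have he : Tendsto (fun n : ℕ => (1 / ((n : ℝ) + 1)) ^ (1 / 4 : ℝ)) atTop (𝓝 0) := by
    have := (tendsto_one_div_add_atTop_nhds_zero_nat (𝕜 := ℝ)).rpow_const
      (p := (1 / 4 : ℝ)) (Or.inr (by norm_num))
    rwa [Real.zero_rpow (by norm_num)] at this
  have hp : ∀ n : ℕ, (0 : ℝ) < 1 / ((n : ℝ) + 1) := fun n => by positivity
  refine hasFDerivAt_of_tendstoUniformly (l := atTop) (𝕜 := ℝ)
    (f := fun (n : ℕ) => conv ℓ (1 / ((n : ℝ) + 1)) f)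
    (f' := fun (n : ℕ) => sing ℓ (1 / ((n : ℝ) + 1)) f) ?_
    (fun n y => hasFDerivAt_conv_sing (hp n) hf h y) (fun y => ?_) x
  · rw [Metric.tendstoUniformly_iff]
    intro η hη
    have h1 : Tendsto (fun n : ℕ => B * (1 / ((n : ℝ) + 1)) ^ (1 / 4 : ℝ)) atTop (𝓝 0) := by
      simpa using he.const_mul B
    filter_upwards [h1.eventually_lt_const hη] with n hn y
    rw [dist_eq_norm, norm_sub_rev]
    exact (hB _ (hp n) y).trans_lt hn
  · rw [tendsto_iff_norm_sub_tendsto_zero]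
    refine squeeze_zero (fun _ => norm_nonneg _)
      (fun n => norm_conv_sub_conv_zero_le (ℓ := ℓ) hfi hA (hp n) y) ?_
    simpa using he.const_mul (‖ℓ‖ * (A * discInt (5 / 4) + ∫ y, ‖f y‖))

theorem regZero_sing {f : Λ → ℝ → Plane → F} (hf : RegZero True f) (h : SuppIn R f) :
    RegZero False (fun l t x => sing ℓ 0 (f l t) x) ∧
    ∀ S, ∃ C : ℝ, ∀ l t x, |t| ≤ S → ‖sing ℓ 0 (f l t) x‖ ≤ C := by
  have hb : ∀ S, ∃ C : ℝ, ∀ l t x, |t| ≤ S → ‖sing ℓ 0 (f l t) x‖ ≤ C := by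
    intro S
    obtain ⟨A, hA0, hA⟩ := hf.exists_bound h S
    obtain ⟨C, hC0, hC⟩ := hf.exists_holder h S
    refine ⟨3 * ‖ℓ‖ * (C * discInt (7 / 4) + A * volume.real (Metric.closedBall (0 : Plane) R) +
      A * volume.real (Metric.ball (0 : Plane) 3)) + ‖singConst ℓ 0‖ * A, fun l t x ht => ?_⟩
    obtain ⟨h1, h2⟩ := integrable_of_support (hf.continuous_space l t) (fun y => hA l t y ht)
      (h l t)
    refine (norm_sing_le h1 (fun y => hA l t y ht) hC0 (fun y z => hC l t y z ht) x).trans ?_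
    gcongr
  refine ⟨⟨fun l => continuous_iff_continuousAt.2 ?_, fun S => ?_, False.elim⟩, hb⟩
  · rintro ⟨t₀, x₀⟩
    obtain ⟨A, hA0, hA⟩ := hf.exists_bound h (|t₀| + 1)
    obtain ⟨C, hC0, hC⟩ := hf.exists_holder h (|t₀| + 1)
    let r := R + ‖x₀‖ + 1
    have near : ∀ᶠ p : ℝ × Plane in 𝓝 (t₀, x₀), |p.1| ≤ |t₀| + 1 ∧ ‖p.2‖ ≤ ‖x₀‖ + 1 := by
      have h1 : ∀ᶠ p : ℝ × Plane in 𝓝 (t₀, x₀), |p.1| < |t₀| + 1 :=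
        (continuous_fst.abs.tendsto (t₀, x₀)).eventually_lt_const (by simp)
      have h2 : ∀ᶠ p : ℝ × Plane in 𝓝 (t₀, x₀), ‖p.2‖ < ‖x₀‖ + 1 :=
        (continuous_snd.norm.tendsto (t₀, x₀)).eventually_lt_const (by simp)
      filter_upwards [h1, h2] with p a b using ⟨a.le, b.le⟩
    have hg : Integrable ((Metric.ball (0 : Plane) (r + 1)).indicator fun _ => A) :=
      (integrable_indicator_iff measurableSet_ball).2 (integrableOn_const measure_ball_lt_top.ne)
    refine ContinuousAt.add ?_ ?_
    · refine continuousAt_of_dominated (F := fun (p : ℝ × Plane) u =>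
        (dkern ℓ 0 u).smulRight (f l p.1 (p.2 - u) - cut u • f l p.1 p.2))
        (bound := fun u => 3 * ‖ℓ‖ * majorant A C
          ((Metric.ball (0 : Plane) (r + 1)).indicator fun _ => A) u) ?_ ?_ ?_ ?_
      · exact Eventually.of_forall fun p => aestronglyMeasurable_smulRight
          measurable_dkern.aestronglyMeasurable
          (continuous_cut_sub (hf.continuous_space l p.1) p.2).aestronglyMeasurable
      · filter_upwards [near] with p hp
        filter_upwards [ae_ne_zero] with u hu
        refine (norm_sing_integrand_le (fun y => hA l p.1 y hp.1) hC0
          (fun y z => hC l p.1 y z hp.1) p.2 hu).trans ?_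
        have : ‖f l p.1 (p.2 - u)‖ ≤ (Metric.ball (0 : Plane) (r + 1)).indicator (fun _ => A) u := by
          by_cases hu : u ∈ Metric.ball (0 : Plane) (r + 1)
          · rw [indicator_of_mem hu]
            exact hA l p.1 _ hp.1
          · rw [indicator_of_notMem hu, h l p.1 (p.2 - u), norm_zero]
            have h1 : r + 1 ≤ ‖u‖ := by simpa using hu
            have h2 := norm_sub_norm_le u p.2
            rw [norm_sub_rev] at h2
            have := hp.2
            simp only [r] at h1
            linarith
        unfold majorant
        gcongr
      · exact (integrable_majorant hg).1.const_mul _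
      · refine Eventually.of_forall fun u => Continuous.continuousAt ?_
        have h1 : Continuous fun p : ℝ × Plane => f l p.1 (p.2 - u) - cut u • f l p.1 p.2 :=
          ((hf.cont l).comp (continuous_fst.prodMk (continuous_snd.sub continuous_const))).sub
            ((hf.cont l).const_smul _)
        exact ((ContinuousLinearMap.smulRightL ℝ Plane F) (dkern ℓ 0 u)).continuous.comp h1
    · exact (((ContinuousLinearMap.smulRightL ℝ Plane F) (singConst ℓ 0)).continuous.comp
        (hf.cont l)).continuousAt
  · obtain ⟨C, hC⟩ := hb S
    exact ⟨C, fun l t x ht _ => hC l t x ht⟩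

theorem SuppIn.hasCompactSupport {f : Λ → ℝ → Plane → F} (h : SuppIn R f) (l t) :
    HasCompactSupport (f l t) :=
  HasCompactSupport.intro (isCompact_closedBall (0 : Plane) R) fun y hy =>
    h l t y (by simpa using hy)

theorem hasFDerivAt_conv_of_holder {f : Λ → ℝ → Plane → F} (hf : RegZero True f) (h : SuppIn R f)
    (l t x) : HasFDerivAt (conv ℓ 0 (f l t)) (sing ℓ 0 (f l t) x) x := by
  obtain ⟨A, hA0, hA⟩ := hf.exists_bound h |t|
  obtain ⟨C, hC0, hC⟩ := hf.exists_holder h |t|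
  exact hasFDerivAt_conv_zero (hf.continuous_space l t) (h.hasCompactSupport l t)
    (fun y => hA l t y le_rfl) hC0 (fun y z => hC l t y z le_rfl) x

/-- The gain of a full derivative: the first `k` derivatives are moved to `f`, and the last one is
the singular integral of a Hölder function. -/
theorem reg_conv_succ {f : Λ → ℝ → Plane → F} (hf : Reg True k f) (h : SuppIn R f) :
    Reg False (k + 1) (fun l t x => conv ℓ 0 (f l t) x) := by
  induction k generalizing F with
  | zero =>
    exact Reg.of_hasFDerivAt (regZero_conv hf h).weaken (hasFDerivAt_conv_of_holder hf h)
      (regZero_sing hf h).1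
  | succ k ih =>
    exact Reg.of_hasFDerivAt (regZero_conv hf.1 h).weaken (hasFDerivAt_conv hf h)
      (ih hf.2.2 h.fderiv)

end SingularIntegral

/-! ### The Biot–Savart law -/

section BiotSavart

variable {Λ : Type} {F G : Type} [NormedAddCommGroup F] [NormedSpace ℝ F] [NormedAddCommGroup G]
  [NormedSpace ℝ G] {H : Prop} {k : ℕ} {R : ℝ}

/-- The coordinate functionals of the plane. -/
def coord (i : Fin 2) : Plane →L[ℝ] ℝ := EuclideanSpace.proj i

theorem coord_apply (i : Fin 2) (x : Plane) : coord i x = x i := rfl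

/-- The standard basis vectors of the plane. -/
def e (i : Fin 2) : Plane := EuclideanSpace.single i (1 : ℝ)

theorem norm_e (i : Fin 2) : ‖e i‖ = 1 := by simp [e]

theorem perp_eq (a : Plane) : perp a = a 1 • e 0 - a 0 • e 1 := by
  ext i
  fin_cases i <;> simp [perp, e]

theorem norm_perp (a : Plane) : ‖perp a‖ = ‖a‖ := by
  simp [perp, EuclideanSpace.norm_eq, Fin.sum_univ_two, add_comm]

theorem inner_perp (a : Plane) : inner ℝ a (perp a) = 0 := by
  simp [perp, PiLp.inner_apply, Fin.sum_univ_two]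
  ring

theorem kernelK_eq (u : Plane) :
    kernelK u = (1 / (2 * Real.pi)) • (kern (coord 1) 0 u • e 0 - kern (coord 0) 0 u • e 1) := by
  rw [kernelK, perp_eq, kern, kern, coord_apply, coord_apply]
  simp only [smul_sub, smul_smul]
  congr 2 <;> field_simp <;> ring

theorem integrable_kern_sub_smul {ℓ : Plane →L[ℝ] ℝ} {A : ℝ} {f : Plane → F} (hA : ∀ y, ‖f y‖ ≤ A)
    (hf : Integrable f) (x : Plane) : Integrable fun y => kern ℓ 0 (x - y) • f y := by
  have := (integrable_kern_smul (ℓ := ℓ) (ε := 0) hA hf x).comp_sub_left x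
  simpa using this

theorem integrable_biotSavart {A : ℝ} {f : Plane → ℝ} (hA : ∀ y, ‖f y‖ ≤ A) (hf : Integrable f)
    (x : Plane) : Integrable fun y => f y • kernelK (x - y) := by
  refine (((((integrable_kern_sub_smul (ℓ := coord 1) hA hf x).smul_const (e 0)).sub
    ((integrable_kern_sub_smul (ℓ := coord 0) hA hf x).smul_const (e 1))).smul
      (1 / (2 * Real.pi)))).congr (Eventually.of_forall fun y => ?_)
  simp only [kernelK_eq, Pi.smul_apply, Pi.sub_apply, smul_sub, smul_smul, smul_eq_mul]
  congr 2 <;> ring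

theorem biotSavart_eq {A : ℝ} {f : Plane → ℝ} (hA : ∀ y, ‖f y‖ ≤ A) (hf : Integrable f)
    (x : Plane) : biotSavart f x = (1 / (2 * Real.pi)) •
      (conv (coord 1) 0 f x • e 0 - conv (coord 0) 0 f x • e 1) := by
  rw [conv_eq, conv_eq, ← integral_smul_const, ← integral_smul_const, ← integral_sub
    ((integrable_kern_sub_smul hA hf x).smul_const _)
    ((integrable_kern_sub_smul hA hf x).smul_const _), ← integral_smul]
  refine integral_congr_ae (Eventually.of_forall fun y => ?_)
  simp only [kernelK_eq, smul_sub, smul_smul, smul_eq_mul]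
  congr 2 <;> ring

theorem biotSavart_add {A B : ℝ} {f g : Plane → ℝ} (hA : ∀ y, ‖f y‖ ≤ A) (hf : Integrable f)
    (hB : ∀ y, ‖g y‖ ≤ B) (hg : Integrable g) (x : Plane) :
    biotSavart (fun y => f y + g y) x = biotSavart f x + biotSavart g x := by
  simp only [biotSavart, add_smul]
  exact integral_add (integrable_biotSavart hA hf x) (integrable_biotSavart hB hg x)

theorem biotSavart_const_mul (c : ℝ) (f : Plane → ℝ) (x : Plane) :
    biotSavart (fun y => c * f y) x = c • biotSavart f x := by
  simp only [biotSavart, mul_smul]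
  exact integral_smul _ _

theorem biotSavart_sub {A B : ℝ} {f g : Plane → ℝ} (hA : ∀ y, ‖f y‖ ≤ A) (hf : Integrable f)
    (hB : ∀ y, ‖g y‖ ≤ B) (hg : Integrable g) (x : Plane) :
    biotSavart (fun y => f y - g y) x = biotSavart f x - biotSavart g x := by
  simp only [biotSavart, sub_smul]
  exact integral_sub (integrable_biotSavart hA hf x) (integrable_biotSavart hB hg x)

/-- The velocity is bounded in terms of the vorticity in `L¹ ∩ L^∞`. -/
theorem exists_norm_biotSavart_le : ∃ C : ℝ, 0 ≤ C ∧ ∀ (A : ℝ) (f : Plane → ℝ),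
    (∀ y, ‖f y‖ ≤ A) → Integrable f → ∀ x, ‖biotSavart f x‖ ≤ C * (A + ∫ y, ‖f y‖) := by
  set D := max (discInt 1) 1
  have hD : 0 ≤ D := le_max_of_le_right zero_le_one
  refine ⟨|1 / (2 * Real.pi)| * ((‖coord 1‖ + ‖coord 0‖) * D), by positivity,
    fun A f hA hf x => ?_⟩
  have hA0 : 0 ≤ A := (norm_nonneg _).trans (hA 0)
  have h0 : 0 ≤ ∫ y, ‖f y‖ := integral_nonneg fun y => norm_nonneg _
  rw [biotSavart_eq hA hf, norm_smul, Real.norm_eq_abs, mul_assoc]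
  have key : ∀ i, ‖conv (coord i) 0 f x‖ ≤ ‖coord i‖ * (D * (A + ∫ y, ‖f y‖)) := fun i => by
    refine (norm_conv_le hA hf x).trans ?_
    have h1 : A * discInt 1 ≤ A * D := by gcongr; exact le_max_left _ _
    have h2 : 1 * (∫ y, ‖f y‖) ≤ D * ∫ y, ‖f y‖ := by gcongr; exact le_max_right _ _
    gcongr
    linarith
  refine mul_le_mul_of_nonneg_left ((norm_sub_le _ _).trans ?_) (abs_nonneg _)
  rw [norm_smul, norm_smul, norm_e, norm_e, mul_one, mul_one]
  calc _ ≤ _ := add_le_add (key 1) (key 0)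
    _ = _ := by ring

/-- Bounds on the space derivatives up to order `k` on the whole plane, locally uniform in time. -/
def GlobBdd : ∀ {F : Type} [NormedAddCommGroup F] [NormedSpace ℝ F], ℕ → (Λ → ℝ → Plane → F) → Prop
  | _, _, _, 0, f => ∀ S, ∃ C : ℝ, ∀ l t x, |t| ≤ S → ‖f l t x‖ ≤ C
  | _, _, _, k + 1, f => (∀ S, ∃ C : ℝ, ∀ l t x, |t| ≤ S → ‖f l t x‖ ≤ C) ∧
      GlobBdd k (fun l t x => fderiv ℝ (f l t) x)

theorem GlobBdd.clm {f : Λ → ℝ → Plane → F} (L : F →L[ℝ] G) (h : GlobBdd k f) (hf : Reg H k f) :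
    GlobBdd k (fun l t x => L (f l t x)) := by
  induction k generalizing F G with
  | zero =>
    intro S
    obtain ⟨C, hC⟩ := h S
    exact ⟨‖L‖ * C, fun l t x ht => (L.le_opNorm _).trans (by gcongr; exact hC l t x ht)⟩
  | succ k ih =>
    refine ⟨fun S => ?_, ?_⟩
    · obtain ⟨C, hC⟩ := h.1 S
      exact ⟨‖L‖ * C, fun l t x ht => (L.le_opNorm _).trans (by gcongr; exact hC l t x ht)⟩
    · have : (fun l t x => fderiv ℝ (fun x => L (f l t x)) x) = fun l t x =>
          (ContinuousLinearMap.compL ℝ Plane F G L) (fderiv ℝ (f l t) x) := by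
        funext l t x
        exact (L.hasFDerivAt.comp x (hf.2.1 l t x).hasFDerivAt).fderiv
      rw [this]
      exact ih _ h.2 hf.2.2

theorem GlobBdd.sub {f g : Λ → ℝ → Plane → F} (h : GlobBdd k f) (hf : Reg H k f)
    (h' : GlobBdd k g) (hg : Reg H k g) : GlobBdd k (fun l t x => f l t x - g l t x) := by
  have key : ∀ {F : Type} [NormedAddCommGroup F] [NormedSpace ℝ F] {f g : Λ → ℝ → Plane → F},
      (∀ S, ∃ C : ℝ, ∀ l t x, |t| ≤ S → ‖f l t x‖ ≤ C) →
      (∀ S, ∃ C : ℝ, ∀ l t x, |t| ≤ S → ‖g l t x‖ ≤ C) →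
      ∀ S, ∃ C : ℝ, ∀ l t x, |t| ≤ S → ‖f l t x - g l t x‖ ≤ C := by
    intro F _ _ f g h h' S
    obtain ⟨C, hC⟩ := h S
    obtain ⟨D, hD⟩ := h' S
    exact ⟨C + D, fun l t x ht => (norm_sub_le _ _).trans (add_le_add (hC l t x ht) (hD l t x ht))⟩
  induction k generalizing F with
  | zero => exact key h h'
  | succ k ih =>
    refine ⟨key h.1 h'.1, ?_⟩
    have : (fun l t x => fderiv ℝ (fun x => f l t x - g l t x) x) = fun l t x =>
        fderiv ℝ (f l t) x - fderiv ℝ (g l t) x := by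
      funext l t x
      exact fderiv_fun_sub (hf.2.1 l t x) (hg.2.1 l t x)
    rw [this]
    exact ih h.2 hf.2.2 h'.2 hg.2.2

theorem globBdd_conv_succ [CompleteSpace F] {ℓ : Plane →L[ℝ] ℝ} {f : Λ → ℝ → Plane → F}
    (hf : Reg True k f) (h : SuppIn R f) :
    GlobBdd (k + 1) (fun l t x => conv ℓ 0 (f l t) x) := by
  have h0 : ∀ {F : Type} [NormedAddCommGroup F] [NormedSpace ℝ F] {f : Λ → ℝ → Plane → F}
      (_ : RegZero False f) (_ : SuppIn R f), ∀ S, ∃ C : ℝ, ∀ l t x, |t| ≤ S →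
        ‖conv ℓ 0 (f l t) x‖ ≤ C := fun hf h S =>
    let ⟨C, _, hC⟩ := hf.exists_bound_conv h S
    ⟨C, hC⟩
  induction k generalizing F with
  | zero =>
    refine ⟨h0 hf.regZero h, ?_⟩
    have : (fun l t x => fderiv ℝ (fun x => conv ℓ 0 (f l t) x) x) = fun l t x =>
        sing ℓ 0 (f l t) x := by
      funext l t x
      exact (hasFDerivAt_conv_of_holder hf h l t x).fderiv
    rw [this]
    exact (regZero_sing hf h).2
  | succ k ih =>
    refine ⟨h0 hf.regZero h, ?_⟩
    have : (fun l t x => fderiv ℝ (fun x => conv ℓ 0 (f l t) x) x) = fun l t x =>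
        conv ℓ 0 (fun y => fderiv ℝ (f l t) y) x := by
      funext l t x
      exact (hasFDerivAt_conv hf h l t x).fderiv
    rw [this]
    exact ih hf.2.2 h.fderiv

theorem biotSavart_family_eq {f : Λ → ℝ → Plane → ℝ} (hf : RegZero H f) (h : SuppIn R f) :
    (fun l t x => biotSavart (f l t) x) = fun l t x =>
      ((1 / (2 * Real.pi)) • ContinuousLinearMap.toSpanSingleton ℝ (e 0)) (conv (coord 1) 0 (f l t) x)
      - ((1 / (2 * Real.pi)) • ContinuousLinearMap.toSpanSingleton ℝ (e 1))
        (conv (coord 0) 0 (f l t) x) := by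
  funext l t x
  obtain ⟨A, hA0, hA⟩ := hf.exists_bound h |t|
  rw [biotSavart_eq (fun y => hA l t y le_rfl)
    (integrable_of_support (hf.continuous_space l t) (fun y => hA l t y le_rfl) (h l t)).1,
    smul_sub]
  rfl

theorem reg_biotSavart {f : Λ → ℝ → Plane → ℝ} (hf : Reg H k f) (h : SuppIn R f) :
    Reg True k (fun l t x => biotSavart (f l t) x) := by
  rw [biotSavart_family_eq hf.regZero h]
  exact ((reg_conv hf h).clm _).sub ((reg_conv hf h).clm _)

/-- This gains a derivative and loses the Hölder flag, while `reg_biotSavart` gains the flag at the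
same order. Alternating the two raises the regularity of a transported vorticity. -/
theorem reg_biotSavart_succ {f : Λ → ℝ → Plane → ℝ} (hf : Reg True k f) (h : SuppIn R f) :
    Reg False (k + 1) (fun l t x => biotSavart (f l t) x) := by
  rw [biotSavart_family_eq hf.regZero h]
  exact ((reg_conv_succ hf h).clm _).sub ((reg_conv_succ hf h).clm _)

theorem globBdd_biotSavart {f : Λ → ℝ → Plane → ℝ} (hf : Reg True k f) (h : SuppIn R f) :
    GlobBdd (k + 1) (fun l t x => biotSavart (f l t) x) := by
  rw [biotSavart_family_eq hf.regZero h]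
  exact ((globBdd_conv_succ hf h).clm _ (reg_conv_succ hf h)).sub ((reg_conv_succ hf h).clm _)
    ((globBdd_conv_succ hf h).clm _ (reg_conv_succ hf h)) ((reg_conv_succ hf h).clm _)

theorem norm_kernelK (u : Plane) : ‖kernelK u‖ = 1 / (2 * Real.pi) * ‖u‖⁻¹ := by
  rcases eq_or_ne u 0 with rfl | hu
  · simp [kernelK, perp]
  have : 0 < ‖u‖ := norm_pos_iff.2 hu
  rw [kernelK, norm_smul, norm_perp, Real.norm_of_nonneg (by positivity)]
  field_simp

theorem perp_sub (a b : Plane) : perp (a - b) = perp a - perp b := by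
  simp only [perp_eq, PiLp.sub_apply, sub_smul]
  abel

theorem perp_smul (c : ℝ) (a : Plane) : perp (c • a) = c • perp a := by
  simp only [perp_eq, PiLp.smul_apply, smul_sub, smul_smul, smul_eq_mul]

/-- Up to a rotation and a factor, `kernelK` is the inversion in the unit circle, whose distance
formula is exact. -/
theorem norm_kernelK_sub {a b : Plane} (ha : a ≠ 0) (hb : b ≠ 0) :
    ‖kernelK a - kernelK b‖ = 1 / (2 * Real.pi) * (‖a - b‖ / (‖a‖ * ‖b‖)) := by
  have ha' : 0 < ‖a‖ := norm_pos_iff.2 ha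
  have hb' : 0 < ‖b‖ := norm_pos_iff.2 hb
  have e : ∀ c : Plane, kernelK c = (1 / (2 * Real.pi)) • perp ((1 / ‖c‖) ^ 2 • c) := fun c => by
    rw [perp_smul, smul_smul, kernelK]
    congr 1
    ring
  have h1 := dist_div_norm_sq_smul ha hb 1
  rw [dist_eq_norm, dist_eq_norm] at h1
  rw [e, e, ← smul_sub, ← perp_sub, norm_smul, norm_perp, h1, Real.norm_of_nonneg (by positivity)]
  ring

/-- Far vorticity induces a small velocity. -/
theorem norm_biotSavart_far_le {r : ℝ} (hr : 0 < r) {f : Plane → ℝ} (hf : Integrable f) {x : Plane}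
    (hx : ∀ y, ‖x - y‖ < r → f y = 0) : ‖biotSavart f x‖ ≤ r⁻¹ * ∫ y, ‖f y‖ := by
  rw [← integral_const_mul]
  refine norm_integral_le_of_norm_le (hf.norm.const_mul _) (Eventually.of_forall fun y => ?_)
  rw [norm_smul]
  by_cases h : ‖x - y‖ < r
  · simp [hx y h]
  · rw [mul_comm, norm_kernelK]
    rw [not_lt] at h
    gcongr
    have h2 : 1 / (2 * Real.pi) ≤ 1 := by
      rw [div_le_one (by positivity)]
      linarith [Real.pi_gt_three]
    calc 1 / (2 * Real.pi) * ‖x - y‖⁻¹ ≤ 1 * r⁻¹ := by gcongr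
      _ = _ := one_mul _

/-- The velocity of far vorticity is Lipschitz. -/
theorem norm_biotSavart_far_sub_le {r A : ℝ} (hr : 0 < r) {f : Plane → ℝ} (hf : Integrable f)
    (hA : ∀ y, ‖f y‖ ≤ A) {x x' : Plane} (hx : ∀ y, ‖x - y‖ < r → f y = 0)
    (hx' : ∀ y, ‖x' - y‖ < r → f y = 0) :
    ‖biotSavart f x - biotSavart f x'‖ ≤ (r ^ 2)⁻¹ * (∫ y, ‖f y‖) * ‖x - x'‖ := by
  rw [biotSavart, biotSavart,
    ← integral_sub (integrable_biotSavart hA hf x) (integrable_biotSavart hA hf x'),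
    mul_right_comm, ← integral_const_mul]
  refine norm_integral_le_of_norm_le (hf.norm.const_mul _) (Eventually.of_forall fun y => ?_)
  rw [← smul_sub, norm_smul]
  by_cases h : ‖x - y‖ < r
  · simp [hx y h]
  by_cases h' : ‖x' - y‖ < r
  · simp [hx' y h']
  rw [not_lt] at h h'
  rw [mul_comm, norm_kernelK_sub (norm_pos_iff.1 (hr.trans_le h)) (norm_pos_iff.1 (hr.trans_le h')),
    sub_sub_sub_cancel_right]
  refine mul_le_mul_of_nonneg_right ?_ (norm_nonneg _)
  have h2 : 1 / (2 * Real.pi) ≤ 1 := by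
    rw [div_le_one (by positivity)]
    linarith [Real.pi_gt_three]
  calc _ ≤ 1 * (‖x - x'‖ / (r * r)) := by gcongr
    _ = _ := by field_simp

end BiotSavart

/-! ### Morrey's inequality -/

section Morrey

variable {F : Type} [NormedAddCommGroup F] [NormedSpace ℝ F] [CompleteSpace F]

/-- Scaling in dimension two at exponent four: the factor is `s^{-2/4}`. -/
theorem eLpNorm_comp_add_smul {g : Plane → F} (hg : Continuous g) (x : Plane) {s : ℝ} (hs : 0 < s) :
    eLpNorm (fun u => g (x + s • u)) 4 volume =
      ENNReal.ofReal (s ^ (-(1 / 2) : ℝ)) * eLpNorm g 4 volume := by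
  have h1 : eLpNorm (fun v => g (x + v)) 4 volume = eLpNorm g 4 volume :=
    eLpNorm_comp_measurePreserving hg.aestronglyMeasurable (measurePreserving_add_left volume x)
  have h2 := eLpNorm_map_measure (p := 4) (μ := (volume : Measure Plane)) (f := fun u => s • u)
    (g := fun v => g (x + v)) (hg.comp (continuous_const.add continuous_id)).aestronglyMeasurable
    (by fun_prop)
  rw [show (fun u => g (x + s • u)) = (fun v => g (x + v)) ∘ fun u => s • u from rfl, ← h2,
    Measure.map_addHaar_smul _ hs.ne', eLpNorm_smul_measure_of_ne_top (by simp), h1, smul_eq_mul]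
  congr 1
  rw [finrank_euclideanSpace, Fintype.card_fin, abs_of_nonneg (by positivity),
    ENNReal.ofReal_rpow_of_nonneg (by positivity) (by positivity)]
  congr 1
  rw [← Real.rpow_natCast, ← Real.rpow_neg hs.le, ← Real.rpow_mul hs.le]
  norm_num

/-- The difference is integrated along the ray from `x`. At ray parameter `s`, Hölder's inequality
on the ball and scaling cost `s^{-1/2}`, which is integrable on `(0, 1]` because the exponent four
exceeds the dimension. -/
theorem lintegral_ball_sub_le {h : Plane → F} (hh : ContDiff ℝ 1 h) (x : Plane) (r : ℝ) :
    ∫⁻ u in Metric.ball (0 : Plane) r, ‖h (x + u) - h x‖ₑ ≤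
      ENNReal.ofReal r * (volume (Metric.ball (0 : Plane) r)) ^ (3 / 4 : ℝ) *
        (∫⁻ s in Ioc (0 : ℝ) 1, ENNReal.ofReal (s ^ (-(1 / 2) : ℝ))) *
        eLpNorm (fderiv ℝ h) 4 volume := by
  have hd : Continuous (fderiv ℝ h) := hh.continuous_fderiv one_ne_zero
  have hpt : ∀ u ∈ Metric.ball (0 : Plane) r, ‖h (x + u) - h x‖ₑ ≤
      ∫⁻ s in Ioc (0 : ℝ) 1, ENNReal.ofReal r * ‖fderiv ℝ h (x + s • u)‖ₑ := by
    intro u hu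
    have hder : ∀ s : ℝ, HasDerivAt (fun s : ℝ => h (x + s • u)) (fderiv ℝ h (x + s • u) u) s := by
      intro s
      have h1 : HasDerivAt (fun s : ℝ => x + s • u) u s := by
        simpa using ((hasDerivAt_id s).smul_const u).const_add x
      exact ((hh.differentiable one_ne_zero (x + s • u)).hasFDerivAt).comp_hasDerivAt s h1
    have hcont : Continuous fun s : ℝ => fderiv ℝ h (x + s • u) u :=
      (hd.comp (by fun_prop)).clm_apply continuous_const
    have hInt : ∫ s in (0 : ℝ)..1, fderiv ℝ h (x + s • u) u = h (x + u) - h x := by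
      have := intervalIntegral.integral_eq_sub_of_hasDerivAt (a := 0) (b := 1)
        (fun s _ => hder s) (hcont.intervalIntegrable 0 1)
      simpa using this
    rw [← hInt, intervalIntegral.integral_of_le zero_le_one]
    refine (enorm_integral_le_lintegral_enorm _).trans (lintegral_mono fun s => ?_)
    have hu' : ‖u‖ ≤ r := by
      rw [mem_ball_zero_iff] at hu
      exact hu.le
    calc ‖fderiv ℝ h (x + s • u) u‖ₑ ≤ ‖fderiv ℝ h (x + s • u)‖ₑ * ‖u‖ₑ :=
          (fderiv ℝ h (x + s • u)).le_opENorm u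
      _ ≤ ‖fderiv ℝ h (x + s • u)‖ₑ * ENNReal.ofReal r := by
          gcongr
          rw [← ofReal_norm]
          exact ENNReal.ofReal_le_ofReal hu'
      _ = _ := mul_comm _ _
  have hm : Continuous fun p : Plane × ℝ => ENNReal.ofReal r * ‖fderiv ℝ h (x + p.2 • p.1)‖ₑ :=
    (ENNReal.continuous_const_mul ENNReal.ofReal_ne_top).comp
      ((hd.comp (by fun_prop)).enorm)
  have hm1 : ∀ s : ℝ, Continuous fun u : Plane => fderiv ℝ h (x + s • u) := fun s =>
    hd.comp (by fun_prop)
  calc _ ≤ ∫⁻ u in Metric.ball (0 : Plane) r, ∫⁻ s in Ioc (0 : ℝ) 1,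
        ENNReal.ofReal r * ‖fderiv ℝ h (x + s • u)‖ₑ :=
        setLIntegral_mono' measurableSet_ball hpt
    _ = ∫⁻ s in Ioc (0 : ℝ) 1, ∫⁻ u in Metric.ball (0 : Plane) r,
        ENNReal.ofReal r * ‖fderiv ℝ h (x + s • u)‖ₑ :=
        lintegral_lintegral_swap hm.measurable.aemeasurable
    _ ≤ ∫⁻ s in Ioc (0 : ℝ) 1, ENNReal.ofReal (s ^ (-(1 / 2) : ℝ)) * (ENNReal.ofReal r *
        (volume (Metric.ball (0 : Plane) r)) ^ (3 / 4 : ℝ) * eLpNorm (fderiv ℝ h) 4 volume) := by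
        refine setLIntegral_mono' measurableSet_Ioc fun s hs => ?_
        rw [lintegral_const_mul _ (hm1 s).enorm.measurable]
        have h1 := eLpNorm_le_eLpNorm_mul_rpow_measure_univ
          (μ := volume.restrict (Metric.ball (0 : Plane) r)) (p := 1) (q := 4) (by norm_num)
          (hm1 s).aestronglyMeasurable
        rw [eLpNorm_one_eq_lintegral_enorm, Measure.restrict_apply_univ] at h1
        have h2 : eLpNorm (fun u => fderiv ℝ h (x + s • u)) 4
            (volume.restrict (Metric.ball (0 : Plane) r)) ≤ _ :=
          (eLpNorm_mono_measure _ Measure.restrict_le_self).trans_eq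
            (eLpNorm_comp_add_smul hd x hs.1)
        have e : (1 / (1 : ℝ≥0∞).toReal - 1 / (4 : ℝ≥0∞).toReal) = (3 / 4 : ℝ) := by norm_num
        rw [e] at h1
        calc _ ≤ ENNReal.ofReal r * (ENNReal.ofReal (s ^ (-(1 / 2) : ℝ)) *
              eLpNorm (fderiv ℝ h) 4 volume *
              (volume (Metric.ball (0 : Plane) r)) ^ (3 / 4 : ℝ)) := by
              gcongr
              exact h1.trans (by gcongr)
          _ = _ := by ring
    _ = _ := by
        rw [lintegral_mul_const _ (by fun_prop)]
        ring

/-- Morrey's inequality. -/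
theorem morrey : ∃ C : ℝ, 0 ≤ C ∧ ∀ h : Plane → F, ContDiff ℝ 1 h → ∀ N : ℝ, 0 ≤ N →
    eLpNorm (fun x => ‖fderiv ℝ h x‖) 4 volume ≤ ENNReal.ofReal N → ∀ x y,
    ‖h x - h y‖ ≤ C * N * √‖x - y‖ := by
  have hfin : ∫⁻ s in Ioc (0 : ℝ) 1, ENNReal.ofReal (s ^ (-(1 / 2) : ℝ)) ≠ ∞ := by
    have h1 : IntegrableOn (fun s : ℝ => s ^ (-(1 / 2) : ℝ)) (Ioc 0 1) := by
      rw [← intervalIntegrable_iff_integrableOn_Ioc_of_le zero_le_one]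
      exact intervalIntegral.intervalIntegrable_rpow' (by norm_num)
    exact h1.lintegral_lt_top.ne
  obtain ⟨c, hc⟩ : ∃ c : ℝ≥0, ∫⁻ s in Ioc (0 : ℝ) 1, ENNReal.ofReal (s ^ (-(1 / 2) : ℝ)) = c :=
    ⟨_, (ENNReal.coe_toNNReal hfin).symm⟩
  -- The quotient of `2 r (π r²)^{3/4} c N`, the bound from the two balls of radius `r`, and `π
  -- (r/2)²`, the area of the ball around the midpoint.
  refine ⟨8 * Real.pi ^ (-(1 / 4) : ℝ) * c, by positivity, fun h hh N hN hle x y => ?_⟩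
  rw [eLpNorm_norm] at hle
  rcases eq_or_ne x y with rfl | hxy
  · simp
  set r := ‖x - y‖ with hr
  have hr0 : 0 < r := norm_pos_iff.2 (sub_ne_zero.2 hxy)
  have hvol : ∀ (p : Plane) (ρ : ℝ), 0 ≤ ρ →
      volume (Metric.ball p ρ) = ENNReal.ofReal (Real.pi * ρ ^ 2) := fun p ρ hρ => by
    rw [EuclideanSpace.volume_ball_fin_two, mul_comm Real.pi, ENNReal.ofReal_mul (by positivity),
      ENNReal.ofReal_pow hρ]
  have hball : ∀ p : Plane, ∫⁻ q in Metric.ball p r, ‖h q - h p‖ₑ ≤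
      ENNReal.ofReal (r * (Real.pi * r ^ 2) ^ (3 / 4 : ℝ) * c * N) := fun p => by
    have h1 : ∫⁻ q in Metric.ball p r, ‖h q - h p‖ₑ =
        ∫⁻ u in Metric.ball (0 : Plane) r, ‖h (p + u) - h p‖ₑ := by
      have := (measurePreserving_add_left (volume : Measure Plane) p).setLIntegral_comp_preimage
        (s := Metric.ball p r) measurableSet_ball (f := fun q => ‖h q - h p‖ₑ)
        (hh.continuous.sub continuous_const).enorm.measurable
      rw [← this]
      congr 2
      ext u
      simp
    rw [h1]
    refine (lintegral_ball_sub_le hh p r).trans ?_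
    rw [hc, hvol _ _ hr0.le, ENNReal.ofReal_rpow_of_nonneg (by positivity) (by norm_num),
      ENNReal.ofReal_mul (by positivity), ENNReal.ofReal_mul (by positivity),
      ENNReal.ofReal_mul (by positivity), ENNReal.ofReal_coe_nnreal]
    gcongr
  -- The ball of radius `r / 2` around the midpoint lies in both balls of radius `r`; averaging over
  -- it compares `h x` with `h y`.
  set m := midpoint ℝ x y with hm
  have hmx : dist m x = r / 2 := by
    rw [hm, dist_midpoint_left, dist_eq_norm]
    norm_num
    ring
  have hmy : dist m y = r / 2 := by
    rw [hm, dist_midpoint_right, dist_eq_norm]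
    norm_num
    ring
  have key : ENNReal.ofReal (‖h x - h y‖ * (Real.pi * (r / 2) ^ 2)) ≤
      ENNReal.ofReal (2 * (r * (Real.pi * r ^ 2) ^ (3 / 4 : ℝ) * c * N)) := by
    calc _ = ‖h x - h y‖ₑ * volume (Metric.ball m (r / 2)) := by
          rw [hvol _ _ (by positivity), ENNReal.ofReal_mul (norm_nonneg _), ofReal_norm]
      _ = ∫⁻ q in Metric.ball m (r / 2), ‖h x - h y‖ₑ := by
          rw [lintegral_const, Measure.restrict_apply_univ]
      _ ≤ ∫⁻ q in Metric.ball m (r / 2), (‖h q - h x‖ₑ + ‖h q - h y‖ₑ) := by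
          refine lintegral_mono fun q => ?_
          have e : h x - h y = (h q - h y) - (h q - h x) := by abel
          rw [e, add_comm]
          exact enorm_sub_le
      _ = (∫⁻ q in Metric.ball m (r / 2), ‖h q - h x‖ₑ) +
          ∫⁻ q in Metric.ball m (r / 2), ‖h q - h y‖ₑ :=
          lintegral_add_left (hh.continuous.sub continuous_const).enorm.measurable _
      _ ≤ (∫⁻ q in Metric.ball x r, ‖h q - h x‖ₑ) + ∫⁻ q in Metric.ball y r, ‖h q - h y‖ₑ := by
          gcongr
          · exact Metric.ball_subset_ball' (by rw [hmx]; linarith)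
          · exact Metric.ball_subset_ball' (by rw [hmy]; linarith)
      _ ≤ _ := by
          rw [two_mul, ENNReal.ofReal_add (by positivity) (by positivity)]
          exact add_le_add (hball x) (hball y)
  rw [ENNReal.ofReal_le_ofReal_iff (by positivity)] at key
  have e1 : (Real.pi * r ^ 2) ^ (3 / 4 : ℝ) =
      Real.pi * Real.pi ^ (-(1 / 4) : ℝ) * (r * √r) := by
    rw [Real.mul_rpow (by positivity) (by positivity)]
    congr 1
    · rw [← Real.rpow_one_add' (by positivity) (by norm_num)]
      norm_num
    · rw [Real.sqrt_eq_rpow, ← Real.rpow_one_add' hr0.le (by norm_num), ← Real.rpow_natCast,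
        ← Real.rpow_mul hr0.le]
      norm_num
  rw [e1] at key
  have hp : 0 < Real.pi * (r / 2) ^ 2 := by positivity
  refine le_of_mul_le_mul_right (key.trans_eq ?_) hp
  ring

theorem eLpNorm_le_of_support {h : Plane → F} {A R : ℝ} (hA : ∀ x, ‖h x‖ ≤ A)
    (hR : ∀ x, R < ‖x‖ → h x = 0) (p : ℝ≥0∞) :
    eLpNorm h p volume ≤ volume (Metric.closedBall (0 : Plane) R) ^ p.toReal⁻¹ *
      ENNReal.ofReal A := by
  have h1 : eLpNorm h p volume = eLpNorm h p (volume.restrict (Metric.closedBall (0 : Plane) R)) :=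
    by
    rw [← eLpNorm_indicator_eq_eLpNorm_restrict Metric.isClosed_closedBall.measurableSet]
    congr 1
    refine (indicator_eq_self.2 fun x hx => ?_).symm
    by_contra hn
    exact hx (hR x (by simpa using hn))
  rw [h1]
  refine (eLpNorm_le_of_ae_bound (Eventually.of_forall hA)).trans_eq ?_
  rw [Measure.restrict_apply_univ]

end Morrey

/-! ### Mollification -/

section Mollify

/-- Convolution of `f` with `φ`. -/
def mollify (φ f : Plane → ℝ) : Plane → ℝ :=
  convolution φ f (ContinuousLinearMap.lsmul ℝ ℝ) volume

variable {φ f g : Plane → ℝ}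

theorem mollify_apply (x : Plane) : mollify φ f x = ∫ u, φ u * f (x - u) := rfl

theorem mollify_eq_swap (x : Plane) : mollify φ f x = ∫ y, φ (x - y) * f y :=
  convolution_lsmul_swap (𝕜 := ℝ)

theorem contDiff_mollify (hφ : ContDiff ℝ (⊤ : ℕ∞) φ) (hc : HasCompactSupport φ)
    (hf : LocallyIntegrable f) : ContDiff ℝ (⊤ : ℕ∞) (mollify φ f) :=
  hc.contDiff_convolution_left _ hφ hf

theorem integrable_mollify (hφ : Continuous φ) (hc : HasCompactSupport φ)
    (hf : LocallyIntegrable f) (x : Plane) : Integrable fun u => φ u * f (x - u) :=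
  (hc.convolutionExists_left (ContinuousLinearMap.lsmul ℝ ℝ) hφ hf x).integrable

theorem fderiv_mollify (hφ : ContDiff ℝ 1 φ) (hc : HasCompactSupport φ)
    (hf : LocallyIntegrable f) (x v : Plane) :
    fderiv ℝ (mollify φ f) x v = mollify (fun y => fderiv ℝ φ y v) f x := by
  have h1 := hc.hasFDerivAt_convolution_left (ContinuousLinearMap.lsmul ℝ ℝ (E := ℝ)) hφ hf x
  have h2 := ((hc.fderiv ℝ).convolutionExists_left
    (ContinuousLinearMap.precompL Plane (ContinuousLinearMap.lsmul ℝ ℝ (E := ℝ)))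
    (hφ.continuous_fderiv one_ne_zero) hf x).integrable
  unfold mollify
  rw [h1.fderiv, convolution, ContinuousLinearMap.integral_apply h2]
  rfl

theorem iteratedFDeriv_succ_apply_last {n : ℕ} {F : Type} [NormedAddCommGroup F] [NormedSpace ℝ F]
    {f : Plane → F} (hf : ContDiff ℝ (⊤ : ℕ∞) f)
    (x : Plane) (m : Fin (n + 1) → Plane) : iteratedFDeriv ℝ (n + 1) f x m =
      iteratedFDeriv ℝ n (fun y => fderiv ℝ f y (m (Fin.last n))) x (Fin.init m) := by
  rw [iteratedFDeriv_succ_apply_right]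
  have h1 : ContDiff ℝ (⊤ : ℕ∞) (fun y => fderiv ℝ f y) := hf.fderiv_right (by simp)
  exact (iteratedFDeriv_clm_apply_const_apply h1 (by exact_mod_cast le_top)).symm

theorem contDiff_fderiv_apply {F : Type} [NormedAddCommGroup F] [NormedSpace ℝ F]
    {f : Plane → F} (hf : ContDiff ℝ (⊤ : ℕ∞) f) (v : Plane) :
    ContDiff ℝ (⊤ : ℕ∞) (fun y => fderiv ℝ f y v) :=
  (hf.fderiv_right (m := (⊤ : ℕ∞)) (by simp)).clm_apply contDiff_const

theorem hasCompactSupport_fderiv_apply {F : Type} [NormedAddCommGroup F] [NormedSpace ℝ F]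
    {f : Plane → F} (hf : HasCompactSupport f) (v : Plane) :
    HasCompactSupport (fun y => fderiv ℝ f y v) :=
  hf.fderiv_apply ℝ v

theorem iteratedFDeriv_mollify {n : ℕ} (hφ : ContDiff ℝ (⊤ : ℕ∞) φ) (hc : HasCompactSupport φ)
    (hf : LocallyIntegrable f) (x : Plane) (m : Fin n → Plane) :
    iteratedFDeriv ℝ n (mollify φ f) x m = mollify (fun y => iteratedFDeriv ℝ n φ y m) f x := by
  induction n generalizing φ with
  | zero => simp
  | succ n ih =>
    rw [iteratedFDeriv_succ_apply_last (contDiff_mollify hφ hc hf)]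
    have h1 : (fun y => fderiv ℝ (mollify φ f) y (m (Fin.last n))) =
        mollify (fun y => fderiv ℝ φ y (m (Fin.last n))) f :=
      funext fun y => fderiv_mollify (hφ.of_le (by exact_mod_cast le_top)) hc hf y _
    rw [h1, ih (contDiff_fderiv_apply hφ _) (hasCompactSupport_fderiv_apply hc _)]
    congr 1
    funext y
    rw [iteratedFDeriv_succ_apply_last hφ]

theorem iteratedFDeriv_comp_const_sub {n : ℕ} (hφ : ContDiff ℝ (⊤ : ℕ∞) φ) (x y : Plane)
    (m : Fin n → Plane) : iteratedFDeriv ℝ n (fun y => φ (x - y)) y m =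
      (-1) ^ n * iteratedFDeriv ℝ n φ (x - y) m := by
  induction n generalizing φ with
  | zero => simp
  | succ n ih =>
    have h0 : ContDiff ℝ (⊤ : ℕ∞) fun y => φ (x - y) := hφ.comp (contDiff_const.sub contDiff_id)
    rw [iteratedFDeriv_succ_apply_last h0, iteratedFDeriv_succ_apply_last hφ]
    have h1 : (fun y => fderiv ℝ (fun y => φ (x - y)) y (m (Fin.last n))) =
        -(fun y => (fun z => fderiv ℝ φ z (m (Fin.last n))) (x - y)) := by
      funext y
      have h2 : HasFDerivAt (fun y => x - y) (-ContinuousLinearMap.id ℝ Plane) y :=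
        (hasFDerivAt_id y).const_sub x
      have h3 := ((hφ.differentiable (by simp)) (x - y)).hasFDerivAt.comp y h2
      have h4 : fderiv ℝ (fun y => φ (x - y)) y = _ := h3.fderiv
      rw [h4]
      simp
    rw [h1, iteratedFDeriv_neg_apply, neg_apply, ih (contDiff_fderiv_apply hφ _)]
    ring

/-- The weak derivative is tested with `y ↦ φ(x - y)`. The sign from the reflection and the sign in
the definition of the weak derivative cancel. -/
theorem iteratedFDeriv_mollify_of_hasWeakDeriv {n : ℕ} (hφ : ContDiff ℝ (⊤ : ℕ∞) φ)
    (hc : HasCompactSupport φ) {α : Fin n → Fin 2} (h : HasWeakDeriv α f g) (x : Plane) :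
    iteratedFDeriv ℝ n (mollify φ f) x (fun j => e (α j)) = mollify φ g x := by
  rw [iteratedFDeriv_mollify hφ hc h.1, mollify_eq_swap, mollify_eq_swap]
  have h0 : ContDiff ℝ (⊤ : ℕ∞) fun y => φ (x - y) := hφ.comp (contDiff_const.sub contDiff_id)
  have hc0 : HasCompactSupport fun y => φ (x - y) :=
    hc.comp_homeomorph (Homeomorph.subLeft x)
  have h1 := h.2.2 _ h0 hc0
  have e1 : ∀ y, iteratedFDeriv ℝ n φ (x - y) (fun j => e (α j)) * f y = (-1) ^ n *
      (iteratedFDeriv ℝ n (fun y => φ (x - y)) y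
        (fun j => EuclideanSpace.single (α j) (1 : ℝ)) • f y) := fun y => by
    have := iteratedFDeriv_comp_const_sub hφ x y (fun j => e (α j))
    have h' : iteratedFDeriv ℝ n (fun y => φ (x - y)) y
        (fun j => EuclideanSpace.single (α j) (1 : ℝ)) = _ := this
    rw [h', smul_eq_mul, ← mul_assoc, ← mul_assoc, ← pow_add, ← two_mul]
    simp
  rw [integral_congr_ae (Eventually.of_forall e1), integral_const_mul, h1, smul_eq_mul, ← mul_assoc,
    ← pow_add, ← two_mul]
  simp

/-- Mollification does not increase the `L⁴` norm. -/
theorem eLpNorm_mollify_le (hφ : Continuous φ) (h0 : ∀ u, 0 ≤ φ u) (h1 : ∫ u, φ u = 1)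
    (hg : AEStronglyMeasurable g) : eLpNorm (mollify φ g) 4 volume ≤ eLpNorm g 4 volume := by
  have hφi : Integrable φ := integrable_of_integral_eq_one h1
  have hl : ∫⁻ u, ENNReal.ofReal (φ u) = 1 := by
    rw [← ofReal_integral_eq_lintegral_ofReal hφi (Eventually.of_forall h0), h1, ENNReal.ofReal_one]
  have hm : Measurable fun u => ENNReal.ofReal (φ u) := hφ.measurable.ennreal_ofReal
  -- The mollification is an average with respect to the probability measure `φ du`, so its modulus
  -- is bounded by the `L⁴` mean of the translates; integrating in `x` finishes by Tonelli and
  -- translation invariance.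
  set μ := (volume : Measure Plane).withDensity fun u => ENNReal.ofReal (φ u) with hμ
  have : IsProbabilityMeasure μ := ⟨by rw [hμ, withDensity_apply _ MeasurableSet.univ]; simpa⟩
  have hgx : ∀ x, AEStronglyMeasurable (fun u => g (x - u)) volume := fun x =>
    hg.comp_measurePreserving (Measure.measurePreserving_sub_left volume x)
  have hpt : ∀ x, ‖mollify φ g x‖ₑ ^ (4 : ℝ) ≤ ∫⁻ u, ENNReal.ofReal (φ u) * ‖g (x - u)‖ₑ ^ (4 : ℝ) :=
    by
    intro x
    have hac : AEStronglyMeasurable (fun u => g (x - u)) μ :=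
      (hgx x).mono_ac (withDensity_absolutelyContinuous _ _)
    have a1 : ‖mollify φ g x‖ₑ ≤ eLpNorm (fun u => g (x - u)) 1 μ := by
      rw [eLpNorm_one_eq_lintegral_enorm, hμ, lintegral_withDensity_eq_lintegral_mul₀
        hm.aemeasurable (hgx x).enorm]
      refine (enorm_integral_le_lintegral_enorm _).trans (lintegral_mono fun u => ?_)
      simp only [ContinuousLinearMap.lsmul_apply, Pi.mul_apply, enorm_smul]
      rw [Real.enorm_of_nonneg (h0 u)]
    have a2 := a1.trans (eLpNorm_le_eLpNorm_of_exponent_le (p := 1) (q := 4) (by norm_num) hac)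
    rw [eLpNorm_eq_lintegral_rpow_enorm_toReal (by norm_num) (by norm_num)] at a2
    have a3 := ENNReal.rpow_le_rpow a2 (z := 4) (by norm_num)
    rw [← ENNReal.rpow_mul] at a3
    norm_num at a3
    norm_num
    refine a3.trans_eq ?_
    rw [hμ, lintegral_withDensity_eq_lintegral_mul₀ hm.aemeasurable ((hgx x).enorm.pow_const 4)]
    rfl
  have hsw : AEMeasurable (fun p : Plane × Plane => ENNReal.ofReal (φ p.2) *
      ‖g (p.1 - p.2)‖ₑ ^ (4 : ℝ)) (volume.prod volume) := by
    have : AEStronglyMeasurable (fun p : Plane × Plane => g (p.1 - p.2)) (volume.prod volume) :=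
      hg.comp_quasiMeasurePreserving (quasiMeasurePreserving_sub volume volume)
    exact (hm.comp measurable_snd).aemeasurable.mul (this.enorm.pow_const _)
  rw [eLpNorm_eq_lintegral_rpow_enorm_toReal (by norm_num) (by norm_num),
    eLpNorm_eq_lintegral_rpow_enorm_toReal (by norm_num) (by norm_num)]
  refine ENNReal.rpow_le_rpow ?_ (by positivity)
  have e4 : (4 : ℝ≥0∞).toReal = 4 := by norm_num
  rw [e4]
  calc _ ≤ ∫⁻ x, ∫⁻ u, ENNReal.ofReal (φ u) * ‖g (x - u)‖ₑ ^ (4 : ℝ) := lintegral_mono hpt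
    _ = ∫⁻ u, ∫⁻ x, ENNReal.ofReal (φ u) * ‖g (x - u)‖ₑ ^ (4 : ℝ) := lintegral_lintegral_swap hsw
    _ = ∫⁻ u, ENNReal.ofReal (φ u) * ∫⁻ x, ‖g x‖ₑ ^ (4 : ℝ) := by
        refine lintegral_congr fun u => ?_
        rw [lintegral_const_mul' _ _ ENNReal.ofReal_ne_top,
          lintegral_sub_right_eq_self (fun x => ‖g x‖ₑ ^ (4 : ℝ)) u]
    _ = _ := by rw [lintegral_mul_const _ hm, hl, one_mul]

/-- The standard mollifiers. -/
def bump (n : ℕ) : ContDiffBump (0 : Plane) :=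
  ⟨1 / (2 * ((n : ℝ) + 1)), 1 / ((n : ℝ) + 1), by positivity, by
    apply one_div_lt_one_div_of_lt <;> linarith [(Nat.cast_nonneg n : (0 : ℝ) ≤ n)]⟩

/-- The standard mollifiers, with integral one. -/
def molly (n : ℕ) : Plane → ℝ := (bump n).normed volume

theorem molly_spec (n : ℕ) : ContDiff ℝ (⊤ : ℕ∞) (molly n) ∧ HasCompactSupport (molly n) ∧
    (∀ u, 0 ≤ molly n u) ∧ (∫ u, molly n u = 1) ∧
    Function.support (molly n) ⊆ Metric.ball 0 (1 / ((n : ℝ) + 1)) :=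
  ⟨(bump n).contDiff_normed, (bump n).hasCompactSupport_normed,
    fun u => (bump n).nonneg_normed u, (bump n).integral_normed,
    ((bump n).support_normed_eq (μ := volume)).le⟩

theorem mollify_sub_of (hφ : Continuous φ) (hc : HasCompactSupport φ)
    (hf : LocallyIntegrable f) (hg : LocallyIntegrable g) (x : Plane) :
    mollify φ (fun y => f y - g y) x = mollify φ f x - mollify φ g x := by
  rw [mollify_apply, mollify_apply, mollify_apply,
    ← integral_sub (integrable_mollify hφ hc hf x) (integrable_mollify hφ hc hg x)]
  congr 1
  funext u
  ring

theorem mollify_eq_zero {R : ℝ} (hf : ∀ y, R < ‖y‖ → f y = 0) (n : ℕ) (x : Plane)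
    (hx : R + 1 < ‖x‖) : mollify (molly n) f x = 0 := by
  rw [mollify_apply]
  refine integral_eq_zero_of_ae (Eventually.of_forall fun u => ?_)
  by_cases hu : u ∈ Function.support (molly n)
  · have h1 := (molly_spec n).2.2.2.2 hu
    rw [mem_ball_zero_iff] at h1
    have h2 : 1 / ((n : ℝ) + 1) ≤ 1 := by
      rw [div_le_one (by positivity)]
      linarith [(Nat.cast_nonneg n : (0 : ℝ) ≤ n)]
    have h3 := norm_sub_norm_le x u
    show molly n u * f (x - u) = 0
    rw [hf _ (by linarith), mul_zero]
  · show molly n u * f (x - u) = 0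
    rw [Function.notMem_support.1 hu, zero_mul]

/-- Continuous functions with compact support are dense in `L⁴` and are mollified uniformly. The
three errors, two from the density and one from the mollification, are each at most `δ` with `3 δ ≤
ε`. -/
theorem tendsto_eLpNorm_mollify_sub (hg : MemLp g 4) :
    Tendsto (fun n => eLpNorm (fun x => mollify (molly n) g x - g x) 4 volume) atTop (𝓝 0) := by
  rw [ENNReal.tendsto_nhds_zero]
  intro ε hε
  obtain ⟨δ, hδ0, hδ⟩ : ∃ δ : ℝ≥0, 0 < δ ∧ 3 * (δ : ℝ≥0∞) ≤ ε := by
    rcases eq_or_ne ε ∞ with rfl | hε'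
    · exact ⟨1, one_pos, le_top⟩
    · lift ε to ℝ≥0 using hε'
      refine ⟨ε / 3, by have : 0 < ε := by exact_mod_cast hε
                        positivity, ?_⟩
      rw [← ENNReal.coe_ofNat, ← ENNReal.coe_mul, mul_div_cancel₀ _ (by norm_num)]
  obtain ⟨h, hcs, hle, hcont, hLp⟩ := hg.exists_hasCompactSupport_eLpNorm_sub_le (by norm_num)
    (ENNReal.coe_ne_zero.2 hδ0.ne')
  obtain ⟨R, hR⟩ : ∃ R : ℝ, ∀ y, R < ‖y‖ → h y = 0 := by
    obtain ⟨R, hR⟩ := hcs.isBounded.subset_closedBall (0 : Plane)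
    refine ⟨R, fun y hy => image_eq_zero_of_notMem_tsupport fun hn => ?_⟩
    have := hR hn
    rw [mem_closedBall_zero_iff] at this
    linarith
  have hu : UniformContinuous h := hcs.uniformContinuous_of_continuous hcont
  set V := volume (Metric.closedBall (0 : Plane) (R + 1)) ^ (4 : ℝ≥0∞).toReal⁻¹ with hV
  have hVt : V ≠ ∞ := ENNReal.rpow_ne_top_of_nonneg (by positivity) measure_closedBall_lt_top.ne
  obtain ⟨η, hη0, hη⟩ : ∃ η : ℝ, 0 < η ∧ V * ENNReal.ofReal η ≤ δ := by
    lift V to ℝ≥0 using hVt with V'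
    refine ⟨δ / (V' + 1), by positivity, ?_⟩
    rw [← ENNReal.ofReal_coe_nnreal, ← ENNReal.ofReal_mul (by positivity),
      ← ENNReal.ofReal_coe_nnreal (p := δ)]
    refine ENNReal.ofReal_le_ofReal ?_
    rw [mul_div_assoc', div_le_iff₀ (by positivity)]
    nlinarith [V'.2, δ.2]
  obtain ⟨r, hr0, hr⟩ := Metric.uniformContinuous_iff.1 hu η hη0
  have h1 : ∀ᶠ n : ℕ in atTop, 1 / ((n : ℝ) + 1) < r :=
    (tendsto_one_div_add_atTop_nhds_zero_nat (𝕜 := ℝ)).eventually_lt_const hr0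
  filter_upwards [h1] with n hn
  obtain ⟨m1, m2, m3, m4, m5⟩ := molly_spec n
  have hgl : LocallyIntegrable g := hg.locallyIntegrable (by norm_num)
  have hhl : LocallyIntegrable h := hcont.locallyIntegrable
  have hpt : ∀ x, ‖mollify (molly n) h x - h x‖ ≤ η := fun x => by
    rw [← dist_eq_norm]
    refine dist_convolution_le hη0.le m5 m3 m4 hcont.aestronglyMeasurable fun y hy => ?_
    exact (hr (lt_trans hy hn)).le
  have hz : ∀ x, R + 1 < ‖x‖ → mollify (molly n) h x - h x = 0 := fun x hx => by
    rw [mollify_eq_zero hR n x hx, hR x (by linarith), sub_zero]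
  have hmg : AEStronglyMeasurable (fun x => g x - h x) volume :=
    hg.aestronglyMeasurable.sub hcont.aestronglyMeasurable
  have e1 : (fun x => mollify (molly n) g x - g x) = fun x =>
      (mollify (molly n) (fun y => g y - h y) x + (mollify (molly n) h x - h x)) - (g x - h x) := by
    funext x
    rw [mollify_sub_of m1.continuous m2 hgl hhl]
    ring
  have c1 : Continuous (mollify (molly n) (fun y => g y - h y)) :=
    (contDiff_mollify m1 m2 (hgl.sub hhl)).continuous
  have c2 : Continuous fun x => mollify (molly n) h x - h x :=
    (contDiff_mollify m1 m2 hhl).continuous.sub hcont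
  rw [e1]
  calc _ ≤ eLpNorm (fun x => mollify (molly n) (fun y => g y - h y) x +
          (mollify (molly n) h x - h x)) 4 volume + eLpNorm (fun x => g x - h x) 4 volume :=
        eLpNorm_sub_le (c1.add c2).aestronglyMeasurable hmg (by norm_num)
    _ ≤ (eLpNorm (mollify (molly n) (fun y => g y - h y)) 4 volume +
          eLpNorm (fun x => mollify (molly n) h x - h x) 4 volume) +
          eLpNorm (fun x => g x - h x) 4 volume := by
        gcongr
        exact eLpNorm_add_le c1.aestronglyMeasurable c2.aestronglyMeasurable (by norm_num)
    _ ≤ (δ + δ) + δ := by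
        gcongr
        · exact (eLpNorm_mollify_le m1.continuous m3 m4 hmg).trans hle
        · exact (eLpNorm_le_of_support hpt hz 4).trans hη
        · exact hle
    _ = 3 * δ := by ring
    _ ≤ ε := hδ

end Mollify

/-! ### Functions in `W^{4,4}` with compact support -/

section SobolevApprox

theorem norm_multilinear_le_sum {n : ℕ} {F : Type} [NormedAddCommGroup F] [NormedSpace ℝ F]
    (M : ContinuousMultilinearMap ℝ (fun _ : Fin n => Plane) F) :
    ‖M‖ ≤ ∑ α : Fin n → Fin 2, ‖M fun j => e (α j)‖ := by
  refine M.opNorm_le_bound (Finset.sum_nonneg fun _ _ => norm_nonneg _) fun m => ?_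
  have h1 : m = fun j => ∑ i, m j i • e i := by
    funext j
    ext i
    fin_cases i <;> simp [e, Fin.sum_univ_two]
  have h2 : M m = ∑ α : Fin n → Fin 2, (∏ j, m j (α j)) • M fun j => e (α j) := by
    conv_lhs => rw [h1]
    rw [M.map_sum]
    refine Finset.sum_congr rfl fun α _ => ?_
    exact M.map_smul_univ (fun j => m j (α j)) (fun j => e (α j))
  rw [h2, Finset.sum_mul]
  refine (norm_sum_le _ _).trans (Finset.sum_le_sum fun α _ => ?_)
  rw [norm_smul, mul_comm, norm_prod]
  gcongr with j
  exact PiLp.norm_apply_le (m j) (α j)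

theorem MemSobolev.exists_memLp {ω₀ : Plane → ℝ} (h : MemSobolev 4 4 ω₀) {n : ℕ} (hn : n ≤ 4)
    (α : Fin n → Fin 2) : ∃ g, HasWeakDeriv α ω₀ g ∧ MemLp g 4 := by
  unfold MemSobolev sobolevNorm at h
  have h1 := (ENNReal.sum_lt_top.1 h) n (by simp; omega)
  have h2 := (ENNReal.sum_lt_top.1 h1) α (Finset.mem_univ _)
  obtain ⟨g, h3⟩ := iInf_lt_iff.1 h2
  obtain ⟨hg, h4⟩ := iInf_lt_iff.1 h3
  exact ⟨g, hg, hg.2.1.aestronglyMeasurable, h4⟩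

theorem exists_norm_le_of_hasCompactSupport {F : Type} [NormedAddCommGroup F] {h : Plane → F}
    (hs : HasCompactSupport h) : ∃ R : ℝ, ∀ y, R < ‖y‖ → h y = 0 := by
  obtain ⟨R, hR⟩ := hs.isBounded.subset_closedBall (0 : Plane)
  refine ⟨R, fun y hy => image_eq_zero_of_notMem_tsupport fun hn => ?_⟩
  have := hR hn
  rw [mem_closedBall_zero_iff] at this
  linarith

theorem iteratedFDeriv_eq_zero_of_support {n : ℕ} {F : Type} [NormedAddCommGroup F]
    [NormedSpace ℝ F] {h : Plane → F} {R : ℝ} (hR : ∀ y, R < ‖y‖ → h y = 0) (x : Plane)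
    (hx : R < ‖x‖) : iteratedFDeriv ℝ n h x = 0 := by
  have : h =ᶠ[𝓝 x] fun _ => 0 := by
    filter_upwards [(isOpen_lt continuous_const continuous_norm).mem_nhds hx] with y hy
    exact hR y hy
  rw [(this.iteratedFDeriv ℝ n).eq_of_nhds]
  simp

/-- A Cauchy sequence of smooth approximations. -/
structure IsApprox (ω₀ : Plane → ℝ) (R : ℝ) (f : ℕ → Plane → ℝ) : Prop where
  smooth : ∀ n, ContDiff ℝ (⊤ : ℕ∞) (f n)
  supp : ∀ n x, R < ‖x‖ → f n x = 0
  tendsto : ∀ x, Tendsto (fun n => f n x) atTop (𝓝 (ω₀ x))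
  cauchy : ∀ j ≤ 4, ∀ ε : ℝ, 0 < ε → ∃ N, ∀ n ≥ N, ∀ m ≥ N,
    eLpNorm (iteratedFDeriv ℝ j fun x => f n x - f m x) 4 volume ≤ ENNReal.ofReal ε

/-- Derivatives of the mollifications are mollifications of the weak derivatives, which converge in
`L⁴`; this makes the sequence Cauchy in `W^{4,4}`, with supports in a common ball. -/
theorem exists_isApprox {ω₀ : Plane → ℝ} (h : MemSobolev 4 4 ω₀) (hc : Continuous ω₀)
    (hs : HasCompactSupport ω₀) : ∃ R f, IsApprox ω₀ R f := by
  obtain ⟨R, hR⟩ := exists_norm_le_of_hasCompactSupport hs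
  have hl : LocallyIntegrable ω₀ := hc.locallyIntegrable
  refine ⟨R + 1, fun n => mollify (molly n) ω₀, fun n => contDiff_mollify (molly_spec n).1
    (molly_spec n).2.1 hl, fun n x hx => mollify_eq_zero hR n x hx, fun x => ?_,
    fun j hj ε hε => ?_⟩
  · exact ContDiffBump.convolution_tendsto_right_of_continuous (φ := bump)
      (tendsto_one_div_add_atTop_nhds_zero_nat (𝕜 := ℝ)) hc x
  · choose g hg hLp using fun α => h.exists_memLp hj α
    have h1 : Tendsto (fun n => ∑ α, eLpNorm (fun x => mollify (molly n) (g α) x - g α x) 4 volume)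
        atTop (𝓝 0) := by
      have := tendsto_finsetSum (Finset.univ : Finset (Fin j → Fin 2))
        fun α _ => tendsto_eLpNorm_mollify_sub (hLp α)
      simpa using this
    rw [ENNReal.tendsto_nhds_zero] at h1
    obtain ⟨N, hN⟩ := eventually_atTop.1 (h1 (ENNReal.ofReal (ε / 2)) (by simpa using half_pos hε))
    have hs := fun n => contDiff_mollify (molly_spec n).1 (molly_spec n).2.1 hl
    have hms : ∀ n α, AEStronglyMeasurable (fun x => mollify (molly n) (g α) x - g α x) volume :=
      fun n α => (contDiff_mollify (molly_spec n).1 (molly_spec n).2.1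
        (hg α).2.1).continuous.aestronglyMeasurable.sub (hLp α).1
    refine ⟨N, fun n hn m hm => ?_⟩
    have hpt : ∀ x, ‖iteratedFDeriv ℝ j (fun x => mollify (molly n) ω₀ x - mollify (molly m) ω₀ x) x‖
        ≤ ‖∑ α, ‖(mollify (molly n) (g α) x - g α x) - (mollify (molly m) (g α) x - g α x)‖‖ := by
      intro x
      have e0 : iteratedFDeriv ℝ j (fun x => mollify (molly n) ω₀ x - mollify (molly m) ω₀ x) x =
          iteratedFDeriv ℝ j (mollify (molly n) ω₀) x - iteratedFDeriv ℝ j (mollify (molly m) ω₀) x :=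
        iteratedFDeriv_sub_apply ((hs n).contDiffAt.of_le (by exact_mod_cast le_top))
          ((hs m).contDiffAt.of_le (by exact_mod_cast le_top))
      rw [Real.norm_of_nonneg (Finset.sum_nonneg fun _ _ => norm_nonneg _)]
      refine (norm_multilinear_le_sum _).trans_eq (Finset.sum_congr rfl fun α _ => ?_)
      rw [e0, sub_apply,
        iteratedFDeriv_mollify_of_hasWeakDeriv (molly_spec n).1 (molly_spec n).2.1 (hg α),
        iteratedFDeriv_mollify_of_hasWeakDeriv (molly_spec m).1 (molly_spec m).2.1 (hg α)]
      congr 1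
      ring
    calc _ ≤ eLpNorm (fun x => ∑ α, ‖(mollify (molly n) (g α) x - g α x) -
            (mollify (molly m) (g α) x - g α x)‖) 4 volume := eLpNorm_mono hpt
      _ = eLpNorm (∑ α, fun x => ‖(mollify (molly n) (g α) x - g α x) -
            (mollify (molly m) (g α) x - g α x)‖) 4 volume := by
          congr 1
          funext x
          simp
      _ ≤ ∑ α, eLpNorm (fun x => ‖(mollify (molly n) (g α) x - g α x) -
            (mollify (molly m) (g α) x - g α x)‖) 4 volume :=
          eLpNorm_sum_le (fun α _ => ((hms n α).sub (hms m α)).norm) (by norm_num)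
      _ ≤ ∑ α, (eLpNorm (fun x => mollify (molly n) (g α) x - g α x) 4 volume +
            eLpNorm (fun x => mollify (molly m) (g α) x - g α x) 4 volume) := by
          refine Finset.sum_le_sum fun α _ => ?_
          rw [eLpNorm_norm]
          exact eLpNorm_sub_le (hms n α) (hms m α) (by norm_num)
      _ ≤ ENNReal.ofReal (ε / 2) + ENNReal.ofReal (ε / 2) := by
          rw [Finset.sum_add_distrib]
          exact add_le_add (hN n hn) (hN m hm)
      _ = ENNReal.ofReal ε := by
          rw [← ENNReal.ofReal_add (by positivity) (by positivity), add_halves]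

variable {F : Type} [NormedAddCommGroup F] [NormedSpace ℝ F] [CompleteSpace F]

/-- Uniform bound and Hölder bound on derivatives by `L⁴` norms of the next derivative. -/
theorem exists_morrey_iterated (j : ℕ) (R : ℝ) : ∃ C : ℝ, 0 ≤ C ∧ ∀ h : Plane → F,
    ContDiff ℝ (⊤ : ℕ∞) h → (∀ x, R < ‖x‖ → h x = 0) → ∀ N : ℝ, 0 ≤ N →
    eLpNorm (iteratedFDeriv ℝ (j + 1) h) 4 volume ≤ ENNReal.ofReal N →
    (∀ x y, ‖iteratedFDeriv ℝ j h x - iteratedFDeriv ℝ j h y‖ ≤ C * N * √‖x - y‖) ∧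
    ∀ x, ‖iteratedFDeriv ℝ j h x‖ ≤ C * N := by
  obtain ⟨C, hC0, hC⟩ := morrey (F := ContinuousMultilinearMap ℝ (fun _ : Fin j => Plane) F)
  refine ⟨C * max 1 √(2 * |R| + 1), by positivity, fun h hh hR N hN hle => ?_⟩
  have hd : ContDiff ℝ 1 (iteratedFDeriv ℝ j h) :=
    hh.iteratedFDeriv_right (by exact_mod_cast le_top)
  have e1 : (fun x => ‖fderiv ℝ (iteratedFDeriv ℝ j h) x‖) = fun x => ‖iteratedFDeriv ℝ (j + 1) h x‖ :=
    funext fun x => norm_fderiv_iteratedFDeriv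
  have hle' : eLpNorm (fun x => ‖fderiv ℝ (iteratedFDeriv ℝ j h) x‖) 4 volume ≤
      ENNReal.ofReal N := by
    rw [e1, eLpNorm_norm]
    exact hle
  have key := hC _ hd N hN hle'
  refine ⟨fun x y => (key x y).trans ?_, fun x => ?_⟩
  · have : C ≤ C * max 1 √(2 * |R| + 1) := le_mul_of_one_le_right hC0 (le_max_left _ _)
    gcongr
  · by_cases hx : R < ‖x‖
    · rw [iteratedFDeriv_eq_zero_of_support hR x hx, norm_zero]
      positivity
    -- The Hölder bound becomes a sup bound by comparison with a point outside the support, at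
    -- distance at most `2 |R| + 1`.
    · have hy : ‖(|R| + 1) • e 0‖ = |R| + 1 := by
        rw [norm_smul, norm_e, mul_one, Real.norm_of_nonneg (by positivity)]
      have h1 := key x ((|R| + 1) • e 0)
      rw [iteratedFDeriv_eq_zero_of_support hR ((|R| + 1) • e 0)
        (by rw [hy]; linarith [le_abs_self R]), sub_zero] at h1
      have h2 : ‖x - (|R| + 1) • e 0‖ ≤ 2 * |R| + 1 := by
        refine (norm_sub_le _ _).trans ?_
        rw [hy]
        linarith [le_abs_self R, not_lt.1 hx]
      calc _ ≤ _ := h1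
        _ ≤ C * N * max 1 √(2 * |R| + 1) := by
          gcongr
          exact (Real.sqrt_le_sqrt h2).trans (le_max_right _ _)
        _ = _ := by ring

theorem norm_iteratedFDeriv_succ_sub (j : ℕ) (f g : Plane → F) (x y : Plane) :
    ‖iteratedFDeriv ℝ (j + 1) f x - iteratedFDeriv ℝ (j + 1) g y‖ =
      ‖iteratedFDeriv ℝ j (fderiv ℝ f) x - iteratedFDeriv ℝ j (fderiv ℝ g) y‖ := by
  rw [← dist_eq_norm, ← dist_eq_norm, iteratedFDeriv_succ_eq_comp_right,
    iteratedFDeriv_succ_eq_comp_right]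
  exact LinearIsometryEquiv.dist_map _ _ _

/-- Completeness of `C^k` for the uniform norms, by induction: the derivatives form a sequence of
the same kind, and their uniform limit is the derivative of the limit. -/
theorem contDiff_of_cauchy {k : ℕ} {g : ℕ → Plane → F} {u : Plane → F}
    (hg : ∀ n, ContDiff ℝ (⊤ : ℕ∞) (g n)) (hu : ∀ x, Tendsto (fun n => g n x) atTop (𝓝 (u x)))
    (hc : ∀ j ≤ k, ∀ ε : ℝ, 0 < ε → ∃ N, ∀ n ≥ N, ∀ m ≥ N, ∀ x,
      ‖iteratedFDeriv ℝ j (g n) x - iteratedFDeriv ℝ j (g m) x‖ ≤ ε) :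
    ContDiff ℝ k u ∧ ∀ j ≤ k, ∀ x,
      Tendsto (fun n => iteratedFDeriv ℝ j (g n) x) atTop (𝓝 (iteratedFDeriv ℝ j u x)) := by
  have unif : ∀ {E : Type} [NormedAddCommGroup E] {g : ℕ → Plane → E} {u : Plane → E},
      (∀ x, Tendsto (fun n => g n x) atTop (𝓝 (u x))) →
      (∀ ε : ℝ, 0 < ε → ∃ N, ∀ n ≥ N, ∀ m ≥ N, ∀ x, ‖g n x - g m x‖ ≤ ε) →
      TendstoUniformly g u atTop := by
    intro E _ g u hu hc
    rw [Metric.tendstoUniformly_iff]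
    intro ε hε
    obtain ⟨N, hN⟩ := hc (ε / 2) (half_pos hε)
    filter_upwards [eventually_ge_atTop N] with n hn x
    have : ‖u x - g n x‖ ≤ ε / 2 :=
      le_of_tendsto ((hu x).sub_const (g n x)).norm
        (by filter_upwards [eventually_ge_atTop N] with m hm using hN m hm n hn x)
    rw [dist_eq_norm]
    linarith
  induction k generalizing F with
  | zero =>
    have h0 : TendstoUniformly g u atTop := by
      refine unif hu fun ε hε => ?_
      obtain ⟨N, hN⟩ := hc 0 le_rfl ε hε
      refine ⟨N, fun n hn m hm x => ?_⟩
      have := hN n hn m hm x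
      rwa [iteratedFDeriv_zero_eq_comp, iteratedFDeriv_zero_eq_comp, Function.comp_apply,
        Function.comp_apply, ← map_sub, LinearIsometryEquiv.norm_map] at this
    refine ⟨contDiff_zero.2 (h0.continuous (Frequently.of_forall fun n => (hg n).continuous)), ?_⟩
    intro j hj x
    obtain rfl : j = 0 := by omega
    simp only [iteratedFDeriv_zero_eq_comp, Function.comp_apply]
    exact ((LinearIsometryEquiv.continuous _).tendsto _).comp (hu x)
  | succ k ih =>
    have hc' : ∀ j ≤ k, ∀ ε : ℝ, 0 < ε → ∃ N, ∀ n ≥ N, ∀ m ≥ N, ∀ x,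
        ‖iteratedFDeriv ℝ j (fderiv ℝ (g n)) x - iteratedFDeriv ℝ j (fderiv ℝ (g m)) x‖ ≤ ε := by
      intro j hj ε hε
      obtain ⟨N, hN⟩ := hc (j + 1) (by omega) ε hε
      refine ⟨N, fun n hn m hm x => ?_⟩
      rw [← norm_iteratedFDeriv_succ_sub]
      exact hN n hn m hm x
    have hc0 : ∀ ε : ℝ, 0 < ε → ∃ N, ∀ n ≥ N, ∀ m ≥ N, ∀ x,
        ‖fderiv ℝ (g n) x - fderiv ℝ (g m) x‖ ≤ ε := by
      intro ε hε
      obtain ⟨N, hN⟩ := hc' 0 (by omega) ε hε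
      refine ⟨N, fun n hn m hm x => ?_⟩
      have := hN n hn m hm x
      rwa [iteratedFDeriv_zero_eq_comp, iteratedFDeriv_zero_eq_comp, Function.comp_apply,
        Function.comp_apply, ← map_sub, LinearIsometryEquiv.norm_map] at this
    have hlim : ∀ x, ∃ G, Tendsto (fun n => fderiv ℝ (g n) x) atTop (𝓝 G) := fun x => by
      refine cauchySeq_tendsto_of_complete (Metric.cauchySeq_iff.2 fun ε hε => ?_)
      obtain ⟨N, hN⟩ := hc0 (ε / 2) (half_pos hε)
      refine ⟨N, fun n hn m hm => ?_⟩
      rw [dist_eq_norm]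
      linarith [hN n hn m hm x]
    choose G hG using hlim
    have hder : ∀ x, HasFDerivAt u (G x) x :=
      hasFDerivAt_of_tendstoUniformly (unif hG hc0)
        (fun n x => ((hg n).differentiable (by simp) x).hasFDerivAt) hu
    have hfd : fderiv ℝ u = G := funext fun x => (hder x).fderiv
    obtain ⟨i1, i2⟩ := ih (fun n => (hg n).fderiv_right (by simp)) hG hc'
    refine ⟨?_, fun j hj x => ?_⟩
    · have := (contDiff_succ_iff_fderiv (𝕜 := ℝ) (n := k) (f := u)).2
        ⟨fun x => (hder x).differentiableAt, by simp, by rw [hfd]; exact i1⟩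
      exact_mod_cast this
    · rcases j with _ | j
      · simp only [iteratedFDeriv_zero_eq_comp, Function.comp_apply]
        exact ((LinearIsometryEquiv.continuous _).tendsto _).comp (hu x)
      · simp only [iteratedFDeriv_succ_eq_comp_right, Function.comp_apply]
        refine ((LinearIsometryEquiv.continuous _).tendsto _).comp ?_
        rw [hfd]
        exact i2 j (by omega) x

theorem Reg.of_contDiff_holder {Λ : Type} {k : ℕ} {g : Plane → F} (hg : ContDiff ℝ k g) {C : ℝ}
    (hC : ∀ x y, ‖iteratedFDeriv ℝ k g x - iteratedFDeriv ℝ k g y‖ ≤ C * √‖x - y‖) :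
    Reg True k (fun (_ : Λ) (_ : ℝ) x => g x) := by
  induction k generalizing F with
  | zero =>
    have := RegZero.of_continuous (Λ := Λ) hg.continuous
    refine ⟨this.cont, this.bdd, fun _ R => ⟨C, fun l t x y _ _ _ => ?_⟩⟩
    have := hC x y
    rwa [iteratedFDeriv_zero_eq_comp, Function.comp_apply,
        Function.comp_apply, ← map_sub, LinearIsometryEquiv.norm_map] at this
  | succ k ih =>
    have := (contDiff_succ_iff_fderiv (𝕜 := ℝ) (n := k) (f := g)).1 (by exact_mod_cast hg)
    refine ⟨RegZero.of_continuous hg.continuous, fun _ _ => this.1, ih this.2.2 fun x y => ?_⟩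
    have h1 := hC x y
    rwa [norm_iteratedFDeriv_succ_sub] at h1

variable {ω₀ : Plane → ℝ} {R : ℝ} {f : ℕ → Plane → ℝ}

theorem iteratedFDeriv_fun_sub {j : ℕ} {f g : Plane → F} (hf : ContDiff ℝ j f)
    (hg : ContDiff ℝ j g) (x : Plane) : iteratedFDeriv ℝ j (fun x => f x - g x) x =
      iteratedFDeriv ℝ j f x - iteratedFDeriv ℝ j g x :=
  iteratedFDeriv_sub_apply hf.contDiffAt hg.contDiffAt

theorem IsApprox.contDiff_nat (h : IsApprox ω₀ R f) (n j : ℕ) : ContDiff ℝ j (f n) :=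
  (h.smooth n).of_le (by exact_mod_cast le_top)

theorem IsApprox.exists_bound (h : IsApprox ω₀ R f) : ∃ A : ℝ, 0 ≤ A ∧ ∃ N, ∀ n ≥ N, ∀ j ≤ 4,
    eLpNorm (iteratedFDeriv ℝ j (f n)) 4 volume ≤ ENNReal.ofReal A := by
  have key : ∀ j ≤ 4, ∃ A : ℝ, 0 ≤ A ∧ ∃ N, ∀ n ≥ N,
      eLpNorm (iteratedFDeriv ℝ j (f n)) 4 volume ≤ ENNReal.ofReal A := by
    intro j hj
    obtain ⟨N, hN⟩ := h.cauchy j hj 1 one_pos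
    have hc : ∀ n, Continuous (iteratedFDeriv ℝ j (f n)) := fun n =>
      (h.contDiff_nat n j).continuous_iteratedFDeriv le_rfl
    have hs : HasCompactSupport (iteratedFDeriv ℝ j (f N)) :=
      HasCompactSupport.intro (isCompact_closedBall (0 : Plane) R) fun y hy =>
        iteratedFDeriv_eq_zero_of_support (h.supp N) y (by simpa using hy)
    have hfin : eLpNorm (iteratedFDeriv ℝ j (f N)) 4 volume ≠ ∞ :=
      ((hc N).memLp_of_hasCompactSupport hs).2.ne
    refine ⟨1 + (eLpNorm (iteratedFDeriv ℝ j (f N)) 4 volume).toReal, by positivity, N,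
      fun n hn => ?_⟩
    rw [ENNReal.ofReal_add zero_le_one ENNReal.toReal_nonneg, ENNReal.ofReal_toReal hfin]
    have e1 : iteratedFDeriv ℝ j (f n) = (iteratedFDeriv ℝ j fun x => f n x - f N x) +
        iteratedFDeriv ℝ j (f N) := by
      funext x
      rw [Pi.add_apply, iteratedFDeriv_fun_sub (h.contDiff_nat n j) (h.contDiff_nat N j)]
      abel
    rw [e1]
    refine (eLpNorm_add_le ?_ (hc N).aestronglyMeasurable (by norm_num)).trans ?_
    · exact (((h.contDiff_nat n j).sub (h.contDiff_nat N j)).continuous_iteratedFDeriv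
        le_rfl).aestronglyMeasurable
    · gcongr
      exact hN n hn N le_rfl
  choose! A hA0 N hN using key
  refine ⟨∑ j ∈ Finset.range 5, A j, Finset.sum_nonneg fun j hj => hA0 j
    (by simp at hj; omega), (Finset.range 5).sup N, fun n hn j hj => ?_⟩
  have hm : j ∈ Finset.range 5 := by simp; omega
  refine (hN j hj n ((Finset.le_sup hm).trans hn)).trans (ENNReal.ofReal_le_ofReal ?_)
  exact Finset.single_le_sum (f := A) (fun i hi => hA0 i (by simp at hi; omega)) hm

/-- Morrey's inequality exchanges the `L⁴` norm of order `j + 1` for the sup norm of order `j`. -/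
theorem IsApprox.uniform_cauchy (h : IsApprox ω₀ R f) : ∀ j ≤ 3, ∀ ε : ℝ, 0 < ε → ∃ N, ∀ n ≥ N,
    ∀ m ≥ N, ∀ x, ‖iteratedFDeriv ℝ j (f n) x - iteratedFDeriv ℝ j (f m) x‖ ≤ ε := by
  intro j hj ε hε
  obtain ⟨C, hC0, hC⟩ := exists_morrey_iterated (F := ℝ) j R
  obtain ⟨N, hN⟩ := h.cauchy (j + 1) (by omega) (ε / (C + 1)) (by positivity)
  refine ⟨N, fun n hn m hm x => ?_⟩
  have h1 := (hC (fun x => f n x - f m x) ((h.smooth n).sub (h.smooth m))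
    (fun x hx => by rw [h.supp n x hx, h.supp m x hx, sub_zero]) _ (by positivity)
    (hN n hn m hm)).2 x
  rw [iteratedFDeriv_fun_sub (h.contDiff_nat n j) (h.contDiff_nat m j)] at h1
  refine h1.trans ?_
  rw [mul_div_assoc', div_le_iff₀ (by positivity)]
  nlinarith

theorem IsApprox.contDiff (h : IsApprox ω₀ R f) : ContDiff ℝ 3 ω₀ ∧ ∀ j ≤ 3, ∀ x,
    Tendsto (fun n => iteratedFDeriv ℝ j (f n) x) atTop (𝓝 (iteratedFDeriv ℝ j ω₀ x)) := by
  have := contDiff_of_cauchy (k := 3) h.smooth h.tendsto h.uniform_cauchy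
  exact ⟨by exact_mod_cast this.1, this.2⟩

theorem IsApprox.tendsto_uniform (h : IsApprox ω₀ R f) {j : ℕ} (hj : j ≤ 3) {ε : ℝ} (hε : 0 < ε) :
    ∃ N, ∀ n ≥ N, ∀ x, ‖iteratedFDeriv ℝ j (fun x => f n x - ω₀ x) x‖ ≤ ε := by
  obtain ⟨N, hN⟩ := h.uniform_cauchy j hj ε hε
  refine ⟨N, fun n hn x => ?_⟩
  have hj' : ContDiff ℝ j ω₀ := h.contDiff.1.of_le (by exact_mod_cast hj)
  rw [iteratedFDeriv_fun_sub (h.contDiff_nat n j) hj']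
  exact le_of_tendsto ((h.contDiff.2 j hj x).const_sub _).norm
    (by filter_upwards [eventually_ge_atTop N] with m hm using hN n hn m hm x)

/-- The embedding of `W^{4,4}` in `C^{3,1/2}`: the approximations have a common Hölder bound for the
third derivative, and it survives pointwise limits. -/
theorem IsApprox.reg {Λ : Type} (h : IsApprox ω₀ R f) :
    Reg True 3 (fun (_ : Λ) (_ : ℝ) x => ω₀ x) := by
  obtain ⟨A, hA0, N, hA⟩ := h.exists_bound
  obtain ⟨C, hC0, hC⟩ := exists_morrey_iterated (F := ℝ) 3 R
  refine Reg.of_contDiff_holder h.contDiff.1 (C := C * A) fun x y => ?_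
  refine le_of_tendsto ((h.contDiff.2 3 le_rfl x).sub (h.contDiff.2 3 le_rfl y)).norm ?_
  filter_upwards [eventually_ge_atTop N] with n hn
  exact (hC (f n) (h.smooth n) (h.supp n) A hA0 (hA n hn 4 le_rfl)).1 x y

end SobolevApprox

/-! ### Weak derivatives up to order two -/

section WeakDeriv

variable {F : Type} [NormedAddCommGroup F] [NormedSpace ℝ F] [CompleteSpace F]

theorem integral_fderiv_smul_eq {φ : Plane → ℝ} {f : Plane → F} (hφ : ContDiff ℝ 1 φ)
    (hc : HasCompactSupport φ) (hf : ContDiff ℝ 1 f) (v : Plane) :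
    ∫ x, fderiv ℝ φ x v • f x = -∫ x, φ x • fderiv ℝ f x v := by
  have h1 : Continuous fun x => fderiv ℝ φ x v :=
    (hφ.continuous_fderiv one_ne_zero).clm_apply continuous_const
  have h2 : Continuous fun x => fderiv ℝ f x v :=
    (hf.continuous_fderiv one_ne_zero).clm_apply continuous_const
  have i1 : Integrable fun x => fderiv ℝ φ x v • f x :=
    (h1.smul hf.continuous).integrable_of_hasCompactSupport (hc.fderiv_apply ℝ v).smul_right
  have i2 : Integrable fun x => φ x • fderiv ℝ f x v :=
    (hφ.continuous.smul h2).integrable_of_hasCompactSupport hc.smul_right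
  have i3 : Integrable fun x => φ x • f x :=
    (hφ.continuous.smul hf.continuous).integrable_of_hasCompactSupport hc.smul_right
  rw [integral_smul_fderiv_eq_neg_fderiv_smul_of_integrable i1 i2 i3
    (fun x _ => hφ.differentiable one_ne_zero x) (fun x _ => hf.differentiable one_ne_zero x),
    neg_neg]

theorem hasWeakDeriv_zero {f : Plane → F} (hf : Continuous f) (α : Fin 0 → Fin 2) :
    HasWeakDeriv α f f := by
  refine ⟨hf.locallyIntegrable, hf.locallyIntegrable, fun φ _ _ => ?_⟩
  simp

theorem hasWeakDeriv_one {f : Plane → F} (hf : ContDiff ℝ 1 f) (α : Fin 1 → Fin 2) :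
    HasWeakDeriv α f (fun x => fderiv ℝ f x (e (α 0))) := by
  refine ⟨hf.continuous.locallyIntegrable, ((hf.continuous_fderiv one_ne_zero).clm_apply
    continuous_const).locallyIntegrable, fun φ hφ hc => ?_⟩
  simp only [iteratedFDeriv_one_apply, pow_one, neg_smul, one_smul]
  exact integral_fderiv_smul_eq (hφ.of_le (by exact_mod_cast le_top)) hc hf _

/-- The second partial derivative `∂_{α₁} ∂_{α₀} f`. -/
def secondDeriv (α : Fin 2 → Fin 2) (f : Plane → F) (x : Plane) : F :=
  fderiv ℝ (fun y => fderiv ℝ f y (e (α 0))) x (e (α 1))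

theorem secondDeriv_eq {f : Plane → F} (hf : ContDiff ℝ 2 f) (α : Fin 2 → Fin 2) (x : Plane) :
    secondDeriv α f x = iteratedFDeriv ℝ 2 f x ![e (α 1), e (α 0)] := by
  have h1 : ContDiff ℝ 1 (fderiv ℝ f) := hf.fderiv_right (by norm_num)
  have h2 := ((h1.differentiable one_ne_zero x).hasFDerivAt.clm_apply
    (hasFDerivAt_const (e (α 0)) x)).fderiv
  rw [iteratedFDeriv_two_apply, secondDeriv, h2]
  simp

theorem continuous_secondDeriv {f : Plane → F} (hf : ContDiff ℝ 2 f) (α : Fin 2 → Fin 2) :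
    Continuous (secondDeriv α f) := by
  have h1 : ContDiff ℝ 1 fun y => fderiv ℝ f y (e (α 0)) :=
    (hf.fderiv_right (m := 1) (by norm_num)).clm_apply contDiff_const
  exact (h1.continuous_fderiv one_ne_zero).clm_apply continuous_const

theorem norm_secondDeriv_le {f : Plane → F} (hf : ContDiff ℝ 2 f) (α : Fin 2 → Fin 2) (x : Plane) :
    ‖secondDeriv α f x‖ ≤ ‖iteratedFDeriv ℝ 2 f x‖ := by
  rw [secondDeriv_eq hf]
  refine ((iteratedFDeriv ℝ 2 f x).le_opNorm _).trans_eq ?_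
  simp [Fin.prod_univ_two, norm_e]

theorem secondDeriv_sub {f g : Plane → F} (hf : ContDiff ℝ 2 f) (hg : ContDiff ℝ 2 g)
    (α : Fin 2 → Fin 2) (x : Plane) :
    secondDeriv α (fun x => f x - g x) x = secondDeriv α f x - secondDeriv α g x := by
  rw [secondDeriv_eq (hf.sub hg), secondDeriv_eq hf, secondDeriv_eq hg,
    iteratedFDeriv_fun_sub (by exact_mod_cast hf) (by exact_mod_cast hg)]
  rfl

theorem hasWeakDeriv_two {f : Plane → F} (hf : ContDiff ℝ 2 f) (α : Fin 2 → Fin 2) :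
    HasWeakDeriv α f (secondDeriv α f) := by
  have h1 : ContDiff ℝ 1 fun y => fderiv ℝ f y (e (α 0)) :=
    (hf.fderiv_right (m := 1) (by norm_num)).clm_apply contDiff_const
  refine ⟨hf.continuous.locallyIntegrable, (continuous_secondDeriv hf α).locallyIntegrable,
    fun φ hφ hc => ?_⟩
  have hφ2 : ContDiff ℝ 2 φ := by exact_mod_cast contDiff_infty.1 hφ 2
  have e1 : ∀ x, iteratedFDeriv ℝ 2 φ x (fun j => EuclideanSpace.single (α j) (1 : ℝ)) =
      fderiv ℝ (fun y => fderiv ℝ φ y (e (α 1))) x (e (α 0)) := fun x => by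
    -- In `secondDeriv` the index `α 0` is the inner derivative, whereas the definition of weak
    -- derivatives applies it outermost; hence the swap. Integrating by parts twice reverses the
    -- order once more.
    have := secondDeriv_eq hφ2 (fun j => if j = 0 then α 1 else α 0) x
    simp only [secondDeriv] at this
    norm_num at this
    rw [this]
    congr 1
    funext j
    fin_cases j <;> rfl
  have h2 : ContDiff ℝ 1 fun y => fderiv ℝ φ y (e (α 1)) :=
    (hφ2.fderiv_right (m := 1) (by norm_num)).clm_apply contDiff_const
  simp only [e1]
  rw [integral_fderiv_smul_eq h2 (hc.fderiv_apply ℝ _) (hf.of_le (by norm_num)),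
    integral_fderiv_smul_eq (hφ.of_le (by exact_mod_cast le_top)) hc h1]
  simp [secondDeriv]

/-- The coefficients `1`, `2`, `4` count the ordered tuples of directions of length zero, one and
two. -/
theorem sobolevNorm_two_le {p : ℝ≥0∞} {f : Plane → F} (hf : ContDiff ℝ 1 f)
    {g : (Fin 2 → Fin 2) → Plane → F} (hg : ∀ α, HasWeakDeriv α f (g α)) {A₀ A₁ A₂ : ℝ≥0∞}
    (h0 : eLpNorm f p volume ≤ A₀) (h1 : eLpNorm (fun x => ‖fderiv ℝ f x‖) p volume ≤ A₁)
    (h2 : ∀ α, eLpNorm (g α) p volume ≤ A₂) :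
    sobolevNorm 2 p f ≤ A₀ + 2 * A₁ + 4 * A₂ := by
  unfold sobolevNorm
  rw [Finset.sum_range_succ, Finset.sum_range_succ, Finset.sum_range_one]
  refine add_le_add (add_le_add ?_ ?_) ?_
  · refine (Finset.sum_le_card_nsmul _ _ A₀ fun α _ => ?_).trans_eq (by simp)
    exact (iInf₂_le f (hasWeakDeriv_zero hf.continuous α)).trans h0
  · refine (Finset.sum_le_card_nsmul _ _ A₁ fun α _ => ?_).trans_eq (by simp)
    refine (iInf₂_le _ (hasWeakDeriv_one hf α)).trans (le_trans (eLpNorm_mono fun x => ?_) h1)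
    rw [norm_norm]
    refine ((fderiv ℝ f x).le_opNorm _).trans_eq ?_
    rw [norm_e, mul_one]
  · refine (Finset.sum_le_card_nsmul _ _ A₂ fun α _ => ?_).trans_eq (by norm_num)
    exact (iInf₂_le _ (hg α)).trans (h2 α)

/-- Both sides of the integration by parts identity pass to the limit: the left one by uniform
convergence against an integrable function, the right one because on the compact support of the test
function `L⁴` convergence implies `L¹` convergence. -/
theorem hasWeakDeriv_of_tendsto {n : ℕ} {α : Fin n → Fin 2} {f : ℕ → Plane → F} {u g : Plane → F}
    {G : ℕ → Plane → F} (h : ∀ k, HasWeakDeriv α (f k) (G k)) (hu : Continuous u)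
    (hf : ∀ k, Continuous (f k)) (hlim : TendstoUniformly f u atTop) (hg : MemLp g 4)
    (hG : ∀ k, MemLp (G k) 4) (hGg : Tendsto (fun k => eLpNorm (G k - g) 4 volume) atTop (𝓝 0)) :
    HasWeakDeriv α u g := by
  have hgl : LocallyIntegrable g := hg.locallyIntegrable (by norm_num)
  refine ⟨hu.locallyIntegrable, hgl, fun φ hφ hc => ?_⟩
  set ψ := fun x => iteratedFDeriv ℝ n φ x (fun j => EuclideanSpace.single (α j) (1 : ℝ)) with hψ
  have hψc : Continuous ψ := by
    have h1 := (hφ.continuous_iteratedFDeriv (m := n) (by exact_mod_cast le_top))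
    exact (ContinuousMultilinearMap.apply ℝ (fun _ : Fin n => Plane) ℝ
      (fun j => EuclideanSpace.single (α j) (1 : ℝ))).continuous.comp h1
  have hψs : HasCompactSupport ψ := (hc.iteratedFDeriv (𝕜 := ℝ) n).comp_left
    (g := fun M : ContinuousMultilinearMap ℝ (fun _ : Fin n => Plane) ℝ =>
      M (fun j => EuclideanSpace.single (α j) (1 : ℝ))) rfl
  have hψi : Integrable ψ := hψc.integrable_of_hasCompactSupport hψs
  have i1 : ∀ {v : Plane → F}, Continuous v → Integrable fun x => ψ x • v x := fun hv =>
    (hψc.smul hv).integrable_of_hasCompactSupport hψs.smul_right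
  have i2 : ∀ {v : Plane → F}, LocallyIntegrable v → Integrable fun x => φ x • v x := fun hv =>
    hv.integrable_smul_left_of_hasCompactSupport hφ.continuous hc
  have l1 : Tendsto (fun k => ∫ x, ψ x • f k x) atTop (𝓝 (∫ x, ψ x • u x)) := by
    rw [Metric.tendsto_atTop]
    intro ε hε
    have hI : 0 ≤ ∫ x, ‖ψ x‖ := integral_nonneg fun x => norm_nonneg _
    obtain ⟨N, hN⟩ := eventually_atTop.1
      (Metric.tendstoUniformly_iff.1 hlim (ε / ((∫ x, ‖ψ x‖) + 1)) (by positivity))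
    refine ⟨N, fun k hk => ?_⟩
    rw [dist_eq_norm, ← integral_sub (i1 (hf k)) (i1 hu)]
    calc _ ≤ ∫ x, ε / ((∫ x, ‖ψ x‖) + 1) * ‖ψ x‖ := by
          refine norm_integral_le_of_norm_le (hψi.norm.const_mul _) (Eventually.of_forall fun x => ?_)
          rw [← smul_sub, norm_smul, mul_comm]
          gcongr
          rw [← dist_eq_norm, dist_comm]
          exact (hN k hk x).le
      _ = ε * ((∫ x, ‖ψ x‖) / ((∫ x, ‖ψ x‖) + 1)) := by
          rw [integral_const_mul]
          ring
      _ < ε * 1 := by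
          gcongr
          rw [div_lt_one (by positivity)]
          linarith
      _ = ε := mul_one _
  have l2 : Tendsto (fun k => ∫ x, φ x • G k x) atTop (𝓝 (∫ x, φ x • g x)) := by
    obtain ⟨A, hA⟩ := hφ.continuous.bounded_above_of_compact_support hc
    set K := tsupport φ
    have hKm : MeasurableSet K := (isClosed_tsupport φ).measurableSet
    have hK : volume K ≠ ∞ := hc.measure_lt_top.ne
    rw [tendsto_iff_edist_tendsto_0]
    have hbd : ∀ k, edist (∫ x, φ x • G k x) (∫ x, φ x • g x) ≤
        ENNReal.ofReal A * (eLpNorm (G k - g) 4 volume * volume K ^ (3 / 4 : ℝ)) := fun k => by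
      have hGl : LocallyIntegrable (G k) := (hG k).locallyIntegrable (by norm_num)
      rw [edist_eq_enorm_sub, ← integral_sub (i2 hGl) (i2 hgl)]
      refine (enorm_integral_le_lintegral_enorm _).trans ?_
      calc _ ≤ ∫⁻ x, K.indicator (fun x => ENNReal.ofReal A * ‖(G k - g) x‖ₑ) x := by
            refine lintegral_mono fun x => ?_
            by_cases hx : x ∈ K
            · rw [indicator_of_mem hx, ← smul_sub, enorm_smul]
              gcongr
              · rw [← ofReal_norm]
                exact ENNReal.ofReal_le_ofReal (hA x)
              · rfl
            · rw [image_eq_zero_of_notMem_tsupport hx]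
              simp
        _ = ENNReal.ofReal A * ∫⁻ x in K, ‖(G k - g) x‖ₑ := by
            rw [lintegral_indicator hKm, lintegral_const_mul' _ _ ENNReal.ofReal_ne_top]
        _ ≤ _ := by
            gcongr
            have hm : AEStronglyMeasurable (G k - g) (volume.restrict K) :=
              ((hG k).1.sub hg.1).restrict
            have h1 := eLpNorm_le_eLpNorm_mul_rpow_measure_univ (μ := volume.restrict K)
              (p := 1) (q := 4) (by norm_num) hm
            rw [eLpNorm_one_eq_lintegral_enorm, Measure.restrict_apply_univ] at h1
            have e4 : (1 / (1 : ℝ≥0∞).toReal - 1 / (4 : ℝ≥0∞).toReal) = (3 / 4 : ℝ) := by norm_num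
            rw [e4] at h1
            refine h1.trans ?_
            gcongr
            exact Measure.restrict_le_self
    refine tendsto_of_tendsto_of_tendsto_of_le_of_le tendsto_const_nhds ?_ (fun _ => zero_le) hbd
    have hfin : volume K ^ (3 / 4 : ℝ) ≠ ∞ := ENNReal.rpow_ne_top_of_nonneg (by norm_num) hK
    have h3 := ENNReal.Tendsto.const_mul (a := ENNReal.ofReal A)
      (ENNReal.Tendsto.mul_const (b := volume K ^ (3 / 4 : ℝ)) hGg (Or.inr hfin))
      (Or.inr ENNReal.ofReal_ne_top)
    simpa using h3
  have l3 : Tendsto (fun k => ∫ x, ψ x • f k x) atTop (𝓝 ((-1 : ℝ) ^ n • ∫ x, φ x • g x)) :=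
    (l2.const_smul ((-1 : ℝ) ^ n)).congr fun k => ((h k).2.2 φ hφ hc).symm
  exact tendsto_nhds_unique l1 l3

theorem exists_lim_of_cauchy {G : ℕ → Plane → ℝ} (hG : ∀ k, MemLp (G k) 4)
    (hc : ∀ ε : ℝ, 0 < ε → ∃ N, ∀ n ≥ N, ∀ m ≥ N,
      eLpNorm (G n - G m) 4 volume ≤ ENNReal.ofReal ε) :
    ∃ g, MemLp g 4 ∧ Tendsto (fun k => eLpNorm (G k - g) 4 volume) atTop (𝓝 0) := by
  have : Fact ((1 : ℝ≥0∞) ≤ 4) := ⟨by norm_num⟩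
  have hcs : CauchySeq fun k => (hG k).toLp (G k) := by
    rw [Metric.cauchySeq_iff]
    intro ε hε
    obtain ⟨N, hN⟩ := hc (ε / 2) (half_pos hε)
    refine ⟨N, fun n hn m hm => ?_⟩
    have h1 : edist ((hG n).toLp (G n)) ((hG m).toLp (G m)) ≤ ENNReal.ofReal (ε / 2) := by
      rw [Lp.edist_toLp_toLp]
      exact hN n hn m hm
    rw [edist_dist, ENNReal.ofReal_le_ofReal_iff (by positivity)] at h1
    linarith
  obtain ⟨g, hg⟩ := cauchySeq_tendsto_of_complete hcs
  refine ⟨g, Lp.memLp g, ?_⟩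
  rw [Lp.tendsto_Lp_iff_tendsto_eLpNorm'] at hg
  refine hg.congr fun k => eLpNorm_congr_ae ?_
  exact (hG k).coeFn_toLp.sub (EventuallyEq.refl _ _)

/-- Bound on the `W^{2,4}` norm of a limit of functions with bounded second derivatives in `L⁴`. -/
theorem sobolevNorm_two_four_le {w : Plane → ℝ} {W : ℕ → Plane → ℝ} (hw : ContDiff ℝ 1 w)
    (hW : ∀ n, ContDiff ℝ 2 (W n)) (hlim : TendstoUniformly W w atTop) {A₀ A₁ A₂ : ℝ≥0∞}
    (hA₂ : A₂ ≠ ∞)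
    (h0 : eLpNorm w 4 volume ≤ A₀) (h1 : eLpNorm (fun x => ‖fderiv ℝ w x‖) 4 volume ≤ A₁)
    (h2 : ∀ n, eLpNorm (fun x => ‖iteratedFDeriv ℝ 2 (W n) x‖) 4 volume ≤ A₂)
    (hc : ∀ ε : ℝ, 0 < ε → ∃ N, ∀ n ≥ N, ∀ m ≥ N,
      eLpNorm (fun x => ‖iteratedFDeriv ℝ 2 (fun x => W n x - W m x) x‖) 4 volume ≤
        ENNReal.ofReal ε) :
    sobolevNorm 2 4 w ≤ A₀ + 2 * A₁ + 4 * A₂ := by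
  have hle : ∀ n α, eLpNorm (secondDeriv α (W n)) 4 volume ≤ A₂ := fun n α =>
    (eLpNorm_mono fun x => by
      rw [norm_norm]
      exact norm_secondDeriv_le (hW n) α x).trans (h2 n)
  have hLp : ∀ n α, MemLp (secondDeriv α (W n)) 4 := fun n α =>
    ⟨(continuous_secondDeriv (hW n) α).aestronglyMeasurable,
      (hle n α).trans_lt (lt_top_iff_ne_top.2 hA₂)⟩
  have hcau : ∀ α, ∀ ε : ℝ, 0 < ε → ∃ N, ∀ n ≥ N, ∀ m ≥ N,
      eLpNorm (secondDeriv α (W n) - secondDeriv α (W m)) 4 volume ≤ ENNReal.ofReal ε := by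
    intro α ε hε
    obtain ⟨N, hN⟩ := hc ε hε
    refine ⟨N, fun n hn m hm => le_trans (eLpNorm_mono fun x => ?_) (hN n hn m hm)⟩
    rw [Pi.sub_apply, ← secondDeriv_sub (hW n) (hW m), norm_norm]
    exact norm_secondDeriv_le ((hW n).sub (hW m)) α x
  choose g hg hgl using fun α => exists_lim_of_cauchy (fun n => hLp n α) (hcau α)
  refine sobolevNorm_two_le hw (g := g) (fun α => hasWeakDeriv_of_tendsto
    (fun k => hasWeakDeriv_two (hW k) α) hw.continuous (fun k => (hW k).continuous) hlim (hg α)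
    (fun k => hLp k α) (hgl α)) h0 h1 fun α => ?_
  have h3 : ∀ k, eLpNorm (g α) 4 volume ≤ A₂ + eLpNorm (secondDeriv α (W k) - g α) 4 volume :=
    fun k => by
      have e1 : g α = secondDeriv α (W k) - (secondDeriv α (W k) - g α) := by abel
      conv_lhs => rw [e1]
      exact (eLpNorm_sub_le (hLp k α).1 ((hLp k α).1.sub (hg α).1) (by norm_num)).trans
        (by gcongr; exact hle k α)
  have h4 := (hgl α).const_add A₂
  rw [add_zero] at h4
  exact ge_of_tendsto' h4 h3

/-- Bound on the `W^{2,∞}` norm of a `C²` function. -/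
theorem sobolevNorm_two_top_le {f : Plane → F} (hf : ContDiff ℝ 2 f) {A : ℝ}
    (h0 : ∀ x, ‖f x‖ ≤ A) (h1 : ∀ x, ‖fderiv ℝ f x‖ ≤ A)
    (h2 : ∀ x, ‖fderiv ℝ (fderiv ℝ f) x‖ ≤ A) : sobolevNorm 2 ∞ f ≤ 7 * ENNReal.ofReal A := by
  have key : ∀ {E : Type} [NormedAddCommGroup E] {g : Plane → E}, (∀ x, ‖g x‖ ≤ A) →
      eLpNorm g ∞ volume ≤ ENNReal.ofReal A := fun h => by
    refine (eLpNorm_le_of_ae_bound (Eventually.of_forall h)).trans_eq ?_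
    simp
  refine (sobolevNorm_two_le (hf.of_le (by norm_num)) (fun α => hasWeakDeriv_two hf α) (key h0)
    (key fun x => by rw [norm_norm]; exact h1 x) fun α => key fun x => ?_).trans_eq (by ring)
  refine (norm_secondDeriv_le hf α x).trans ?_
  refine le_trans (le_of_eq ?_) (h2 x)
  rw [← norm_iteratedFDeriv_fderiv, ← norm_iteratedFDeriv_fderiv]
  simp

end WeakDeriv

/-! ### The cut-off drift -/

section Clamp

variable {Λ : Type} {F : Type} [NormedAddCommGroup F] [NormedSpace ℝ F] {H : Prop} {k : ℕ}

/-- Projection of the time axis to `[0, T]`. -/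
def clamp (T t : ℝ) : ℝ := max 0 (min t T)

variable {T : ℝ}

theorem clamp_mem (hT : 0 ≤ T) (t : ℝ) : clamp T t ∈ Icc 0 T :=
  ⟨le_max_left _ _, max_le hT (min_le_right _ _)⟩

theorem clamp_of_mem {t : ℝ} (ht : t ∈ Icc 0 T) : clamp T t = t := by
  rw [clamp, min_eq_left ht.2, max_eq_right ht.1]

theorem clamp_clamp (hT : 0 ≤ T) (t : ℝ) : clamp T (clamp T t) = clamp T t :=
  clamp_of_mem (clamp_mem hT t)

theorem continuous_clamp : Continuous (clamp T) :=
  continuous_const.max (continuous_id.min continuous_const)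

theorem abs_clamp_le (hT : 0 ≤ T) (t : ℝ) : |clamp T t| ≤ |t| := by
  rw [abs_of_nonneg (clamp_mem hT t).1, clamp]
  exact max_le (abs_nonneg _) ((min_le_left _ _).trans (le_abs_self _))

theorem abs_clamp_le_right (hT : 0 ≤ T) (t : ℝ) : |clamp T t| ≤ T := by
  rw [abs_of_nonneg (clamp_mem hT t).1]
  exact (clamp_mem hT t).2

/-- Functions known on `[0, T]` are frozen outside. All families then live on the whole time axis,
where flows are global. -/
theorem Reg.clampTime (hT : 0 ≤ T) {f : Λ → ℝ → Plane → F} (hf : Reg H k f) :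
    Reg H k (fun l t x => f l (clamp T t) x) := by
  have base : ∀ {F : Type} [NormedAddCommGroup F] [NormedSpace ℝ F] {f : Λ → ℝ → Plane → F}
      {K : Prop}, RegZero K f → RegZero K (fun l t x => f l (clamp T t) x) := by
    intro F _ _ f K hf
    refine ⟨fun l => (hf.cont l).comp ((continuous_clamp.comp continuous_fst).prodMk
      continuous_snd), fun R => ?_, fun hK R => ?_⟩
    · obtain ⟨C, hC⟩ := hf.bdd R
      exact ⟨C, fun l t x ht hx => hC l _ x ((abs_clamp_le hT t).trans ht) hx⟩
    · obtain ⟨C, hC⟩ := hf.holder hK R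
      exact ⟨C, fun l t x y ht hx hy => hC l _ x y ((abs_clamp_le hT t).trans ht) hx hy⟩
  induction k generalizing F with
  | zero => exact base hf
  | succ k ih => exact ⟨base hf.1, fun l t => hf.2.1 l _, ih hf.2.2⟩

/-- The family index enters only through a parameter in the compact interval `[-1, 1]`, so all
bounds are uniform in the index. -/
theorem Reg.of_param {Φ : ℝ × Plane → F} (hΦ : ContDiff ℝ (⊤ : ℕ∞) Φ) {a : Λ → ℝ → ℝ}
    (ha : ∀ l, Continuous (a l)) (hb : ∀ l t, |a l t| ≤ 1) :
    Reg H k (fun l t x => Φ (a l t, x)) := by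
  suffices h : ∀ k, Reg False k (fun l t x => Φ (a l t, x)) from (h (k + 1)).of_succ
  intro k
  have base : ∀ {F : Type} [NormedAddCommGroup F] [NormedSpace ℝ F] {Φ : ℝ × Plane → F},
      Continuous Φ → RegZero False (fun l t x => Φ (a l t, x)) := by
    intro F _ _ Φ hΦ
    refine ⟨fun l => hΦ.comp (((ha l).comp continuous_fst).prodMk continuous_snd), fun R => ?_,
      False.elim⟩
    obtain ⟨C, hC⟩ := ((isCompact_closedBall (0 : ℝ) 1).prod
      (isCompact_closedBall (0 : Plane) R)).exists_bound_of_continuousOn hΦ.continuousOn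
    refine ⟨C, fun l t x _ hx => hC _ ⟨?_, ?_⟩⟩
    · simpa using hb l t
    · simpa using hx
  induction k generalizing F with
  | zero => exact base hΦ.continuous
  | succ k ih =>
    refine Reg.of_hasFDerivAt (f' := fun l t x =>
      (fun p => (fderiv ℝ Φ p).comp (ContinuousLinearMap.inr ℝ ℝ Plane)) (a l t, x))
      (base hΦ.continuous) (fun l t x => ?_) (ih (Φ := fun p =>
        (fderiv ℝ Φ p).comp (ContinuousLinearMap.inr ℝ ℝ Plane)) ?_)
    · exact ((hΦ.differentiable (by simp) (a l t, x)).hasFDerivAt).comp x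
        (hasFDerivAt_prodMk_right (a l t) x)
    · exact (hΦ.fderiv_right (m := (⊤ : ℕ∞)) (by simp)).clm_comp contDiff_const

/-- Global Lipschitz bound for compactly supported families. -/
theorem Reg.exists_lipschitz_of_suppIn {R : ℝ} {f : Λ → ℝ → Plane → F} (h : Reg H (k + 1) f)
    (hs : SuppIn R f) (S : ℝ) : ∃ C : ℝ, 0 ≤ C ∧ ∀ l t x y, |t| ≤ S →
      ‖f l t x - f l t y‖ ≤ C * ‖x - y‖ := by
  obtain ⟨C, hC0, hC⟩ := h.2.2.regZero.exists_bound hs.fderiv S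
  refine ⟨C, hC0, fun l t x y ht => ?_⟩
  exact convex_univ.norm_image_sub_le_of_norm_fderiv_le (f := f l t) (fun u _ => (h.2.1 l t) u)
    (fun u _ => hC l t u ht) (mem_univ _) (mem_univ _)

end Clamp

/-! ### The vortex velocity with its core removed. -/

section Swirl

/-- A smooth function that vanishes on the disc of radius `d / 2` and is one outside the disc of
radius `d`. -/
def hole (d : ℝ) (hd : 0 < d) : ContDiffBump (0 : Plane) := ⟨d / 2, d, by positivity, by linarith⟩

/-- The rotating flow of the spreading vortex, switched off near the origin. The parameter is
`p = νt / (1 + νt)`. -/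
def swirl (d : ℝ) (hd : 0 < d) (p : ℝ × Plane) : Plane :=
  ((1 - hole d hd p.2) * (1 - Real.exp (‖p.2‖ ^ 2 / 4) * expNegInvGlue (4 * p.1 / ‖p.2‖ ^ 2))) •
    kernelK p.2

variable {d : ℝ} (hd : 0 < d)

theorem contDiffAt_kernelK {y : Plane} (hy : y ≠ 0) : ContDiffAt ℝ (⊤ : ℕ∞) kernelK y := by
  have h1 : ContDiffAt ℝ (⊤ : ℕ∞) (fun x : Plane => 1 / (2 * Real.pi * ‖x‖ ^ 2)) y := by
    refine contDiffAt_const.div (contDiffAt_const.mul (contDiff_norm_sq ℝ).contDiffAt) ?_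
    have := norm_pos_iff.2 hy
    positivity
  have h2 : ContDiff ℝ (⊤ : ℕ∞) perp := by
    have : perp = fun a => (coord 1 a) • e 0 - (coord 0 a) • e 1 := funext perp_eq
    rw [this]
    exact ((coord 1).contDiff.smul contDiff_const).sub ((coord 0).contDiff.smul contDiff_const)
  exact h1.smul h2.contDiffAt

/-- Near the origin the function vanishes. Elsewhere the only delicate factor is `expNegInvGlue`,
which is smooth and flat at zero; this is the smoothness up to `νt = 0`. -/
theorem contDiff_swirl : ContDiff ℝ (⊤ : ℕ∞) (swirl d hd) := by
  rw [contDiff_iff_contDiffAt]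
  rintro ⟨p, y⟩
  by_cases hy : ‖y‖ < d / 2
  · have : swirl d hd =ᶠ[𝓝 (p, y)] fun _ => 0 := by
      have h1 : ∀ᶠ q : ℝ × Plane in 𝓝 (p, y), ‖q.2‖ < d / 2 :=
        (continuous_snd.norm.tendsto (p, y)).eventually_lt_const hy
      filter_upwards [h1] with q hq
      have : hole d hd q.2 = 1 := (hole d hd).one_of_mem_closedBall (by
        rw [mem_closedBall_zero_iff]
        exact hq.le)
      simp [swirl, this]
    exact contDiffAt_const.congr_of_eventuallyEq this
  · have hy0 : y ≠ 0 := by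
      rintro rfl
      rw [norm_zero] at hy
      exact hy (by positivity)
    have hn : (‖y‖ ^ 2 : ℝ) ≠ 0 := by
      have := norm_pos_iff.2 hy0
      positivity
    have h2 : ContDiffAt ℝ (⊤ : ℕ∞) (fun q : ℝ × Plane => ‖q.2‖ ^ 2) (p, y) :=
      ((contDiff_norm_sq ℝ).comp contDiff_snd).contDiffAt
    have h3 : ContDiffAt ℝ (⊤ : ℕ∞) (fun q : ℝ × Plane => Real.exp (‖q.2‖ ^ 2 / 4)) (p, y) :=
      Real.contDiff_exp.contDiffAt.comp (p, y) (h2.div_const 4)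
    have h4 : ContDiffAt ℝ (⊤ : ℕ∞) (fun q : ℝ × Plane => expNegInvGlue (4 * q.1 / ‖q.2‖ ^ 2))
        (p, y) := (expNegInvGlue.contDiff (n := (⊤ : ℕ∞))).contDiffAt.comp (p, y)
          (((contDiff_const.mul contDiff_fst).contDiffAt).div h2 hn)
    have h5 : ContDiffAt ℝ (⊤ : ℕ∞) (fun q : ℝ × Plane => 1 - hole d hd q.2) (p, y) :=
      contDiffAt_const.sub ((hole d hd).contDiff.comp contDiff_snd).contDiffAt
    have h6 : ContDiffAt ℝ (⊤ : ℕ∞) (fun q : ℝ × Plane => kernelK q.2) (p, y) :=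
      ContDiffAt.comp (g := kernelK) (f := fun q : ℝ × Plane => q.2) (p, y)
        (contDiffAt_kernelK hy0) contDiffAt_snd
    exact (h5.mul (contDiffAt_const.sub (h3.mul h4))).smul h6

theorem inner_kernelK (y : Plane) : inner ℝ y (kernelK y) = 0 := by
  rw [kernelK, inner_smul_right, inner_perp, mul_zero]

/-- The orthogonality on which all distance estimates to the point vortex rest: the swirl does not
change `|y|`. -/
theorem inner_swirl (p : ℝ) (y : Plane) : inner ℝ y (swirl d hd (p, y)) = 0 := by
  rw [swirl, inner_smul_right, inner_kernelK, mul_zero]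

theorem hole_eq_zero {y : Plane} (hy : d ≤ ‖y‖) : hole d hd y = 0 :=
  (hole d hd).zero_of_le_dist (by rw [dist_zero_right]; exact hy)

theorem swirl_zero {y : Plane} (hy : d ≤ ‖y‖) : swirl d hd (0, y) = kernelK y := by
  rw [swirl]
  simp [hole_eq_zero hd hy, expNegInvGlue.zero]

/-- The velocity of the Lamb–Oseen vortex at time `σ` (with `ν = 1`). -/
theorem swirl_eq_lambOseen {y : Plane} (hy : d ≤ ‖y‖) {σ : ℝ} (hσ : 0 < σ) :
    swirl d hd (σ / (1 + σ), y) = (1 / √σ) • lambOseen ((1 / √σ) • y) := by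
  have hy0 : 0 < ‖y‖ := hd.trans_le hy
  have hs : 0 < √σ := Real.sqrt_pos.2 hσ
  have hs2 : √σ ^ 2 = σ := Real.sq_sqrt hσ.le
  have e1 : (1 / √σ) • kernelK ((1 / √σ) • y) = kernelK y := by
    rw [kernelK, kernelK, perp_smul, norm_smul, smul_smul, smul_smul,
      Real.norm_of_nonneg (by positivity)]
    congr 1
    field_simp
  have e2 : -‖(1 / √σ) • y‖ ^ 2 / 4 = -(‖y‖ ^ 2 / (4 * σ)) := by
    rw [norm_smul, Real.norm_of_nonneg (by positivity), mul_pow, div_pow, hs2]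
    field_simp
  rw [lambOseen, smul_comm, e1, e2, swirl, hole_eq_zero hd hy]
  congr 1
  rw [sub_zero, one_mul]
  congr 1
  -- With `p = σ/(1+σ)` one has `1/p = 1 + 1/σ`, so the glue function equals `exp(-|y|²/4)
  -- exp(-|y|²/(4σ))`; the prefactor `exp(|y|²/4)` cancels the first factor.
  rw [expNegInvGlue, if_neg (not_le.2 (by positivity)), ← Real.exp_add]
  congr 1
  field_simp
  ring

end Swirl

/-! ### The cut-off drift and the distance of its trajectories to the point vortex. -/

section CutField

/-- A velocity field `v` and a point `z` that is advected by it on `[0, T]`. -/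
structure IsDrift (T B Z : ℝ) (v : ℝ → Plane → Plane) (z : ℝ → Plane) : Prop where
  pos : 0 < T
  clamp_v : ∀ t, v (clamp T t) = v t
  clamp_z : ∀ t, z (clamp T t) = z t
  cont : Continuous fun p : ℝ × Plane => v p.1 p.2
  bound : ∀ t x, ‖v t x‖ ≤ B
  lip : ∀ R : ℝ, ∃ L : ℝ, 0 ≤ L ∧ ∀ t x y, ‖x‖ ≤ R → ‖y‖ ≤ R → ‖v t x - v t y‖ ≤ L * ‖x - y‖
  zcont : Continuous z
  zbound : ∀ t, ‖z t‖ ≤ Z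
  zder : ∀ t ∈ Icc 0 T, HasDerivWithinAt z (v t (z t)) (Icc 0 T) t

/-- A smooth function that is one on the disc of radius `R` and vanishes outside the disc of radius
`2 * R`. -/
def disc (R : ℝ) (hR : 0 < R) : ContDiffBump (0 : Plane) := ⟨R, 2 * R, hR, by linarith⟩

theorem disc_eq_one {R : ℝ} (hR : 0 < R) {x : Plane} (hx : ‖x‖ ≤ R) : disc R hR x = 1 :=
  (disc R hR).one_of_mem_closedBall (by rw [mem_closedBall_zero_iff]; exact hx)

theorem disc_eq_zero {R : ℝ} (hR : 0 < R) {x : Plane} (hx : 2 * R ≤ ‖x‖) : disc R hR x = 0 :=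
  (disc R hR).zero_of_le_dist (by rw [dist_zero_right]; exact hx)

theorem exists_lipschitz_disc {R : ℝ} (hR : 0 < R) : ∃ C : ℝ, 0 ≤ C ∧
    ∀ x y, |disc R hR x - disc R hR y| ≤ C * ‖x - y‖ := by
  have h : Reg False 1 (fun (_ : Unit) (_ : ℝ) x => disc R hR x) :=
    Reg.of_contDiff (disc R hR).contDiff
  obtain ⟨C, hC0, hC⟩ := h.exists_lipschitz_of_suppIn (R := 2 * R)
    (fun l t x hx => disc_eq_zero hR hx.le) 0
  exact ⟨C, hC0, fun x y => hC () 0 x y (by simp)⟩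

/-- The compactly supported drift with the core of the vortex removed. -/
def cutField (T : ℝ) (v : ℝ → Plane → Plane) (z : ℝ → Plane) (R : ℝ) (hR : 0 < R) (d : ℝ)
    (hd : 0 < d) (ν : ℝ≥0) (t : ℝ) (x : Plane) : Plane :=
  disc R hR x • v t x + disc R hR x •
    swirl d hd (ν * clamp T t / (1 + ν * clamp T t), x - z t)

variable {T B Z R d : ℝ} {v : ℝ → Plane → Plane} {z : ℝ → Plane} (hR : 0 < R) (hd : 0 < d)

theorem IsDrift.nonneg_B (h : IsDrift T B Z v z) : 0 ≤ B := (norm_nonneg _).trans (h.bound 0 0)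

/-- The parameter `νt/(1+νt)` stays in `[0, 1]` for all `ν ≥ 0`, which gives bounds uniform in `ν`
for every order `k`. -/
theorem IsDrift.reg_swirl (h : IsDrift T B Z v z) {H : Prop} {k : ℕ} : Reg H k
    (fun (ν : ℝ≥0) t x => disc R hR x •
      swirl d hd (ν * clamp T t / (1 + ν * clamp T t), x - z t)) := by
  have h0 : ∀ (ν : ℝ≥0) t, 0 ≤ ν * clamp T t := fun ν t =>
    mul_nonneg ν.2 (clamp_mem h.pos.le t).1
  have h1 : Reg H k (fun (ν : ℝ≥0) t x =>
      swirl d hd (ν * clamp T t / (1 + ν * clamp T t), x)) := by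
    refine Reg.of_param (contDiff_swirl hd) (fun ν => ?_) (fun ν t => ?_)
    · refine (continuous_const.mul continuous_clamp).div
        (continuous_const.add (continuous_const.mul continuous_clamp)) fun t => ?_
      have := h0 ν t
      positivity
    · have := h0 ν t
      rw [abs_of_nonneg (by positivity), div_le_one (by positivity)]
      linarith
  have h2 : ∀ {H : Prop} {k : ℕ}, Reg H k (fun (_ : ℝ≥0) t x => x - z t) := fun {H k} => by
    refine Reg.sub (g := fun _ t _ => z t) ?_ (Reg.of_time (fun _ => h.zcont)
      fun _ => ⟨Z, fun _ t _ => h.zbound t⟩)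
    have : Reg False (k + 1) (fun (_ : ℝ≥0) (_ : ℝ) (x : Plane) => x) := Reg.of_contDiff contDiff_id
    exact this.of_succ
  have h3 : Reg H k (fun (_ : ℝ≥0) (_ : ℝ) x => disc R hR x) := by
    have : Reg False (k + 1) (fun (_ : ℝ≥0) (_ : ℝ) x => disc R hR x) :=
      Reg.of_contDiff (disc R hR).contDiff
    exact this.of_succ
  exact h3.smul (h1.comp h2 h2)

theorem IsDrift.reg_cutField (h : IsDrift T B Z v z) {H : Prop} {k : ℕ}
    (hv : Reg H k (fun (_ : ℝ≥0) => v)) : Reg H k (cutField T v z R hR d hd) := by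
  have h3 : Reg H k (fun (_ : ℝ≥0) (_ : ℝ) x => disc R hR x) := by
    have : Reg False (k + 1) (fun (_ : ℝ≥0) (_ : ℝ) x => disc R hR x) :=
      Reg.of_contDiff (disc R hR).contDiff
    exact this.of_succ
  exact (h3.smul hv).add (h.reg_swirl hR hd)

theorem IsDrift.exists_lipschitz (h : IsDrift T B Z v z) : ∃ L : ℝ, 0 ≤ L ∧ ∀ t x y,
    ‖disc R hR x • v t x - disc R hR y • v t y‖ ≤ L * ‖x - y‖ := by
  obtain ⟨L, hL0, hL⟩ := h.lip (2 * R)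
  obtain ⟨C, hC0, hC⟩ := exists_lipschitz_disc hR
  have key : ∀ t x y, ‖x‖ ≤ 2 * R → ‖y‖ ≤ 2 * R →
      ‖disc R hR x • v t x - disc R hR y • v t y‖ ≤ (C * B + L) * ‖x - y‖ := by
    intro t x y hx hy
    have e1 : disc R hR x • v t x - disc R hR y • v t y =
        (disc R hR x - disc R hR y) • v t x + disc R hR y • (v t x - v t y) := by
      rw [sub_smul, smul_sub]
      abel
    rw [e1]
    calc _ ≤ |disc R hR x - disc R hR y| * ‖v t x‖ + disc R hR y * ‖v t x - v t y‖ := by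
          refine (norm_add_le _ _).trans_eq ?_
          rw [norm_smul, norm_smul, Real.norm_eq_abs, Real.norm_of_nonneg (disc R hR).nonneg]
      _ ≤ (C * ‖x - y‖) * B + 1 * (L * ‖x - y‖) := by
          gcongr
          · exact hC x y
          · exact h.bound t x
          · exact (disc R hR).le_one
          · exact hL t x y hx hy
      _ = _ := by ring
  have key2 : ∀ t x y, 2 * R < ‖y‖ →
      ‖disc R hR x • v t x - disc R hR y • v t y‖ ≤ (C * B + L) * ‖x - y‖ := by
    intro t x y hy
    have e1 : disc R hR x • v t x - disc R hR y • v t y =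
        (disc R hR x - disc R hR y) • v t x := by
      rw [disc_eq_zero hR hy.le, sub_zero, zero_smul, sub_zero]
    rw [e1, norm_smul, Real.norm_eq_abs]
    calc _ ≤ (C * ‖x - y‖) * B := by
          gcongr
          · exact hC x y
          · exact h.bound t x
      _ ≤ _ := by nlinarith [mul_nonneg hL0 (norm_nonneg (x - y))]
  have hB := h.nonneg_B
  refine ⟨C * B + L, by positivity, fun t x y => ?_⟩
  by_cases hy : 2 * R < ‖y‖
  · exact key2 t x y hy
  · by_cases hx : 2 * R < ‖x‖
    · rw [norm_sub_rev, norm_sub_rev x y]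
      exact key2 t y x hx
    · exact key t x y (not_lt.1 hx) (not_lt.1 hy)

/-- The constants are common to all `ν`. Uniformity in time follows because the field depends on `t`
only through the clamped time. -/
theorem IsDrift.isLipField (h : IsDrift T B Z v z) :
    ∃ K M : ℝ≥0, IsLipField (cutField T v z R hR d hd) K M := by
  obtain ⟨L, hL0, hL⟩ := h.exists_lipschitz hR
  have hs : SuppIn (2 * R) (fun (ν : ℝ≥0) t x => disc R hR x •
      swirl d hd (ν * clamp T t / (1 + ν * clamp T t), x - z t)) := fun ν t x hx => by
    show disc R hR x • _ = 0
    rw [disc_eq_zero hR hx.le, zero_smul]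
  have hr := h.reg_swirl hR hd (H := False) (k := 1)
  obtain ⟨C, hC0, hC⟩ := hr.exists_lipschitz_of_suppIn hs T
  obtain ⟨A, hA0, hA⟩ := hr.1.exists_bound hs T
  have hcl : ∀ (ν : ℝ≥0) t x, disc R hR x •
      swirl d hd (ν * clamp T t / (1 + ν * clamp T t), x - z t) = disc R hR x •
      swirl d hd (ν * clamp T (clamp T t) / (1 + ν * clamp T (clamp T t)), x - z (clamp T t)) :=
    fun ν t x => by rw [clamp_clamp h.pos.le, h.clamp_z]
  have hT := abs_clamp_le_right h.pos.le
  have hB := h.nonneg_B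
  refine ⟨⟨L + C, by positivity⟩, ⟨B + A, by positivity⟩, fun ν => ?_, fun ν t => ?_,
    fun ν t x => ?_⟩
  · refine Continuous.add ?_ (hr.1.cont ν)
    exact ((disc R hR).continuous.comp continuous_snd).smul h.cont
  · refine LipschitzWith.of_dist_le_mul fun x y => ?_
    rw [dist_eq_norm, dist_eq_norm]
    have h2 := hC ν (clamp T t) x y (hT t)
    rw [← hcl, ← hcl] at h2
    calc _ = ‖(disc R hR x • v t x - disc R hR y • v t y) + (_ - _)‖ := by
          rw [cutField, cutField, add_sub_add_comm]
      _ ≤ L * ‖x - y‖ + C * ‖x - y‖ := (norm_add_le _ _).trans (add_le_add (hL t x y) h2)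
      _ = _ := by
        rw [← add_mul]
        rfl
  · have h2 := hA ν (clamp T t) x (hT t)
    rw [← hcl] at h2
    refine (norm_add_le _ _).trans (add_le_add ?_ h2)
    rw [norm_smul, Real.norm_of_nonneg (disc R hR).nonneg]
    exact (mul_le_of_le_one_left (norm_nonneg _) (disc R hR).le_one).trans (h.bound t x)

/-- The distance of a trajectory of the cut-off drift to the point vortex. -/
theorem IsDrift.norm_trajectory_sub_le (h : IsDrift T B Z v z) (hZ : Z ≤ R) {L : ℝ}
    (hL : ∀ t x y, ‖disc R hR x • v t x - disc R hR y • v t y‖ ≤ L * ‖x - y‖) {ν : ℝ≥0}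
    {γ : ℝ → Plane} (hγ : ∀ s, HasDerivAt γ (cutField T v z R hR d hd ν s (γ s)) s) {s t : ℝ}
    (hs : s ∈ Icc 0 T) (ht : t ∈ Icc 0 T) :
    ‖γ s - z s‖ ≤ Real.exp (L * T) * ‖γ t - z t‖ ∧ ‖γ s - z s‖ ≤ ‖γ t - z t‖ + (2 * B * T + 1) := by
  set u : ℝ → Plane := fun s => γ s - z s with hu
  set D : ℝ → Plane := fun s => disc R hR (γ s) • v s (γ s) - v s (z s) with hD
  have hDL : ∀ s, ‖D s‖ ≤ L * ‖u s‖ := fun s => by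
    have := hL s (γ s) (z s)
    -- The point vortex lies where the cut-off is one, so its velocity is the cut-off velocity
    -- evaluated at `z s`.
    rwa [disc_eq_one hR ((h.zbound s).trans hZ), one_smul] at this
  have hDB : ∀ s, ‖D s‖ ≤ 2 * B := fun s => by
    refine (norm_sub_le _ _).trans ?_
    have h1 : ‖disc R hR (γ s) • v s (γ s)‖ ≤ B := by
      rw [norm_smul, Real.norm_of_nonneg (disc R hR).nonneg]
      exact (mul_le_of_le_one_left (norm_nonneg _) (disc R hR).le_one).trans (h.bound s _)
    linarith [h.bound s (z s)]
  have hder : ∀ s ∈ Icc 0 T, HasDerivWithinAt (fun s => ‖u s‖ ^ 2) (2 * inner ℝ (u s) (D s))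
      (Icc 0 T) s := fun s hs => by
    have h1 : HasDerivWithinAt u (cutField T v z R hR d hd ν s (γ s) - v s (z s)) (Icc 0 T) s :=
      (hγ s).hasDerivWithinAt.sub (h.zder s hs)
    refine h1.norm_sq.congr_deriv ?_
    congr 1
    have e1 : cutField T v z R hR d hd ν s (γ s) - v s (z s) = D s + disc R hR (γ s) •
        swirl d hd (ν * clamp T s / (1 + ν * clamp T s), u s) := by
      rw [cutField]
      exact add_sub_right_comm _ _ _
    -- The swirl around `z s` is orthogonal to `u s`, whatever `ν` is; only the difference `D` of
    -- the regular velocities remains.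
    rw [e1, inner_add_right, inner_smul_right, inner_swirl, mul_zero, add_zero]
  have hcont : ContinuousOn (fun s => ‖u s‖ ^ 2) (Icc 0 T) := fun s hs =>
    (hder s hs).continuousWithinAt
  have hder' : ∀ s ∈ interior (Icc 0 T), HasDerivAt (fun s => ‖u s‖ ^ 2)
      (2 * inner ℝ (u s) (D s)) s := fun s hs =>
    (hder s (interior_subset hs)).hasDerivAt (mem_interior_iff_mem_nhds.1 hs)
  have hin : ∀ s, |inner ℝ (u s) (D s)| ≤ L * ‖u s‖ ^ 2 := fun s => by
    refine (abs_real_inner_le_norm _ _).trans ?_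
    calc _ ≤ ‖u s‖ * (L * ‖u s‖) := by gcongr; exact hDL s
      _ = _ := by ring
  constructor
  · have mono : MonotoneOn (fun s => Real.exp (2 * L * s) * ‖u s‖ ^ 2) (Icc 0 T) := by
      refine monotoneOn_of_hasDerivWithinAt_nonneg (f' := fun s =>
        Real.exp (2 * L * s) * (2 * L) * ‖u s‖ ^ 2 +
          Real.exp (2 * L * s) * (2 * inner ℝ (u s) (D s))) (convex_Icc 0 T)
        ((by fun_prop : Continuous fun s => Real.exp (2 * L * s)).continuousOn.mul hcont)
        (fun s hs => ?_) (fun s hs => ?_)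
      · have h1 : HasDerivAt (fun s => Real.exp (2 * L * s)) (Real.exp (2 * L * s) * (2 * L)) s := by
          simpa using ((hasDerivAt_id s).const_mul (2 * L)).exp
        exact (h1.mul (hder' s hs)).hasDerivWithinAt
      · have := neg_abs_le (inner ℝ (u s) (D s))
        have h2 := hin s
        have h3 : 0 ≤ Real.exp (2 * L * s) * (2 * (L * ‖u s‖ ^ 2 + inner ℝ (u s) (D s))) := by
          refine mul_nonneg (Real.exp_nonneg _) ?_
          linarith
        linarith
    have anti : AntitoneOn (fun s => Real.exp (-(2 * L * s)) * ‖u s‖ ^ 2) (Icc 0 T) := by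
      refine antitoneOn_of_hasDerivWithinAt_nonpos (f' := fun s =>
        Real.exp (-(2 * L * s)) * (-(2 * L)) * ‖u s‖ ^ 2 +
          Real.exp (-(2 * L * s)) * (2 * inner ℝ (u s) (D s))) (convex_Icc 0 T)
        ((by fun_prop : Continuous fun s => Real.exp (-(2 * L * s))).continuousOn.mul hcont)
        (fun s hs => ?_) (fun s hs => ?_)
      · have h1 : HasDerivAt (fun s => Real.exp (-(2 * L * s)))
            (Real.exp (-(2 * L * s)) * (-(2 * L))) s := by
          simpa using (((hasDerivAt_id s).const_mul (2 * L)).neg).exp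
        exact (h1.mul (hder' s hs)).hasDerivWithinAt
      · have := le_abs_self (inner ℝ (u s) (D s))
        have h2 := hin s
        have h3 : 0 ≤ Real.exp (-(2 * L * s)) * (2 * (L * ‖u s‖ ^ 2 - inner ℝ (u s) (D s))) := by
          refine mul_nonneg (Real.exp_nonneg _) ?_
          linarith
        linarith
    -- No sign of `L` is assumed; it is forced by the bound on `D` unless `u t` vanishes, and then
    -- nothing is left to prove.
    have hL0 : ‖u t‖ ≠ 0 → 0 ≤ L := fun hne => by
      have h1 := (norm_nonneg _).trans (hDL t)
      by_contra hneg
      have : 0 < ‖u t‖ := lt_of_le_of_ne (norm_nonneg _) (Ne.symm hne)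
      nlinarith
    have key : ‖u s‖ ^ 2 ≤ Real.exp (2 * L * |s - t|) * ‖u t‖ ^ 2 := by
      rcases le_total s t with hst | hst
      · have h1 : Real.exp (2 * L * s) * ‖u s‖ ^ 2 ≤ Real.exp (2 * L * t) * ‖u t‖ ^ 2 :=
          mono hs ht hst
        rw [abs_of_nonpos (by linarith), show 2 * L * -(s - t) = 2 * L * t - 2 * L * s by ring,
          Real.exp_sub, div_mul_eq_mul_div, le_div_iff₀ (Real.exp_pos _)]
        linarith
      · have h1 : Real.exp (-(2 * L * s)) * ‖u s‖ ^ 2 ≤ Real.exp (-(2 * L * t)) * ‖u t‖ ^ 2 :=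
          anti ht hs hst
        rw [abs_of_nonneg (by linarith),
          show 2 * L * (s - t) = -(2 * L * t) - -(2 * L * s) by ring,
          Real.exp_sub, div_mul_eq_mul_div, le_div_iff₀ (Real.exp_pos _)]
        linarith
    have hab : |s - t| ≤ T := by
      rw [abs_le]
      constructor <;> linarith [hs.1, hs.2, ht.1, ht.2]
    have key2 : ‖u s‖ ^ 2 ≤ (Real.exp (L * T) * ‖u t‖) ^ 2 := by
      refine key.trans ?_
      rw [mul_pow, ← Real.exp_nat_mul]
      by_cases hne : ‖u t‖ = 0
      · simp [hne]
      · have := hL0 hne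
        refine mul_le_mul_of_nonneg_right (Real.exp_le_exp.2 ?_) (by positivity)
        push_cast
        nlinarith [mul_le_mul_of_nonneg_left hab this]
    exact (sq_le_sq₀ (norm_nonneg _) (by positivity)).1 key2
  -- The second bound uses only `B` and not `L`, so that the radius `R` can be fixed before `L`,
  -- which depends on it. The smooth `√(|u|² + 1)` replaces `|u|`, and this costs the additive `1`.
  · have hlip : ‖√(‖u s‖ ^ 2 + 1) - √(‖u t‖ ^ 2 + 1)‖ ≤ 2 * B * ‖s - t‖ := by
      refine (convex_Icc 0 T).norm_image_sub_le_of_norm_hasDerivWithin_le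
        (f := fun s => √(‖u s‖ ^ 2 + 1))
        (f' := fun s => (2 * inner ℝ (u s) (D s)) / (2 * √(‖u s‖ ^ 2 + 1)))
        (fun r hr => ?_) (fun r hr => ?_) ht hs
      · exact ((hder r hr).add_const 1).sqrt (by positivity)
      · have h1 : ‖u r‖ ≤ √(‖u r‖ ^ 2 + 1) := Real.le_sqrt_of_sq_le (by linarith)
        rw [norm_div, norm_mul, norm_mul, Real.norm_eq_abs (inner ℝ (u r) (D r)),
          Real.norm_of_nonneg (Real.sqrt_nonneg _),
          div_le_iff₀ (by have : 0 < √(‖u r‖ ^ 2 + 1) := by positivity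
                          simpa using this)]
        norm_num
        calc _ ≤ 2 * (‖u r‖ * ‖D r‖) := by gcongr; exact abs_real_inner_le_norm _ _
          _ ≤ 2 * (√(‖u r‖ ^ 2 + 1) * (2 * B)) := by
            gcongr
            exact hDB r
          _ = _ := by ring
    have h1 : ‖u s‖ ≤ √(‖u s‖ ^ 2 + 1) := Real.le_sqrt_of_sq_le (by linarith)
    have h2 : √(‖u t‖ ^ 2 + 1) ≤ ‖u t‖ + 1 := by
      rw [Real.sqrt_le_left (by positivity)]
      nlinarith [norm_nonneg (u t)]
    have h3 := (le_abs_self _).trans hlip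
    have hab : ‖s - t‖ ≤ T := by
      rw [Real.norm_eq_abs, abs_le]
      constructor <;> linarith [hs.1, hs.2, ht.1, ht.2]
    have h4 : 2 * B * ‖s - t‖ ≤ 2 * B * T := by
      have := h.nonneg_B
      gcongr
    show ‖u s‖ ≤ ‖u t‖ + _
    linarith

end CutField

/-! ### Velocities of bounded integrable vorticities -/

section ClassicalVorticity

variable {T : ℝ} {ω : ℝ → Plane → ℝ}

theorem hasDerivWithinAt_slice (h : ContDiffOn ℝ 1 (fun p : ℝ × Plane => ω p.1 p.2) (Icc 0 T ×ˢ univ))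
    {t : ℝ} (ht : t ∈ Icc 0 T) (x : Plane) :
    HasDerivWithinAt (fun s => ω s x)
      (fderivWithin ℝ (fun p : ℝ × Plane => ω p.1 p.2) (Icc 0 T ×ˢ univ) (t, x) (1, 0)) (Icc 0 T) t := by
  have h1 := (h.differentiableOn one_ne_zero (t, x) ⟨ht, mem_univ _⟩).hasFDerivWithinAt
  have h2 : HasDerivWithinAt (fun s : ℝ => (s, x)) ((1 : ℝ), (0 : Plane)) (Icc 0 T) t :=
    (hasDerivWithinAt_id t _).prodMk (hasDerivWithinAt_const t _ x)
  exact h1.comp_hasDerivWithinAt t h2 fun s hs => mk_mem_prod hs (mem_univ _)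

theorem hasFDerivAt_slice (h : ContDiffOn ℝ 1 (fun p : ℝ × Plane => ω p.1 p.2) (Icc 0 T ×ˢ univ))
    {t : ℝ} (ht : t ∈ Icc 0 T) (x : Plane) :
    HasFDerivAt (ω t) ((fderivWithin ℝ (fun p : ℝ × Plane => ω p.1 p.2) (Icc 0 T ×ˢ univ) (t, x)).comp
      (ContinuousLinearMap.inr ℝ ℝ Plane)) x := by
  have h1 := (h.differentiableOn one_ne_zero (t, x) ⟨ht, mem_univ _⟩).hasFDerivWithinAt
  have h2 : HasFDerivWithinAt (fun y : Plane => (t, y)) (ContinuousLinearMap.inr ℝ ℝ Plane) univ x :=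
    (hasFDerivAt_prodMk_right t x).hasFDerivWithinAt
  exact hasFDerivWithinAt_univ.1 (h1.comp x h2 fun y _ => ⟨ht, mem_univ _⟩)

/-- The chain rule along a curve. -/
theorem hasDerivWithinAt_along (hT : 0 < T)
    (h : ContDiffOn ℝ 1 (fun p : ℝ × Plane => ω p.1 p.2) (Icc 0 T ×ˢ univ))
    {t : ℝ} (ht : t ∈ Icc 0 T) {γ : ℝ → Plane} {γ' : Plane}
    (hγ : HasDerivWithinAt γ γ' (Icc 0 T) t) :
    HasDerivWithinAt (fun s => ω s (γ s))
      (derivWithin (fun s => ω s (γ t)) (Icc 0 T) t + fderiv ℝ (ω t) (γ t) γ') (Icc 0 T) t := by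
  have h1 := (h.differentiableOn one_ne_zero (t, γ t) ⟨ht, mem_univ _⟩).hasFDerivWithinAt
  have h2 : HasDerivWithinAt (fun s : ℝ => (s, γ s)) ((1 : ℝ), γ') (Icc 0 T) t :=
    (hasDerivWithinAt_id t _).prodMk hγ
  refine (h1.comp_hasDerivWithinAt t h2 fun s hs => mk_mem_prod hs (mem_univ _)).congr_deriv ?_
  rw [(hasDerivWithinAt_slice h ht (γ t)).derivWithin (uniqueDiffOn_Icc hT t ht),
    (hasFDerivAt_slice h ht (γ t)).fderiv, ContinuousLinearMap.comp_apply,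
    ContinuousLinearMap.inr_apply, ← map_add]
  simp

theorem reg_clamp_of_contDiffOn {Λ : Type} (hT : 0 < T)
    (h : ContDiffOn ℝ 1 (fun p : ℝ × Plane => ω p.1 p.2) (Icc 0 T ×ˢ univ)) :
    Reg False 1 (fun (_ : Λ) t x => ω (clamp T t) x) := by
  have hmap : Continuous fun p : ℝ × Plane => (clamp T p.1, p.2) :=
    (continuous_clamp.comp continuous_fst).prodMk continuous_snd
  have hmem : ∀ p : ℝ × Plane, (clamp T p.1, p.2) ∈ Icc 0 T ×ˢ (univ : Set Plane) := fun p =>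
    ⟨clamp_mem hT.le _, mem_univ _⟩
  have base : ∀ {F : Type} [NormedAddCommGroup F] {g : ℝ → Plane → F},
      (Continuous fun p : ℝ × Plane => g p.1 p.2) → RegZero False (fun (_ : Λ) => g) := by
    intro F _ g hg
    refine ⟨fun _ => hg, fun R => ?_, False.elim⟩
    obtain ⟨C, hC⟩ := ((isCompact_closedBall (0 : ℝ) R).prod
      (isCompact_closedBall (0 : Plane) R)).exists_bound_of_continuousOn hg.continuousOn
    exact ⟨C, fun l t x ht hx => hC (t, x) ⟨by simpa using ht, by simpa using hx⟩⟩
  refine Reg.of_hasFDerivAt (k := 0) (f' := fun _ t x =>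
    (fderivWithin ℝ (fun p : ℝ × Plane => ω p.1 p.2) (Icc 0 T ×ˢ univ) (clamp T t, x)).comp
      (ContinuousLinearMap.inr ℝ ℝ Plane)) (base ?_)
    (fun _ t x => hasFDerivAt_slice h (clamp_mem hT.le t) x) (base ?_)
  · exact h.continuousOn.comp_continuous hmap hmem
  · have hu : UniqueDiffOn ℝ (Icc 0 T ×ˢ (univ : Set Plane)) :=
      (uniqueDiffOn_Icc hT).prod uniqueDiffOn_univ
    have := (h.continuousOn_fderivWithin hu le_rfl).comp_continuous hmap hmem
    exact this.clm_comp continuous_const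

end ClassicalVorticity

/-- A continuously differentiable vorticity that is bounded in `L¹ ∩ L^∞`. -/
structure IsVorticity (T A : ℝ) (ω : ℝ → Plane → ℝ) : Prop where
  nonneg : 0 ≤ T
  clamp_eq : ∀ t, ω (clamp T t) = ω t
  reg : Reg False 1 (fun (_ : Unit) => ω)
  bound : ∀ t x, ‖ω t x‖ ≤ A
  integrable : ∀ t, Integrable (ω t)
  integral_le : ∀ t, ∫ x, ‖ω t x‖ ≤ A

/-- A continuous function is bounded by its `L^∞` norm. -/
theorem norm_le_of_eLpNorm_top {f : Plane → ℝ} (hf : Continuous f) {A : ℝ≥0}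
    (h : eLpNorm f ∞ volume ≤ A) (x : Plane) : ‖f x‖ ≤ A := by
  have h1 : ∀ᵐ x, ‖f x‖ ≤ A := by
    have := ae_le_eLpNormEssSup (f := f) (μ := volume)
    filter_upwards [this] with x hx
    rw [eLpNorm_exponent_top] at h
    have := hx.trans h
    rwa [enorm_le_coe] at this
  have h2 : Dense {x : Plane | ‖f x‖ ≤ A} := Measure.dense_of_ae h1
  have h3 : IsClosed {x : Plane | ‖f x‖ ≤ A} := isClosed_le hf.norm continuous_const
  have := h2.closure_eq
  rw [h3.closure_eq] at this
  exact (this.symm ▸ mem_univ x : x ∈ {x : Plane | ‖f x‖ ≤ A})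

theorem IsVorticity.of_contDiffOn {T : ℝ} (hT : 0 < T) {ω : ℝ → Plane → ℝ}
    (h : ContDiffOn ℝ 1 (fun p : ℝ × Plane => ω p.1 p.2) (Icc 0 T ×ˢ univ)) {C : ℝ≥0}
    (hC : ∀ t ∈ Icc 0 T, eLpNorm (ω t) 1 volume + eLpNorm (ω t) ∞ volume ≤ C) :
    IsVorticity T C (fun t => ω (clamp T t)) := by
  have hr := reg_clamp_of_contDiffOn (Λ := Unit) hT h
  have hc : ∀ t, Continuous (ω (clamp T t)) := fun t => hr.1.continuous_space () t
  have h1 : ∀ t, eLpNorm (ω (clamp T t)) 1 volume ≤ C := fun t =>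
    le_self_add.trans (hC _ (clamp_mem hT.le t))
  have hi : ∀ t, Integrable (ω (clamp T t)) := fun t => by
    rw [← memLp_one_iff_integrable]
    exact ⟨(hc t).aestronglyMeasurable, (h1 t).trans_lt ENNReal.coe_lt_top⟩
  refine ⟨hT.le, fun t => ?_, hr, fun t x => ?_, hi, fun t => ?_⟩
  · rw [clamp_clamp hT.le]
  · exact norm_le_of_eLpNorm_top (hc t) (le_add_self.trans (hC _ (clamp_mem hT.le t))) x
  · rw [integral_norm_eq_lintegral_enorm (hc t).aestronglyMeasurable, ← eLpNorm_one_eq_lintegral_enorm]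
    exact ENNReal.toReal_le_of_le_ofReal C.2 (by simpa using h1 t)

namespace IsVorticity

variable {T A : ℝ} {ω : ℝ → Plane → ℝ}

theorem exists_bound (h : IsVorticity T A ω) : ∃ B : ℝ, 0 ≤ B ∧ ∀ t x, ‖biotSavart (ω t) x‖ ≤ B := by
  obtain ⟨C, hC0, hC⟩ := exists_norm_biotSavart_le
  have hA : 0 ≤ A := (norm_nonneg _).trans (h.bound 0 0)
  refine ⟨C * (A + A), by positivity, fun t x => (hC A _ (h.bound t) (h.integrable t) x).trans ?_⟩
  gcongr
  exact h.integral_le t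

/-- The part of the vorticity in a large disc. -/
theorem exists_split (h : IsVorticity T A ω) {R : ℝ} (hR : 0 < R) :
    ∃ f g : ℝ → Plane → ℝ, Reg False 1 (fun _ : Unit => f) ∧ SuppIn (2 * R) (fun _ : Unit => f) ∧
      (∀ t x, ‖x‖ ≤ R → g t x = 0) ∧ (∀ t x, ‖g t x‖ ≤ A) ∧ (∀ t, Integrable (g t)) ∧
      (∀ t, ∫ x, ‖g t x‖ ≤ A) ∧
      ∀ t x, biotSavart (ω t) x = biotSavart (f t) x + biotSavart (g t) x := by
  have hd0 : ∀ x, 0 ≤ disc R hR x := fun x => (disc R hR).nonneg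
  have hd1 : ∀ x, disc R hR x ≤ 1 := fun x => (disc R hR).le_one
  have hdc : Continuous (disc R hR) := (disc R hR).continuous
  have hωc : ∀ t, Continuous (ω t) := fun t => h.reg.1.continuous_space () t
  have hf : ∀ t x, ‖disc R hR x * ω t x‖ ≤ ‖ω t x‖ := fun t x => by
    rw [norm_mul, Real.norm_of_nonneg (hd0 x)]
    exact mul_le_of_le_one_left (norm_nonneg _) (hd1 x)
  have hg : ∀ t x, ‖(1 - disc R hR x) * ω t x‖ ≤ ‖ω t x‖ := fun t x => by
    rw [norm_mul, Real.norm_of_nonneg (sub_nonneg.2 (hd1 x))]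
    exact mul_le_of_le_one_left (norm_nonneg _) (by linarith [hd0 x])
  have hfi : ∀ t, Integrable (fun x => disc R hR x * ω t x) := fun t =>
    (h.integrable t).mono (hdc.mul (hωc t)).aestronglyMeasurable (ae_of_all _ (hf t))
  have hgi : ∀ t, Integrable (fun x => (1 - disc R hR x) * ω t x) := fun t =>
    (h.integrable t).mono ((continuous_const.sub hdc).mul (hωc t)).aestronglyMeasurable
      (ae_of_all _ (hg t))
  refine ⟨fun t x => disc R hR x * ω t x, fun t x => (1 - disc R hR x) * ω t x, ?_,
    fun _ t x hx => ?_, fun t x hx => ?_, fun t x => (hg t x).trans (h.bound t x), hgi,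
    fun t => ?_, fun t x => ?_⟩
  · have : Reg False 1 (fun (_ : Unit) (_ : ℝ) x => disc R hR x) :=
      Reg.of_contDiff (disc R hR).contDiff
    exact this.smul h.reg
  · show disc R hR x * _ = 0
    rw [disc_eq_zero hR hx.le, zero_mul]
  · show (1 - disc R hR x) * _ = 0
    rw [disc_eq_one hR hx, sub_self, zero_mul]
  · exact (integral_mono (hgi t).norm (h.integrable t).norm (hg t)).trans (h.integral_le t)
  · rw [← biotSavart_add (fun y => (hf t y).trans (h.bound t y)) (hfi t)
      (fun y => (hg t y).trans (h.bound t y)) (hgi t)]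
    congr 1
    funext y
    ring

/-- A locally uniform limit: the part of the vorticity in a large disc has a continuous velocity,
and the rest is far from the point and contributes at most `ε`. -/
theorem continuous_biotSavart (h : IsVorticity T A ω) :
    Continuous fun p : ℝ × Plane => biotSavart (ω p.1) p.2 := by
  have hA : 0 ≤ A := (norm_nonneg _).trans (h.bound 0 0)
  rw [continuous_iff_continuousAt]
  intro p
  refine continuousAt_of_locally_uniform_approx_of_continuousAt fun u hu => ?_
  obtain ⟨ε, hε, hu⟩ := Metric.mem_uniformity_dist.1 hu
  have hr : 0 < (A + 1) / ε := by positivity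
  obtain ⟨f, g, hf, hfs, hg0, -, hgi, hgA, hs⟩ :=
    h.exists_split (R := ‖p.2‖ + 1 + (A + 1) / ε) (by positivity)
  refine ⟨{q | ‖q.2‖ < ‖p.2‖ + 1}, ?_, fun q => biotSavart (f q.1) q.2, ?_, fun q hq => hu ?_⟩
  · exact (continuous_snd.norm.tendsto p).eventually_lt_const (by linarith)
  · exact ((reg_biotSavart hf hfs).regZero.cont ()).continuousAt
  · rw [dist_eq_norm, hs, add_sub_cancel_left]
    refine (norm_biotSavart_far_le hr (hgi _) fun y hy => hg0 _ _ ?_).trans_lt ?_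
    · have := norm_sub_norm_le y q.2
      rw [norm_sub_rev] at hy
      have hq' : ‖q.2‖ < ‖p.2‖ + 1 := hq
      linarith
    · calc ((A + 1) / ε)⁻¹ * ∫ x, ‖g q.1 x‖ ≤ ((A + 1) / ε)⁻¹ * A := by
            gcongr
            exact hgA _
        _ < ε := by
          rw [inv_div, div_mul_eq_mul_div, div_lt_iff₀ (by linarith)]
          nlinarith

/-- The near part is `C¹` with bounded support, thus Hölder, and its velocity has a bounded
derivative on the ball. The far part sees the kernel only at distance at least one, where it is
Lipschitz. -/
theorem exists_lipschitz_biotSavart (h : IsVorticity T A ω) (R : ℝ) : ∃ L : ℝ, 0 ≤ L ∧ ∀ t x y,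
    ‖x‖ ≤ R → ‖y‖ ≤ R → ‖biotSavart (ω t) x - biotSavart (ω t) y‖ ≤ L * ‖x - y‖ := by
  have hA : 0 ≤ A := (norm_nonneg _).trans (h.bound 0 0)
  by_cases hR : R < 0
  · exact ⟨0, le_rfl, fun t x y hx _ => absurd ((norm_nonneg x).trans hx) (not_le.2 hR)⟩
  obtain ⟨f, g, hf, hfs, hg0, hgA, hgi, hgA', hs⟩ := h.exists_split (R := R + 1) (by linarith)
  obtain ⟨C, hC0, hC⟩ := (reg_biotSavart_succ (k := 0) hf.of_succ hfs).exists_lipschitz (max R T)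
  refine ⟨C + A, by positivity, fun t x y hx hy => ?_⟩
  rw [← h.clamp_eq t, hs, hs, add_sub_add_comm, add_mul]
  refine (norm_add_le _ _).trans (add_le_add ?_ ?_)
  · exact hC () _ x y ((abs_clamp_le_right h.nonneg t).trans (le_max_right _ _))
      (hx.trans (le_max_left _ _)) (hy.trans (le_max_left _ _))
  · have hfar : ∀ u : Plane, ‖u‖ ≤ R → ∀ y, ‖u - y‖ < 1 → g (clamp T t) y = 0 := fun u hu y hy => by
      refine hg0 _ _ ?_
      have := norm_sub_norm_le y u
      rw [norm_sub_rev] at hy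
      linarith
    refine (norm_biotSavart_far_sub_le one_pos (hgi _) (hgA _) (hfar x hx) (hfar y hy)).trans ?_
    rw [one_pow, inv_one, one_mul]
    gcongr
    exact hgA' _

end IsVorticity

/-! ### The vorticity of the vortex-wave system -/

section Characteristics

variable {T B Z R d L : ℝ} {v : ℝ → Plane → Plane} {z : ℝ → Plane} (hR : 0 < R) (hd : 0 < d)

theorem IsDrift.nonneg_Z (h : IsDrift T B Z v z) : 0 ≤ Z := (norm_nonneg _).trans (h.zbound 0)

/-- A trajectory of the cut-off drift that starts far from the point vortex and from the boundary of
the cut-off region is a trajectory of the full drift. -/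
theorem IsDrift.trajectory_mem (h : IsDrift T B Z v z)
    (hL : ∀ t x y, ‖disc R hR x • v t x - disc R hR y • v t y‖ ≤ L * ‖x - y‖) {ν : ℝ≥0}
    {γ : ℝ → Plane} (hγ : ∀ s, HasDerivAt γ (cutField T v z R hR d hd ν s (γ s)) s) {s t : ℝ}
    (hs : s ∈ Icc 0 T) (ht : t ∈ Icc 0 T) (hRt : ‖γ t‖ + 2 * Z + 2 * B * T + 1 ≤ R)
    (hdt : d * Real.exp (L * T) ≤ ‖γ t - z t‖) : ‖γ s‖ ≤ R ∧ d ≤ ‖γ s - z s‖ := by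
  have hZ := h.nonneg_Z
  have hBT : 0 ≤ B * T := mul_nonneg h.nonneg_B h.pos.le
  have hZR : Z ≤ R := by linarith [norm_nonneg (γ t)]
  constructor
  · have h1 := (h.norm_trajectory_sub_le hR hd hZR hL hγ hs ht).2
    have h2 := norm_sub_norm_le (γ s) (z s)
    have h3 := norm_sub_le (γ t) (z t)
    linarith [h.zbound s, h.zbound t]
  · have h1 := hdt.trans (h.norm_trajectory_sub_le hR hd hZR hL hγ ht hs).1
    rw [mul_comm] at h1
    exact le_of_mul_le_mul_left h1 (Real.exp_pos _)

theorem cutField_eq {ν : ℝ≥0} {t : ℝ} {x : Plane} (hx : ‖x‖ ≤ R) : cutField T v z R hR d hd ν t x =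
    v t x + swirl d hd (ν * clamp T t / (1 + ν * clamp T t), x - z t) := by
  rw [cutField, disc_eq_one hR hx, one_smul, one_smul]

theorem cutField_zero {t : ℝ} {x : Plane} (hx : ‖x‖ ≤ R) (hx' : d ≤ ‖x - z t‖) :
    cutField T v z R hR d hd 0 t x = v t x + kernelK (x - z t) := by
  rw [cutField_eq hR hd hx]
  simp [swirl_zero hd hx']

theorem cutField_lambOseen {ν : ℝ≥0} {t : ℝ} {x : Plane} (hν : 0 < ν) (ht : t ∈ Ioc 0 T)
    (hx : ‖x‖ ≤ R) (hx' : d ≤ ‖x - z t‖) : cutField T v z R hR d hd ν t x =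
      v t x + (1 / √(ν * t)) • lambOseen ((1 / √(ν * t)) • (x - z t)) := by
  have hν' : (0 : ℝ) < ν := hν
  rw [cutField_eq hR hd hx, clamp_of_mem ⟨ht.1.le, ht.2⟩,
    swirl_eq_lambOseen hd hx' (mul_pos hν' ht.1)]

/-- Transport of the vorticity along a trajectory. -/
theorem IsDrift.transport (h : IsDrift T B Z v z)
    (hL : ∀ t x y, ‖disc R hR x • v t x - disc R hR y • v t y‖ ≤ L * ‖x - y‖)
    {ω : ℝ → Plane → ℝ} (hω : ContDiffOn ℝ 1 (fun p : ℝ × Plane => ω p.1 p.2) (Icc 0 T ×ˢ univ))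
    (heq : ∀ t ∈ Icc 0 T, ∀ x, x ≠ z t → derivWithin (fun s => ω s x) (Icc 0 T) t
      + fderiv ℝ (ω t) x (v t x + kernelK (x - z t)) = 0)
    {γ : ℝ → Plane} (hγ : ∀ s, HasDerivAt γ (cutField T v z R hR d hd 0 s (γ s)) s) {t : ℝ}
    (ht : t ∈ Icc 0 T) (hRt : ‖γ t‖ + 2 * Z + 2 * B * T + 1 ≤ R)
    (hdt : d * Real.exp (L * T) ≤ ‖γ t - z t‖) : ω t (γ t) = ω 0 (γ 0) := by
  have hder : ∀ s ∈ Icc 0 T, HasDerivWithinAt (fun s => ω s (γ s)) 0 (Icc 0 T) s := fun s hs => by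
    obtain ⟨h1, h2⟩ := h.trajectory_mem hR hd hL hγ hs ht hRt hdt
    refine (hasDerivWithinAt_along h.pos hω hs (hγ s).hasDerivWithinAt).congr_deriv ?_
    rw [cutField_zero hR hd h1 h2]
    exact heq s hs (γ s) (sub_ne_zero.1 (norm_pos_iff.1 (hd.trans_le h2)))
  exact constant_of_derivWithin_zero (fun s hs => (hder s hs).differentiableWithinAt)
    (fun s hs => (hder s ⟨hs.1, hs.2.le⟩).derivWithin (uniqueDiffOn_Icc h.pos s ⟨hs.1, hs.2.le⟩)) t ht

end Characteristics

/-- The vortex-wave solution on `[0, T]` together with the constants that describe the support of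
its vorticity and a cut-off of its drift. -/
structure Background where
  (T B Z ρ δ L R d : ℝ)
  (ω₀ : Plane → ℝ)
  (ω : ℝ → Plane → ℝ)
  (z : ℝ → Plane)
  hR : 0 < R
  hd : 0 < d
  hδ : 0 < δ
  drift : IsDrift T B Z (fun t => biotSavart (ω t)) z
  clamp_ω : ∀ t, ω (clamp T t) = ω t
  supp : ∀ t x, ρ < ‖x‖ → ω t x = 0
  core : ∀ t x, ‖x - z t‖ < δ → ω t x = 0
  R_eq : ρ + 2 * Z + 2 * B * T + 1 = R
  d_eq : d * Real.exp (L * T) = δ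
  hρ : Z + δ ≤ ρ
  lip : ∀ t x y, ‖disc R hR x • biotSavart (ω t) x - disc R hR y • biotSavart (ω t) y‖ ≤ L * ‖x - y‖
  transport : ∀ t x, ω t x =
    ω₀ (flow (cutField T (fun t => biotSavart (ω t)) z R hR d hd 0) (clamp T t) x 0)
  reg_one : Reg False 1 (fun _ : ℝ≥0 => ω)
  reg_init : Reg True 3 (fun (_ : ℝ≥0) (_ : ℝ) x => ω₀ x)

/-! ### From the vortex-wave solution to the background on `[0, T]`. -/

section Construction

variable {z₀ : Plane} {ω₀ : Plane → ℝ} {z : ℝ → Plane} {ω : ℝ → Plane → ℝ}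

theorem IsVortexWaveSolution.contDiffOn_Icc (h : IsVortexWaveSolution z₀ ω₀ z ω) (T : ℝ) :
    ContDiffOn ℝ 1 (fun p : ℝ × Plane => ω p.1 p.2) (Icc 0 T ×ˢ univ) :=
  h.contDiff.mono (prod_mono Icc_subset_Ici_self Subset.rfl)

theorem IsVortexWaveSolution.eq_Icc (h : IsVortexWaveSolution z₀ ω₀ z ω) {T : ℝ} (hT : 0 < T)
    {t : ℝ} (ht : t ∈ Icc 0 T) {x : Plane} (hx : x ≠ z t) :
    derivWithin (fun s => ω s x) (Icc 0 T) t
      + fderiv ℝ (ω t) x (biotSavart (ω t) x + kernelK (x - z t)) = 0 := by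
  have h1 : DifferentiableWithinAt ℝ (fun s => ω s x) (Ici 0) t := by
    have h2 : DifferentiableWithinAt ℝ (fun s : ℝ => (s, x)) (Ici 0) t :=
      differentiableWithinAt_id.prodMk (differentiableWithinAt_const x)
    exact (h.contDiff.differentiableOn one_ne_zero (t, x) ⟨ht.1, mem_univ _⟩).comp t h2
      fun s hs => mk_mem_prod hs (mem_univ _)
  rw [derivWithin_subset Icc_subset_Ici_self (uniqueDiffOn_Icc hT t ht) h1]
  exact h.vorticity_eq t ht.1 x hx

theorem IsVortexWaveSolution.exists_isDrift (h : IsVortexWaveSolution z₀ ω₀ z ω) {T : ℝ}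
    (hT : 0 < T) : ∃ B Z : ℝ,
      IsDrift T B Z (fun t => biotSavart (ω (clamp T t))) (fun t => z (clamp T t)) := by
  obtain ⟨A, hA⟩ := h.bounded T
  have hv := IsVorticity.of_contDiffOn hT (h.contDiffOn_Icc T) hA
  obtain ⟨B, -, hB⟩ := hv.exists_bound
  have hzc : ContinuousOn z (Icc 0 T) := fun t ht =>
    ((h.point_eq t ht.1).mono Icc_subset_Ici_self).continuousWithinAt
  obtain ⟨Z, hZ⟩ := isCompact_Icc.exists_bound_of_continuousOn hzc
  refine ⟨B, Z, hT, fun t => ?_, fun t => ?_, hv.continuous_biotSavart, hB,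
    hv.exists_lipschitz_biotSavart, hzc.comp_continuous continuous_clamp (clamp_mem hT.le),
    fun t => hZ _ (clamp_mem hT.le t), fun t ht => ?_⟩
  · simp only [clamp_clamp hT.le]
  · simp only [clamp_clamp hT.le]
  · simp only [clamp_of_mem ht]
    refine ((h.point_eq t ht.1).mono Icc_subset_Ici_self).congr (fun s hs => ?_) ?_
    · rw [clamp_of_mem hs]
    · rw [clamp_of_mem ht]

/-- The supports are located before the final cut-off is available. For each single point `x ≠ z(t)`
a cut-off adapted to `x`, with large radius and small core, makes the characteristic through `x` a
trajectory of the full drift, and `ω` is constant along it. Once the supports are known, a single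
cut-off serves for all points. -/
theorem IsVortexWaveSolution.exists_background (h : IsVortexWaveSolution z₀ ω₀ z ω)
    (hs : HasCompactSupport ω₀) (hvan : ω₀ =ᶠ[𝓝 z₀] 0)
    (hreg : Reg True 3 (fun (_ : ℝ≥0) (_ : ℝ) x => ω₀ x)) {T : ℝ} (hT : 0 < T) :
    ∃ S : Background, S.T = T ∧ S.ω₀ = ω₀ ∧ (S.ω = fun t => ω (clamp T t)) ∧
      S.z = fun t => z (clamp T t) := by
  obtain ⟨B, Z, hdr⟩ := h.exists_isDrift hT
  obtain ⟨R₀, hR₀⟩ := exists_norm_le_of_hasCompactSupport hs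
  obtain ⟨δ₀, hδ₀, hδ₀'⟩ : ∃ δ₀ : ℝ, 0 < δ₀ ∧ ∀ x, ‖x - z₀‖ < δ₀ → ω₀ x = 0 := by
    obtain ⟨ε, hε, hε'⟩ := Metric.eventually_nhds_iff.1 hvan
    exact ⟨ε, hε, fun x hx => hε' (by rwa [dist_eq_norm])⟩
  have hB := hdr.nonneg_B
  have hZ := hdr.nonneg_Z
  have hBT : 0 ≤ B * T := mul_nonneg hB hT.le
  -- A trajectory of the cut-off drift changes its norm by at most `2Z + 2BT + 1`, so one that is
  -- outside radius `ρ` at time `t` starts outside the support of `ω₀`. The summand `δ₀` leaves room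
  -- for the disc around `z`. The radius `R` allows the same displacement once more.
  set ρ : ℝ := |R₀| + 2 * Z + 2 * B * T + 1 + δ₀ with hρ
  set R : ℝ := ρ + 2 * Z + 2 * B * T + 1 with hRdef
  have hρ0 : 0 ≤ ρ := by
    have := abs_nonneg R₀
    rw [hρ]
    linarith
  have hR : 0 < R := by rw [hRdef]; linarith
  have hZR : Z ≤ R := by rw [hRdef]; linarith
  obtain ⟨L, hL0, hL⟩ := hdr.exists_lipschitz hR
  -- Trajectories ending within `δ` of `z` start within `δ₀` of `z₀`; those at distance at least `δ`
  -- from `z` stay at distance at least `d = δ e^{-LT}`.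
  set δ : ℝ := δ₀ * Real.exp (-(L * T)) with hδdef
  have hδ : 0 < δ := by positivity
  have hδle : δ ≤ δ₀ := by
    refine mul_le_of_le_one_right hδ₀.le (Real.exp_le_one_iff.2 ?_)
    have := mul_nonneg hL0 hT.le
    linarith
  set d : ℝ := δ * Real.exp (-(L * T)) with hddef
  have hd : 0 < d := by positivity
  have hdδ : d * Real.exp (L * T) = δ := by
    rw [hddef, mul_assoc, ← Real.exp_add, neg_add_cancel, Real.exp_zero, mul_one]
  have hδδ : Real.exp (L * T) * δ = δ₀ := by
    rw [mul_comm, hδdef, mul_assoc, ← Real.exp_add, neg_add_cancel, Real.exp_zero, mul_one]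
  have hz0 : z (clamp T 0) = z₀ := by rw [clamp_of_mem ⟨le_rfl, hT.le⟩, h.point_zero]
  have h0mem : (0 : ℝ) ∈ Icc 0 T := ⟨le_rfl, hT.le⟩
  have heq : ∀ t ∈ Icc 0 T, ∀ x, x ≠ z (clamp T t) → derivWithin (fun s => ω s x) (Icc 0 T) t
      + fderiv ℝ (ω t) x (biotSavart (ω (clamp T t)) x + kernelK (x - z (clamp T t))) = 0 := by
    intro t ht x hx
    rw [clamp_of_mem ht] at hx ⊢
    exact h.eq_Icc hT ht hx
  have hz00 : ∀ {R' : ℝ} (hR' : 0 < R') {d' : ℝ} (hd' : 0 < d') {γ : ℝ → Plane}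
      (_ : Z ≤ R') (_ : ∀ s, HasDerivAt γ (cutField T (fun t => biotSavart (ω (clamp T t)))
        (fun t => z (clamp T t)) R' hR' d' hd' 0 s (γ s)) s) {t : ℝ} (_ : t ∈ Icc 0 T)
        (_ : ρ < ‖γ t‖), ω₀ (γ 0) = 0 := by
    intro R' hR' d' hd' γ hZR' hγ t ht hx
    obtain ⟨L', hL0', hL'⟩ := hdr.exists_lipschitz hR'
    refine hR₀ _ ?_
    have h1 := (hdr.norm_trajectory_sub_le hR' hd' hZR' hL' hγ ht h0mem).2
    have h2 := norm_sub_norm_le (γ t) (z (clamp T t))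
    have h3 := norm_sub_le (γ 0) (z (clamp T 0))
    have h4 : ‖z (clamp T t)‖ ≤ Z := hdr.zbound t
    have h5 : ‖z (clamp T 0)‖ ≤ Z := hdr.zbound 0
    have h6 := le_abs_self R₀
    linarith
  have hsupp : ∀ t ∈ Icc 0 T, ∀ x, ρ < ‖x‖ → ω t x = 0 := by
    intro t ht x hx
    have hxz : x ≠ z (clamp T t) := by
      rintro rfl
      have : ‖z (clamp T t)‖ ≤ Z := hdr.zbound t
      have := abs_nonneg R₀
      linarith
    -- Radius and core of this cut-off are the extreme values for which the trajectory through `x`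
    -- still follows the full drift.
    have hR' : 0 < ‖x‖ + 2 * Z + 2 * B * T + 1 := by positivity
    obtain ⟨L', hL0', hL'⟩ := hdr.exists_lipschitz hR'
    have hn : 0 < ‖x - z (clamp T t)‖ := norm_pos_iff.2 (sub_ne_zero.2 hxz)
    have hd' : 0 < ‖x - z (clamp T t)‖ * Real.exp (-(L' * T)) := by positivity
    obtain ⟨K, M, hlip⟩ := hdr.isLipField hR' hd'
    have hγ := hlip.hasDerivAt_flow 0 t x
    have hγt := hlip.flow_self 0 t x
    have h1 := hdr.transport hR' hd' hL' (h.contDiffOn_Icc T) heq hγ ht (by rw [hγt])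
      (by rw [hγt, mul_assoc, ← Real.exp_add, neg_add_cancel, Real.exp_zero, mul_one])
    rw [hγt, h.vorticity_zero] at h1
    rw [h1]
    exact hz00 hR' hd' (by linarith [norm_nonneg x]) hγ ht (by rwa [hγt])
  have hcont : ∀ t ∈ Icc 0 T, Continuous (ω t) := fun t ht => by
    have := (reg_clamp_of_contDiffOn (Λ := Unit) hT (h.contDiffOn_Icc T)).1.continuous_space () t
    rwa [clamp_of_mem ht] at this
  have hcore : ∀ t ∈ Icc 0 T, ∀ x, ‖x - z (clamp T t)‖ < δ → ω t x = 0 := by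
    intro t ht
    have key : ∀ x, ‖x - z (clamp T t)‖ < δ → x ≠ z (clamp T t) → ω t x = 0 := by
      intro x hx hxz
      have hn : 0 < ‖x - z (clamp T t)‖ := norm_pos_iff.2 (sub_ne_zero.2 hxz)
      have hd' : 0 < ‖x - z (clamp T t)‖ * Real.exp (-(L * T)) := by positivity
      obtain ⟨K, M, hlip⟩ := hdr.isLipField hR hd'
      have hγ := hlip.hasDerivAt_flow 0 t x
      have hγt := hlip.flow_self 0 t x
      have hxρ : ‖x‖ ≤ ρ := by
        have h1 := norm_sub_norm_le x (z (clamp T t))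
        have h2 : ‖z (clamp T t)‖ ≤ Z := hdr.zbound t
        have h3 := abs_nonneg R₀
        linarith
      have h1 := hdr.transport hR hd' hL (h.contDiffOn_Icc T) heq hγ ht (by rw [hγt]; linarith)
        (by rw [hγt, mul_assoc, ← Real.exp_add, neg_add_cancel, Real.exp_zero, mul_one])
      rw [hγt, h.vorticity_zero] at h1
      rw [h1]
      refine hδ₀' _ ?_
      have h2 := (hdr.norm_trajectory_sub_le hR hd' hZR hL hγ h0mem ht).1
      simp only [hγt, hz0] at h2
      refine h2.trans_lt ?_
      rw [← hδδ]
      exact mul_lt_mul_of_pos_left hx (Real.exp_pos _)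
    intro x hx
    by_cases hxz : x = z (clamp T t)
    -- At the point vortex itself no characteristic is available; the value is the limit of the
    -- values nearby.
    · have h1 : Tendsto (ω t) (𝓝[≠] x) (𝓝 (ω t x)) :=
        ((hcont t ht).tendsto x).mono_left nhdsWithin_le_nhds
      have h2 : ∀ᶠ y in 𝓝[≠] x, ω t y = 0 := by
        have h3 : ∀ᶠ y in 𝓝[≠] x, ‖y - z (clamp T t)‖ < δ := by
          refine nhdsWithin_le_nhds ?_
          exact ((continuous_id.sub continuous_const).norm.tendsto x).eventually_lt_const hx
        filter_upwards [h3, self_mem_nhdsWithin] with y hy hyx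
        exact key y hy (hxz ▸ hyx)
      exact tendsto_nhds_unique h1 (tendsto_const_nhds.congr' (h2.mono fun y hy => hy.symm))
    · exact key x hx hxz
  obtain ⟨K, M, hlip⟩ := hdr.isLipField hR hd
  -- Outside radius `ρ` and within `δ` of the vortex both sides vanish. In between, the trajectory
  -- of the cut-off drift is a genuine characteristic.
  have htrans : ∀ t ∈ Icc 0 T, ∀ x, ω t x = ω₀ (flow (cutField T
      (fun t => biotSavart (ω (clamp T t))) (fun t => z (clamp T t)) R hR d hd 0) t x 0) := by
    intro t ht x
    have hγ := hlip.hasDerivAt_flow 0 t x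
    have hγt := hlip.flow_self 0 t x
    by_cases hx : ρ < ‖x‖
    · rw [hsupp t ht x hx, hz00 hR hd hZR hγ ht (by rwa [hγt])]
    by_cases hx' : ‖x - z (clamp T t)‖ < δ
    · rw [hcore t ht x hx', hδ₀' _ ?_]
      have h2 := (hdr.norm_trajectory_sub_le hR hd hZR hL hγ h0mem ht).1
      simp only [hγt, hz0] at h2
      refine h2.trans_lt ?_
      rw [← hδδ]
      exact mul_lt_mul_of_pos_left hx' (Real.exp_pos _)
    · have h1 := hdr.transport hR hd hL (h.contDiffOn_Icc T) heq hγ ht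
        (by rw [hγt]; linarith) (by rw [hγt, hdδ]; exact not_lt.1 hx')
      rwa [hγt, h.vorticity_zero] at h1
  refine ⟨⟨T, B, Z, ρ, δ, L, R, d, ω₀, fun t => ω (clamp T t), fun t => z (clamp T t), hR, hd, hδ,
    hdr, fun t => ?_, fun t => hsupp _ (clamp_mem hT.le t), fun t x hx => ?_, rfl, hdδ, ?_, hL,
    fun t => htrans _ (clamp_mem hT.le t), reg_clamp_of_contDiffOn hT (h.contDiffOn_Icc T), hreg⟩,
    rfl, rfl, rfl, rfl⟩
  · simp only [clamp_clamp hT.le]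
  · refine hcore _ (clamp_mem hT.le t) x ?_
    simpa only [clamp_clamp hT.le] using hx
  · have := abs_nonneg R₀
    linarith

end Construction

/-! ### Regularity of the vorticity and the velocity of the background. -/

namespace Background

variable (S : Background)

/-- The velocity field of the vorticity. -/
def v (t : ℝ) : Plane → Plane := biotSavart (S.ω t)

/-- The cut-off drift with viscosity `ν`. -/
def b : ℝ≥0 → ℝ → Plane → Plane := cutField S.T S.v S.z S.R S.hR S.d S.hd

theorem suppIn : SuppIn S.ρ (fun _ : ℝ≥0 => S.ω) := fun _ t x hx => S.supp t x hx

theorem exists_isLipField : ∃ K M : ℝ≥0, IsLipField S.b K M := S.drift.isLipField S.hR S.hd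

theorem reg_flow {H : Prop} {k : ℕ} (hv : Reg H (k + 1) (fun _ : ℝ≥0 => S.v)) :
    Reg H (k + 1) (fun ν t x => flow (S.b ν) 0 x t) ∧
      Reg H (k + 1) (fun ν t x => flow (S.b ν) t x 0) := by
  obtain ⟨K, M, hlip⟩ := S.exists_isLipField
  have hb : Reg H (k + 1) S.b := S.drift.reg_cutField S.hR S.hd hv
  exact ⟨hlip.reg_forward hb, hlip.reg_backward hb⟩

/-- The flow inherits the regularity of the velocity, and `ω` is the initial vorticity composed with
the inverse flow for `ν = 0`. -/
theorem reg_of_velocity {H : Prop} {k : ℕ} (hk : k + 1 ≤ 3)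
    (hv : Reg H (k + 1) (fun _ : ℝ≥0 => S.v)) (h0 : Reg H (k + 1) (fun (_ : ℝ≥0) (_ : ℝ) x => S.ω₀ x)) :
    Reg H (k + 1) (fun _ : ℝ≥0 => S.ω) := by
  have hY : Reg H (k + 1) (fun (_ : ℝ≥0) t x => flow (S.b 0) (clamp S.T t) x 0) :=
    ((S.reg_flow hv).2.reindex (fun _ : ℝ≥0 => 0)).clampTime S.drift.pos.le
  have h1 := Reg.comp h0 hY (hY.of_le (by omega)).weaken
  have : (fun _ : ℝ≥0 => S.ω) =
      fun (_ : ℝ≥0) t x => S.ω₀ (flow (S.b 0) (clamp S.T t) x 0) := by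
    funext _ t x
    exact S.transport t x
  rwa [this]

/-- One round of the bootstrap: `v` of order `k + 1` gives `ω` of order `k + 1` without Hölder
bound, hence `v` with Hölder bound at that order, hence `ω` with it, and then `v` of order `k + 2`.
The round stops at the three derivatives of the initial vorticity. -/
theorem reg_velocity_of_le : ∀ {k : ℕ}, k ≤ 3 → Reg False (k + 1) (fun _ : ℝ≥0 => S.v) ∧
    Reg True k (fun _ : ℝ≥0 => S.ω)
  | 0, _ => by
    have : Reg True 0 (fun _ : ℝ≥0 => S.ω) := S.reg_one.of_succ
    exact ⟨reg_biotSavart_succ this S.suppIn, this⟩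
  | k + 1, hk => by
    have h1 := (reg_velocity_of_le (k := k) (by omega)).1
    have h2 := S.reg_of_velocity hk h1 ((S.reg_init.of_le hk).weaken)
    have h3 : Reg True (k + 1) (fun _ : ℝ≥0 => S.v) := reg_biotSavart h2 S.suppIn
    have h4 := S.reg_of_velocity hk h3 (S.reg_init.of_le hk)
    exact ⟨reg_biotSavart_succ h4 S.suppIn, h4⟩

theorem reg_ω : Reg True 3 (fun _ : ℝ≥0 => S.ω) := (S.reg_velocity_of_le le_rfl).2

theorem reg_v : Reg False 4 (fun _ : ℝ≥0 => S.v) := (S.reg_velocity_of_le le_rfl).1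

end Background

/-! ### Construction of the correction -/

/-- The trace of a bilinear form. -/
def traceForm : (Plane →L[ℝ] Plane →L[ℝ] ℝ) →L[ℝ] ℝ :=
  ∑ i, (ContinuousLinearMap.apply ℝ ℝ (e i)).comp
    (ContinuousLinearMap.apply ℝ (Plane →L[ℝ] ℝ) (e i))

/-- As a fixed linear image of the second derivative, the Laplacian falls under `Reg.clm` and under
the estimates for linear maps. -/
theorem laplacian_eq_traceForm (f : Plane → ℝ) (x : Plane) :
    (Δ f) x = traceForm (fderiv ℝ (fderiv ℝ f) x) := by
  rw [InnerProductSpace.laplacian_eq_iteratedFDeriv_orthonormalBasis f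
    (EuclideanSpace.basisFun (Fin 2) ℝ)]
  simp [traceForm, iteratedFDeriv_two_apply, e]

theorem exists_norm_biotSavart_le_of_support (R : ℝ) : ∃ C : ℝ, 0 ≤ C ∧ ∀ (A : ℝ) (f : Plane → ℝ),
    Continuous f → (∀ y, ‖f y‖ ≤ A) → (∀ y, R < ‖y‖ → f y = 0) → ∀ x, ‖biotSavart f x‖ ≤ C * A := by
  obtain ⟨C, hC0, hC⟩ := exists_norm_biotSavart_le
  refine ⟨C * (1 + volume.real (Metric.closedBall (0 : Plane) R)), by positivity,
    fun A f hf hA hR x => ?_⟩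
  obtain ⟨h1, h2⟩ := integrable_of_support hf hA hR
  calc _ ≤ C * (A + ∫ y, ‖f y‖) := hC A f hA h1 x
    _ ≤ C * (A + A * volume.real (Metric.closedBall (0 : Plane) R)) := by gcongr
    _ = _ := by ring

theorem integral_exp_mul_le {c : ℝ} (hc : 0 < c) (t : ℝ) :
    ∫ s in (0 : ℝ)..t, Real.exp (c * s) ≤ Real.exp (c * t) / c := by
  have h : ∀ s ∈ uIcc 0 t, HasDerivAt (fun s => Real.exp (c * s) / c) (Real.exp (c * s)) s := by
    intro s _
    have h1 : HasDerivAt (fun s => Real.exp (c * s)) (Real.exp (c * s) * c) s := by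
      simpa using ((hasDerivAt_id s).const_mul c).exp
    refine (h1.div_const c).congr_deriv ?_
    field_simp
  rw [intervalIntegral.integral_eq_sub_of_hasDerivAt h
    ((by fun_prop : Continuous fun s => Real.exp (c * s)).intervalIntegrable _ _)]
  have : 0 ≤ Real.exp (c * 0) / c := by positivity
  linarith

namespace Background

variable (S : Background)

/-- Integration along the trajectories of the cut-off drift. -/
def duhamel (ν : ℝ≥0) (g : ℝ → Plane → ℝ) (t : ℝ) (x : Plane) : ℝ :=
  ∫ s in (0 : ℝ)..t, g s (flow (S.b ν) 0 (flow (S.b ν) t x 0) s)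

/-- The right-hand side of the transport equation of the correction with velocity `u`. -/
def source (u : ℝ → Plane → Plane) (s : ℝ) (y : Plane) : ℝ :=
  (Δ (S.ω s)) y - fderiv ℝ (S.ω s) y (u s y)

/-- The solution of the transport equation with velocity `u` on the right-hand side. -/
def response (ν : ℝ≥0) (u : ℝ → Plane → Plane) (t : ℝ) : Plane → ℝ :=
  S.duhamel ν (S.source u) (clamp S.T t)

variable {Λ : Type} {H : Prop} {k : ℕ}

theorem duhamel_eq (ν : ℝ≥0) (g : ℝ → Plane → ℝ) (t : ℝ) (x : Plane) :
    S.duhamel ν g t x = ∫ s in (0 : ℝ)..t, g s (flow (S.b ν) t x s) := by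
  obtain ⟨K, M, hlip⟩ := S.exists_isLipField
  simp only [duhamel, hlip.flow_flow]

theorem reg_flow_forward : Reg False 4 (fun ν t x => flow (S.b ν) 0 x t) := (S.reg_flow S.reg_v).1

theorem reg_flow_backward : Reg False 4 (fun ν t x => flow (S.b ν) t x 0) := (S.reg_flow S.reg_v).2

theorem reg_integral_forward (hk : k ≤ 3) (φ : Λ → ℝ≥0) {g : Λ → ℝ → Plane → ℝ} (hg : Reg H k g) :
    Reg H k (fun l t y => ∫ s in (0 : ℝ)..t, g l s (flow (S.b (φ l)) 0 y s)) := by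
  have hX := S.reg_flow_forward.reindex φ
  have hX' : Reg H k (fun l t x => flow (S.b (φ l)) 0 x t) := (hX.of_succ (H₂ := H)).of_le hk
  exact (Reg.comp hg hX' (hX.of_le (by norm_num))).integral

theorem reg_duhamel (hk : k ≤ 3) (φ : Λ → ℝ≥0) {g : Λ → ℝ → Plane → ℝ} (hg : Reg H k g) :
    Reg H k (fun l t x => S.duhamel (φ l) (g l) t x) := by
  have hY := S.reg_flow_backward.reindex φ
  have hY' : Reg H k (fun l t x => flow (S.b (φ l)) t x 0) := (hY.of_succ (H₂ := H)).of_le hk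
  have h1 : Reg False 1 (fun l t x => flow (S.b (φ l)) t x 0) := hY.of_le (by norm_num)
  have h2 := Reg.comp (S.reg_integral_forward hk φ hg) hY' h1
  exact h2

theorem reg_laplacian : Reg True 1 (fun (_ : ℝ≥0) s y => (Δ (S.ω s)) y) := by
  have h := S.reg_ω.2.2.2.2
  have h1 := Reg.clm (G := ℝ) traceForm h
  have : (fun (_ : ℝ≥0) s y => (Δ (S.ω s)) y) =
      fun (_ : ℝ≥0) s y => traceForm (fderiv ℝ (fderiv ℝ (S.ω s)) y) := by
    funext _ s y
    exact laplacian_eq_traceForm _ _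
  rw [this]
  exact h1

theorem reg_fderiv_ω : Reg True 2 (fun (_ : ℝ≥0) s y => fderiv ℝ (S.ω s) y) := S.reg_ω.2.2

theorem reg_source (φ : Λ → ℝ≥0) {u : Λ → ℝ → Plane → Plane} (h0 : Reg H k (fun (_ : ℝ≥0) s y => (Δ (S.ω s)) y))
    (h1 : Reg H k (fun (_ : ℝ≥0) s y => fderiv ℝ (S.ω s) y)) (hu : Reg H k u) :
    Reg H k (fun l => S.source (u l)) :=
  (h0.reindex φ).sub ((h1.reindex φ).clm_apply hu)

theorem laplacian_supp {s : ℝ} {y : Plane} (hy : S.ρ < ‖y‖) : (Δ (S.ω s)) y = 0 := by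
  rw [laplacian_eq_traceForm]
  have := (S.suppIn.fderiv.fderiv) 0 s y hy
  simp only at this
  rw [show fderiv ℝ (fderiv ℝ (S.ω s)) y = 0 from this, map_zero]

theorem fderiv_supp {s : ℝ} {y : Plane} (hy : S.ρ < ‖y‖) : fderiv ℝ (S.ω s) y = 0 :=
  S.suppIn.fderiv 0 s y hy

theorem eventually_core {s : ℝ} {y : Plane} (hy : ‖y - S.z s‖ < S.δ) : S.ω s =ᶠ[𝓝 y] fun _ => 0 := by
  have h3 : ∀ᶠ x in 𝓝 y, ‖x - S.z s‖ < S.δ :=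
    ((continuous_id.sub continuous_const).norm.tendsto y).eventually_lt_const hy
  filter_upwards [h3] with x hx using S.core s x hx

/-- Both terms of the source contain derivatives of `ω` at `y`, so the source vanishes near the
vortex whatever the velocity `u` is. -/
theorem source_core {u : ℝ → Plane → Plane} {s : ℝ} {y : Plane} (hy : ‖y - S.z s‖ < S.δ) :
    S.source u s y = 0 := by
  have h := S.eventually_core hy
  have h1 : fderiv ℝ (S.ω s) =ᶠ[𝓝 y] fun _ => 0 := by
    refine h.fderiv.trans (Eventually.of_forall fun x => ?_)
    simp
  rw [source, laplacian_eq_traceForm, h1.fderiv_eq, h1.self_of_nhds]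
  simp

theorem source_supp {u : ℝ → Plane → Plane} {s : ℝ} {y : Plane} (hy : S.ρ < ‖y‖) :
    S.source u s y = 0 := by
  rw [source, S.laplacian_supp hy, S.fderiv_supp hy]
  simp

theorem exists_bound_source : ∃ A : ℝ, 0 ≤ A ∧ ∀ s y, ‖(Δ (S.ω s)) y‖ ≤ A ∧
    ‖fderiv ℝ (S.ω s) y‖ ≤ A := by
  obtain ⟨A, hA0, hA⟩ := S.reg_laplacian.regZero.exists_bound (R := S.ρ)
    (fun _ s y hy => S.laplacian_supp hy) S.T
  obtain ⟨A', hA0', hA'⟩ := S.reg_fderiv_ω.regZero.exists_bound S.suppIn.fderiv S.T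
  refine ⟨max A A', le_max_of_le_left hA0, fun s y => ?_⟩
  rw [← S.clamp_ω s]
  have := abs_clamp_le_right S.drift.pos.le s
  exact ⟨(hA 0 _ y this).trans (le_max_left _ _), (hA' 0 _ y this).trans (le_max_right _ _)⟩

theorem hZR : S.Z ≤ S.R := by
  have h1 := S.drift.nonneg_Z
  have h2 : 0 ≤ S.B * S.T := mul_nonneg S.drift.nonneg_B S.drift.pos.le
  linarith [S.R_eq, S.hρ, S.hδ]

/-- Trajectories through points far away, or close to the point vortex, avoid the support of the
vorticity. -/
theorem trajectory_avoids {ν : ℝ≥0} {γ : ℝ → Plane}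
    (hγ : ∀ s, HasDerivAt γ (S.b ν s (γ s)) s) {s t : ℝ} (hs : s ∈ Icc 0 S.T)
    (ht : t ∈ Icc 0 S.T) (h : S.R < ‖γ t‖ ∨ ‖γ t - S.z t‖ < S.d) :
    S.ρ < ‖γ s‖ ∨ ‖γ s - S.z s‖ < S.δ := by
  rcases h with h | h
  · left
    have h1 := (S.drift.norm_trajectory_sub_le S.hR S.hd S.hZR S.lip hγ ht hs).2
    have h2 := norm_sub_norm_le (γ t) (S.z t)
    have h3 := norm_sub_le (γ s) (S.z s)
    linarith [S.drift.zbound t, S.drift.zbound s, S.R_eq]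
  · right
    have h1 := (S.drift.norm_trajectory_sub_le S.hR S.hd S.hZR S.lip hγ hs ht).1
    refine h1.trans_lt ?_
    rw [← S.d_eq, mul_comm S.d]
    exact mul_lt_mul_of_pos_left h (Real.exp_pos _)

theorem duhamel_eq_zero {ν : ℝ≥0} {g : ℝ → Plane → ℝ} (h1 : ∀ s y, S.ρ < ‖y‖ → g s y = 0)
    (h2 : ∀ s y, ‖y - S.z s‖ < S.δ → g s y = 0) {t : ℝ} (ht : t ∈ Icc 0 S.T) {x : Plane}
    (hx : S.R < ‖x‖ ∨ ‖x - S.z t‖ < S.d) : S.duhamel ν g t x = 0 := by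
  obtain ⟨K, M, hlip⟩ := S.exists_isLipField
  rw [duhamel_eq]
  refine intervalIntegral.integral_zero_ae (ae_of_all _ fun s hs => ?_)
  rw [uIoc_of_le ht.1] at hs
  rcases S.trajectory_avoids (hlip.hasDerivAt_flow ν t x) (s := s) ⟨hs.1.le, hs.2.trans ht.2⟩ ht
    (by rwa [hlip.flow_self]) with h | h
  · exact h1 _ _ h
  · exact h2 _ _ h

/-- The trajectory through such a point avoids the support of the source on all of `[0, t]`, so the
integrand vanishes identically. -/
theorem response_eq_zero (ν : ℝ≥0) (u : ℝ → Plane → Plane) {t : ℝ} {x : Plane}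
    (hx : S.R < ‖x‖ ∨ ‖x - S.z t‖ < S.d) : S.response ν u t x = 0 := by
  refine S.duhamel_eq_zero (fun s y => S.source_supp) (fun s y => S.source_core)
    (clamp_mem S.drift.pos.le t) ?_
  rwa [S.drift.clamp_z]

theorem suppIn_response (φ : Λ → ℝ≥0) (u : Λ → ℝ → Plane → Plane) :
    SuppIn S.R (fun l => S.response (φ l) (u l)) := fun l _ _ hx =>
  S.response_eq_zero (φ l) (u l) (Or.inl hx)

theorem reg_response (hk : k ≤ 3) (φ : Λ → ℝ≥0) {u : Λ → ℝ → Plane → Plane}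
    (h0 : Reg H k (fun (_ : ℝ≥0) s y => (Δ (S.ω s)) y))
    (h1 : Reg H k (fun (_ : ℝ≥0) s y => fderiv ℝ (S.ω s) y)) (hu : Reg H k u) :
    Reg H k (fun l => S.response (φ l) (u l)) :=
  (S.reg_duhamel hk φ (S.reg_source φ h0 h1 hu)).clampTime S.drift.pos.le

theorem norm_duhamel_le {ν : ℝ≥0} {g : ℝ → Plane → ℝ} {G : ℝ → ℝ} (hG : Continuous G) {t : ℝ}
    (ht : t ∈ Icc 0 S.T) (h : ∀ s ∈ Icc 0 S.T, ∀ y, ‖g s y‖ ≤ G s) (x : Plane) :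
    ‖S.duhamel ν g t x‖ ≤ ∫ s in (0 : ℝ)..t, G s := by
  refine intervalIntegral.norm_integral_le_of_norm_le ht.1 (ae_of_all _ fun s hs => ?_)
    (hG.intervalIntegrable _ _)
  exact h s ⟨hs.1.le, hs.2.trans ht.2⟩ _

theorem continuous_source {u : ℝ → Plane → Plane}
    (hu : Continuous fun p : ℝ × Plane => u p.1 p.2) :
    Continuous fun p : ℝ × Plane => S.source u p.1 p.2 :=
  (S.reg_laplacian.regZero.cont 0).sub ((S.reg_fderiv_ω.regZero.cont 0).clm_apply hu)

theorem duhamel_sub (ν : ℝ≥0) {g₁ g₂ : ℝ → Plane → ℝ}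
    (h₁ : Continuous fun p : ℝ × Plane => g₁ p.1 p.2)
    (h₂ : Continuous fun p : ℝ × Plane => g₂ p.1 p.2) (t : ℝ) (x : Plane) :
    S.duhamel ν (fun s y => g₁ s y - g₂ s y) t x = S.duhamel ν g₁ t x - S.duhamel ν g₂ t x := by
  have hX : Continuous fun s => flow (S.b ν) 0 (flow (S.b ν) t x 0) s :=
    (S.reg_flow_forward.regZero.cont ν).comp (continuous_id.prodMk continuous_const)
  exact intervalIntegral.integral_sub
    ((h₁.comp (continuous_id.prodMk hX)).intervalIntegrable _ _)
    ((h₂.comp (continuous_id.prodMk hX)).intervalIntegrable _ _)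

theorem continuous_response (ν : ℝ≥0) {u : ℝ → Plane → Plane}
    (hu : Continuous fun p : ℝ × Plane => u p.1 p.2) :
    RegZero False (fun _ : Unit => S.response ν u) := by
  have hu' : Reg False 0 (fun _ : Unit => u) := by
    refine ⟨fun _ => hu, fun R => ?_, False.elim⟩
    obtain ⟨C, hC⟩ := ((isCompact_closedBall (0 : ℝ) R).prod
      (isCompact_closedBall (0 : Plane) R)).exists_bound_of_continuousOn hu.continuousOn
    exact ⟨C, fun l t x ht hx => hC (t, x) ⟨by simpa using ht, by simpa using hx⟩⟩
  exact S.reg_response (Nat.zero_le _) (fun _ : Unit => ν) (S.reg_laplacian.of_le (Nat.zero_le _)).weaken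
    (S.reg_fderiv_ω.of_le (Nat.zero_le _)).weaken hu'

/-- The correction and its velocity, for all viscosities. -/
theorem exists_velocity : ∃ u : ℝ≥0 → ℝ → Plane → Plane, RegZero False u ∧
    ∀ ν t x, u ν t x = biotSavart (S.response ν (u ν) t) x := by
  obtain ⟨A, hA0, hA⟩ := S.exists_bound_source
  obtain ⟨C, hC0, hC⟩ := exists_norm_biotSavart_le_of_support S.R
  -- The fixed point map has Lipschitz constant at most `C A / c`, which this choice makes at most
  -- `1/2`.
  set c : ℝ := 2 * (C * A) + 1 with hc
  have hc0 : 0 < c := by positivity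
  have hT := S.drift.pos
  let E := BoundedContinuousFunction (ℝ × Plane) Plane
  -- The unknown is rescaled as `u = e^{ct} U`. Integration in time then gains `1/c`, so the map
  -- contracts on the whole of `[0, T]` at once.
  let up : E → ℝ → Plane → Plane := fun U t x => Real.exp (c * clamp S.T t) • U (t, x)
  have hup : ∀ U, Continuous fun p : ℝ × Plane => up U p.1 p.2 := fun U => by
    have h1 : Continuous fun p : ℝ × Plane => Real.exp (c * clamp S.T p.1) :=
      Real.continuous_exp.comp (continuous_const.mul (continuous_clamp.comp continuous_fst))
    exact h1.smul U.continuous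
  have hrc : ∀ ν U t, Continuous (S.response ν (up U) t) := fun ν U t =>
    (S.continuous_response ν (hup U)).continuous_space () t
  have hdiff : ∀ ν (U V : E) t x, ‖S.response ν (up U) t x - S.response ν (up V) t x‖ ≤
      A * ‖U - V‖ * (Real.exp (c * clamp S.T t) / c) := by
    intro ν U V t x
    rw [response, response, ← S.duhamel_sub ν (S.continuous_source (hup U))
      (S.continuous_source (hup V))]
    refine (S.norm_duhamel_le (G := fun s => A * ‖U - V‖ * Real.exp (c * s)) (by fun_prop)
      (clamp_mem hT.le t) (fun s hs y => ?_) x).trans ?_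
    · have e1 : S.source (up U) s y - S.source (up V) s y =
          -fderiv ℝ (S.ω s) y (up U s y - up V s y) := by
        rw [source, source, map_sub]
        ring
      have e2 : ‖up U s y - up V s y‖ ≤ Real.exp (c * s) * ‖U - V‖ := by
        show ‖Real.exp (c * clamp S.T s) • U (s, y) - Real.exp (c * clamp S.T s) • V (s, y)‖ ≤ _
        rw [← smul_sub, norm_smul, Real.norm_of_nonneg (Real.exp_nonneg _), clamp_of_mem hs]
        gcongr
        exact (U - V).norm_coe_le_norm (s, y)
      rw [e1, norm_neg]
      calc _ ≤ A * (Real.exp (c * s) * ‖U - V‖) :=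
            ((fderiv ℝ (S.ω s) y).le_opNorm _).trans (mul_le_mul (hA s y).2 e2 (norm_nonneg _) hA0)
        _ = _ := by ring
    · rw [intervalIntegral.integral_const_mul]
      exact mul_le_mul_of_nonneg_left (integral_exp_mul_le hc0 _) (by positivity)
  have hzero : ∀ ν t x, ‖S.response ν (up 0) t x‖ ≤ A * S.T := by
    intro ν t x
    refine (S.norm_duhamel_le (G := fun s => A) continuous_const
      (clamp_mem hT.le t) (fun s hs y => ?_) x).trans ?_
    · have : up 0 s y = 0 := smul_zero _
      rw [source, this, map_zero, sub_zero]
      exact (hA s y).1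
    · rw [intervalIntegral.integral_const, smul_eq_mul, sub_zero, mul_comm]
      exact mul_le_mul_of_nonneg_left (clamp_mem hT.le t).2 hA0
  have hbd : ∀ ν U t x, ‖biotSavart (S.response ν (up U) t) x‖ ≤
      C * (A * S.T) + C * (A * ‖U‖ * (Real.exp (c * clamp S.T t) / c)) := by
    intro ν U t x
    rw [← mul_add]
    refine hC _ _ (hrc ν U t) (fun y => ?_) (fun y hy => S.response_eq_zero ν _ (Or.inl hy)) x
    have h1 := hdiff ν U 0 t y
    rw [sub_zero] at h1
    calc _ = ‖S.response ν (up 0) t y + (S.response ν (up U) t y - S.response ν (up 0) t y)‖ := by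
          rw [add_sub_cancel]
      _ ≤ _ := (norm_add_le _ _).trans (add_le_add (hzero ν t y) h1)
  have hexp : ∀ t, Real.exp (-(c * clamp S.T t)) ≤ 1 := fun t => by
    rw [Real.exp_le_one_iff]
    have := mul_nonneg hc0.le (clamp_mem hT.le t).1
    linarith
  have hexp2 : ∀ t, Real.exp (-(c * clamp S.T t)) * (Real.exp (c * clamp S.T t) / c) = 1 / c :=
    fun t => by rw [← mul_div_assoc, ← Real.exp_add, neg_add_cancel, Real.exp_zero]
  have hΨ : ∀ ν (U : E), ∃ V : E, ∀ p, V p =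
      Real.exp (-(c * clamp S.T p.1)) • biotSavart (S.response ν (up U) p.1) p.2 := by
    intro ν U
    have hcont : Continuous fun p : ℝ × Plane =>
        Real.exp (-(c * clamp S.T p.1)) • biotSavart (S.response ν (up U) p.1) p.2 := by
      have h1 : Continuous fun p : ℝ × Plane => Real.exp (-(c * clamp S.T p.1)) :=
        Real.continuous_exp.comp
          (continuous_const.mul (continuous_clamp.comp continuous_fst)).neg
      have h2 : Reg False 0 (fun _ : Unit => S.response ν (up U)) := S.continuous_response ν (hup U)
      exact h1.smul ((reg_biotSavart h2
        (S.suppIn_response (fun _ => ν) (fun _ => up U))).regZero.cont ())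
    refine ⟨BoundedContinuousFunction.ofNormedAddCommGroup _ hcont
      (C * (A * S.T) + C * (A * ‖U‖ * (1 / c))) fun p => ?_, fun p => rfl⟩
    rw [norm_smul, Real.norm_of_nonneg (Real.exp_nonneg _)]
    refine (mul_le_mul_of_nonneg_left (hbd ν U p.1 p.2) (Real.exp_nonneg _)).trans ?_
    rw [mul_add]
    refine add_le_add (mul_le_of_le_one_left (by positivity) (hexp _)) (le_of_eq ?_)
    rw [← hexp2 p.1]
    ring
  choose Ψ hΨ using hΨ
  have hlip : ∀ ν, ContractingWith (1 / 2 : ℝ≥0) (Ψ ν) := by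
    intro ν
    refine ⟨by norm_num, LipschitzWith.of_dist_le_mul fun U V => ?_⟩
    rw [BoundedContinuousFunction.dist_le (by positivity)]
    intro p
    have hb : ∀ W : E, (∀ y, ‖S.response ν (up W) p.1 y‖ ≤
        A * S.T + A * ‖W‖ * (Real.exp (c * clamp S.T p.1) / c)) := fun W y => by
      have h1 := hdiff ν W 0 p.1 y
      rw [sub_zero] at h1
      calc _ = ‖S.response ν (up 0) p.1 y +
            (S.response ν (up W) p.1 y - S.response ν (up 0) p.1 y)‖ := by rw [add_sub_cancel]
        _ ≤ _ := (norm_add_le _ _).trans (add_le_add (hzero ν p.1 y) h1)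
    have hi : ∀ W : E, Integrable (S.response ν (up W) p.1) := fun W =>
      (integrable_of_support (hrc ν W p.1) (hb W)
        (fun y hy => S.response_eq_zero ν _ (Or.inl hy))).1
    rw [dist_eq_norm, hΨ, hΨ, ← smul_sub, ← biotSavart_sub (hb U) (hi U) (hb V) (hi V), norm_smul,
      Real.norm_of_nonneg (Real.exp_nonneg _)]
    have h1 := hC _ _ ((hrc ν U p.1).sub (hrc ν V p.1)) (hdiff ν U V p.1)
      (fun y hy => by
        show _ - _ = (0 : ℝ)
        rw [S.response_eq_zero ν _ (Or.inl hy), S.response_eq_zero ν _ (Or.inl hy), sub_zero]) p.2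
    refine (mul_le_mul_of_nonneg_left h1 (Real.exp_nonneg _)).trans ?_
    calc _ = C * A * ‖U - V‖ *
          (Real.exp (-(c * clamp S.T p.1)) * (Real.exp (c * clamp S.T p.1) / c)) := by ring
      _ = (C * A / c) * ‖U - V‖ := by rw [hexp2]; ring
      _ ≤ _ := by
        rw [← dist_eq_norm]
        gcongr
        rw [div_le_iff₀ hc0, hc]
        push_cast
        have := mul_nonneg hC0 hA0
        linarith
  -- The distance from zero to the fixed point is recorded too: it bounds the velocity uniformly in
  -- `ν`, as `RegZero` over the index `ν` demands.
  choose! U hU hU' using fun ν => (⟨_, (hlip ν).fixedPoint_isFixedPt,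
    (hlip ν).dist_fixedPoint_le 0⟩ : ∃ U : E, Function.IsFixedPt (Ψ ν) U ∧
      dist 0 U ≤ dist 0 (Ψ ν 0) / (1 - (1 / 2 : ℝ≥0)))
  have hUb : ∀ ν, ‖U ν‖ ≤ 2 * (C * (A * S.T)) := fun ν => by
    have h1 := hU' ν
    rw [dist_zero_left, dist_zero_left] at h1
    have h2 : ‖Ψ ν 0‖ ≤ C * (A * S.T) := by
      rw [BoundedContinuousFunction.norm_le (by positivity)]
      intro p
      rw [hΨ, norm_smul, Real.norm_of_nonneg (Real.exp_nonneg _)]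
      refine (mul_le_of_le_one_left (norm_nonneg _) (hexp _)).trans ?_
      simpa using hbd ν 0 p.1 p.2
    refine h1.trans ?_
    rw [div_le_iff₀ (by norm_num)]
    push_cast
    linarith
  refine ⟨fun ν => up (U ν), ⟨fun ν => hup _, fun R =>
    ⟨Real.exp (c * S.T) * (2 * (C * (A * S.T))), fun ν t x _ _ => ?_⟩, False.elim⟩, fun ν t x => ?_⟩
  · show ‖Real.exp (c * clamp S.T t) • U ν (t, x)‖ ≤ _
    rw [norm_smul, Real.norm_of_nonneg (Real.exp_nonneg _)]
    have := (clamp_mem hT.le t).2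
    gcongr
    exact ((U ν).norm_coe_le_norm _).trans (hUb ν)
  · show Real.exp (c * clamp S.T t) • U ν (t, x) = _
    have h1 : U ν (t, x) = Ψ ν (U ν) (t, x) := by rw [hU ν]
    rw [h1, hΨ, smul_smul, ← Real.exp_add, add_neg_cancel, Real.exp_zero, one_smul]

end Background

/-! ### The transport equation of the correction -/

theorem hasDerivAt_primitive {g : ℝ → ℝ} (hg : Continuous g) (t : ℝ) :
    HasDerivAt (fun t => ∫ s in (0 : ℝ)..t, g s) (g t) t :=
  (hg.integral_hasStrictDerivAt 0 t).hasDerivAt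

namespace Background

variable (S : Background)

/-- The velocity of the correction. -/
def u : ℝ≥0 → ℝ → Plane → Plane := S.exists_velocity.choose

/-- The correction. -/
def w (ν : ℝ≥0) : ℝ → Plane → ℝ := S.response ν (S.u ν)

theorem u_eq (ν : ℝ≥0) (t : ℝ) : S.u ν t = biotSavart (S.w ν t) :=
  funext fun x => S.exists_velocity.choose_spec.2 ν t x

theorem suppIn_w : SuppIn S.R S.w := S.suppIn_response id S.u

theorem reg_of_u {H : Prop} {k : ℕ} (hk : k ≤ 1) (h0 : Reg H k (fun (_ : ℝ≥0) s y => (Δ (S.ω s)) y))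
    (h1 : Reg H k (fun (_ : ℝ≥0) s y => fderiv ℝ (S.ω s) y)) (hu : Reg H k S.u) : Reg H k S.w :=
  S.reg_response (by omega) id h0 h1 hu

theorem u_eq' : S.u = fun ν t x => biotSavart (S.w ν t) x := by
  funext ν t x
  rw [S.u_eq]

theorem reg_w_zero : Reg True 0 S.w := by
  have h1 : Reg False 0 S.u := S.exists_velocity.choose_spec.1
  have h2 : Reg False 0 S.w := S.reg_of_u (by omega) (S.reg_laplacian.of_le (by omega)).weaken
    (S.reg_fderiv_ω.of_le (by omega)).weaken h1
  have h3 : Reg True 0 S.u := by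
    rw [u_eq']
    exact reg_biotSavart h2 S.suppIn_w
  exact S.reg_of_u (by omega) (S.reg_laplacian.of_le (by omega)) (S.reg_fderiv_ω.of_le (by omega)) h3

/-- The same alternation as for the background, now limited by the source: `Δω` has one Hölder
continuous derivative. The Hölder bound of `w` at order zero gives `u` one derivative, thus `w` one,
thus `u` a Hölder derivative, and finally `w` as well. -/
theorem reg_w : Reg True 1 S.w := by
  have h1 : Reg False 1 S.u := by
    rw [u_eq']
    exact reg_biotSavart_succ S.reg_w_zero S.suppIn_w
  have h2 : Reg False 1 S.w := S.reg_of_u (by omega) S.reg_laplacian.weaken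
    (S.reg_fderiv_ω.of_le (by omega)).weaken h1
  have h3 : Reg True 1 S.u := by
    rw [u_eq']
    exact reg_biotSavart h2 S.suppIn_w
  exact S.reg_of_u (by omega) S.reg_laplacian (S.reg_fderiv_ω.of_le (by omega)) h3

theorem reg_u : Reg False 2 S.u := by
  rw [u_eq']
  exact reg_biotSavart_succ S.reg_w S.suppIn_w

theorem globBdd_u : GlobBdd 2 S.u := by
  rw [u_eq']
  exact globBdd_biotSavart S.reg_w S.suppIn_w

/-- In the coordinates of the initial positions the integral is differentiable in time by the
fundamental theorem and in space by `reg_integral_forward`; composing with the `C¹` backward flow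
returns to `(t, x)`. -/
theorem contDiff_duhamel (ν : ℝ≥0) {g : ℝ → Plane → ℝ} (hg : Reg False 1 (fun _ : Unit => g)) :
    ContDiff ℝ 1 fun p : ℝ × Plane => S.duhamel ν g p.1 p.2 := by
  obtain ⟨K, M, hlip⟩ := S.exists_isLipField
  have hI := S.reg_integral_forward (by norm_num) (fun _ => ν) hg
  have hX : Continuous fun p : ℝ × Plane => flow (S.b ν) 0 p.2 p.1 :=
    S.reg_flow_forward.regZero.cont ν
  have hc : Continuous fun p : ℝ × Plane => g p.1 (flow (S.b ν) 0 p.2 p.1) :=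
    (hg.1.cont ()).comp (continuous_fst.prodMk hX)
  have h1 : ContDiff ℝ 1 fun p : ℝ × Plane =>
      ∫ s in (0 : ℝ)..p.1, g s (flow (S.b ν) 0 p.2 s) := by
    refine contDiff_one_of_partials
      (f := fun t y => ∫ s in (0 : ℝ)..t, g s (flow (S.b ν) 0 y s))
      (ft := fun t y => g t (flow (S.b ν) 0 y t)) (fun t y => ?_)
      (fun t y => (hI.2.1 () t y).hasFDerivAt) hc (hI.2.2.regZero.cont ())
    have h2 : Continuous fun s => g s (flow (S.b ν) 0 y s) :=
      hc.comp (continuous_id.prodMk continuous_const)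
    exact hasDerivAt_primitive h2 t
  have hb : Reg False 4 S.b := S.drift.reg_cutField S.hR S.hd S.reg_v
  have h3 : ContDiff ℝ 1 fun p : ℝ × Plane => (p.1, flow (S.b ν) p.1 p.2 0) :=
    contDiff_fst.prodMk (hlip.contDiff_backward hb ν)
  exact h1.comp h3

theorem hasDerivAt_duhamel (ν : ℝ≥0) {g : ℝ → Plane → ℝ}
    (hg : Continuous fun p : ℝ × Plane => g p.1 p.2) (t : ℝ) (x : Plane) :
    HasDerivAt (fun s => S.duhamel ν g s (flow (S.b ν) t x s)) (g t x) t := by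
  obtain ⟨K, M, hlip⟩ := S.exists_isLipField
  have hγ := hlip.hasDerivAt_flow ν t x
  have hγc : Continuous fun s => flow (S.b ν) t x s :=
    continuous_iff_continuousAt.2 fun s => (hγ s).continuousAt
  have hc : Continuous fun s => g s (flow (S.b ν) t x s) := hg.comp (continuous_id.prodMk hγc)
  have h := hasDerivAt_primitive hc t
  rw [hlip.flow_self] at h
  have e1 : (fun s => S.duhamel ν g s (flow (S.b ν) t x s)) =
      fun s => ∫ r in (0 : ℝ)..s, g r (flow (S.b ν) t x r) := by
    funext s
    rw [duhamel_eq]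
    simp only [hlip.flow_flow]
  rw [e1]
  exact h

theorem reg_source_u (ν : ℝ≥0) : Reg False 1 (fun _ : Unit => S.source (S.u ν)) :=
  S.reg_source (fun _ => ν) S.reg_laplacian.weaken (S.reg_fderiv_ω.of_le (by norm_num)).weaken
    ((S.reg_u.of_le (j := 1) (by norm_num)).reindex (fun _ : Unit => ν))

theorem w_of_mem (ν : ℝ≥0) {t : ℝ} (ht : t ∈ Icc 0 S.T) :
    S.w ν t = S.duhamel ν (S.source (S.u ν)) t := by
  rw [w, response, clamp_of_mem ht]

theorem contDiffOn_w (ν : ℝ≥0) :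
    ContDiffOn ℝ 1 (fun p : ℝ × Plane => S.w ν p.1 p.2) (Icc 0 S.T ×ˢ univ) :=
  (S.contDiff_duhamel ν (S.reg_source_u ν)).contDiffOn.congr fun p hp => by rw [S.w_of_mem ν hp.1]

theorem w_zero (ν : ℝ≥0) (x : Plane) : S.w ν 0 x = 0 := by
  rw [S.w_of_mem ν ⟨le_rfl, S.drift.pos.le⟩, duhamel, intervalIntegral.integral_same]

/-- The transport equation with the cut-off drift. -/
theorem cut_equation (ν : ℝ≥0) {t : ℝ} (ht : t ∈ Icc 0 S.T) (x : Plane) :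
    derivWithin (fun s => S.w ν s x) (Icc 0 S.T) t + fderiv ℝ (S.w ν t) x (S.b ν t x)
      + fderiv ℝ (S.ω t) x (S.u ν t x) = (Δ (S.ω t)) x := by
  obtain ⟨K, M, hlip⟩ := S.exists_isLipField
  have hγ := hlip.hasDerivAt_flow ν t x
  have hγt := hlip.flow_self ν t x
  have h1 := hasDerivWithinAt_along S.drift.pos (S.contDiffOn_w ν) ht (hγ t).hasDerivWithinAt
  have h2 : HasDerivWithinAt (fun s => S.w ν s (flow (S.b ν) t x s)) (S.source (S.u ν) t x)
      (Icc 0 S.T) t :=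
    (S.hasDerivAt_duhamel ν ((S.reg_source_u ν).1.cont ()) t x).hasDerivWithinAt.congr
      (fun s hs => by rw [S.w_of_mem ν hs]) (by rw [S.w_of_mem ν ht])
  have h3 := (uniqueDiffOn_Icc S.drift.pos t ht).eq_deriv _ h1 h2
  rw [hγt, source] at h3
  linarith

theorem eventually_w_eq_zero (ν : ℝ≥0) {t : ℝ} {x : Plane}
    (hx : S.R < ‖x‖ ∨ ‖x - S.z t‖ < S.d) : S.w ν t =ᶠ[𝓝 x] fun _ => 0 := by
  rcases hx with hx | hx
  · have h3 : ∀ᶠ y : Plane in 𝓝 x, S.R < ‖y‖ :=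
      (continuous_norm.tendsto x).eventually_const_lt hx
    filter_upwards [h3] with y hy using S.response_eq_zero ν _ (Or.inl hy)
  · have h3 : ∀ᶠ y in 𝓝 x, ‖y - S.z t‖ < S.d :=
      ((continuous_id.sub continuous_const).norm.tendsto x).eventually_lt_const hx
    filter_upwards [h3] with y hy using S.response_eq_zero ν _ (Or.inr hy)

/-- Where the cut-off drift differs from the true one, `w` vanishes locally, so its gradient
annihilates the difference. -/
theorem equation {ν : ℝ≥0} (hν : 0 < ν) {t : ℝ} (ht : t ∈ Ioc 0 S.T) (x : Plane) :
    derivWithin (fun s => S.w ν s x) (Icc 0 S.T) t + fderiv ℝ (S.w ν t) x (biotSavart (S.ω t) x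
        + (1 / √(ν * t)) • lambOseen ((1 / √(ν * t)) • (x - S.z t)))
      + fderiv ℝ (S.ω t) x (biotSavart (S.w ν t) x) = (Δ (S.ω t)) x := by
  rw [← S.cut_equation ν ⟨ht.1.le, ht.2⟩ x, u_eq]
  congr 2
  by_cases hx : S.R < ‖x‖ ∨ ‖x - S.z t‖ < S.d
  · have : fderiv ℝ (S.w ν t) x = 0 := by
      rw [(S.eventually_w_eq_zero ν hx).fderiv_eq]
      simp
    rw [this]
    simp
  · rw [not_or, not_lt, not_lt] at hx
    rw [b, cutField_lambOseen S.hR S.hd hν ht hx.1 hx.2]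
    rfl

theorem exists_bound_u : ∃ A : ℝ, 0 ≤ A ∧ ∀ ν, ∀ t ∈ Icc 0 S.T, ∀ x, ‖S.u ν t x‖ ≤ A ∧
    ‖fderiv ℝ (S.u ν t) x‖ ≤ A ∧ ‖fderiv ℝ (fderiv ℝ (S.u ν t)) x‖ ≤ A := by
  obtain ⟨A₀, h0⟩ := S.globBdd_u.1 S.T
  obtain ⟨A₁, h1⟩ := S.globBdd_u.2.1 S.T
  obtain ⟨A₂, h2⟩ := S.globBdd_u.2.2 S.T
  refine ⟨max (max A₀ A₁) (max A₂ 0), le_max_of_le_right (le_max_right _ _), fun ν t ht x => ?_⟩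
  have ht' : |t| ≤ S.T := by rw [abs_of_nonneg ht.1]; exact ht.2
  exact ⟨(h0 ν t x ht').trans (le_max_of_le_left (le_max_left _ _)),
    (h1 ν t x ht').trans (le_max_of_le_left (le_max_right _ _)),
    (h2 ν t x ht').trans (le_max_of_le_right (le_max_left _ _))⟩

/-- Read off from the equation with the cut-off drift, which is bounded uniformly in `ν`; the true
drift is not bounded near the vortex as `νt → 0`. -/
theorem exists_bound_deriv : ∃ A : ℝ, 0 ≤ A ∧ ∀ ν, ∀ t ∈ Icc 0 S.T, ∀ x,
    ‖derivWithin (fun s => S.w ν s x) (Icc 0 S.T) t‖ ≤ A := by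
  obtain ⟨K, M, hlip⟩ := S.exists_isLipField
  obtain ⟨A, hA0, hA⟩ := S.exists_bound_source
  obtain ⟨C, hC0, hC⟩ := S.exists_bound_u
  obtain ⟨D, hD0, hD⟩ := S.reg_w.2.2.regZero.exists_bound S.suppIn_w.fderiv S.T
  refine ⟨A + D * M + A * C, by positivity, fun ν t ht x => ?_⟩
  have ht' : |t| ≤ S.T := by rw [abs_of_nonneg ht.1]; exact ht.2
  have e1 : derivWithin (fun s => S.w ν s x) (Icc 0 S.T) t = (Δ (S.ω t)) x
      - fderiv ℝ (S.w ν t) x (S.b ν t x) - fderiv ℝ (S.ω t) x (S.u ν t x) := by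
    rw [← S.cut_equation ν ht x]
    ring
  rw [e1]
  refine (norm_sub_le _ _).trans (add_le_add ((norm_sub_le _ _).trans
    (add_le_add (hA t x).1 ?_)) ?_)
  · exact (ContinuousLinearMap.le_opNorm _ _).trans
      (mul_le_mul (hD ν t x ht') (hlip.bound ν t x) (norm_nonneg _) hD0)
  · exact (ContinuousLinearMap.le_opNorm _ _).trans
      (mul_le_mul (hA t x).2 (hC ν t ht x).1 (norm_nonneg _) hA0)

theorem exists_sobolevNorm_u_le : ∃ C : ℝ≥0, ∀ ν, ∀ t ∈ Icc 0 S.T,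
    sobolevNorm 2 ∞ (biotSavart (S.w ν t)) ≤ C := by
  obtain ⟨A, hA0, hA⟩ := S.exists_bound_u
  refine ⟨7 * A.toNNReal, fun ν t ht => ?_⟩
  rw [← S.u_eq]
  refine (sobolevNorm_two_top_le (S.reg_u.contDiff ν t) (fun x => (hA ν t ht x).1)
    (fun x => (hA ν t ht x).2.1) (fun x => (hA ν t ht x).2.2)).trans_eq ?_
  rw [ENNReal.coe_mul]
  rfl

theorem tsupport_w_subset (ν : ℝ≥0) (t : ℝ) : tsupport (S.w ν t) ⊆ Metric.closedBall 0 S.R := by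
  refine closure_minimal (fun x hx => ?_) Metric.isClosed_closedBall
  rw [mem_closedBall_zero_iff]
  by_contra h
  exact hx (S.response_eq_zero ν _ (Or.inl (not_le.1 h)))

end Background

/-! ### Fourth powers along bi-Lipschitz changes of variables -/

section ChangeOfVariables

/-- A map with a Lipschitz left inverse changes integrals at most by a factor. -/
theorem lintegral_comp_le {Ψ Ψ' : Plane → Plane} {K : ℝ≥0} (hΨ : Measurable Ψ)
    (hK : LipschitzWith K Ψ') (h : ∀ x, Ψ' (Ψ x) = x) {F : Plane → ℝ≥0∞} (hF : Measurable F) :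
    ∫⁻ x, F (Ψ x) ≤ (K : ℝ≥0∞) ^ 2 * ∫⁻ x, F x := by
  have h2 : Module.finrank ℝ Plane = 2 := by simp
  have hH : (Measure.hausdorffMeasure (Module.finrank ℝ Plane) : Measure Plane).IsAddHaarMeasure :=
    inferInstance
  -- The volume is a multiple of the two-dimensional Hausdorff measure, which a `K`-Lipschitz map
  -- enlarges at most by `K²`. Applied to the left inverse, this bounds the image measure under `Ψ`
  -- without any Jacobian.
  set μ : Measure Plane := Measure.hausdorffMeasure (Module.finrank ℝ Plane) with hμ
  have hv : (volume : Measure Plane) = Measure.addHaarScalarFactor volume μ • μ :=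
    Measure.isAddLeftInvariant_eq_smul volume μ
  have key : ∀ A, volume (Ψ' '' A) ≤ (K : ℝ≥0∞) ^ 2 * volume A := by
    intro A
    have h3 := hK.hausdorffMeasure_image_le (d := (Module.finrank ℝ Plane : ℝ)) (by positivity) A
    rw [hv, Measure.smul_apply, Measure.smul_apply, mul_smul_comm]
    gcongr
    refine h3.trans_eq ?_
    congr 1
    rw [h2]
    norm_num
  have hle : Measure.map Ψ volume ≤ ((K : ℝ≥0∞) ^ 2) • (volume : Measure Plane) := by
    refine Measure.le_iff.2 fun A hA => ?_
    rw [Measure.map_apply hΨ hA, Measure.smul_apply, smul_eq_mul]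
    refine (measure_mono fun x hx => ?_).trans (key A)
    exact ⟨Ψ x, hx, h x⟩
  rw [← lintegral_map hF hΨ]
  refine (lintegral_mono' hle le_rfl).trans_eq ?_
  rw [lintegral_smul_measure, smul_eq_mul]

theorem pow_lintegral_le (t : ℝ) {f : ℝ → ℝ} (hf : Continuous f) :
    (∫⁻ s in Ioc 0 t, ‖f s‖ₑ) ^ (4 : ℝ) ≤
      ENNReal.ofReal t ^ (3 : ℝ) * ∫⁻ s in Ioc 0 t, ‖f s‖ₑ ^ (4 : ℝ) := by
  have h := eLpNorm_le_eLpNorm_mul_rpow_measure_univ (p := 1) (q := 4)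
    (μ := volume.restrict (Ioc 0 t)) (by norm_num) hf.aestronglyMeasurable
  rw [eLpNorm_one_eq_lintegral_enorm, eLpNorm_eq_lintegral_rpow_enorm_toReal (by norm_num)
    (by norm_num), Measure.restrict_apply_univ, Real.volume_Ioc, sub_zero] at h
  refine (ENNReal.rpow_le_rpow h (by norm_num : (0 : ℝ) ≤ 4)).trans_eq ?_
  rw [ENNReal.mul_rpow_of_nonneg _ _ (by norm_num), ← ENNReal.rpow_mul, ← ENNReal.rpow_mul, mul_comm]
  norm_num

/-- The `L⁴` norm of a time integral along a family of bi-Lipschitz maps. -/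
theorem eLpNorm_integral_comp_le {t T : ℝ} (ht : 0 ≤ t) (htT : t ≤ T) {E : Plane → ℝ}
    (hE : Continuous E) {Ψ Ψ' : ℝ → Plane → Plane}
    (hΨ : Continuous fun p : ℝ × Plane => Ψ p.1 p.2) {K : ℝ≥0} (hK1 : 1 ≤ K)
    (hK : ∀ s ∈ Icc 0 t, LipschitzWith K (Ψ' s)) (h : ∀ s ∈ Icc 0 t, ∀ x, Ψ' s (Ψ s x) = x) :
    eLpNorm (fun x => ∫ s in (0 : ℝ)..t, E (Ψ s x)) 4 volume ≤
      ENNReal.ofReal T * K * eLpNorm E 4 volume := by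
  have hcx : ∀ x, Continuous fun s => E (Ψ s x) := fun x =>
    hE.comp (hΨ.comp (continuous_id.prodMk continuous_const))
  have hcs : ∀ s, Continuous (Ψ s) := fun s => hΨ.comp (continuous_const.prodMk continuous_id)
  have hF : Measurable fun y => ‖E y‖ₑ ^ (4 : ℝ) := (hE.enorm.measurable).pow_const _
  have main : ∫⁻ x, ‖∫ s in (0 : ℝ)..t, E (Ψ s x)‖ₑ ^ (4 : ℝ) ≤
      (ENNReal.ofReal T * K) ^ (4 : ℝ) * ∫⁻ y, ‖E y‖ₑ ^ (4 : ℝ) := by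
    calc _ ≤ ∫⁻ x, ENNReal.ofReal t ^ (3 : ℝ) * ∫⁻ s in Ioc 0 t, ‖E (Ψ s x)‖ₑ ^ (4 : ℝ) := by
          refine lintegral_mono fun x => le_trans ?_ (pow_lintegral_le t (hcx x))
          rw [intervalIntegral.integral_of_le ht]
          exact ENNReal.rpow_le_rpow (enorm_integral_le_lintegral_enorm _) (by norm_num)
      _ = ENNReal.ofReal t ^ (3 : ℝ) * ∫⁻ x, ∫⁻ s in Ioc 0 t, ‖E (Ψ s x)‖ₑ ^ (4 : ℝ) := by
          rw [lintegral_const_mul']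
          exact ENNReal.rpow_ne_top_of_nonneg (by norm_num) ENNReal.ofReal_ne_top
      _ = ENNReal.ofReal t ^ (3 : ℝ) * ∫⁻ s in Ioc 0 t, ∫⁻ x, ‖E (Ψ s x)‖ₑ ^ (4 : ℝ) := by
          rw [lintegral_lintegral_swap]
          refine Measurable.aemeasurable ?_
          have : Continuous fun p : Plane × ℝ => E (Ψ p.2 p.1) :=
            hE.comp (hΨ.comp (continuous_snd.prodMk continuous_fst))
          exact this.enorm.measurable.pow_const _
      _ ≤ ENNReal.ofReal t ^ (3 : ℝ) *
          ∫⁻ _ in Ioc 0 t, (K : ℝ≥0∞) ^ 2 * ∫⁻ y, ‖E y‖ₑ ^ (4 : ℝ) := by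
          refine mul_le_mul' le_rfl (setLIntegral_mono' measurableSet_Ioc fun s hs => ?_)
          exact lintegral_comp_le (hcs s).measurable (hK s ⟨hs.1.le, hs.2⟩) (h s ⟨hs.1.le, hs.2⟩) hF
      _ = ENNReal.ofReal t ^ (4 : ℝ) * (K : ℝ≥0∞) ^ 2 * ∫⁻ y, ‖E y‖ₑ ^ (4 : ℝ) := by
          rw [setLIntegral_const, Real.volume_Ioc, sub_zero,
            show (4 : ℝ) = 3 + 1 by norm_num,
            ENNReal.rpow_add_of_nonneg (x := ENNReal.ofReal t) _ _ (by norm_num) (by norm_num),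
            ENNReal.rpow_one]
          ring
      _ ≤ _ := by
          rw [ENNReal.mul_rpow_of_nonneg _ _ (by norm_num)]
          gcongr
          -- Since `1 ≤ K`, the factor `K²` is enlarged to `K⁴`, whose fourth root is `K`.
          rw [← ENNReal.rpow_natCast]
          exact ENNReal.rpow_le_rpow_of_exponent_le (by exact_mod_cast hK1) (by norm_num)
  rw [eLpNorm_eq_lintegral_rpow_enorm_toReal (by norm_num) (by norm_num),
    eLpNorm_eq_lintegral_rpow_enorm_toReal (by norm_num) (by norm_num)]
  refine (ENNReal.rpow_le_rpow main (by norm_num)).trans_eq ?_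
  rw [ENNReal.mul_rpow_of_nonneg _ _ (by norm_num), ← ENNReal.rpow_mul]
  norm_num

end ChangeOfVariables

/-! ### Higher derivatives of compositions, integrals and Laplacians. -/

section Derivatives

variable {Λ : Type} {F G : Type} [NormedAddCommGroup F] [NormedSpace ℝ F] [NormedAddCommGroup G]
  [NormedSpace ℝ G] {H : Prop} {k : ℕ}

theorem Reg.exists_bound_iteratedFDeriv {f : Λ → ℝ → Plane → F} (hf : Reg H k f) {j : ℕ}
    (hj : j ≤ k) (S : ℝ) : ∃ C : ℝ, ∀ l t x, |t| ≤ S → ‖x‖ ≤ S →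
      ‖iteratedFDeriv ℝ j (f l t) x‖ ≤ C := by
  induction j generalizing F k with
  | zero =>
    obtain ⟨C, hC⟩ := hf.regZero.bdd S
    exact ⟨C, fun l t x ht hx => by rw [norm_iteratedFDeriv_zero]; exact hC l t x ht hx⟩
  | succ j ih =>
    obtain ⟨k, rfl⟩ : ∃ m, k = m + 1 := ⟨k - 1, by omega⟩
    obtain ⟨C, hC⟩ := ih hf.2.2 (by omega)
    exact ⟨C, fun l t x ht hx => by rw [← norm_iteratedFDeriv_fderiv]; exact hC l t x ht hx⟩

/-- Derivatives of a composition with a family of regular maps. -/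
theorem Reg.exists_bound_comp {Φ : Λ → ℝ → Plane → Plane} (hΦ : Reg H k Φ) (S : ℝ) :
    ∃ C : ℝ, 0 ≤ C ∧ ∀ l t x, |t| ≤ S → ‖x‖ ≤ S → ∀ g : Plane → F, ContDiff ℝ k g → ∀ B : ℝ,
      (∀ j ≤ k, ‖iteratedFDeriv ℝ j g (Φ l t x)‖ ≤ B) →
      ∀ j ≤ k, ‖iteratedFDeriv ℝ j (fun y => g (Φ l t y)) x‖ ≤ C * B := by
  choose! D hD using fun j (hj : j ≤ k) => hΦ.exists_bound_iteratedFDeriv hj S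
  -- The bound for derivatives of a composition asks for `‖DⁱΦ‖ ≤ Mⁱ`. A common `M ≥ 1` above all
  -- the bounds provides it for every `i ≥ 1`, and `k! M^k` covers all orders.
  set M : ℝ := 1 + ∑ j ∈ Finset.range (k + 1), |D j| with hM
  have hM1 : 1 ≤ M := by
    have : 0 ≤ ∑ j ∈ Finset.range (k + 1), |D j| := Finset.sum_nonneg fun _ _ => abs_nonneg _
    linarith
  have hDM : ∀ j ≤ k, D j ≤ M := fun j hj => by
    have := Finset.single_le_sum (f := fun j => |D j|) (fun _ _ => abs_nonneg _)
      (Finset.mem_range.2 (Nat.lt_succ_of_le hj))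
    have h2 := le_abs_self (D j)
    linarith
  refine ⟨k.factorial * M ^ k, by positivity, fun l t x ht hx g hg B hB j hj => ?_⟩
  have hB0 : 0 ≤ B := (norm_nonneg _).trans (hB j hj)
  have h1 := norm_iteratedFDeriv_comp_le hg (hΦ.contDiff l t) (n := j) (by exact_mod_cast hj) x
    (C := B) (D := M) (fun i hi => hB i (hi.trans hj)) fun i hi1 hi => by
      refine (hD i (hi.trans hj) l t x ht hx).trans ((hDM i (hi.trans hj)).trans ?_)
      exact le_self_pow₀ hM1 (by omega)
  calc _ ≤ _ := h1
    _ ≤ k.factorial * B * M ^ k := by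
      gcongr
    _ = _ := by ring

theorem Reg.norm_iteratedFDeriv_integral_le [CompleteSpace F] {f : Λ → ℝ → Plane → F}
    (hf : Reg H k f) {j : ℕ} (hj : j ≤ k) (l : Λ) {t : ℝ} (ht : 0 ≤ t) (x : Plane) :
    ‖iteratedFDeriv ℝ j (fun x => ∫ s in (0 : ℝ)..t, f l s x) x‖ ≤
      ∫ s in (0 : ℝ)..t, ‖iteratedFDeriv ℝ j (f l s) x‖ := by
  induction j generalizing F k with
  | zero =>
    simp only [norm_iteratedFDeriv_zero]
    exact intervalIntegral.norm_integral_le_integral_norm ht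
  | succ j ih =>
    obtain ⟨k, rfl⟩ : ∃ m, k = m + 1 := ⟨k - 1, by omega⟩
    have h1 : fderiv ℝ (fun x => ∫ s in (0 : ℝ)..t, f l s x) =
        fun x => ∫ s in (0 : ℝ)..t, fderiv ℝ (f l s) x :=
      funext fun y => (hf.hasFDerivAt_integral l t y).fderiv
    rw [← norm_iteratedFDeriv_fderiv, h1]
    refine (ih hf.2.2 (by omega)).trans_eq ?_
    simp only [norm_iteratedFDeriv_fderiv]

theorem Reg.continuous_norm_iteratedFDeriv {f : Λ → ℝ → Plane → F} (hf : Reg H k f) {j : ℕ}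
    (hj : j ≤ k) (l : Λ) :
    Continuous fun p : ℝ × Plane => ‖iteratedFDeriv ℝ j (f l p.1) p.2‖ := by
  induction j generalizing F k with
  | zero =>
    simp only [norm_iteratedFDeriv_zero]
    exact (hf.regZero.cont l).norm
  | succ j ih =>
    obtain ⟨k, rfl⟩ : ∃ m, k = m + 1 := ⟨k - 1, by omega⟩
    simp only [← norm_iteratedFDeriv_fderiv]
    exact ih hf.2.2 (by omega)

theorem exists_norm_iteratedFDeriv_clm_le (L : F →L[ℝ] G) : ∃ c : ℝ, 0 ≤ c ∧
    ∀ (j : ℕ) (g : Plane → F), ContDiff ℝ j g → ∀ x,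
      ‖iteratedFDeriv ℝ j (fun y => L (g y)) x‖ ≤ c * ‖iteratedFDeriv ℝ j g x‖ := by
  refine ⟨‖L‖, norm_nonneg _, fun j g hg x => ?_⟩
  have := L.iteratedFDeriv_comp_left (x := x) hg.contDiffAt (i := j) le_rfl
  show ‖iteratedFDeriv ℝ j (L ∘ g) x‖ ≤ _
  rw [this]
  exact L.norm_compContinuousMultilinearMap_le _

theorem exists_norm_iteratedFDeriv_laplacian_le : ∃ c : ℝ, 0 ≤ c ∧
    ∀ (j : ℕ) (f : Plane → ℝ), ContDiff ℝ (j + 1 + 1 : ℕ) f → ∀ x,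
      ‖iteratedFDeriv ℝ j (fun y => (Δ f) y) x‖ ≤ c * ‖iteratedFDeriv ℝ (j + 1 + 1) f x‖ := by
  obtain ⟨c, hc0, hc⟩ :=
    exists_norm_iteratedFDeriv_clm_le (F := Plane →L[ℝ] Plane →L[ℝ] ℝ) (G := ℝ) traceForm
  refine ⟨c, hc0, fun j f hf x => ?_⟩
  have h2 : ContDiff ℝ j (fderiv ℝ (fderiv ℝ f)) :=
    (hf.fderiv_right (m := (j + 1 : ℕ)) (by norm_cast)).fderiv_right (m := j) (by norm_cast)
  have h3 := hc j _ h2 x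
  rw [norm_iteratedFDeriv_fderiv, norm_iteratedFDeriv_fderiv] at h3
  simp only [laplacian_eq_traceForm]
  exact h3

/-- The sum of the norms of the derivatives up to order four. -/
def jet (f : Plane → ℝ) (x : Plane) : ℝ := ∑ j ∈ Finset.range 5, ‖iteratedFDeriv ℝ j f x‖

theorem le_jet (f : Plane → ℝ) (x : Plane) {j : ℕ} (hj : j ≤ 4) :
    ‖iteratedFDeriv ℝ j f x‖ ≤ jet f x :=
  Finset.single_le_sum (f := fun j => ‖iteratedFDeriv ℝ j f x‖) (fun _ _ => norm_nonneg _)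
    (Finset.mem_range.2 (by omega))

theorem jet_nonneg (f : Plane → ℝ) (x : Plane) : 0 ≤ jet f x :=
  Finset.sum_nonneg fun _ _ => norm_nonneg _

theorem continuous_jet {f : Plane → ℝ} (hf : ContDiff ℝ 4 f) : Continuous (jet f) :=
  continuous_finsetSum _ fun j hj => (hf.continuous_iteratedFDeriv (m := j) (by
    have := Finset.mem_range.1 hj
    exact_mod_cast (by omega : j ≤ 4))).norm

theorem eLpNorm_jet_le {f : Plane → ℝ} (hf : ContDiff ℝ 4 f) {A : ℝ≥0∞}
    (hA : ∀ j ≤ 4, eLpNorm (iteratedFDeriv ℝ j f) 4 volume ≤ A) :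
    eLpNorm (jet f) 4 volume ≤ 5 * A := by
  have h1 : jet f = ∑ j ∈ Finset.range 5, fun x => ‖iteratedFDeriv ℝ j f x‖ := by
    funext x
    rw [Finset.sum_apply]
    rfl
  rw [h1]
  refine (eLpNorm_sum_le (fun j hj => ?_) (by norm_num)).trans ?_
  · have := Finset.mem_range.1 hj
    exact (hf.continuous_iteratedFDeriv (m := j)
      (by exact_mod_cast (by omega : j ≤ 4))).norm.aestronglyMeasurable
  · refine (Finset.sum_le_card_nsmul _ _ A fun j hj => ?_).trans_eq (by simp)
    rw [eLpNorm_norm]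
    exact hA j (by have := Finset.mem_range.1 hj; omega)

end Derivatives

/-! ### Second derivatives of the correction -/

namespace Background

variable (S : Background) {Λ : Type}

/-- The inverse flow of the vortex-wave system. -/
def back (s : ℝ) (x : Plane) : Plane := flow (S.b 0) (clamp S.T s) x 0

/-- The Laplacian of the transported profile `f`. -/
def diffused (f : Plane → ℝ) (s : ℝ) (y : Plane) : ℝ := (Δ (fun x => f (S.back s x))) y

theorem reg_back : Reg False 4 (fun (_ : Λ) s x => S.back s x) :=
  (S.reg_flow_backward.reindex (fun _ : Λ => 0)).clampTime S.drift.pos.le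

theorem reg_pullback {k : ℕ} (hk : k ≤ 4) {f : Plane → ℝ} (hf : ContDiff ℝ k f) :
    Reg False k (fun (_ : Λ) s x => f (S.back s x)) := by
  have h1 : Reg False k (fun (_ : Λ) (_ : ℝ) x => f x) := Reg.of_contDiff hf
  have h2 : Reg False k (fun (_ : Λ) s x => S.back s x) := S.reg_back.of_le hk
  exact Reg.comp h1 h2 (S.reg_back.of_le (by norm_num))

theorem diffused_eq (f : Plane → ℝ) (s : ℝ) : S.diffused f s =
    fun y => traceForm (fderiv ℝ (fderiv ℝ fun x => f (S.back s x)) y) :=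
  funext fun _ => laplacian_eq_traceForm _ _

theorem reg_diffused {k : ℕ} (hk : k + 2 ≤ 4) {f : Plane → ℝ} (hf : ContDiff ℝ (k + 2 : ℕ) f) :
    Reg False k (fun (_ : Λ) => S.diffused f) := by
  have h : Reg False k (fun (_ : Λ) s y => fderiv ℝ (fderiv ℝ fun x => f (S.back s x)) y) :=
    (S.reg_pullback hk hf).2.2.2.2
  have h1 := Reg.clm (G := ℝ) traceForm h
  have : (fun (_ : Λ) => S.diffused f) =
      fun (_ : Λ) s y => traceForm (fderiv ℝ (fderiv ℝ fun x => f (S.back s x)) y) := by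
    funext _ s
    exact S.diffused_eq f s
  rw [this]
  exact h1

/-- For the true initial profile the pulled back function is `ω` itself; other profiles replace `ω₀`
by its smooth approximations while the flow is kept fixed. -/
theorem diffused_init : S.diffused S.ω₀ = fun s y => (Δ (S.ω s)) y := by
  funext s y
  have h : (fun x => S.ω₀ (S.back s x)) = S.ω s := funext fun x => (S.transport s x).symm
  rw [diffused, h]

theorem continuous_diffused {f : Plane → ℝ} (hf : ContDiff ℝ 2 f) :
    Continuous fun p : ℝ × Plane => S.diffused f p.1 p.2 :=
  (S.reg_diffused (Λ := Unit) (k := 0) (by norm_num) hf).regZero.cont ()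

theorem diffused_sub {f g : Plane → ℝ} (hf : ContDiff ℝ 2 f) (hg : ContDiff ℝ 2 g) :
    S.diffused (fun x => f x - g x) = fun s y => S.diffused f s y - S.diffused g s y := by
  funext s y
  have h : ∀ {h : Plane → ℝ}, ContDiff ℝ 2 h → ContDiffAt ℝ 2 (fun x => h (S.back s x)) y :=
    fun {h} hh => ((S.reg_pullback (Λ := Unit) (k := 2) (by norm_num) hh).contDiff () s).contDiffAt
  exact (h hf).laplacian_sub (h hg)

/-- Bounds for trajectories of all the flows on `[0, T]`. -/
theorem exists_displacement : ∃ M : ℝ, 0 ≤ M ∧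
    (∀ (ν : ℝ≥0), ∀ s ∈ Icc 0 S.T, ∀ t ∈ Icc 0 S.T, ∀ x, ‖flow (S.b ν) s x t - x‖ ≤ M) ∧
    ∀ s x, ‖S.back s x - x‖ ≤ M := by
  obtain ⟨K, M, hlip⟩ := S.exists_isLipField
  have key : ∀ (ν : ℝ≥0), ∀ s ∈ Icc 0 S.T, ∀ t ∈ Icc 0 S.T, ∀ x,
      ‖flow (S.b ν) s x t - x‖ ≤ M * S.T := fun ν s hs t ht x => by
    refine (hlip.norm_flow_sub_le ν s x t).trans ?_
    gcongr
    rw [abs_le]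
    constructor <;> linarith [hs.1, hs.2, ht.1, ht.2]
  have hT := S.drift.pos.le
  exact ⟨M * S.T, by positivity, key, fun s x => key 0 _ (clamp_mem hT s) 0 ⟨le_rfl, hT⟩ x⟩

theorem abs_le_of_mem {t : ℝ} (ht : t ∈ Icc 0 S.T) : |t| ≤ S.T := by
  rw [abs_of_nonneg ht.1]
  exact ht.2

/-- Supports of the diffused profile and of its integrals. -/
theorem exists_support (r : ℝ) : ∃ R : ℝ, 0 ≤ R ∧ ∀ f : Plane → ℝ, (∀ x, r < ‖x‖ → f x = 0) →
    (∀ s y, R < ‖y‖ → S.diffused f s y = 0) ∧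
    ∀ ν, ∀ t ∈ Icc 0 S.T, ∀ x, R < ‖x‖ → S.duhamel ν (S.diffused f) t x = 0 := by
  obtain ⟨M, hM0, hM, hM'⟩ := S.exists_displacement
  -- One displacement `M` for the inverse flow of the background, one for the flow of the
  -- correction.
  refine ⟨max r 0 + 2 * M, by positivity, fun f hf => ?_⟩
  have h1 : ∀ s y, max r 0 + M < ‖y‖ → S.diffused f s y = 0 := fun s y hy => by
    have h2 : SuppIn (max r 0 + M) (fun (_ : Unit) (_ : ℝ) x => f (S.back s x)) := fun _ _ x hx => by
      refine hf _ ?_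
      have h3 := norm_sub_norm_le x (S.back s x)
      rw [norm_sub_rev] at h3
      have := hM' s x
      have := le_max_left r 0
      linarith
    have h3 : fderiv ℝ (fderiv ℝ fun x => f (S.back s x)) y = 0 := h2.fderiv.fderiv () s y hy
    rw [diffused, laplacian_eq_traceForm, h3, map_zero]
  refine ⟨fun s y hy => h1 s y (by linarith), fun ν t ht x hx => ?_⟩
  rw [duhamel_eq]
  refine intervalIntegral.integral_zero_ae (ae_of_all _ fun s hs => h1 _ _ ?_)
  rw [uIoc_of_le ht.1] at hs
  have h3 := norm_sub_norm_le x (flow (S.b ν) t x s)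
  rw [norm_sub_rev] at h3
  have := hM ν t ht s ⟨hs.1.le, hs.2.trans ht.2⟩ x
  linarith

/-- The integrals of the diffused profile depend continuously on the profile. -/
theorem exists_bound_duhamel_diffused (r : ℝ) : ∃ C : ℝ, 0 ≤ C ∧ ∀ f : Plane → ℝ, ContDiff ℝ 2 f →
    (∀ x, r < ‖x‖ → f x = 0) → ∀ ε : ℝ, 0 ≤ ε → (∀ j ≤ 2, ∀ x, ‖iteratedFDeriv ℝ j f x‖ ≤ ε) →
    ∀ ν, ∀ t ∈ Icc 0 S.T, ∀ x, ‖S.duhamel ν (S.diffused f) t x‖ ≤ C * ε := by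
  obtain ⟨R, hR0, hR⟩ := S.exists_support r
  have hreg : Reg False 2 (fun (_ : Unit) s x => S.back s x) := S.reg_back.of_le (by norm_num)
  obtain ⟨C, hC0, hC⟩ := hreg.exists_bound_comp (F := ℝ) (max R S.T)
  obtain ⟨c, hc0, hc⟩ := exists_norm_iteratedFDeriv_laplacian_le
  have hT := S.drift.pos.le
  refine ⟨S.T * (c * C), by positivity, fun f hf hfr ε hε hfε ν t ht x => ?_⟩
  have h1 : ∀ s ∈ Icc 0 S.T, ∀ y, ‖S.diffused f s y‖ ≤ c * (C * ε) := by
    intro s hs y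
    by_cases hy : R < ‖y‖
    · rw [(hR f hfr).1 s y hy, norm_zero]
      positivity
    · have h3 := hc 0 _ ((S.reg_pullback (Λ := Unit) (k := 2) (by norm_num) hf).contDiff () s) y
      rw [norm_iteratedFDeriv_zero] at h3
      refine h3.trans (mul_le_mul_of_nonneg_left ?_ hc0)
      exact hC () s y ((S.abs_le_of_mem hs).trans (le_max_right _ _))
        ((not_lt.1 hy).trans (le_max_left _ _)) f hf ε (fun j hj => hfε j hj _) 2 le_rfl
  refine (S.norm_duhamel_le continuous_const ht h1 x).trans ?_
  rw [intervalIntegral.integral_const, smul_eq_mul, sub_zero]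
  calc t * (c * (C * ε)) ≤ S.T * (c * (C * ε)) := by
        gcongr
        exact ht.2
    _ = _ := by ring

/-- Two derivatives of the Laplacian of `f ∘ back` use at most four of `f`, all at the same point,
and four of the flow `back`, which are bounded. This is where the four derivatives of the velocity
are needed. -/
theorem exists_bound_diffused_forward (r : ℝ) : ∃ C : ℝ, 0 ≤ C ∧ ∀ f : Plane → ℝ, ContDiff ℝ 4 f →
    ∀ ν, ∀ s ∈ Icc 0 S.T, ∀ y, ‖y‖ ≤ r → ∀ i ≤ 2,
      ‖iteratedFDeriv ℝ i (fun y => S.diffused f s (flow (S.b ν) 0 y s)) y‖ ≤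
        C * jet f (S.back s (flow (S.b ν) 0 y s)) := by
  obtain ⟨M, hM0, hM, -⟩ := S.exists_displacement
  have hT := S.drift.pos.le
  obtain ⟨C₁, hC₁0, hC₁⟩ := (S.reg_back (Λ := Unit)).exists_bound_comp (F := ℝ) (max (r + M) S.T)
  have hreg : Reg False 2 (fun ν t x => flow (S.b ν) 0 x t) := S.reg_flow_forward.of_le (by norm_num)
  obtain ⟨C₂, hC₂0, hC₂⟩ := hreg.exists_bound_comp (F := ℝ) (max r S.T)
  obtain ⟨c, hc0, hc⟩ := exists_norm_iteratedFDeriv_laplacian_le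
  refine ⟨C₂ * (c * C₁), by positivity, fun f hf ν s hs y hy i hi => ?_⟩
  set y' := flow (S.b ν) 0 y s with hy'
  have hyr : ‖y'‖ ≤ r + M := by
    have h1 := hM ν 0 ⟨le_rfl, hT⟩ s hs y
    have h2 := norm_sub_norm_le y' y
    linarith
  have hd2 : ContDiff ℝ (2 : ℕ) (S.diffused f s) :=
    (S.reg_diffused (Λ := Unit) (k := 2) (by norm_num) hf).contDiff () s
  have h1 : ∀ j ≤ 2, ‖iteratedFDeriv ℝ j (S.diffused f s) y'‖ ≤
      c * (C₁ * jet f (S.back s y')) := by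
    intro j hj
    have hp : ContDiff ℝ (j + 1 + 1 : ℕ) fun x => f (S.back s x) := by
      refine ((S.reg_pullback (Λ := Unit) (k := 4) le_rfl hf).contDiff () s).of_le ?_
      exact_mod_cast (by omega : j + 1 + 1 ≤ 4)
    refine (hc j _ hp y').trans (mul_le_mul_of_nonneg_left ?_ hc0)
    exact hC₁ () s y' ((S.abs_le_of_mem hs).trans (le_max_right _ _))
      (hyr.trans (le_max_left _ _)) f hf _ (fun j hj => le_jet f _ hj) _ (by omega)
  have h2 := hC₂ ν s y ((S.abs_le_of_mem hs).trans (le_max_right _ _)) (hy.trans (le_max_left _ _))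
    (S.diffused f s) hd2 _ h1 i hi
  refine h2.trans_eq ?_
  ring

/-- The previous bound under the time integral, followed by the chain rule for the backward flow.
The right side is pointwise and linear in the derivatives of `f`, ready for the `L⁴` norm. -/
theorem exists_bound_second_deriv (r : ℝ) : ∃ C : ℝ, 0 ≤ C ∧ ∀ f : Plane → ℝ, ContDiff ℝ 4 f →
    ∀ ν, ∀ t ∈ Icc 0 S.T, ∀ x, ‖x‖ ≤ r →
      ‖iteratedFDeriv ℝ 2 (S.duhamel ν (S.diffused f) t) x‖ ≤
        C * ∫ s in (0 : ℝ)..t, jet f (S.back s (flow (S.b ν) 0 (flow (S.b ν) t x 0) s)) := by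
  obtain ⟨M, hM0, hM, -⟩ := S.exists_displacement
  have hT := S.drift.pos.le
  obtain ⟨C₁, hC₁0, hC₁⟩ := S.exists_bound_diffused_forward (r + M)
  have hreg : Reg False 2 (fun ν t x => flow (S.b ν) t x 0) := S.reg_flow_backward.of_le (by norm_num)
  obtain ⟨C₂, hC₂0, hC₂⟩ := hreg.exists_bound_comp (F := ℝ) (max r S.T)
  refine ⟨C₂ * C₁, by positivity, fun f hf ν t ht x hx => ?_⟩
  have hX : Reg False 2 (fun (_ : Unit) s y => flow (S.b ν) 0 y s) :=
    (S.reg_flow_forward.of_le (by norm_num)).reindex (fun _ => ν)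
  have hh : Reg False 2 (fun (_ : Unit) s y => S.diffused f s (flow (S.b ν) 0 y s)) :=
    Reg.comp (S.reg_diffused (k := 2) (by norm_num) hf) hX (hX.of_le (by norm_num))
  set y' := flow (S.b ν) t x 0 with hy'
  have hyr : ‖y'‖ ≤ r + M := by
    have h1 := hM ν t ht 0 ⟨le_rfl, hT⟩ x
    have h2 := norm_sub_norm_le y' x
    linarith
  have hcj : Continuous fun s => jet f (S.back s (flow (S.b ν) 0 y' s)) := by
    have h1 : Continuous fun s => flow (S.b ν) 0 y' s :=
      (S.reg_flow_forward.regZero.cont ν).comp (continuous_id.prodMk continuous_const)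
    exact (continuous_jet hf).comp (((S.reg_back (Λ := Unit)).regZero.cont ()).comp
      (continuous_id.prodMk h1))
  have h1 : ∀ j ≤ 2, ‖iteratedFDeriv ℝ j
      (fun y => ∫ s in (0 : ℝ)..t, S.diffused f s (flow (S.b ν) 0 y s)) y'‖ ≤
      C₁ * ∫ s in (0 : ℝ)..t, jet f (S.back s (flow (S.b ν) 0 y' s)) := by
    intro j hj
    refine (hh.norm_iteratedFDeriv_integral_le hj () ht.1 y').trans ?_
    rw [← intervalIntegral.integral_const_mul]
    refine intervalIntegral.integral_mono_on_of_le_Ioo ht.1 ?_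
      ((continuous_const.mul hcj).intervalIntegrable _ _) fun s hs => ?_
    · have := (hh.continuous_norm_iteratedFDeriv hj ()).comp
        (continuous_id.prodMk (continuous_const (y := y')))
      exact this.intervalIntegrable _ _
    · exact hC₁ f hf ν s ⟨hs.1.le, hs.2.le.trans ht.2⟩ y' hyr j hj
  have hJ : ContDiff ℝ (2 : ℕ) (fun y => ∫ s in (0 : ℝ)..t, S.diffused f s (flow (S.b ν) 0 y s)) :=
    hh.integral.contDiff () t
  have h2 := hC₂ ν t x ((S.abs_le_of_mem ht).trans (le_max_right _ _)) (hx.trans (le_max_left _ _))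
    _ hJ _ h1 2 le_rfl
  refine h2.trans_eq ?_
  ring

end Background

/-! ### Splitting of the correction and its bound in `W^{2,4}`. -/

namespace Background

variable (S : Background) {Λ : Type}

/-- The `L⁴` bound of the second derivatives of the integrals of the diffused profile. -/
theorem exists_eLpNorm_second_deriv_le (r : ℝ) : ∃ C : ℝ≥0, ∀ f : Plane → ℝ, ContDiff ℝ 4 f →
    (∀ x, r < ‖x‖ → f x = 0) → ∀ ν, ∀ t ∈ Icc 0 S.T,
      eLpNorm (fun x => ‖iteratedFDeriv ℝ 2 (S.duhamel ν (S.diffused f) t) x‖) 4 volume ≤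
        C * eLpNorm (jet f) 4 volume := by
  obtain ⟨R, hR0, hR⟩ := S.exists_support r
  obtain ⟨C, hC0, hC⟩ := S.exists_bound_second_deriv R
  obtain ⟨K, M, hlip⟩ := S.exists_isLipField
  have hT := S.drift.pos.le
  set E : ℝ≥0 := ⟨Real.exp (K * S.T), (Real.exp_pos _).le⟩ with hE
  have hE1 : 1 ≤ E := by
    rw [← NNReal.coe_le_coe]
    exact Real.one_le_exp (by positivity)
  have hflow : ∀ ν, ∀ s ∈ Icc 0 S.T, ∀ t ∈ Icc 0 S.T,
      LipschitzWith E fun x => flow (S.b ν) s x t := by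
    intro ν s hs t ht
    refine LipschitzWith.of_dist_le_mul fun x y => ?_
    rw [dist_eq_norm, dist_eq_norm, mul_comm]
    refine (hlip.norm_flow_sub_flow_le ν s t x y).trans ?_
    refine mul_le_mul_of_nonneg_left (Real.exp_le_exp.2 ?_) (norm_nonneg _)
    gcongr
    rw [abs_le]
    constructor <;> linarith [hs.1, hs.2, ht.1, ht.2]
  refine ⟨C.toNNReal * (S.T.toNNReal * (E * (E * E))), fun f hf hfr ν t ht => ?_⟩
  have h0 : (0 : ℝ) ∈ Icc 0 S.T := ⟨le_rfl, hT⟩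
  have hX : Continuous fun p : ℝ × Plane => flow (S.b ν) 0 p.2 p.1 :=
    S.reg_flow_forward.regZero.cont ν
  have hΨ : Continuous fun p : ℝ × Plane =>
      S.back p.1 (flow (S.b ν) 0 (flow (S.b ν) t p.2 0) p.1) := by
    have h1 : Continuous fun p : ℝ × Plane => flow (S.b ν) t p.2 0 :=
      (hflow ν t ht 0 h0).continuous.comp continuous_snd
    exact ((S.reg_back (Λ := Unit)).regZero.cont ()).comp
      (continuous_fst.prodMk (hX.comp (continuous_fst.prodMk h1)))
  have hpt : ∀ x, ‖iteratedFDeriv ℝ 2 (S.duhamel ν (S.diffused f) t) x‖ ≤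
      C * ∫ s in (0 : ℝ)..t, jet f (S.back s (flow (S.b ν) 0 (flow (S.b ν) t x 0) s)) := by
    intro x
    by_cases hx : R < ‖x‖
    · rw [iteratedFDeriv_eq_zero_of_support ((hR f hfr).2 ν t ht) x hx, norm_zero]
      exact mul_nonneg hC0 (intervalIntegral.integral_nonneg ht.1 fun s _ => jet_nonneg _ _)
    · exact hC f hf ν t ht x (not_lt.1 hx)
  have hmain := eLpNorm_integral_comp_le ht.1 ht.2 (continuous_jet hf)
    (Ψ := fun s x => S.back s (flow (S.b ν) 0 (flow (S.b ν) t x 0) s))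
    -- The three flows composed in `Ψ` are undone in the opposite order; each inverse has Lipschitz
    -- constant `E`, hence `E * (E * E)`.
    (Ψ' := fun s y => flow (S.b ν) 0 (flow (S.b ν) s (flow (S.b 0) 0 y (clamp S.T s)) 0) t) hΨ
    (K := E * (E * E)) (one_le_mul hE1 (one_le_mul hE1 hE1))
    (fun s hs => by
      have hs' : s ∈ Icc 0 S.T := ⟨hs.1, hs.2.trans ht.2⟩
      exact (hflow ν 0 h0 t ht).comp ((hflow ν s hs' 0 h0).comp
        (hflow 0 0 h0 _ (clamp_mem hT s))))
    (fun s hs x => by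
      rw [back, hlip.flow_cancel, hlip.flow_cancel, hlip.flow_cancel])
  calc _ ≤ eLpNorm (fun x => C * ∫ s in (0 : ℝ)..t,
        jet f (S.back s (flow (S.b ν) 0 (flow (S.b ν) t x 0) s))) 4 volume :=
        eLpNorm_mono_real fun x => by
          rw [norm_norm]
          exact hpt x
    _ = ENNReal.ofReal C * eLpNorm (fun x => ∫ s in (0 : ℝ)..t,
        jet f (S.back s (flow (S.b ν) 0 (flow (S.b ν) t x 0) s))) 4 volume := by
        have := eLpNorm_const_smul (μ := volume) (p := 4) C (fun x => ∫ s in (0 : ℝ)..t,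
          jet f (S.back s (flow (S.b ν) 0 (flow (S.b ν) t x 0) s)))
        rw [Real.enorm_eq_ofReal hC0] at this
        exact this
    _ ≤ ENNReal.ofReal C * (ENNReal.ofReal S.T * (E * (E * E) : ℝ≥0) * eLpNorm (jet f) 4 volume) :=
        mul_le_mul' le_rfl hmain
    _ = _ := by
        rw [ENNReal.coe_mul, ENNReal.coe_mul, ← mul_assoc]
        rfl

/-- The part of the correction that comes from the interaction of the velocity of the correction
with the vorticity. -/
def stretch (ν : ℝ≥0) (s : ℝ) (y : Plane) : ℝ := fderiv ℝ (S.ω s) y (S.u ν s y)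

/-- Here `∇ω` and `u` both have two derivatives, so this part of the correction is `C²` and needs no
approximation. -/
theorem reg_stretch : Reg False 2 S.stretch :=
  S.reg_fderiv_ω.weaken.clm_apply S.reg_u

theorem suppIn_stretch (ν : ℝ≥0) {t : ℝ} (ht : t ∈ Icc 0 S.T) {x : Plane} (hx : S.R < ‖x‖) :
    S.duhamel ν (S.stretch ν) t x = 0 := by
  refine S.duhamel_eq_zero (fun s y hy => ?_) (fun s y hy => ?_) ht (Or.inl hx)
  · rw [stretch, S.fderiv_supp hy, zero_apply]
  · rw [stretch, (S.eventually_core hy).fderiv_eq]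
    simp

theorem exists_bound_stretch : ∃ A : ℝ, 0 ≤ A ∧ ∀ ν, ∀ t ∈ Icc 0 S.T, ∀ x,
    ‖iteratedFDeriv ℝ 2 (S.duhamel ν (S.stretch ν) t) x‖ ≤ A := by
  have h1 : Reg False 2 (fun ν t x => S.duhamel ν (S.stretch ν) (clamp S.T t) x) :=
    (S.reg_duhamel (by norm_num) id S.reg_stretch).clampTime S.drift.pos.le
  have h2 : SuppIn S.R (fun ν t x => S.duhamel ν (S.stretch ν) (clamp S.T t) x) := fun ν t x hx =>
    S.suppIn_stretch ν (clamp_mem S.drift.pos.le t) hx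
  obtain ⟨A, hA0, hA⟩ := h1.2.2.2.2.regZero.exists_bound h2.fderiv.fderiv S.T
  refine ⟨A, hA0, fun ν t ht x => ?_⟩
  have h3 := hA ν t x (S.abs_le_of_mem ht)
  simp only [clamp_of_mem ht] at h3
  rw [← norm_iteratedFDeriv_fderiv, ← norm_iteratedFDeriv_fderiv, norm_iteratedFDeriv_zero]
  exact h3

theorem contDiff_stretch (ν : ℝ≥0) (t : ℝ) : ContDiff ℝ 2 (S.duhamel ν (S.stretch ν) t) := by
  have h := (S.reg_duhamel (by norm_num) id S.reg_stretch).contDiff ν t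
  exact h

theorem contDiff_duhamel_diffused (ν : ℝ≥0) (t : ℝ) {f : Plane → ℝ} (hf : ContDiff ℝ 4 f) :
    ContDiff ℝ 2 (S.duhamel ν (S.diffused f) t) := by
  have h := (S.reg_duhamel (by norm_num) id
    (S.reg_diffused (Λ := ℝ≥0) (k := 2) (by norm_num) hf)).contDiff ν t
  exact h

/-- The first term is linear in the initial profile and is approximated; the second is kept fixed,
so it cancels in differences of approximations. -/
theorem w_eq (ν : ℝ≥0) {t : ℝ} (ht : t ∈ Icc 0 S.T) (hω₀ : ContDiff ℝ 2 S.ω₀) (x : Plane) :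
    S.w ν t x = S.duhamel ν (S.diffused S.ω₀) t x - S.duhamel ν (S.stretch ν) t x := by
  rw [S.w_of_mem ν ht, ← S.duhamel_sub ν (S.continuous_diffused hω₀) (S.reg_stretch.regZero.cont ν),
    diffused_init]
  rfl

/-- The `W^{2,4}` bound of the correction. -/
theorem exists_sobolevNorm_w_le {r : ℝ} {f : ℕ → Plane → ℝ} (hf : IsApprox S.ω₀ r f) :
    ∃ C : ℝ≥0, ∀ ν, ∀ t ∈ Icc 0 S.T, sobolevNorm 2 4 (S.w ν t) ≤ C := by
  obtain ⟨A, hA0, N, hA⟩ := hf.exists_bound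
  obtain ⟨C, hC⟩ := S.exists_eLpNorm_second_deriv_le r
  obtain ⟨D, hD0, hD⟩ := S.exists_bound_stretch
  obtain ⟨P, hP0, hP⟩ := S.exists_bound_duhamel_diffused r
  obtain ⟨A₀, hA₀0, hA₀⟩ := S.reg_w.regZero.exists_bound S.suppIn_w S.T
  obtain ⟨A₁, hA₁0, hA₁⟩ := S.reg_w.2.2.regZero.exists_bound S.suppIn_w.fderiv S.T
  have hω₀ : ContDiff ℝ 3 S.ω₀ := hf.contDiff.1
  have hω₀2 : ContDiff ℝ 2 S.ω₀ := hω₀.of_le (by norm_num)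
  have hsupp0 : ∀ x, r < ‖x‖ → S.ω₀ x = 0 := fun x hx =>
    tendsto_nhds_unique (hf.tendsto x) (tendsto_const_nhds.congr fun n => (hf.supp n x hx).symm)
  set V : ℝ≥0∞ := volume (Metric.closedBall (0 : Plane) S.R) ^ (4 : ℝ≥0∞).toReal⁻¹ with hV
  have hVt : V ≠ ∞ := ENNReal.rpow_ne_top_of_nonneg (by positivity) measure_closedBall_lt_top.ne
  set A₂ : ℝ≥0∞ := C * (5 * ENNReal.ofReal A) + V * ENNReal.ofReal D with hA₂
  have hA₂t : A₂ ≠ ∞ := by finiteness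
  set B : ℝ≥0∞ := V * ENNReal.ofReal A₀ + 2 * (V * ENNReal.ofReal A₁) + 4 * A₂ with hB
  have hBt : B ≠ ∞ := by finiteness
  refine ⟨B.toNNReal, fun ν t ht => ?_⟩
  rw [ENNReal.coe_toNNReal hBt]
  have hc4 : ∀ n, ContDiff ℝ 4 (f n) := fun n => hf.contDiff_nat n 4
  have hc2 : ∀ n, ContDiff ℝ 2 (f n) := fun n => hf.contDiff_nat n 2
  have hQ2 := S.contDiff_stretch ν t
  have hP2 : ∀ n, ContDiff ℝ 2 (S.duhamel ν (S.diffused (f n)) t) := fun n =>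
    S.contDiff_duhamel_diffused ν t (hc4 n)
  have ht' := S.abs_le_of_mem ht
  have hsub : ∀ {g h : Plane → ℝ}, ContDiff ℝ 2 g → ContDiff ℝ 2 h → ∀ x,
      S.duhamel ν (S.diffused g) t x - S.duhamel ν (S.diffused h) t x =
      S.duhamel ν (S.diffused fun x => g x - h x) t x := fun hg hh x => by
    rw [S.diffused_sub hg hh, S.duhamel_sub ν (S.continuous_diffused hg) (S.continuous_diffused hh)]
  -- The approximations are shifted by `N`, from where on their norms are bounded by `A`.
  refine sobolevNorm_two_four_le
    (W := fun n x => S.duhamel ν (S.diffused (f (n + N))) t x - S.duhamel ν (S.stretch ν) t x)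
    (S.reg_w.contDiff ν t) (fun n => (hP2 _).sub hQ2) ?_ hA₂t ?_ ?_ (fun n => ?_) fun ε hε => ?_
  -- Uniform convergence of the profiles with two derivatives is enough for uniform convergence of
  -- the integrals.
  · rw [Metric.tendstoUniformly_iff]
    intro ε hε
    obtain ⟨η, hη0, hη⟩ : ∃ η : ℝ, 0 < η ∧ P * η < ε := by
      refine ⟨ε / (P + 1), by positivity, ?_⟩
      rw [mul_div_assoc', div_lt_iff₀ (by positivity)]
      nlinarith
    choose! M hM using fun j (hj : j ≤ 2) => hf.tendsto_uniform (j := j) (by omega) hη0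
    filter_upwards [eventually_ge_atTop (max (M 0) (max (M 1) (M 2)))] with n hn x
    rw [S.w_eq ν ht hω₀2, dist_comm, dist_eq_norm, sub_sub_sub_cancel_right, hsub (hc2 _) hω₀2]
    refine lt_of_le_of_lt (hP _ ((hc2 _).sub hω₀2) (fun x hx => ?_) η hη0.le (fun j hj x => ?_)
      ν t ht x) hη
    · show f (n + N) x - S.ω₀ x = 0
      rw [hf.supp _ x hx, hsupp0 x hx, sub_zero]
    · refine hM j hj _ ?_ x
      interval_cases j <;> omega
  · exact eLpNorm_le_of_support (fun x => hA₀ ν t x ht') (fun x hx => S.suppIn_w ν t x hx) 4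
  · rw [eLpNorm_norm]
    exact eLpNorm_le_of_support (fun x => hA₁ ν t x ht') (fun x hx => S.suppIn_w.fderiv ν t x hx) 4
  · have e1 : ∀ x, ‖iteratedFDeriv ℝ 2 (fun x => S.duhamel ν (S.diffused (f (n + N))) t x -
        S.duhamel ν (S.stretch ν) t x) x‖ ≤
        ‖iteratedFDeriv ℝ 2 (S.duhamel ν (S.diffused (f (n + N))) t) x‖ +
        ‖iteratedFDeriv ℝ 2 (S.duhamel ν (S.stretch ν) t) x‖ := fun x => by
      rw [iteratedFDeriv_fun_sub (hP2 _) hQ2]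
      exact norm_sub_le _ _
    calc _ ≤ eLpNorm ((fun x => ‖iteratedFDeriv ℝ 2 (S.duhamel ν (S.diffused (f (n + N))) t) x‖) +
          fun x => ‖iteratedFDeriv ℝ 2 (S.duhamel ν (S.stretch ν) t) x‖) 4 volume :=
          eLpNorm_mono_real fun x => by
            rw [norm_norm]
            exact e1 x
      _ ≤ _ := eLpNorm_add_le ((hP2 _).continuous_iteratedFDeriv le_rfl).norm.aestronglyMeasurable
          (hQ2.continuous_iteratedFDeriv le_rfl).norm.aestronglyMeasurable (by norm_num)
      _ ≤ A₂ := by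
        refine add_le_add ((hC _ (hc4 _) (hf.supp _) ν t ht).trans ?_) ?_
        · exact mul_le_mul' le_rfl (eLpNorm_jet_le (hc4 _) fun j hj => hA _ (by omega) j hj)
        · refine eLpNorm_le_of_support (fun x => ?_) (fun x hx => ?_) 4
          · rw [norm_norm]
            exact hD ν t ht x
          · rw [iteratedFDeriv_eq_zero_of_support (fun y hy => S.suppIn_stretch ν ht hy) x hx,
              norm_zero]
  · obtain ⟨η, hη0, hη⟩ : ∃ η : ℝ, 0 < η ∧ (C : ℝ) * (5 * η) ≤ ε := by
      refine ⟨ε / (5 * C + 1), by positivity, ?_⟩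
      rw [← mul_assoc, mul_div_assoc', div_le_iff₀ (by positivity)]
      nlinarith [C.2]
    choose! M hM using fun j (hj : j ≤ 4) => hf.cauchy j hj η hη0
    refine ⟨∑ j ∈ Finset.range 5, M j, fun n hn m hm => ?_⟩
    have hMle : ∀ j ≤ 4, M j ≤ ∑ j ∈ Finset.range 5, M j := fun j hj =>
      Finset.single_le_sum (f := M) (fun _ _ => Nat.zero_le _) (Finset.mem_range.2 (by omega))
    have e1 : (fun x => S.duhamel ν (S.diffused (f (n + N))) t x - S.duhamel ν (S.stretch ν) t x -
        (S.duhamel ν (S.diffused (f (m + N))) t x - S.duhamel ν (S.stretch ν) t x)) =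
        S.duhamel ν (S.diffused fun x => f (n + N) x - f (m + N) x) t := by
      funext x
      rw [sub_sub_sub_cancel_right, hsub (hc2 _) (hc2 _)]
    rw [e1]
    -- By linearity the `L⁴` estimate applies to the difference of two profiles, so the Cauchy
    -- property in `W^{4,4}` carries over to the second derivatives.
    have hc4' : ContDiff ℝ 4 fun x => f (n + N) x - f (m + N) x := (hc4 _).sub (hc4 _)
    refine (hC _ hc4' (fun x hx => ?_) ν t ht).trans ?_
    · rw [hf.supp _ x hx, hf.supp _ x hx, sub_zero]
    · calc (C : ℝ≥0∞) * _ ≤ C * (5 * ENNReal.ofReal η) :=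
            mul_le_mul' le_rfl (eLpNorm_jet_le hc4' fun j hj =>
              hM j hj _ (by have := hMle j hj; omega) _ (by have := hMle j hj; omega))
        _ = ENNReal.ofReal (C * (5 * η)) := by
          rw [ENNReal.ofReal_mul (NNReal.coe_nonneg C), ENNReal.ofReal_mul (by norm_num)]
          simp
        _ ≤ _ := ENNReal.ofReal_le_ofReal hη

end Background

/-! ### Uniqueness of the correction and the corrected point vortex -/

namespace Background

variable (S : Background)

/-- The equation satisfied by the corrections. -/
def Solves (ν : ℝ≥0) (q : ℝ → Plane → ℝ) : Prop :=
  ∀ t ∈ Ioc 0 S.T, ∀ x, derivWithin (fun s => q s x) (Icc 0 S.T) t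
    + fderiv ℝ (q t) x (biotSavart (S.ω t) x
        + (1 / √(ν * t)) • lambOseen ((1 / √(ν * t)) • (x - S.z t)))
    + fderiv ℝ (S.ω t) x (biotSavart (q t) x) = (Δ (S.ω t)) x

/-- Through every point other than the point vortex there is a trajectory of the full drift. -/
theorem exists_characteristic {ν : ℝ≥0} (hν : 0 < ν) {t : ℝ} (ht : t ∈ Icc 0 S.T) {x : Plane}
    (hx : x ≠ S.z t) : ∃ γ : ℝ → Plane, γ t = x ∧ Continuous γ ∧
      (∀ s ∈ Ioc 0 S.T, HasDerivAt γ (biotSavart (S.ω s) (γ s)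
        + (1 / √(ν * s)) • lambOseen ((1 / √(ν * s)) • (γ s - S.z s))) s) ∧
      (S.R < ‖x‖ → ∀ s ∈ Icc 0 S.T, S.ρ < ‖γ s‖) := by
  have hZ := S.drift.nonneg_Z
  have hT := S.drift.pos.le
  have hB := S.drift.nonneg_B
  have hBT : 0 ≤ S.B * S.T := mul_nonneg hB hT
  -- The cut-off is adapted to `x`, with radius and core just sufficient for the trajectory through
  -- `x` to follow the full drift on `[0, T]`.
  have hR' : 0 < ‖x‖ + 2 * S.Z + 2 * S.B * S.T + 1 := by positivity
  have hZR : S.Z ≤ ‖x‖ + 2 * S.Z + 2 * S.B * S.T + 1 := by linarith [norm_nonneg x]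
  obtain ⟨L, hL0, hL⟩ := S.drift.exists_lipschitz hR'
  have hn : 0 < ‖x - S.z t‖ := norm_pos_iff.2 (sub_ne_zero.2 hx)
  have hd' : 0 < ‖x - S.z t‖ * Real.exp (-(L * S.T)) := by positivity
  obtain ⟨K, M, hlip⟩ := S.drift.isLipField hR' hd'
  have hγ := hlip.hasDerivAt_flow ν t x
  have hγt := hlip.flow_self ν t x
  refine ⟨_, hγt, continuous_iff_continuousAt.2 fun s => (hγ s).continuousAt, fun s hs => ?_,
    fun hx s hs => ?_⟩
  · obtain ⟨h1, h2⟩ := S.drift.trajectory_mem hR' hd' hL hγ (s := s) ⟨hs.1.le, hs.2⟩ ht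
      (by rw [hγt]) (by rw [hγt, mul_assoc, ← Real.exp_add, neg_add_cancel, Real.exp_zero, mul_one])
    have h3 := hγ s
    rw [cutField_lambOseen hR' hd' hν hs h1 h2] at h3
    exact h3
  · have h1 := (S.drift.norm_trajectory_sub_le hR' hd' hZR hL hγ ht hs).2
    rw [hγt] at h1
    have h2 := norm_sub_norm_le x (S.z t)
    have h3 := norm_sub_le (flow (cutField S.T (fun t => biotSavart (S.ω t)) S.z
      (‖x‖ + 2 * S.Z + 2 * S.B * S.T + 1) hR' (‖x - S.z t‖ * Real.exp (-(L * S.T))) hd' ν) t x s)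
      (S.z s)
    linarith [S.drift.zbound t, S.drift.zbound s, S.R_eq]

/-- The difference of two solutions along characteristics. -/
theorem sub_eq_integral {ν : ℝ≥0} (hν : 0 < ν) {q p : ℝ → Plane → ℝ} {A : ℝ}
    (hq : ContDiffOn ℝ 1 (fun p : ℝ × Plane => q p.1 p.2) (Icc 0 S.T ×ˢ univ))
    (hp : ContDiffOn ℝ 1 (fun p' : ℝ × Plane => p p'.1 p'.2) (Icc 0 S.T ×ˢ univ))
    (hqv : IsVorticity S.T A (fun t => q (clamp S.T t)))
    (hpv : IsVorticity S.T A (fun t => p (clamp S.T t)))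
    (hq0 : ∀ x, q 0 x = 0) (hp0 : ∀ x, p 0 x = 0) (hqs : S.Solves ν q) (hps : S.Solves ν p)
    {t : ℝ} (ht : t ∈ Icc 0 S.T) {x : Plane} (hx : x ≠ S.z t) :
    ∃ γ : ℝ → Plane, (S.R < ‖x‖ → ∀ s ∈ Icc 0 S.T, S.ρ < ‖γ s‖) ∧
      q t x - p t x = ∫ s in (0 : ℝ)..t, -fderiv ℝ (S.ω s) (γ s)
        (biotSavart (fun y => q (clamp S.T s) y - p (clamp S.T s) y) (γ s)) := by
  obtain ⟨γ, hγt, hγc, hγ, hγR⟩ := S.exists_characteristic hν ht hx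
  refine ⟨γ, hγR, ?_⟩
  have hsub : ∀ s y, biotSavart (fun y => q (clamp S.T s) y - p (clamp S.T s) y) y =
      biotSavart (q (clamp S.T s)) y - biotSavart (p (clamp S.T s)) y := fun s y =>
    biotSavart_sub (hqv.bound s) (hqv.integrable s) (hpv.bound s) (hpv.integrable s) y
  have hpair : Continuous fun s => (s, γ s) := continuous_id.prodMk hγc
  have hfc : Continuous fun s => -fderiv ℝ (S.ω s) (γ s)
      (biotSavart (fun y => q (clamp S.T s) y - p (clamp S.T s) y) (γ s)) := by
    simp only [hsub]
    exact (((S.reg_fderiv_ω.regZero.cont 0).comp hpair).clm_apply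
      ((hqv.continuous_biotSavart.comp hpair).sub (hpv.continuous_biotSavart.comp hpair))).neg
  have hcont : ∀ {q : ℝ → Plane → ℝ},
      ContDiffOn ℝ 1 (fun p : ℝ × Plane => q p.1 p.2) (Icc 0 S.T ×ˢ univ) →
      ContinuousOn (fun s => q s (γ s)) (Icc 0 t) := fun hq =>
    hq.continuousOn.comp hpair.continuousOn fun s hs => ⟨⟨hs.1, hs.2.trans ht.2⟩, mem_univ _⟩
  -- The equation and the characteristic are available only for positive times; at `s = 0`
  -- continuity of the two solutions is enough.
  have hder : ∀ s ∈ Ioo 0 t, HasDerivAt (fun s => q s (γ s) - p s (γ s)) (-fderiv ℝ (S.ω s) (γ s)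
      (biotSavart (fun y => q (clamp S.T s) y - p (clamp S.T s) y) (γ s))) s := by
    intro s hs
    have hs' : s ∈ Ioc 0 S.T := ⟨hs.1, hs.2.le.trans ht.2⟩
    have hs'' : s ∈ Icc 0 S.T := ⟨hs.1.le, hs'.2⟩
    have hd := (hγ s hs').hasDerivWithinAt (s := Icc 0 S.T)
    have h1 := (hasDerivWithinAt_along S.drift.pos hq hs'' hd).sub
      (hasDerivWithinAt_along S.drift.pos hp hs'' hd)
    refine (h1.hasDerivAt (Icc_mem_nhds hs.1 (hs.2.trans_le ht.2))).congr_deriv ?_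
    have h2 := hqs s hs' (γ s)
    have h3 := hps s hs' (γ s)
    rw [hsub, clamp_of_mem hs'', map_sub]
    linarith
  have := intervalIntegral.integral_eq_sub_of_hasDerivAt_of_le ht.1 ((hcont hq).sub (hcont hp)) hder
    (hfc.intervalIntegrable _ _)
  rw [this]
  simp [hγt, hq0, hp0]

/-- Solutions that are bounded in `L¹ ∩ L^∞` are unique. -/
theorem solution_unique {ν : ℝ≥0} (hν : 0 < ν) {q p : ℝ → Plane → ℝ} {A : ℝ}
    (hq : ContDiffOn ℝ 1 (fun p : ℝ × Plane => q p.1 p.2) (Icc 0 S.T ×ˢ univ))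
    (hp : ContDiffOn ℝ 1 (fun p' : ℝ × Plane => p p'.1 p'.2) (Icc 0 S.T ×ˢ univ))
    (hqv : IsVorticity S.T A (fun t => q (clamp S.T t)))
    (hpv : IsVorticity S.T A (fun t => p (clamp S.T t)))
    (hq0 : ∀ x, q 0 x = 0) (hp0 : ∀ x, p 0 x = 0) (hqs : S.Solves ν q) (hps : S.Solves ν p)
    {t : ℝ} (ht : t ∈ Icc 0 S.T) : q t = p t := by
  obtain ⟨D, hD0, hD⟩ := S.exists_bound_source
  obtain ⟨C, hC0, hC⟩ := exists_norm_biotSavart_le_of_support S.R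
  have hT := S.drift.pos.le
  have hA0 : 0 ≤ A := (norm_nonneg _).trans (hqv.bound 0 0)
  have hdc : ∀ t ∈ Icc 0 S.T, Continuous fun x => q t x - p t x := fun t ht => by
    have h1 := (hqv.reg.1.continuous_space () t).sub (hpv.reg.1.continuous_space () t)
    simp only [clamp_of_mem ht] at h1
    exact h1
  have dense : ∀ (y : Plane), Dense {x : Plane | x ≠ y} := fun y => dense_compl_singleton y
  -- Characteristics through points outside radius `R` stay outside radius `ρ`, where `∇ω` vanishes.
  -- The difference thus has bounded support, and its velocity is controlled by its supremum alone.
  have hsupp : ∀ t ∈ Icc 0 S.T, ∀ x, S.R < ‖x‖ → q t x - p t x = 0 := by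
    intro t ht x hx
    have hxz : x ≠ S.z t := by
      rintro rfl
      linarith [S.drift.zbound t, S.hZR]
    obtain ⟨γ, hγ, h⟩ := S.sub_eq_integral hν hq hp hqv hpv hq0 hp0 hqs hps ht hxz
    rw [h]
    refine intervalIntegral.integral_zero_ae (ae_of_all _ fun s hs => ?_)
    rw [uIoc_of_le ht.1] at hs
    rw [S.fderiv_supp (hγ hx s ⟨hs.1.le, hs.2.trans ht.2⟩), zero_apply, neg_zero]
  set c : ℝ := 2 * (D * C) + 1 with hc
  have hc0 : 0 < c := by positivity
  -- With the weight `e^{ct}`, each use of the integral identity halves the bound; iteration forces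
  -- the difference to vanish.
  have step : ∀ N : ℝ, 0 ≤ N → (∀ t ∈ Icc 0 S.T, ∀ x, ‖q t x - p t x‖ ≤ N * Real.exp (c * t)) →
      ∀ t ∈ Icc 0 S.T, ∀ x, ‖q t x - p t x‖ ≤ N / 2 * Real.exp (c * t) := by
    intro N hN0 hN t ht
    have hcl : IsClosed {x | ‖q t x - p t x‖ ≤ N / 2 * Real.exp (c * t)} :=
      isClosed_le (hdc t ht).norm continuous_const
    -- The point `z t`, through which no characteristic is known, is recovered by density and
    -- continuity.
    suffices hsubs : {x | x ≠ S.z t} ⊆ {x | ‖q t x - p t x‖ ≤ N / 2 * Real.exp (c * t)} from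
      fun x => hcl.closure_subset_iff.2 hsubs (dense (S.z t) x)
    intro x hx
    obtain ⟨γ, -, h⟩ := S.sub_eq_integral hν hq hp hqv hpv hq0 hp0 hqs hps ht hx
    show ‖_‖ ≤ _
    rw [h]
    calc _ ≤ ∫ s in (0 : ℝ)..t, D * C * N * Real.exp (c * s) := by
          refine intervalIntegral.norm_integral_le_of_norm_le ht.1 (ae_of_all _ fun s hs => ?_)
            ((by fun_prop : Continuous fun s => D * C * N * Real.exp (c * s)).intervalIntegrable _ _)
          have hs' : s ∈ Icc 0 S.T := ⟨hs.1.le, hs.2.trans ht.2⟩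
          rw [norm_neg, clamp_of_mem hs']
          refine ((fderiv ℝ (S.ω s) (γ s)).le_opNorm _).trans ?_
          have h1 := hC _ _ (hdc s hs') (hN s hs') (hsupp s hs') (γ s)
          calc _ ≤ D * (C * (N * Real.exp (c * s))) :=
                mul_le_mul (hD s _).2 h1 (norm_nonneg _) hD0
            _ = _ := by ring
      _ ≤ D * C * N * (Real.exp (c * t) / c) := by
          rw [intervalIntegral.integral_const_mul]
          exact mul_le_mul_of_nonneg_left (integral_exp_mul_le hc0 t) (by positivity)
      _ = (D * C / c) * (N * Real.exp (c * t)) := by ring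
      _ ≤ 1 / 2 * (N * Real.exp (c * t)) := by
          refine mul_le_mul_of_nonneg_right ?_ (by positivity)
          rw [div_le_iff₀ hc0, hc]
          linarith
      _ = _ := by ring
  have iter : ∀ n : ℕ, ∀ t ∈ Icc 0 S.T, ∀ x,
      ‖q t x - p t x‖ ≤ (A + A) / 2 ^ n * Real.exp (c * t) := by
    intro n
    induction n with
    | zero =>
      intro t ht x
      have h1 : ‖q t x - p t x‖ ≤ A + A := by
        have h2 := hqv.bound t x
        have h3 := hpv.bound t x
        simp only [clamp_of_mem ht] at h2 h3
        exact (norm_sub_le _ _).trans (add_le_add h2 h3)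
      have h2 : 1 ≤ Real.exp (c * t) := Real.one_le_exp (mul_nonneg hc0.le ht.1)
      rw [pow_zero, div_one]
      nlinarith
    | succ n ih =>
      have h1 := step _ (by positivity) ih
      intro t ht x
      refine (h1 t ht x).trans_eq ?_
      rw [pow_succ, div_div]
  funext x
  have hlim : Tendsto (fun n : ℕ => (A + A) / 2 ^ n * Real.exp (c * t)) atTop (𝓝 0) := by
    have h1 : Tendsto (fun n : ℕ => (A + A) / (2 : ℝ) ^ n) atTop (𝓝 0) :=
      tendsto_const_nhds.div_atTop (tendsto_pow_atTop_atTop_of_one_lt (by norm_num))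
    simpa using h1.mul_const (Real.exp (c * t))
  have h0 : ‖q t x - p t x‖ ≤ 0 := ge_of_tendsto' hlim fun n => iter n t ht x
  exact sub_eq_zero.1 (norm_le_zero_iff.1 h0)

/-- The gradient of the velocity is bounded on the whole plane, so the comparison of the two points
needs no localization. -/
theorem exists_lipschitz_v : ∃ L : ℝ≥0, ∀ t, LipschitzWith L (S.v t) := by
  obtain ⟨C, hC⟩ := (globBdd_biotSavart S.reg_ω S.suppIn).2.1 S.T
  refine ⟨C.toNNReal, fun t => ?_⟩
  have h1 : S.v t = biotSavart (S.ω (clamp S.T t)) := by rw [S.clamp_ω]; rfl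
  have hd : Differentiable ℝ (biotSavart (S.ω (clamp S.T t))) := S.reg_v.2.1 0 (clamp S.T t)
  rw [h1]
  refine lipschitzWith_of_nnnorm_fderiv_le hd fun x => ?_
  rw [← NNReal.coe_le_coe]
  exact (hC 0 _ x (abs_clamp_le_right S.drift.pos.le t)).trans (Real.le_coe_toNNReal _)

theorem biotSavart_total (ν : ℝ≥0) (t : ℝ) (x : Plane) :
    biotSavart (fun y => S.ω t y + ν * S.w ν t y) x = S.v t x + (ν : ℝ) • S.u ν t x := by
  obtain ⟨A, hA0, hA⟩ := S.reg_ω.regZero.exists_bound S.suppIn |t|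
  obtain ⟨D, hD0, hD⟩ := S.reg_w.regZero.exists_bound S.suppIn_w |t|
  have h1 := (integrable_of_support (S.reg_ω.regZero.continuous_space 0 t)
    (fun y => hA 0 t y le_rfl) (S.supp t)).1
  have h2 := (integrable_of_support (S.reg_w.regZero.continuous_space ν t)
    (fun y => hD ν t y le_rfl) (fun y hy => S.suppIn_w ν t y hy)).1
  rw [biotSavart_add (fun y => hA 0 t y le_rfl) h1 (B := ν * D) (fun y => ?_) (h2.const_mul _),
    biotSavart_const_mul, ← S.u_eq]
  · rfl
  · rw [norm_mul, Real.norm_of_nonneg (NNReal.coe_nonneg ν)]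
    exact mul_le_mul_of_nonneg_left (hD ν t y le_rfl) (NNReal.coe_nonneg ν)

/-- The corrected point vortex exists. -/
theorem exists_corrected_point (ν : ℝ≥0) (z₀ : Plane) : ∃ z' : ℝ → Plane, z' 0 = z₀ ∧
    ∀ t ∈ Icc 0 S.T, HasDerivWithinAt z' (S.v t (z' t) + (ν : ℝ) • S.u ν t (z' t)) (Icc 0 S.T) t := by
  obtain ⟨L, hL⟩ := S.exists_lipschitz_v
  obtain ⟨A, hA0, hA⟩ := S.exists_bound_u
  have hT := S.drift.pos.le
  have hu : ∀ t, LipschitzWith (ν * A.toNNReal)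
      (fun x => (ν : ℝ) • S.u ν (clamp S.T t) x) := fun t => by
    have h1 : LipschitzWith A.toNNReal (S.u ν (clamp S.T t)) := by
      refine lipschitzWith_of_nnnorm_fderiv_le (S.reg_u.2.1 ν _) fun x => ?_
      rw [← NNReal.coe_le_coe]
      exact (hA ν _ (clamp_mem hT t) x).2.1.trans (Real.le_coe_toNNReal _)
    refine LipschitzWith.of_dist_le_mul fun x y => ?_
    rw [dist_smul₀, Real.norm_of_nonneg (NNReal.coe_nonneg ν), NNReal.coe_mul, mul_assoc]
    exact mul_le_mul_of_nonneg_left (h1.dist_le_mul x y) (NNReal.coe_nonneg ν)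
  have hc : Continuous fun p : ℝ × Plane => S.v p.1 p.2 + (ν : ℝ) • S.u ν (clamp S.T p.1) p.2 := by
    have h1 : Continuous fun p : ℝ × Plane => (clamp S.T p.1, p.2) :=
      (continuous_clamp.comp continuous_fst).prodMk continuous_snd
    have h2 : Continuous fun p : ℝ × Plane => S.u ν (clamp S.T p.1) p.2 :=
      (S.reg_u.1.cont ν).comp h1
    have h3 : Continuous fun p : ℝ × Plane => (ν : ℝ) • S.u ν (clamp S.T p.1) p.2 :=
      (continuous_const_smul (ν : ℝ)).comp h2
    exact S.drift.cont.add h3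
  obtain ⟨z', h0, h⟩ := exists_trajectory
    (f := fun t x => S.v t x + (ν : ℝ) • S.u ν (clamp S.T t) x) hc
    (fun t => (hL t).add (hu t)) 0 z₀
  refine ⟨z', h0, fun t ht => ?_⟩
  have h1 := (h t).hasDerivWithinAt (s := Icc 0 S.T)
  rwa [clamp_of_mem ht] at h1

/-- The distance of the corrected point vortex to the point vortex. -/
theorem exists_corrected_point_bound : ∃ C : ℝ, 0 ≤ C ∧ ∀ (ν : ℝ≥0) (z' : ℝ → Plane),
    z' 0 = S.z 0 →
    (∀ t ∈ Icc 0 S.T, HasDerivWithinAt z' (S.v t (z' t) + (ν : ℝ) • S.u ν t (z' t)) (Icc 0 S.T) t) →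
    ∀ t ∈ Icc 0 S.T, ‖z' t - S.z t‖ ≤ C * ν * t := by
  obtain ⟨L, hL⟩ := S.exists_lipschitz_v
  obtain ⟨A, hA0, hA⟩ := S.exists_bound_u
  -- The added `1` makes `K` nonzero, as the closed form of `gronwallBound` requires.
  set K : ℝ := L + 1 with hK
  have hK0 : 0 < K := by positivity
  refine ⟨A * Real.exp (K * S.T), by positivity, fun ν z' h0 h t ht => ?_⟩
  have hder : ∀ s ∈ Icc 0 S.T, HasDerivWithinAt (fun s => z' s - S.z s)
      (S.v s (z' s) + (ν : ℝ) • S.u ν s (z' s) - S.v s (S.z s)) (Icc 0 S.T) s := fun s hs =>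
    (h s hs).sub (S.drift.zder s hs)
  have hg := norm_le_gronwallBound_of_norm_deriv_right_le (δ := 0) (K := K) (ε := ν * A)
    (f := fun s => z' s - S.z s) (fun s hs => (hder s hs).continuousWithinAt)
    (fun s hs => (hder s ⟨hs.1, hs.2.le⟩).mono_of_mem_nhdsWithin (Icc_mem_nhdsGE_of_mem hs))
    (by simp [h0]) (fun s hs => ?_) t ht
  · rw [gronwallBound_of_K_ne_0 hK0.ne', sub_zero] at hg
    simp only [zero_mul, zero_add] at hg
    refine hg.trans ?_
    -- The inequality `e^a - 1 ≤ a e^a` supplies the factor `t` in the final estimate.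
    have h1 : Real.exp (K * t) - 1 ≤ K * t * Real.exp (K * t) := by
      have h2 := Real.add_one_le_exp (-(K * t))
      have h3 : Real.exp (-(K * t)) * Real.exp (K * t) = 1 := by
        rw [← Real.exp_add, neg_add_cancel, Real.exp_zero]
      nlinarith [Real.exp_pos (K * t)]
    have h4 : Real.exp (K * t) ≤ Real.exp (K * S.T) :=
      Real.exp_le_exp.2 (mul_le_mul_of_nonneg_left ht.2 hK0.le)
    have hν : (0 : ℝ) ≤ ν := (NNReal.coe_nonneg ν)
    calc ν * A / K * (Real.exp (K * t) - 1) ≤ ν * A / K * (K * t * Real.exp (K * t)) := by gcongr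
      _ = ν * A * t * Real.exp (K * t) := by field_simp
      _ ≤ ν * A * t * Real.exp (K * S.T) := by
        have := ht.1
        gcongr
      _ = _ := by ring
  · have hs' : s ∈ Icc 0 S.T := ⟨hs.1, hs.2.le⟩
    have h1 : ‖S.v s (z' s) - S.v s (S.z s)‖ ≤ L * ‖z' s - S.z s‖ := by
      have := (hL s).dist_le_mul (z' s) (S.z s)
      rwa [dist_eq_norm, dist_eq_norm] at this
    have h2 : ‖(ν : ℝ) • S.u ν s (z' s)‖ ≤ ν * A := by
      rw [norm_smul, Real.norm_of_nonneg (NNReal.coe_nonneg ν)]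
      exact mul_le_mul_of_nonneg_left (hA ν s hs' _).1 (NNReal.coe_nonneg ν)
    calc _ = ‖(S.v s (z' s) - S.v s (S.z s)) + (ν : ℝ) • S.u ν s (z' s)‖ := by
          congr 1
          abel
      _ ≤ L * ‖z' s - S.z s‖ + ν * A := (norm_add_le _ _).trans (add_le_add h1 h2)
      _ ≤ _ := by
        rw [hK]
        nlinarith [norm_nonneg (z' s - S.z s)]

end Background

/-! ### The first order correction -/

namespace Background

variable (S : Background)

theorem exists_eLpNorm_w_le (p : ℝ≥0∞) : ∃ C : ℝ≥0, ∀ (ν : ℝ≥0), ∀ t ∈ Icc 0 S.T,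
    eLpNorm (S.w ν t) p volume ≤ C := by
  obtain ⟨A, hA0, hA⟩ := S.reg_w.regZero.exists_bound S.suppIn_w S.T
  have hfin : volume (Metric.closedBall (0 : Plane) S.R) ^ p.toReal⁻¹ * ENNReal.ofReal A ≠ ∞ :=
    ENNReal.mul_ne_top (ENNReal.rpow_ne_top_of_nonneg (by positivity)
      measure_closedBall_lt_top.ne) ENNReal.ofReal_ne_top
  refine ⟨(volume (Metric.closedBall (0 : Plane) S.R) ^ p.toReal⁻¹ * ENNReal.ofReal A).toNNReal,
    fun ν t ht => ?_⟩
  rw [ENNReal.coe_toNNReal hfin]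
  exact eLpNorm_le_of_support (fun x => hA ν t x (S.abs_le_of_mem ht))
    (fun x hx => S.suppIn_w ν t x hx) p

theorem exists_eLpNorm_deriv_le : ∃ C : ℝ≥0, ∀ (ν : ℝ≥0), ∀ t ∈ Icc 0 S.T,
    eLpNorm (fun x => derivWithin (fun s => S.w ν s x) (Icc 0 S.T) t) ∞ volume ≤ C := by
  obtain ⟨A, hA0, hA⟩ := S.exists_bound_deriv
  refine ⟨A.toNNReal, fun ν t ht => ?_⟩
  refine (eLpNorm_le_of_ae_bound (C := A) (Eventually.of_forall fun x => hA ν t ht x)).trans_eq ?_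
  simp [ENNReal.ofReal]

/-- The sum of the norms that control the correction. -/
theorem exists_bound_w {r : ℝ} {f : ℕ → Plane → ℝ} (hf : IsApprox S.ω₀ r f) :
    ∃ C : ℝ≥0, ∀ (ν : ℝ≥0), ∀ t ∈ Icc 0 S.T,
      volume (tsupport (S.w ν t)) + sobolevNorm 2 4 (S.w ν t)
        + eLpNorm (fun x => derivWithin (fun s => S.w ν s x) (Icc 0 S.T) t) ∞ volume
        + sobolevNorm 2 ∞ (biotSavart (S.w ν t)) ≤ C := by
  obtain ⟨C₁, h₁⟩ := S.exists_sobolevNorm_w_le hf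
  obtain ⟨C₂, h₂⟩ := S.exists_eLpNorm_deriv_le
  obtain ⟨C₃, h₃⟩ := S.exists_sobolevNorm_u_le
  refine ⟨(volume (Metric.closedBall (0 : Plane) S.R)).toNNReal + C₁ + C₂ + C₃, fun ν t ht => ?_⟩
  rw [ENNReal.coe_add, ENNReal.coe_add, ENNReal.coe_add,
    ENNReal.coe_toNNReal measure_closedBall_lt_top.ne]
  exact add_le_add (add_le_add (add_le_add (measure_mono (S.tsupport_w_subset ν t)) (h₁ ν t ht))
    (h₂ ν t ht)) (h₃ ν t ht)

theorem isCorrection_w {ν : ℝ≥0} (hν : 0 < ν) : IsCorrection ν S.T S.z S.ω (S.w ν) := by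
  obtain ⟨C₁, h₁⟩ := S.exists_eLpNorm_w_le 1
  obtain ⟨C₂, h₂⟩ := S.exists_eLpNorm_w_le ∞
  refine ⟨S.contDiffOn_w ν, ⟨C₁ + C₂, fun t ht => ?_⟩, fun t ht x => S.equation hν ht x, S.w_zero ν⟩
  rw [ENNReal.coe_add]
  exact add_le_add (h₁ ν t ht) (h₂ ν t ht)

theorem isCorrection_unique {ν : ℝ≥0} (hν : 0 < ν) {q p : ℝ → Plane → ℝ}
    (hq : IsCorrection ν S.T S.z S.ω q) (hp : IsCorrection ν S.T S.z S.ω p) {t : ℝ}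
    (ht : t ∈ Icc 0 S.T) : q t = p t := by
  obtain ⟨C₁, h₁⟩ := hq.bounded
  obtain ⟨C₂, h₂⟩ := hp.bounded
  refine S.solution_unique (A := (C₁ + C₂ : ℝ≥0)) hν hq.contDiff hp.contDiff
    (.of_contDiffOn S.drift.pos hq.contDiff fun t ht => (h₁ t ht).trans ?_)
    (.of_contDiffOn S.drift.pos hp.contDiff fun t ht => (h₂ t ht).trans ?_)
    hq.vorticity_zero hp.vorticity_zero hq.vorticity_eq hp.vorticity_eq ht
  · exact ENNReal.coe_le_coe.2 le_self_add
  · exact ENNReal.coe_le_coe.2 le_add_self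

end Background

/-- Being a correction only depends on the background on the time interval. -/
theorem IsCorrection.congr {ν T : ℝ} {z z' : ℝ → Plane} {ω ω' w : ℝ → Plane → ℝ}
    (h : IsCorrection ν T z ω w) (hz : ∀ t ∈ Icc 0 T, z' t = z t)
    (hω : ∀ t ∈ Icc 0 T, ω' t = ω t) : IsCorrection ν T z' ω' w := by
  refine ⟨h.contDiff, h.bounded, fun t ht x => ?_, h.vorticity_zero⟩
  rw [hz t ⟨ht.1.le, ht.2⟩, hω t ⟨ht.1.le, ht.2⟩]
  exact h.vorticity_eq t ht x

theorem IsVortexWaveSolution.continuous_init {z₀ : Plane} {ω₀ : Plane → ℝ} {z : ℝ → Plane}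
    {ω : ℝ → Plane → ℝ} (h : IsVortexWaveSolution z₀ ω₀ z ω) : Continuous ω₀ := by
  rw [← h.vorticity_zero]
  exact h.contDiff.continuousOn.comp_continuous (Continuous.prodMk_right (0 : ℝ))
    fun x => mk_mem_prod self_mem_Ici (mem_univ x)

end VortexWave

end

/-! ### The main theorem. -/

theorem proposition2p1 (z₀ : VortexWave.Plane) (ω₀ : VortexWave.Plane → ℝ)
    (hω₀ : VortexWave.MemSobolev 4 4 ω₀) (hsupp : HasCompactSupport ω₀) (hvan : ω₀ =ᶠ[𝓝 z₀] 0)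
    (z : ℝ → VortexWave.Plane) (ω : ℝ → VortexWave.Plane → ℝ)
    (hsol : VortexWave.IsVortexWaveSolution z₀ ω₀ z ω)
    (T : ℝ) (hT : 0 < T) (hTstar : (T : EReal) < VortexWave.meetingTime z ω) :
    ∃ C : ℝ≥0, ∀ ν : ℝ, 0 < ν →
      ∃ w : ℝ → VortexWave.Plane → ℝ,
        VortexWave.IsCorrection ν T z ω w ∧
        (∀ w' : ℝ → VortexWave.Plane → ℝ, VortexWave.IsCorrection ν T z ω w' →
          ∀ t ∈ Icc 0 T, w' t = w t) ∧
        (∀ t ∈ Icc 0 T,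
          HasCompactSupport (w t) ∧
          w t =ᶠ[𝓝 (z t)] 0 ∧
          volume (tsupport (w t))
            + VortexWave.sobolevNorm 2 4 (w t)
            + eLpNorm (fun x => derivWithin (fun s => w s x) (Icc 0 T) t) ∞ volume
            + VortexWave.sobolevNorm 2 ∞ (VortexWave.biotSavart (w t)) ≤ C) ∧
        (∃ z' : ℝ → VortexWave.Plane, VortexWave.IsCorrectedPoint ν T z₀ ω w z') ∧
        (∀ z' : ℝ → VortexWave.Plane, VortexWave.IsCorrectedPoint ν T z₀ ω w z' →
          ∀ t ∈ Icc 0 T, ‖z' t - z t‖ ≤ C * ν * t) := by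
  -- The smooth approximations serve twice: for the `C^{3,1/2}` regularity of `ω₀` needed by the
  -- background, and for the `W^{2,4}` bound of the correction.
  obtain ⟨r, f, hf⟩ := VortexWave.exists_isApprox hω₀ hsol.continuous_init hsupp
  obtain ⟨S, rfl, rfl, hω, hz⟩ := hsol.exists_background hsupp hvan hf.reg hT
  have hω' : ∀ t ∈ Icc 0 S.T, S.ω t = ω t := fun t ht => by
    rw [hω]
    exact congrArg ω (VortexWave.clamp_of_mem ht)
  have hz' : ∀ t ∈ Icc 0 S.T, S.z t = z t := fun t ht => by
    rw [hz]
    exact congrArg z (VortexWave.clamp_of_mem ht)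
  have hz₀ : S.z 0 = z₀ := (hz' 0 ⟨le_rfl, hT.le⟩).trans hsol.point_zero
  obtain ⟨C₁, h₁⟩ := S.exists_bound_w hf
  obtain ⟨C₂, hC₂, h₂⟩ := S.exists_corrected_point_bound
  -- `C₁` bounds the norms of the correction and `C₂` the displacement of the point; both come from
  -- the background alone and precede the choice of `ν`.
  refine ⟨C₁ + C₂.toNNReal, fun ν hν => ?_⟩
  lift ν to ℝ≥0 using hν.le
  have hν' : 0 < ν := NNReal.coe_pos.1 hν
  have htotal : ∀ t ∈ Icc 0 S.T, ∀ x, VortexWave.biotSavart (fun y => ω t y + ν * S.w ν t y) x =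
      S.v t x + (ν : ℝ) • S.u ν t x := fun t ht x => by
    rw [← hω' t ht]
    exact S.biotSavart_total ν t x
  refine ⟨S.w ν, (S.isCorrection_w hν').congr (fun t ht => (hz' t ht).symm)
    fun t ht => (hω' t ht).symm, fun w' hw' t ht => S.isCorrection_unique hν' (hw'.congr hz' hω')
    (S.isCorrection_w hν') ht, fun t ht => ⟨?_, ?_, ?_⟩, ?_, fun z' h t ht => ?_⟩
  · exact S.suppIn_w.hasCompactSupport ν t
  · rw [← hz' t ht]
    exact S.eventually_w_eq_zero ν (Or.inr (by simpa using S.hd))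
  · exact (h₁ ν t ht).trans (ENNReal.coe_le_coe.2 le_self_add)
  · obtain ⟨z', h0, h⟩ := S.exists_corrected_point ν z₀
    exact ⟨z', fun t ht => by rw [htotal t ht]; exact h t ht, h0⟩
  · rw [← hz' t ht]
    refine (h₂ ν z' (h.point_zero.trans hz₀.symm) (fun s hs => ?_) t ht).trans ?_
    · rw [← htotal s hs]
      exact h.point_eq s hs
    · have hC : C₂ ≤ ((C₁ + C₂.toNNReal : ℝ≥0) : ℝ) := by
        rw [NNReal.coe_add, Real.coe_toNNReal _ hC₂]
        exact le_add_of_nonneg_left C₁.2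
      have := ht.1
      gcongr
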